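/- **Theorem (Detecting Cut Pairs).** Let $F_n$ be the free group of rank $n\ge 2$ with free basis $a_1,\dots,a_n$, let $T$ be its Cayley tree, $*$ the identity vertex, and let $W=(w_1,\dots,w_k)$ be a finite list of nontrivial elements of $F_n$. The line pattern generated by $W$ consists of the axes in $T$ of the conjugates of the $w_i$ (the geodesics at bounded distance from the cosets $\{gw_i^m\}_{m\in\mathbb Z}$). The decomposition space $\mathcal D_W$ is the quotient of the Cantor set $\partial T$ that identifies $gw_i^{\infty}$ with $gw_i^{-\infty}$ for all $g\in F_n$ and all $i$. Let $q:\partial T\to\mathcal D_W$ be the quotient map. A set $S$ is a cut set of a space $X$ if $X\setminus S$ is disconnected; a cut point is a one-point cut set. We say that $\mathcal D_W$ *has cut pairs* if it is disconnected, or has a cut point, or has two distinct points that form a cut set. **(A)** There is an algorithm (a total computable function) that, given $n\ge2$ and the reduced words of a list $W$ as above, decides whether $\mathcal D_W$ has cut pairs. **(B)** The decision can be made by the following finite tests. Let $\mathrm{Wh}_V(*)$ be the Whitehead graph of a list $V$: its vertices are the $2n$ neighbours of $*$ and its edges are the lines of the pattern of $V$ through $*$, each joining the two neighbours that it contains. Its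 number of edges is the complexity of $V$. A cut vertex is a vertex whose deletion disconnects two other vertices of its component. For $x\in Z\subset\{a_i^{\pm1}\}$ with $x^{-1}\notin Z$, the Whitehead automorphism $\phi_{x,Z}$ fixes $x$, and sends every other basis element $y$ to $x^{\epsilon}\,y\,x^{-\delta}$, where $\epsilon=1$ if $y\in Z$ and $0$ otherwise, and $\delta=1$ if $y^{-1}\in Z$ and $0$ otherwise. 1. *Reduction.* Some finite sequence of Whitehead automorphisms, each lowering the complexity, takes $W$ to a list $V$ whose Whitehead graph has no cut vertex. For every $V$ obtained in this way, $\mathcal D_W$ is connected if and only if $\mathrm{Wh}_V(*)$ is connected. Suppose from now on that $V$ is such a list and $\mathrm{Wh}_V(*)$ is connected. For a cyclically reduced $g\ne1$ with axis $H$, let $X=[*,g)$ be the set of vertices on the segment of $H$ from $*$ to $g$, without $g$, let $e$ be the edge of $H$ that ends at $*$ and lies outside this segment, and let $\mathrm{Wh}(X)\setminus H$ be the graph whose edges are the lines meeting $X$ and whose vertices are the components of $T\setminus X$, the two components containing ends of $H$ being deleted and their incident edges kept with loose ends at $e$ and at $ge$. Let $P_g$ be the finest partition of the loose ends at $e$ (that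 is, of the lines crossing $e$) such that loose ends in the same component of $\mathrm{Wh}(X)\setminus H$ lie in the same subset, and such that, whenever lines $a,b$ crossing $e$ lie in the same components of $\mathrm{Wh}(X)\setminus H$ as the lines $gc,gd$ crossing $ge$, respectively, $a$ and $b$ lie in the same subset if and only if $c$ and $d$ do. We say that $P_g$ has a segregated free edge if it has a subset that consists of a single line $l$ with $gl=l$. 2. *Cut points.* $\mathcal D_W$ has a cut point if and only if some cyclically reduced conjugate $g$ of an element of $V$ has the property that $P_g$ has a segregated free edge and more than two subsets. 3. *Cut pairs.* If $\mathcal D_W$ has no cut point, then it has two distinct points that form a cut set if and only if there is a cyclically reduced $g\neq 1$ of length at most $R$ such that $P_g$ has at least two subsets and no segregated free edge. Here $R=2n(2n-1)\,\max_{0\le c\le K} S(K,c)$, where $K$ is the complexity of $V$ and $S(K,c)$ is the number of partitions of a $K$-element set into $c$ nonempty subsets. -/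

import Mathlib

noncomputable section

namespace LinePattern

/-! ### Topology: cut sets -/

/-- A subset `S` of a space is a cut set if its complement is disconnected. -/
def IsCutSet {X : Type*} [TopologicalSpace X] (S : Set X) : Prop :=
  ¬ IsPreconnected Sᶜ

/-- The space has a cut point. -/
def HasCutPoint (X : Type*) [TopologicalSpace X] : Prop :=
  ∃ x : X, IsCutSet {x}

/-- Some pair of distinct points is a cut set. -/
def HasCutTwoPoints (X : Type*) [TopologicalSpace X] : Prop :=
  ∃ x y : X, x ≠ y ∧ IsCutSet {x, y}

/-- "Has cut pairs", in the inclusive sense: a space has *no* cut pairs when it is connected, has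
no cut points, and no pair of points is a cut set. -/
def HasCutPairs (X : Type*) [TopologicalSpace X] : Prop :=
  ¬ ConnectedSpace X ∨ HasCutPoint X ∨ HasCutTwoPoints X

/-! ### The free group of rank `n`, its tree and the boundary of the tree -/

/-- Generators and their inverses: `(i, true)` is `a_i`, and `(i, false)` is its inverse. -/
abbrev Letter (n : ℕ) : Type := Fin n × Bool

/-- The formal inverse of a letter. -/
def Letter.bar {n : ℕ} (x : Letter n) : Letter n := (x.1, !x.2)

/-- A letter as an element of the free group; also, a neighbour of the identity vertex. -/
def Letter.elt {n : ℕ} (x : Letter n) : FreeGroup (Fin n) := FreeGroup.mk [x]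

/-- The Cayley graph of the free group with respect to its free basis. -/
def cayleyTree (n : ℕ) : SimpleGraph (FreeGroup (Fin n)) :=
  SimpleGraph.fromRel fun u v => ∃ i : Fin n, v = u * FreeGroup.of i

/-- The boundary at infinity of the Cayley tree: geodesic rays from the identity vertex, that is,
infinite reduced words, with the topology of letterwise convergence (the shadows of vertices
are a basis). -/
abbrev Boundary (n : ℕ) : Type :=
  {ξ : ℕ → Letter n // ∀ i, ξ (i + 1) ≠ (ξ i).bar}

/-- Convergence of a sequence of vertices of the tree to a point of the boundary: every finite
initial segment of `ξ` is eventually an initial segment of the reduced word of `u i`. -/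
def ConvergesTo {n : ℕ} (u : ℕ → FreeGroup (Fin n)) (ξ : Boundary n) : Prop :=
  ∀ k : ℕ, ∀ᶠ i in Filter.atTop, ∀ j < k, (u i).toWord[j]? = some (ξ.1 j)

/-- `ξ` and `η` are the two endpoints `g w^∞` and `g w^{-∞}` of the line `{g w^m}`, for some `w`
in the list `W` and some `g`. -/
def EndpointsOfLine {n : ℕ} (W : List (FreeGroup (Fin n))) (ξ η : Boundary n) : Prop :=
  ∃ w ∈ W, ∃ g : FreeGroup (Fin n),
    ConvergesTo (fun m : ℕ => g * w ^ m) ξ ∧ ConvergesTo (fun m : ℕ => g * (w⁻¹) ^ m) η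

/-- The decomposition space of the line pattern generated by `W`: the quotient of the boundary of
the tree that identifies the two endpoints of each line, with the quotient topology. -/
abbrev DecompositionSpace {n : ℕ} (W : List (FreeGroup (Fin n))) : Type :=
  Quot (EndpointsOfLine W)

/-! ### Lines in the tree and Whitehead graphs -/

/-- The reduced word of `g` is cyclically reduced. -/
def CycReduced {n : ℕ} (g : FreeGroup (Fin n)) : Prop :=
  FreeGroup.IsCyclicallyReduced g.toWord

/-- The vertices of the axis of `h ≠ 1` in the tree: the `x` whose distance to `h x` is minimal,
that is, for which `x⁻¹ h x` is cyclically reduced. For `h = g w g⁻¹` with `w` cyclically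
reduced this is the geodesic through all the vertices `g w ^ m`. -/
def axis {n : ℕ} (h : FreeGroup (Fin n)) : Set (FreeGroup (Fin n)) :=
  {x | CycReduced (x⁻¹ * h * x)}

/-- The lines of the pattern generated by `W`, as vertex sets of geodesics in the tree. -/
def lines {n : ℕ} (W : List (FreeGroup (Fin n))) : Set (Set (FreeGroup (Fin n))) :=
  {l | ∃ w ∈ W, ∃ g : FreeGroup (Fin n), l = axis (g * w * g⁻¹)}

/-- The Whitehead graph `Wh(*)` at the identity vertex, as far as adjacency is concerned: its
vertices are the neighbours of `*`, and its edges from `x` to `y` are the lines of the pattern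
through `x`, `*` and `y`. -/
def whiteheadGraph {n : ℕ} (W : List (FreeGroup (Fin n))) : SimpleGraph (Letter n) where
  Adj x y := x ≠ y ∧ ∃ l ∈ lines W, x.elt ∈ l ∧ y.elt ∈ l
  symm := ⟨fun _ _ h => ⟨h.1.symm, h.2.imp fun _ hl => ⟨hl.1, hl.2.2, hl.2.1⟩⟩⟩
  loopless := ⟨fun _ h => h.1 rfl⟩

/-- The number of edges of `Wh(*)` (counted with multiplicity): the number of lines of the pattern
through the identity vertex. -/
def complexity {n : ℕ} (W : List (FreeGroup (Fin n))) : ℕ :=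
  Set.ncard {l | l ∈ lines W ∧ (1 : FreeGroup (Fin n)) ∈ l}

/-- `x` is a cut vertex: two other vertices in the same component of the graph are no longer
connected when `x` is deleted. -/
def IsCutVertex {V : Type*} (G : SimpleGraph V) (x : V) : Prop :=
  ∃ u v : V, u ≠ x ∧ v ≠ x ∧ G.Reachable u v ∧ ¬ ∃ p : G.Walk u v, x ∉ p.support

open Classical in
/-- The Whitehead automorphism that pushes `Z` through `x` (for `x ∈ Z` and `x.bar ∉ Z`). -/
def whiteheadAut {n : ℕ} (x : Letter n) (Z : Set (Letter n)) :
    FreeGroup (Fin n) →* FreeGroup (Fin n) :=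
  FreeGroup.lift fun i =>
    if i = x.1 then FreeGroup.of i
    else (if (i, true) ∈ Z then x.elt else 1) * FreeGroup.of i *
      (if (i, false) ∈ Z then x.elt⁻¹ else 1)

/-- `V` is obtained from `W` by a Whitehead automorphism that reduces the complexity. -/
def WhiteheadStep {n : ℕ} (W V : List (FreeGroup (Fin n))) : Prop :=
  ∃ (x : Letter n) (Z : Set (Letter n)), x ∈ Z ∧ x.bar ∉ Z ∧
    V = W.map (whiteheadAut x Z) ∧ complexity V < complexity W

/-- `V` is obtained from `W` by finitely many complexity-reducing Whitehead automorphisms, and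
its Whitehead graph has no cut vertex. -/
def IsReductionOf {n : ℕ} (V W : List (FreeGroup (Fin n))) : Prop :=
  Relation.ReflTransGen WhiteheadStep W V ∧ ∀ x, ¬ IsCutVertex (whiteheadGraph V) x

/-! ### Generalized Whitehead graphs -/

/-- The vertices of the generalized Whitehead graph `Wh(X)`, for `X` a finite connected set of
vertices of the tree: the components of the complement of `X`, each of which is given by its
unique vertex adjacent to `X`. -/
def whVertices {n : ℕ} (X : Set (FreeGroup (Fin n))) : Set (FreeGroup (Fin n)) :=
  {v | v ∉ X ∧ ∃ x ∈ X, (cayleyTree n).Adj x v}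

/-- The edges of `Wh(X)`: the lines of the pattern that meet `X`. The line `l` joins the two
vertices of `Wh(X)` that lie on `l`. -/
def whEdges {n : ℕ} (W : List (FreeGroup (Fin n))) (X : Set (FreeGroup (Fin n))) :
    Set (Set (FreeGroup (Fin n))) :=
  {l | l ∈ lines W ∧ (l ∩ X).Nonempty}

/-- Two edges of `Wh(X)` lie in the same connected component of `Wh(X) ∖ H`, the graph in which
the vertices of `Wh(X)` that belong to `H` are deleted and the edges at these vertices are
retained, with loose ends. -/
def WhConn {n : ℕ} (W : List (FreeGroup (Fin n))) (X H : Set (FreeGroup (Fin n))) :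
    Set (FreeGroup (Fin n)) → Set (FreeGroup (Fin n)) → Prop :=
  Relation.ReflTransGen fun a b =>
    a ∈ whEdges W X ∧ b ∈ whEdges W X ∧ ∃ v ∈ whVertices X, v ∉ H ∧ v ∈ a ∧ v ∈ b

/-! ### The periodic criterion, for a cyclically reduced `g ≠ 1` with axis `H` -/

/-- The segment `[*, g)` of the axis of `g`: the vertices from `*` to `g`, without `g`. -/
def segment {n : ℕ} (g : FreeGroup (Fin n)) : Set (FreeGroup (Fin n)) :=
  {x | ∃ p : List (Letter n), p <+: g.toWord ∧ p ≠ g.toWord ∧ x = FreeGroup.mk p}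

/-- The vertex before `*` on the axis of `g`: the inverse of the last letter of `g`. -/
def backVertex {n : ℕ} (g : FreeGroup (Fin n)) : FreeGroup (Fin n) :=
  (FreeGroup.mk g.toWord.getLast?.toList)⁻¹

/-- The loose ends of `Wh([*, g)) ∖ H` at the edge `e` of the axis that ends in `*`: the lines of
the pattern that cross `e`. The loose ends at the edge `g e` are the translates `g a` of these. -/
def looseEnds {n : ℕ} (W : List (FreeGroup (Fin n))) (g : FreeGroup (Fin n)) :
    Set (Set (FreeGroup (Fin n))) :=
  {l | l ∈ lines W ∧ backVertex g ∈ l ∧ (1 : FreeGroup (Fin n)) ∈ l}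

/-- Translation of a set of vertices by `g`. -/
def translate {n : ℕ} (g : FreeGroup (Fin n)) (l : Set (FreeGroup (Fin n))) :
    Set (FreeGroup (Fin n)) :=
  (fun x => g * x) '' l

/-- The partition `P` of the loose ends at `e` is at least as coarse as connectivity in
`Wh([*, g)) ∖ H`, and it is compatible with the splicing map: the partition `P'` of the loose ends
at `g e` that `P` induces through connectivity in `Wh([*, g)) ∖ H` is the translate `g P`. -/
def IsCompatible {n : ℕ} (W : List (FreeGroup (Fin n))) (g : FreeGroup (Fin n))
    (P : Setoid (looseEnds W g)) : Prop :=
  (∀ a b : looseEnds W g, WhConn W (segment g) (axis g) a b → P a b) ∧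
  ∀ a b c d : looseEnds W g,
    WhConn W (segment g) (axis g) a (translate g c) →
    WhConn W (segment g) (axis g) b (translate g d) → (P a b ↔ P c d)

/-- The finest partition of the loose ends at `e` that is at least as coarse as connectivity and
compatible with the splicing map (such partitions are closed under intersection). -/
def finestPartition {n : ℕ} (W : List (FreeGroup (Fin n))) (g : FreeGroup (Fin n)) :
    Setoid (looseEnds W g) :=
  sInf {P | IsCompatible W g P}

/-- The number of subsets in the finest partition. -/
def partitionSize {n : ℕ} (W : List (FreeGroup (Fin n))) (g : FreeGroup (Fin n)) : ℕ :=
  Nat.card (Quotient (finestPartition W g))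

/-- The finest partition has a segregated free edge: one of its subsets is a single line, and this
line runs along the whole axis of `g`, so that splicing joins it to its own translate. -/
def HasSegregatedFreeEdge {n : ℕ} (W : List (FreeGroup (Fin n))) (g : FreeGroup (Fin n)) : Prop :=
  ∃ a : looseEnds W g, translate g a = a ∧ ∀ b, finestPartition W g a b → b = a

/-- The finite test for `{g^∞, g^{-∞}}` to give a cut point. -/
def PassesCutPointTest {n : ℕ} (W : List (FreeGroup (Fin n))) (g : FreeGroup (Fin n)) : Prop :=
  HasSegregatedFreeEdge W g ∧ 2 < partitionSize W g

/-- The finite test for `{g^∞, g^{-∞}}` to give a cut pair. -/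
def PassesCutPairTest {n : ℕ} (W : List (FreeGroup (Fin n))) (g : FreeGroup (Fin n)) : Prop :=
  ¬ HasSegregatedFreeEdge W g ∧ 1 < partitionSize W g

/-- The constant `R = 2n(2n-1)m`, where `m` is the maximum over `c` of the number of partitions of
`K` things into `c` nonempty subsets. -/
def segmentBound (n K : ℕ) : ℕ :=
  2 * n * (2 * n - 1) * (Finset.range (K + 1)).sup (Nat.stirlingSecond K)

/-! ### Input of the algorithm -/

/-- The list `W` of elements of the free group, written as a list of reduced words in the letters
`(i, true)` and `(i, false)` with `i` a natural number. -/
def encodeWords {n : ℕ} (W : List (FreeGroup (Fin n))) : List (List (ℕ × Bool)) :=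
  W.map fun w => w.toWord.map fun x => (x.1.val, x.2)

end LinePattern

end

noncomputable section

namespace LinePattern

open Filter Topology

variable {n : ℕ}

/-! ### Letters and reduced words -/

/-! Everything is read off in the Cantor set of infinite reduced words. `dir x ξ` is the direction
in which the vertex `x` sees the end `ξ`, and the geodesic between two ends consists of the vertices
that see them in different directions (`geod`). An end lies on at most one line, so the points of
the decomposition space are fibres of one or two ends, and a set with closed preimage `E` is a cut
set exactly when the complement of `E` splits into two nonempty open sets that no line joins
(`isCutSet_iff`, `Separable`). Automorphisms act on the boundary by homeomorphisms that carry
patterns to patterns (`bmap`), so the list may be changed by Whitehead automorphisms; at a cut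
vertex, one of them lowers the complexity (`complexity_lt`, `exists_whiteheadStep`).

Let the Whitehead graph be connected without cut vertices (`TwoConn`). The engine is `TwoConn.mono`:
in a separation, a shadow that avoids the removed ends has one colour. Otherwise both colours would
occur in some smaller shadow at the next vertex, because lines connect the directions ahead without
using the way back, and the nested shadows would shrink to an end that has a neighbourhood of one
colour. Hence the space is connected, no single end separates, and a separation off two ends is
determined by the colours of the lines that leave the path between them.

Such colourings are recorded by finitely many states: the way in, the way out, and the set of
coloured lines at a vertex of the path. The central equivalence is `hasCutPairs_iff`: there are cut
pairs if and only if there is a closed path of states along which lines of both colours leave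
(`HasCycle`). A closed path, repeated, colours the lines along the axis of a cyclically reduced `g`
of the same length, and giving each end the colour found at its projection to the axis separates off
the two ends of `g` (`separable_of_periodic`). Conversely, take a separation off one or two fibres.
If both colours accumulate at a removed end, states repeat along the ray to it (`hasCycle_of_ray`).
If not, the colouring extends to all ends, and only removed lines can have ends of different
colours. Without such a line the space would be disconnected; with one, a single end would separate;
with two, the paths between them close up, because the states near the ends of a line are periodic
under the element that translates along it (`hasCycle_of_two_lines`).

A transition depends on its source only through the edge ahead and the colours of the lines across
it, so both halves of the closed path can be shortened to at most `2n * 2 ^ (K - 2)` steps; this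
gives the bound (`exists_short_separable`).

For a fixed `g`, a separation off the ends of the axis amounts to two inequivalent loose ends other
than the axis (`exists_inequivalent`, `separable_of_inequivalent`). Every component over the segment
has a loose end at `e`, so connectivity permutes the classes of loose ends, and following one class
along the axis gives a colouring that is periodic under a power of `g`. A segregated free edge means
that the axis is itself a line, so that its two ends are a single point; this tells cut points from
cut pairs.

The algorithm is an unbounded search for a certificate: an automorphism with its inverse, the
rotations of cyclic words for the transformed list, and conjugators, such that the Whitehead graph
is disconnected or satisfies `TwoConn`. Any certificate yields the right answer by a finite search
for closed paths (`answerB_iff`), and the reduction shows that one exists (`exists_certificate`). -/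

@[simp] theorem Letter.bar_bar (y : Letter n) : y.bar.bar = y := by
  simp [Letter.bar]

theorem Letter.bar_ne (y : Letter n) : y.bar ≠ y := by
  intro h
  have := congrArg Prod.snd h
  simp [Letter.bar] at this

theorem Letter.ne_bar (y : Letter n) : y ≠ y.bar := (Letter.bar_ne y).symm

theorem Letter.bar_inj {x y : Letter n} : x.bar = y.bar ↔ x = y :=
  ⟨fun h => by rw [← x.bar_bar, h, y.bar_bar], fun h => h ▸ rfl⟩

theorem Letter.bar_eq_comm {x y : Letter n} : x.bar = y ↔ x = y.bar := by
  rw [← Letter.bar_inj, Letter.bar_bar]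

@[simp] theorem Letter.elt_bar (y : Letter n) : y.bar.elt = y.elt⁻¹ := by
  simp [Letter.elt, Letter.bar, FreeGroup.inv_mk, FreeGroup.invRev]

@[simp] theorem Letter.toWord_elt (y : Letter n) : y.elt.toWord = [y] := by
  simp [Letter.elt, FreeGroup.toWord_mk]

theorem Letter.elt_ne_one (y : Letter n) : y.elt ≠ 1 := by
  intro h
  have := congrArg FreeGroup.toWord h
  simp at this

theorem cancel_iff {a b : Letter n} : (a.1 = b.1 → a.2 = b.2) ↔ b ≠ a.bar := by
  rcases a with ⟨a, s⟩; rcases b with ⟨b, t⟩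
  simp only [Letter.bar, ne_eq, Prod.mk.injEq]
  cases s <;> cases t <;> simp [eq_comm]

theorem isReduced_cons_cons {a b : Letter n} {L : List (Letter n)} :
    FreeGroup.IsReduced (a :: b :: L) ↔ b ≠ a.bar ∧ FreeGroup.IsReduced (b :: L) := by
  rw [FreeGroup.IsReduced, List.isChain_cons_cons, cancel_iff]; rfl

theorem isReduced_cons {a : Letter n} {L : List (Letter n)} :
    FreeGroup.IsReduced (a :: L) ↔ L.head? ≠ some a.bar ∧ FreeGroup.IsReduced L := by
  cases L with
  | nil => simp
  | cons b L => rw [isReduced_cons_cons]; simp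

/-- First letter of the reduced word of a group element. -/
def hd (g : FreeGroup (Fin n)) : Option (Letter n) := g.toWord.head?

@[simp] theorem hd_one : hd (1 : FreeGroup (Fin n)) = none := by simp [hd]

theorem hd_eq_none {g : FreeGroup (Fin n)} : hd g = none ↔ g = 1 := by
  simp [hd]

@[simp] theorem hd_elt (y : Letter n) : hd y.elt = some y := by simp [hd]

theorem toWord_elt_mul_of_ne {y : Letter n} {g : FreeGroup (Fin n)} (h : hd g ≠ some y.bar) :
    (y.elt * g).toWord = y :: g.toWord := by
  rw [FreeGroup.toWord_mul, Letter.toWord_elt, List.singleton_append]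
  exact (isReduced_cons.2 ⟨h, FreeGroup.isReduced_toWord⟩).reduce_eq

theorem exists_eq_elt_mul {y : Letter n} {g : FreeGroup (Fin n)} (h : hd g = some y) :
    ∃ g', g = y.elt * g' ∧ hd g' ≠ some y.bar ∧ g.toWord = y :: g'.toWord := by
  have hr := FreeGroup.isReduced_toWord (x := g)
  rw [hd] at h
  obtain ⟨L, hL⟩ : ∃ L, g.toWord = y :: L := by
    cases hg : g.toWord with
    | nil => simp [hg] at h
    | cons a L => rw [hg] at h; simp at h; exact ⟨L, by rw [h]⟩
  rw [hL, isReduced_cons] at hr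
  have hw : (FreeGroup.mk L).toWord = L := by rw [FreeGroup.toWord_mk, hr.2.reduce_eq]
  refine ⟨FreeGroup.mk L, ?_, ?_, ?_⟩
  · rw [Letter.elt, FreeGroup.mul_mk, List.singleton_append, ← hL, FreeGroup.mk_toWord]
  · rw [hd, hw]; exact hr.1
  · rw [hw, hL]

theorem toWord_elt_mul_of_eq {y : Letter n} {g : FreeGroup (Fin n)} (h : hd g = some y.bar) :
    (y.elt * g).toWord = g.toWord.tail := by
  obtain ⟨g', rfl, h2, h3⟩ := exists_eq_elt_mul h
  rw [h3]
  simp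

theorem hd_elt_mul {y : Letter n} {g : FreeGroup (Fin n)} :
    hd (y.elt * g) = some y ↔ hd g ≠ some y.bar := by
  constructor
  · rintro h h'
    obtain ⟨g', rfl, h2, h3⟩ := exists_eq_elt_mul h'
    simp only [Letter.elt_bar, mul_inv_cancel_left] at h
    exact h2 (by simpa using h)
  · intro h
    rw [hd, toWord_elt_mul_of_ne h]; rfl

/-- Induction on the letters of a group element. -/
theorem elt_induction {P : FreeGroup (Fin n) → Prop} (h1 : P 1)
    (h : ∀ (y : Letter n) (g : FreeGroup (Fin n)), P g → P (y.elt * g)) (g : FreeGroup (Fin n)) :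
    P g := by
  rw [← FreeGroup.mk_toWord (x := g)]
  induction g.toWord with
  | nil => exact h1
  | cons a L ih =>
    have := h a _ ih
    rwa [Letter.elt, FreeGroup.mul_mk] at this

/-- Induction on reduced words. -/
theorem reduced_induction {P : FreeGroup (Fin n) → Prop} (h1 : P 1)
    (h : ∀ (y : Letter n) (g : FreeGroup (Fin n)), hd g ≠ some y.bar → P g → P (y.elt * g))
    (g : FreeGroup (Fin n)) : P g := by
  induction hg : g.toWord generalizing g with
  | nil => rw [FreeGroup.toWord_eq_nil_iff] at hg; rw [hg]; exact h1
  | cons a L ih =>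
    obtain ⟨g', rfl, h2, h3⟩ := exists_eq_elt_mul (g := g) (y := a) (by rw [hd, hg]; rfl)
    rw [hg] at h3
    exact h a g' h2 (ih g' (by simpa using h3.symm))

/-- The first letter of the geodesic from the vertex `x` to the vertex `v`. -/
def dirv (x v : FreeGroup (Fin n)) : Option (Letter n) := hd (x⁻¹ * v)

@[simp] theorem dirv_self (x : FreeGroup (Fin n)) : dirv x x = none := by simp [dirv]

theorem dirv_eq_none {x v : FreeGroup (Fin n)} : dirv x v = none ↔ x = v := by
  rw [dirv, hd_eq_none, inv_mul_eq_one]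

theorem dirv_mul (g x v : FreeGroup (Fin n)) : dirv (g * x) (g * v) = dirv x v := by
  simp [dirv, mul_assoc]

/-- Of the two endpoints of an edge, exactly the one farther from `v` looks along the edge. Together
with the analogue `dir_mul_elt` for ends, this is the source of nearly all the geometry of the tree
below. -/
theorem dirv_mul_elt {x v : FreeGroup (Fin n)} {y : Letter n} :
    dirv (x * y.elt) v = some y.bar ↔ dirv x v ≠ some y := by
  have : (x * y.elt)⁻¹ * v = y.bar.elt * (x⁻¹ * v) := by simp [mul_assoc]
  rw [dirv, this, hd_elt_mul, Letter.bar_bar, dirv]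

/-! ### The boundary and the action of the group on it -/

/-- Multiplication of an infinite reduced word by a letter. -/
def step (y : Letter n) (ξ : Boundary n) : Boundary n :=
  if h : ξ.1 0 = y.bar then ⟨fun i => ξ.1 (i + 1), fun i => ξ.2 (i + 1)⟩
  else ⟨fun i => Nat.casesOn i y (fun j => ξ.1 j), fun i => by
    cases i with
    | zero => exact h
    | succ i => exact ξ.2 i⟩

/-- The infinite word without its first letter. -/
def tail (ξ : Boundary n) : Boundary n := ⟨fun i => ξ.1 (i + 1), fun i => ξ.2 (i + 1)⟩

theorem step_of_eq {y : Letter n} {ξ : Boundary n} (h : ξ.1 0 = y.bar) : step y ξ = tail ξ := by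
  rw [step, dif_pos h]; rfl

theorem step_zero_of_ne {y : Letter n} {ξ : Boundary n} (h : ξ.1 0 ≠ y.bar) :
    (step y ξ).1 0 = y := by
  simp [step, dif_neg h]

theorem step_succ_of_ne {y : Letter n} {ξ : Boundary n} (h : ξ.1 0 ≠ y.bar) (i : ℕ) :
    (step y ξ).1 (i + 1) = ξ.1 i := by
  rw [step, dif_neg h]

theorem tail_step {y : Letter n} {ξ : Boundary n} (h : ξ.1 0 ≠ y.bar) : tail (step y ξ) = ξ :=
  Subtype.ext (funext fun i => step_succ_of_ne h i)

theorem step_tail (ξ : Boundary n) : step (ξ.1 0) (tail ξ) = ξ := by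
  have h : (tail ξ).1 0 ≠ (ξ.1 0).bar := ξ.2 0
  apply Subtype.ext; funext i
  cases i with
  | zero => exact step_zero_of_ne h
  | succ i => exact step_succ_of_ne h i

theorem step_zero {y : Letter n} {ξ : Boundary n} : (step y ξ).1 0 = y ↔ ξ.1 0 ≠ y.bar := by
  constructor
  · intro h h'
    rw [step_of_eq h'] at h
    apply ξ.2 0
    rw [h', Letter.bar_bar]; exact h
  · exact step_zero_of_ne

theorem step_bar_step (y : Letter n) (ξ : Boundary n) : step y.bar (step y ξ) = ξ := by
  by_cases h : ξ.1 0 = y.bar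
  · rw [step_of_eq h, ← h, step_tail]
  · rw [step_of_eq (by rw [step_zero_of_ne h, Letter.bar_bar]), tail_step h]

/-- Multiplication by a letter as a permutation of the boundary. -/
def stepEquiv (y : Letter n) : Equiv.Perm (Boundary n) where
  toFun := step y
  invFun := step y.bar
  left_inv := step_bar_step y
  right_inv ξ := by simpa using step_bar_step y.bar ξ

/-- The action of the free group on the boundary of its tree. -/
def act : FreeGroup (Fin n) →* Equiv.Perm (Boundary n) :=
  FreeGroup.lift fun i => stepEquiv (i, true)

theorem act_elt (y : Letter n) (ξ : Boundary n) : act y.elt ξ = step y ξ := by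
  rcases y with ⟨i, b⟩
  cases b with
  | true =>
    have : (Letter.elt (i, true) : FreeGroup (Fin n)) = FreeGroup.of i := rfl
    rw [this, act, FreeGroup.lift_apply_of]; rfl
  | false =>
    have : (Letter.elt (i, false) : FreeGroup (Fin n)) = (FreeGroup.of i)⁻¹ := rfl
    rw [this, act, map_inv, FreeGroup.lift_apply_of]; rfl

@[simp] theorem act_one (ξ : Boundary n) : act 1 ξ = ξ := by simp

theorem act_mul (g h : FreeGroup (Fin n)) (ξ : Boundary n) : act (g * h) ξ = act g (act h ξ) := by
  simp

@[simp] theorem act_inv_act (g : FreeGroup (Fin n)) (ξ : Boundary n) : act g⁻¹ (act g ξ) = ξ := by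
  rw [← act_mul]; simp

@[simp] theorem act_act_inv (g : FreeGroup (Fin n)) (ξ : Boundary n) : act g (act g⁻¹ ξ) = ξ := by
  rw [← act_mul]; simp

theorem act_injective (g : FreeGroup (Fin n)) : Function.Injective (act g) := (act g).injective

/-- The first letter of the geodesic from the vertex `x` to the end `ξ`. -/
def dir (x : FreeGroup (Fin n)) (ξ : Boundary n) : Letter n := (act x⁻¹ ξ).1 0

theorem dir_one (ξ : Boundary n) : dir 1 ξ = ξ.1 0 := by simp [dir]

theorem dir_act (g x : FreeGroup (Fin n)) (ξ : Boundary n) :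
    dir x (act g ξ) = dir (g⁻¹ * x) ξ := by
  simp [dir]

theorem dir_mul_act (g x : FreeGroup (Fin n)) (ξ : Boundary n) :
    dir (g * x) (act g ξ) = dir x ξ := by
  simp [dir_act]

theorem dir_mul (g x : FreeGroup (Fin n)) (ξ : Boundary n) :
    dir (g * x) ξ = dir x (act g⁻¹ ξ) := by
  rw [dir_act, inv_inv]

theorem dir_mul_elt {x : FreeGroup (Fin n)} {y : Letter n} {ξ : Boundary n} :
    dir (x * y.elt) ξ = y.bar ↔ dir x ξ ≠ y := by
  have : act (x * y.elt)⁻¹ ξ = step y.bar (act x⁻¹ ξ) := by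
    rw [← act_elt, ← act_mul]; simp
  rw [dir, this, step_zero, Letter.bar_bar, dir]

theorem dir_eq_of_mul_elt {x : FreeGroup (Fin n)} {y : Letter n} {ξ : Boundary n}
    (h : dir (x * y.elt) ξ ≠ y.bar) : dir x ξ = y := by
  by_contra h'
  exact h (dir_mul_elt.2 h')

theorem dir_mul_elt_ne {x : FreeGroup (Fin n)} {y : Letter n} {ξ : Boundary n}
    (h : dir x ξ = y) : dir (x * y.elt) ξ ≠ y.bar :=
  fun h' => dir_mul_elt.1 h' h

/-- An assignment of directions to the vertices of the tree that points to a vertex or to an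
end. -/
def IsTarget (D : FreeGroup (Fin n) → Option (Letter n)) : Prop :=
  ∀ x y, D (x * Letter.elt y) = some y.bar ↔ D x ≠ some y

theorem isTarget_dirv (v : FreeGroup (Fin n)) : IsTarget fun x => dirv x v :=
  fun _ _ => dirv_mul_elt

theorem isTarget_dir (ξ : Boundary n) : IsTarget fun x => some (dir x ξ) := fun x y => by
  rw [Option.some_inj, dir_mul_elt, ne_eq, ne_eq, Option.some_inj]

/-- From a vertex in the half-tree behind an edge, all targets outside of this half-tree are seen
in the same direction. -/
theorem IsTarget.eq {D D' : FreeGroup (Fin n) → Option (Letter n)} (hD : IsTarget D)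
    (hD' : IsTarget D') {p v : FreeGroup (Fin n)} {y : Letter n} (hv : dirv p v = some y)
    (h : D p ≠ some y) (h' : D' p ≠ some y) : D v = D' v := by
  obtain ⟨v, rfl⟩ : ∃ w, v = p * w := ⟨p⁻¹ * v, by simp⟩
  rw [dirv, inv_mul_cancel_left] at hv
  induction v using reduced_induction generalizing y p with
  | h1 => simp at hv
  | h z g hg ih =>
    have hz : z = y := by
      rw [hd_elt_mul.2 hg] at hv; simpa using hv
    subst hz
    -- After one step both targets are seen looking back, along `z.bar`. The word is reduced, so the
    -- next letter is not `z.bar` and the hypotheses are passed on.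
    have e := (hD p z).2 h
    have e' := (hD' p z).2 h'
    cases hgg : hd g with
    | none =>
      rw [hd_eq_none] at hgg
      rw [hgg, mul_one, e, e']
    | some a =>
      have hne : some z.bar ≠ some a := fun hh => hg (by rw [hgg, hh])
      rw [← mul_assoc]
      exact ih (by rw [e]; exact hne) (by rw [e']; exact hne) hgg

theorem dir_eq_dirv {p v : FreeGroup (Fin n)} {y : Letter n} {ξ : Boundary n}
    (hv : dirv p v = some y) (hξ : dir p ξ ≠ y) : some (dir v ξ) = dirv v p :=
  (isTarget_dir ξ).eq (isTarget_dirv p) hv (by simpa using hξ) (by simp)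

theorem dir_eq_dir {p v : FreeGroup (Fin n)} {y : Letter n} {ξ η : Boundary n}
    (hv : dirv p v = some y) (hξ : dir p ξ ≠ y) (hη : dir p η ≠ y) : dir v ξ = dir v η :=
  Option.some_inj.1 ((isTarget_dir ξ).eq (isTarget_dir η) hv (by simpa using hξ) (by simpa using hη))

/-! ### Initial segments of infinite words -/

/-- The vertex reached by the first `k` letters of an infinite reduced word. -/
def pre (ξ : Boundary n) (k : ℕ) : FreeGroup (Fin n) := FreeGroup.mk ((List.range k).map ξ.1)

@[simp] theorem pre_zero (ξ : Boundary n) : pre ξ 0 = 1 := rfl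

theorem pre_succ (ξ : Boundary n) (k : ℕ) : pre ξ (k + 1) = pre ξ k * (ξ.1 k).elt := by
  simp [pre, List.range_succ, Letter.elt, FreeGroup.mul_mk]

theorem pre_succ' (ξ : Boundary n) (k : ℕ) : pre ξ (k + 1) = (ξ.1 0).elt * pre (tail ξ) k := by
  simp [pre, List.range_succ_eq_map, Letter.elt, FreeGroup.mul_mk, tail, Function.comp_def]

theorem act_pre_inv (ξ : Boundary n) (k : ℕ) (i : ℕ) :
    (act (pre ξ k)⁻¹ ξ).1 i = ξ.1 (k + i) := by
  induction k generalizing ξ with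
  | zero => simp
  | succ k ih =>
    have : act (pre ξ (k + 1))⁻¹ ξ = act (pre (tail ξ) k)⁻¹ (tail ξ) := by
      conv_lhs => rw [pre_succ', mul_inv_rev, act_mul, ← step_tail ξ, ← Letter.elt_bar, act_elt]
      rw [step_tail, ← step_bar_step (ξ.1 0) (tail ξ), step_tail]
    rw [this, ih]
    exact congrArg ξ.1 (by omega : k + i + 1 = k + 1 + i)

theorem dir_pre (ξ : Boundary n) (k : ℕ) : dir (pre ξ k) ξ = ξ.1 k := act_pre_inv ξ k 0

/-- The shadow of a vertex on a ray is a cylinder set: `ζ` is seen ahead as long as the two words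
have not parted. This links the tree to the product topology. -/
theorem dir_pre_eq_iff (ξ ζ : Boundary n) (k : ℕ) :
    dir (pre ξ k) ζ = ξ.1 k ↔ ∀ j ≤ k, ζ.1 j = ξ.1 j := by
  induction k with
  | zero => simp [dir_one]
  | succ k ih =>
    constructor
    · intro h
      have h1 : dir (pre ξ k) ζ = ξ.1 k := by
        apply dir_eq_of_mul_elt
        rw [← pre_succ, h]; exact ξ.2 k
      have h2 := ih.1 h1
      have h3 : pre ξ (k + 1) = pre ζ (k + 1) := by
        rw [pre, pre]; congr 1
        apply List.map_congr_left
        intro j hj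
        exact (h2 j (by rw [List.mem_range] at hj; omega)).symm
      intro j hj
      rcases Nat.lt_or_ge j (k + 1) with hj' | hj'
      · exact h2 j (by omega)
      · obtain rfl : j = k + 1 := by omega
        rw [← h, h3, dir_pre]
    · intro h
      have h3 : pre ξ (k + 1) = pre ζ (k + 1) := by
        rw [pre, pre]; congr 1
        apply List.map_congr_left
        intro j hj
        exact (h j (by rw [List.mem_range] at hj; omega)).symm
      rw [h3, dir_pre]; exact h _ le_rfl

theorem toWord_pre (ξ : Boundary n) (k : ℕ) : (pre ξ k).toWord = (List.range k).map ξ.1 := by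
  rw [pre, FreeGroup.toWord_mk]
  apply FreeGroup.IsReduced.reduce_eq
  rw [FreeGroup.IsReduced, List.isChain_map]
  rw [List.isChain_iff_getElem]
  intro i hi
  simp only [List.getElem_range]
  exact cancel_iff.2 (ξ.2 i)

theorem dir_pre_succ_eq_bar {ξ ζ : Boundary n} {k : ℕ} (h : dir (pre ξ k) ζ ≠ ξ.1 k) :
    dir (pre ξ (k + 1)) ζ = (ξ.1 k).bar := by
  rw [pre_succ]; exact dir_mul_elt.2 h

/-- Two distinct ends are eventually separated by the vertices on a ray. -/
theorem exists_dir_pre_ne {ξ ζ : Boundary n} (h : ξ ≠ ζ) :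
    ∃ k₀, ∀ k ≥ k₀, dir (pre ξ k) ζ ≠ ξ.1 k := by
  obtain ⟨j, hj⟩ : ∃ j, ζ.1 j ≠ ξ.1 j := by
    by_contra! hh
    exact h (Subtype.ext (funext fun j => (hh j).symm))
  refine ⟨j, fun k hk h' => hj ?_⟩
  exact (dir_pre_eq_iff ξ ζ k).1 h' j hk

theorem dir_pre_le {ξ ζ : Boundary n} {j k : ℕ} (hjk : j ≤ k) (h : dir (pre ξ k) ζ = ξ.1 k) :
    dir (pre ξ j) ζ = ξ.1 j :=
  (dir_pre_eq_iff ξ ζ j).2 fun i hi => (dir_pre_eq_iff ξ ζ k).1 h i (hi.trans hjk)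

/-! ### Convergence of vertices to ends -/

/-- The first `k` letters of `g` are those of `ξ`. -/
def Agree (ξ : Boundary n) (k : ℕ) (g : FreeGroup (Fin n)) : Prop :=
  ∀ j < k, g.toWord[j]? = some (ξ.1 j)

theorem Agree.mono {ξ : Boundary n} {k l : ℕ} {g : FreeGroup (Fin n)} (h : Agree ξ l g)
    (hkl : k ≤ l) : Agree ξ k g := fun j hj => h j (by omega)

theorem Agree.hd {ξ : Boundary n} {k : ℕ} {g : FreeGroup (Fin n)} (h : Agree ξ (k + 1) g) :
    hd g = some (ξ.1 0) := by
  rw [LinePattern.hd, List.head?_eq_getElem?]; exact h 0 (by omega)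

theorem agree_succ {ξ : Boundary n} {k : ℕ} {g : FreeGroup (Fin n)} :
    Agree ξ (k + 1) ((ξ.1 0).elt * g) ↔ LinePattern.hd g ≠ some (ξ.1 0).bar ∧
      Agree (tail ξ) k g := by
  constructor
  · intro h
    have h1 := hd_elt_mul.1 h.hd
    refine ⟨h1, fun j hj => ?_⟩
    have := h (j + 1) (by omega)
    rwa [toWord_elt_mul_of_ne h1, List.getElem?_cons_succ] at this
  · rintro ⟨h1, h2⟩ j hj
    rw [toWord_elt_mul_of_ne h1]
    cases j with
    | zero => simp
    | succ j => rw [List.getElem?_cons_succ]; exact h2 j (by omega)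

/-- Multiplication by a letter cancels at most one letter, so at most one letter of agreement is
lost. -/
theorem Agree.elt_mul {ξ : Boundary n} {k : ℕ} {g : FreeGroup (Fin n)} (h : Agree ξ (k + 1) g)
    (y : Letter n) : Agree (step y ξ) k (y.elt * g) := by
  by_cases h0 : ξ.1 0 = y.bar
  · rw [step_of_eq h0]
    obtain ⟨g', rfl⟩ : ∃ g', g = (ξ.1 0).elt * g' := ⟨(ξ.1 0).elt⁻¹ * g, by simp⟩
    rw [h0, Letter.elt_bar, mul_inv_cancel_left]
    exact (agree_succ.1 h).2
  · have h1 := step_zero_of_ne h0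
    have := (agree_succ (ξ := step y ξ) (k := k + 1) (g := g)).2
    rw [h1, tail_step h0] at this
    refine (this ⟨?_, h⟩).mono (by omega)
    rw [h.hd]; simpa using h0

theorem ConvergesTo.act {u : ℕ → FreeGroup (Fin n)} {ξ : Boundary n} (h : ConvergesTo u ξ)
    (g : FreeGroup (Fin n)) : ConvergesTo (fun i => g * u i) (act g ξ) := by
  induction g using elt_induction with
  | h1 => simpa using h
  | h y g ih =>
    intro k
    filter_upwards [ih (k + 1)] with i hi
    rw [act_mul, act_elt, mul_assoc]
    exact Agree.elt_mul hi y

theorem toWord_mul_elt (g : FreeGroup (Fin n)) (y : Letter n) :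
    (g * y.elt).toWord = g.toWord ++ [y] ∨ (g * y.elt).toWord = g.toWord.dropLast := by
  have e : (g * y.elt).toWord = FreeGroup.invRev ((y.bar.elt * g⁻¹).toWord) := by
    rw [← FreeGroup.toWord_inv]; simp
  by_cases hy : LinePattern.hd g⁻¹ = some y
  · right
    rw [e, toWord_elt_mul_of_eq (by simpa using hy), FreeGroup.toWord_inv]
    simp [FreeGroup.invRev, Function.comp_def]
  · left
    rw [e, toWord_elt_mul_of_ne (by simpa using hy), FreeGroup.toWord_inv]
    simp [FreeGroup.invRev, Letter.bar, Function.comp_def]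

theorem Agree.mul_elt {ξ : Boundary n} {k : ℕ} {g : FreeGroup (Fin n)} (h : Agree ξ (k + 1) g)
    (y : Letter n) : Agree ξ k (g * y.elt) := by
  have key := toWord_mul_elt g y
  have hl : k < g.toWord.length := by
    have := h k (by omega)
    by_contra h'
    rw [List.getElem?_eq_none (by omega)] at this
    simp at this
  intro j hj
  rw [← h j (by omega)]
  rcases key with e | e
  · rw [e, List.getElem?_append_left (by omega)]
  · rw [e, List.getElem?_dropLast, if_pos (by omega)]

theorem ConvergesTo.mul_right {u : ℕ → FreeGroup (Fin n)} {ξ : Boundary n} (h : ConvergesTo u ξ)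
    (g : FreeGroup (Fin n)) : ConvergesTo (fun i => u i * g) ξ := by
  induction g using elt_induction generalizing u with
  | h1 => simpa using h
  | h y g ih =>
    have : ConvergesTo (fun i => u i * y.elt) ξ := fun k => by
      filter_upwards [h (k + 1)] with i hi using Agree.mul_elt hi y
    simpa [mul_assoc] using ih this

theorem ConvergesTo.unique {u : ℕ → FreeGroup (Fin n)} {ξ ζ : Boundary n} (h : ConvergesTo u ξ)
    (h' : ConvergesTo u ζ) : ξ = ζ := by
  apply Subtype.ext; funext k
  obtain ⟨i, hi, hi'⟩ := ((h (k + 1)).and (h' (k + 1))).exists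
  have := hi k (by omega)
  rw [hi' k (by omega)] at this
  simpa using this.symm

theorem ConvergesTo.comp {u : ℕ → FreeGroup (Fin n)} {ξ : Boundary n} (h : ConvergesTo u ξ)
    {φ : ℕ → ℕ} (hφ : Tendsto φ atTop atTop) : ConvergesTo (u ∘ φ) ξ :=
  fun k => hφ.eventually (h k)

theorem agree_iff_dirv {ξ : Boundary n} {k : ℕ} {g : FreeGroup (Fin n)} :
    Agree ξ (k + 1) g ↔ dirv (pre ξ k) g = some (ξ.1 k) := by
  induction k generalizing ξ g with
  | zero =>
    rw [pre_zero, dirv, inv_one, one_mul, LinePattern.hd, List.head?_eq_getElem?, Agree]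
    simp
  | succ k ih =>
    obtain ⟨g, rfl⟩ : ∃ g', g = (ξ.1 0).elt * g' := ⟨(ξ.1 0).elt⁻¹ * g, by simp⟩
    rw [agree_succ, pre_succ', dirv_mul, ih]
    constructor
    · exact fun h => h.2
    · intro h
      refine ⟨?_, h⟩
      have := (ih.2 h).hd
      rw [this]
      intro hh
      exact ξ.2 0 (Option.some_inj.1 hh)

theorem agree_pre (ξ : Boundary n) (k : ℕ) : Agree ξ k (pre ξ k) := by
  intro j hj
  rw [toWord_pre]; simp [hj]

theorem convergesTo_pre (ξ : Boundary n) : ConvergesTo (pre ξ) ξ := fun k => by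
  filter_upwards [eventually_ge_atTop k] with i hi
  exact (agree_pre ξ i).mono hi

/-! ### Topology of the boundary -/

instance : DiscreteTopology (Letter n) := inferInstance

theorem continuous_coord (i : ℕ) : Continuous fun ξ : Boundary n => ξ.1 i :=
  (continuous_apply i).comp continuous_subtype_val

theorem continuous_step (y : Letter n) : Continuous (step y) := by
  apply Continuous.subtype_mk (f := fun ξ => (step y ξ).1)
  apply continuous_pi
  intro j
  -- Coordinate `j` of the product depends on three letters of `ξ` only. The truncated `j - 1` does
  -- no harm: for `j = 0` the last component is not consulted.
  have : (fun ξ : Boundary n => (step y ξ).1 j) = (fun p : Letter n × Letter n × Letter n =>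
      if p.1 = y.bar then p.2.1 else if j = 0 then y else p.2.2) ∘
      fun ξ => (ξ.1 0, ξ.1 (j + 1), ξ.1 (j - 1)) := by
    funext ξ
    by_cases h : ξ.1 0 = y.bar
    · simp [step_of_eq h, tail, h]
    · cases j with
      | zero => simp [step_zero_of_ne h, h]
      | succ j => simp [step_succ_of_ne h, h]
  rw [this]
  exact continuous_of_discreteTopology.comp
    ((continuous_coord 0).prodMk ((continuous_coord _).prodMk (continuous_coord _)))

theorem continuous_act (g : FreeGroup (Fin n)) : Continuous (act g) := by
  induction g using elt_induction with
  | h1 => simpa using continuous_id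
  | h y g ih =>
    have : ⇑(act (y.elt * g)) = step y ∘ act g := by
      funext ξ; rw [act_mul, act_elt]; rfl
    rw [this]; exact (continuous_step y).comp ih

theorem continuous_dir (x : FreeGroup (Fin n)) : Continuous (dir x) :=
  (continuous_coord 0).comp (continuous_act x⁻¹)

theorem isOpen_dir (x : FreeGroup (Fin n)) (P : Letter n → Prop) : IsOpen {ζ | P (dir x ζ)} :=
  (isOpen_discrete {y | P y}).preimage (continuous_dir x)

/-- The shadows of the vertices on a ray form a basis of neighbourhoods of its end. -/
theorem exists_shadow_subset {A : Set (Boundary n)} (hA : IsOpen A) {ξ : Boundary n} (hξ : ξ ∈ A) :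
    ∃ k₀, ∀ k ≥ k₀, ∀ ζ, dir (pre ξ k) ζ = ξ.1 k → ζ ∈ A := by
  obtain ⟨U, hU, rfl⟩ := isOpen_induced_iff.1 hA
  obtain ⟨I, u, hu, hs⟩ := isOpen_pi_iff.1 hU ξ.1 hξ
  refine ⟨I.sup id, fun k hk ζ hζ => hs ?_⟩
  intro i hi
  rw [(dir_pre_eq_iff ξ ζ k).1 hζ i ((Finset.le_sup (f := id) hi).trans hk)]
  exact (hu i hi).2

theorem isOpen_of_shadows {A : Set (Boundary n)}
    (h : ∀ ξ ∈ A, ∃ x : FreeGroup (Fin n), ∀ ζ, dir x ζ = dir x ξ → ζ ∈ A) : IsOpen A := by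
  rw [isOpen_iff_forall_mem_open]
  intro ξ hξ
  obtain ⟨x, hx⟩ := h ξ hξ
  exact ⟨{ζ | dir x ζ = dir x ξ}, hx, isOpen_dir x (· = dir x ξ), rfl⟩

/-- Every half-tree contains an end. -/
theorem exists_dir_eq (x : FreeGroup (Fin n)) (y : Letter n) : ∃ ξ, dir x ξ = y :=
  ⟨act x ⟨fun _ => y, fun _ => y.ne_bar⟩, by rw [dir, act_inv_act]⟩

/-! ### Geodesics between ends -/

/-- The vertices of the geodesic with ends `ξ ≠ η`. -/
def geod (ξ η : Boundary n) : Set (FreeGroup (Fin n)) := {x | dir x ξ ≠ dir x η}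

theorem mem_geod {ξ η : Boundary n} {x : FreeGroup (Fin n)} :
    x ∈ geod ξ η ↔ dir x ξ ≠ dir x η := Iff.rfl

theorem geod_comm (ξ η : Boundary n) : geod ξ η = geod η ξ := by
  ext x; simp [mem_geod, eq_comm]

theorem mem_translate {g x : FreeGroup (Fin n)} {l : Set (FreeGroup (Fin n))} :
    x ∈ translate g l ↔ g⁻¹ * x ∈ l := by
  constructor
  · rintro ⟨y, hy, rfl⟩; simpa using hy
  · intro h; exact ⟨_, h, by simp⟩

theorem translate_mul (g h : FreeGroup (Fin n)) (l : Set (FreeGroup (Fin n))) :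
    translate (g * h) l = translate g (translate h l) := by
  ext x; simp [mem_translate, mul_assoc]

@[simp] theorem translate_one (l : Set (FreeGroup (Fin n))) : translate 1 l = l := by
  ext x; simp [mem_translate]

theorem translate_geod (g : FreeGroup (Fin n)) (ξ η : Boundary n) :
    translate g (geod ξ η) = geod (act g ξ) (act g η) := by
  ext x; simp [mem_translate, mem_geod, dir_act]

theorem translate_injective (g : FreeGroup (Fin n)) :
    Function.Injective (translate g) := fun a b h => by
  have := congrArg (translate g⁻¹) h
  simpa [← translate_mul] using this

theorem mem_geod_of_dir {x : FreeGroup (Fin n)} {y : Letter n} {ξ η : Boundary n}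
    (h : dir x ξ = y) (h' : dir x η ≠ y) : x ∈ geod ξ η := by
  rw [mem_geod, h]; exact h'.symm

theorem mul_elt_mem_geod_of_dir {x : FreeGroup (Fin n)} {y : Letter n} {ξ η : Boundary n}
    (h : dir x ξ = y) (h' : dir x η ≠ y) : x * y.elt ∈ geod ξ η := by
  rw [mem_geod, dir_mul_elt.2 h']
  exact dir_mul_elt_ne h

theorem mul_elt_mem_geod {x : FreeGroup (Fin n)} {y : Letter n} {ξ η : Boundary n}
    (hx : x ∈ geod ξ η) : x * y.elt ∈ geod ξ η ↔ dir x ξ = y ∨ dir x η = y := by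
  constructor
  · intro h
    by_contra! h'
    rw [mem_geod, dir_mul_elt.2 h'.1, dir_mul_elt.2 h'.2] at h
    exact h rfl
  · rintro (h | h)
    · exact mul_elt_mem_geod_of_dir h fun h' => hx (by rw [h, h'])
    · rw [geod_comm]
      exact mul_elt_mem_geod_of_dir h fun h' => hx (by rw [h, h'])

/-- The two ends of a vertex pair `x`, `x y` of a geodesic lie on different sides of the edge. -/
theorem edge_mem_geod {x : FreeGroup (Fin n)} {y : Letter n} {ξ η : Boundary n}
    (hx : x ∈ geod ξ η) (hy : x * y.elt ∈ geod ξ η) :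
    (dir x ξ = y ∧ dir x η ≠ y) ∨ (dir x η = y ∧ dir x ξ ≠ y) := by
  rcases (mul_elt_mem_geod hx).1 hy with h | h
  · exact Or.inl ⟨h, fun h' => hx (by rw [h, h'])⟩
  · exact Or.inr ⟨h, fun h' => hx (by rw [h, h'])⟩

theorem dirv_of_mem_geod {x v : FreeGroup (Fin n)} {z : Letter n} {ξ η : Boundary n}
    (hv : v ∈ geod ξ η) (h : dirv x v = some z) : dir x ξ = z ∨ dir x η = z := by
  by_contra! h'
  exact hv (dir_eq_dir h h'.1 h'.2)

theorem exists_pre_mem_geod {ξ η : Boundary n} (h : ξ ≠ η) :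
    ∃ k₀, ∀ k ≥ k₀, pre ξ k ∈ geod ξ η := by
  obtain ⟨k₀, hk⟩ := exists_dir_pre_ne h
  exact ⟨k₀, fun k hk' => by rw [mem_geod, dir_pre]; exact (hk k hk').symm⟩

/-- An end other than `ξ` and `η` has a shadow that contains neither of them, and by
`dirv_of_mem_geod` the geodesic has no vertex in the half-tree behind it. It follows that a geodesic
determines its ends. -/
theorem end_of_frequently {ξ η ζ : Boundary n}
    (h : ∀ k, ∃ u ∈ geod ξ η, Agree ζ k u) : ζ = ξ ∨ ζ = η := by
  by_contra! hne
  obtain ⟨k₁, h₁⟩ := exists_dir_pre_ne hne.1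
  obtain ⟨k₂, h₂⟩ := exists_dir_pre_ne hne.2
  obtain ⟨u, hu, hk⟩ := h (k₁ + k₂ + 1)
  rw [agree_iff_dirv] at hk
  rcases dirv_of_mem_geod hu hk with h | h
  · exact h₁ _ (by omega) h
  · exact h₂ _ (by omega) h

theorem end_of_geod_subset {ξ η ξ' η' : Boundary n} (hne : ξ ≠ η)
    (h : geod ξ η ⊆ geod ξ' η') : ξ = ξ' ∨ ξ = η' := by
  obtain ⟨k₀, hk⟩ := exists_pre_mem_geod hne
  refine end_of_frequently fun k => ⟨pre ξ (k + k₀), h (hk _ (by omega)), ?_⟩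
  exact (agree_pre ξ (k + k₀)).mono (by omega)

theorem geod_subset_inj {ξ η ξ' η' : Boundary n} (hne : ξ ≠ η) (h : geod ξ η ⊆ geod ξ' η') :
    (ξ = ξ' ∧ η = η') ∨ (ξ = η' ∧ η = ξ') := by
  have h1 := end_of_geod_subset hne h
  have h2 : η = ξ' ∨ η = η' := end_of_geod_subset hne.symm (by rw [geod_comm]; exact h)
  rcases h1 with h1 | h1 <;> rcases h2 with h2 | h2
  · exact absurd (h1.trans h2.symm) hne
  · exact Or.inl ⟨h1, h2⟩
  · exact Or.inr ⟨h1, h2⟩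
  · exact absurd (h1.trans h2.symm) hne

theorem geod_inj {ξ η ξ' η' : Boundary n} (hne : ξ ≠ η) (h : geod ξ η = geod ξ' η') :
    (ξ = ξ' ∧ η = η') ∨ (ξ = η' ∧ η = ξ') :=
  geod_subset_inj hne h.subset

/-! ### Fixed ends of group elements -/

/-- `ξ` is the attracting end of `h`. -/
def Attr (h : FreeGroup (Fin n)) (ξ : Boundary n) : Prop := ConvergesTo (fun m : ℕ => h ^ m) ξ

theorem Attr.unique {h : FreeGroup (Fin n)} {ξ ζ : Boundary n} (hξ : Attr h ξ) (hζ : Attr h ζ) :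
    ξ = ζ := ConvergesTo.unique hξ hζ

theorem Attr.conj {h : FreeGroup (Fin n)} {ξ : Boundary n} (hξ : Attr h ξ)
    (g : FreeGroup (Fin n)) : Attr (g * h * g⁻¹) (act g ξ) := by
  have := (ConvergesTo.act hξ g).mul_right g⁻¹
  simpa [Attr, conj_pow] using this

theorem Attr.conj' {h : FreeGroup (Fin n)} {ξ : Boundary n} (hξ : Attr h ξ)
    (g : FreeGroup (Fin n)) : Attr (g⁻¹ * h * g) (act g⁻¹ ξ) := by
  simpa using hξ.conj g⁻¹

theorem Attr.pow {h : FreeGroup (Fin n)} {ξ : Boundary n} (hξ : Attr h ξ) {m : ℕ} (hm : 0 < m) :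
    Attr (h ^ m) ξ := by
  have := ConvergesTo.comp hξ (φ := fun i => m * i) (tendsto_id.const_mul_atTop' hm)
  intro k
  filter_upwards [this k] with i hi
  simpa [pow_mul] using hi

theorem Attr.act_self {h : FreeGroup (Fin n)} {ξ : Boundary n} (hξ : Attr h ξ) : act h ξ = ξ := by
  have h1 := ConvergesTo.act hξ h
  have h2 := ConvergesTo.comp hξ (tendsto_add_atTop_nat 1)
  refine h1.unique ?_
  convert h2 using 2 with m
  simp [pow_succ']

theorem act_inv_of_act {h : FreeGroup (Fin n)} {ξ : Boundary n} (hξ : act h ξ = ξ) :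
    act h⁻¹ ξ = ξ := by
  conv_lhs => rw [← hξ]
  exact act_inv_act h ξ

theorem act_zpow_of_act {h : FreeGroup (Fin n)} {ξ : Boundary n} (hξ : act h ξ = ξ) (i : ℤ) :
    act (h ^ i) ξ = ξ := by
  rw [map_zpow]
  exact Function.IsFixedPt.perm_zpow hξ i

theorem Attr.act_self' {h : FreeGroup (Fin n)} {ξ : Boundary n} (hξ : Attr h⁻¹ ξ) :
    act h ξ = ξ := by
  simpa using act_inv_of_act hξ.act_self

/-- The last letter of `c` is the inverse of the first letter of `c⁻¹`. In this form the condition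
compares two directions at the identity vertex, as membership in a geodesic does. -/
theorem cycReduced_iff {c : FreeGroup (Fin n)} : CycReduced c ↔ c = 1 ∨ hd c ≠ hd c⁻¹ := by
  rw [CycReduced, FreeGroup.isCyclicallyReduced_iff, and_iff_right FreeGroup.isReduced_toWord]
  rw [hd, hd, FreeGroup.toWord_inv]
  rcases List.eq_nil_or_concat' c.toWord with h | ⟨L, a, h⟩
  · rw [h]; simp [FreeGroup.toWord_eq_nil_iff.1 h]
  · have hc : c ≠ 1 := by rintro rfl; simp at h
    rw [or_iff_right hc]
    have e : (FreeGroup.invRev c.toWord).head? = some (Letter.bar a) := by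
      rw [h]; simp [FreeGroup.invRev, Letter.bar]
    rw [e]
    have e' : c.toWord.getLast? = some a := by rw [h]; simp
    rw [e']
    cases hh : c.toWord.head? with
    | none => simp
    | some b =>
      simp only [Option.mem_def, Option.some.injEq, forall_eq', ne_eq]
      exact cancel_iff

theorem pre_add (ξ : Boundary n) (k l : ℕ) :
    pre ξ (k + l) = pre ξ k * pre (act (pre ξ k)⁻¹ ξ) l := by
  induction l with
  | zero => simp
  | succ l ih => rw [← add_assoc, pre_succ, ih, pre_succ, act_pre_inv, mul_assoc]

theorem pre_mul_of_periodic {ξ : Boundary n} {m : ℕ} (hξ : ∀ i, ξ.1 (m + i) = ξ.1 i) (k : ℕ) :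
    pre ξ (m * k) = pre ξ m ^ k := by
  have h : act (pre ξ m)⁻¹ ξ = ξ := Subtype.ext (funext fun i => by rw [act_pre_inv, hξ])
  induction k with
  | zero => simp
  | succ k ih => rw [mul_add, mul_one, add_comm, pre_add, h, ih, pow_succ']

theorem attr_of_periodic {ξ : Boundary n} {m : ℕ} (hm : 0 < m)
    (hξ : ∀ i, ξ.1 (m + i) = ξ.1 i) : Attr (pre ξ m) ξ := by
  have := ConvergesTo.comp (convergesTo_pre ξ) (φ := fun i => m * i)
    (tendsto_id.const_mul_atTop' hm)
  intro k
  filter_upwards [this k] with i hi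
  simpa [pre_mul_of_periodic hξ] using hi

theorem norm_pre (ξ : Boundary n) (m : ℕ) : (pre ξ m).norm = m := by
  simp [FreeGroup.norm, toWord_pre]

/-- The periodic infinite word of a cyclically reduced element. -/
theorem exists_periodic {c : FreeGroup (Fin n)} (hc : CycReduced c) (h1 : c ≠ 1) :
    ∃ ξ : Boundary n, (∀ i, ξ.1 (c.norm + i) = ξ.1 i) ∧ pre ξ c.norm = c := by
  have hpos : 0 < c.norm := Nat.pos_of_ne_zero (by simpa using h1)
  have hlt : ∀ i, i % c.norm < c.toWord.length := fun i => Nat.mod_lt _ hpos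
  refine ⟨⟨fun i => c.toWord[i % c.norm]'(hlt i), fun i => ?_⟩, fun i => ?_, ?_⟩
  · rw [← cancel_iff]
    by_cases hi : i % c.norm + 1 < c.norm
    · have := (List.isChain_iff_getElem.1 (FreeGroup.isReduced_toWord (x := c))) (i % c.norm) hi
      have e : (i + 1) % c.norm = i % c.norm + 1 := by
        rw [Nat.add_mod, Nat.mod_eq_of_lt (a := 1) (by omega), Nat.mod_eq_of_lt hi]
      simp only [e]; exact this
    · have hlast : i % c.norm = c.toWord.length - 1 := by
        have := hlt i
        have : c.norm = c.toWord.length := rfl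
        omega
      have e : (i + 1) % c.norm = 0 := by
        rw [← Nat.mod_add_mod, hlast]
        have : c.toWord.length - 1 + 1 = c.norm := Nat.sub_add_cancel hpos
        rw [this, Nat.mod_self]
      simp only [e, hlast]
      refine hc.2 _ ?_ _ ?_
      · rw [List.getLast?_eq_getElem?]; simp
      · rw [List.head?_eq_getElem?]; simp
  · simp
  · rw [pre]
    conv_rhs => rw [← FreeGroup.mk_toWord (x := c)]
    congr 1
    apply List.ext_getElem
    · simp [FreeGroup.norm]
    · intro i h1 h2
      simp only [List.getElem_map, List.getElem_range]
      congr 1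
      exact Nat.mod_eq_of_lt h2

theorem exists_attr_of_cycReduced {c : FreeGroup (Fin n)} (hc : CycReduced c) (h1 : c ≠ 1) :
    ∃ ξ : Boundary n, Attr c ξ ∧ some (ξ.1 0) = hd c ∧ ∀ k, pre ξ (c.norm * k) = c ^ k := by
  have hpos : 0 < c.norm := Nat.pos_of_ne_zero (by simpa using h1)
  obtain ⟨ξ, h2, h3⟩ := exists_periodic hc h1
  refine ⟨ξ, ?_, ?_, ?_⟩
  · have := attr_of_periodic hpos h2
    rwa [h3] at this
  · have := agree_pre ξ c.norm
    rw [h3] at this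
    obtain ⟨m, hm⟩ := Nat.exists_eq_succ_of_ne_zero hpos.ne'
    rw [hm] at this
    exact this.hd.symm
  · intro k; rw [pre_mul_of_periodic h2, h3]

theorem Attr.zero_of_cycReduced {c : FreeGroup (Fin n)} (hc : CycReduced c) (h1 : c ≠ 1)
    {ξ : Boundary n} (hξ : Attr c ξ) : some (ξ.1 0) = hd c := by
  obtain ⟨ζ, h2, h3, -⟩ := exists_attr_of_cycReduced hc h1
  rwa [hξ.unique h2]

theorem CycReduced.inv {c : FreeGroup (Fin n)} (hc : CycReduced c) : CycReduced c⁻¹ := by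
  rw [cycReduced_iff] at *
  rw [inv_inv, inv_eq_one]
  exact hc.imp_right Ne.symm

theorem exists_conj_cycReduced (h : FreeGroup (Fin n)) :
    ∃ d : FreeGroup (Fin n), CycReduced (d⁻¹ * h * d) := by
  refine ⟨FreeGroup.mk (FreeGroup.reduceCyclically.conjugator h.toWord), ?_⟩
  have h1 := FreeGroup.reduceCyclically.conj_conjugator_reduceCyclically h.toWord
  have h2 := FreeGroup.reduceCyclically.isCyclicallyReduced (FreeGroup.isReduced_toWord (x := h))
  have h3 : h = FreeGroup.mk (FreeGroup.reduceCyclically.conjugator h.toWord) *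
      FreeGroup.mk (FreeGroup.reduceCyclically h.toWord) *
      (FreeGroup.mk (FreeGroup.reduceCyclically.conjugator h.toWord))⁻¹ := by
    rw [FreeGroup.inv_mk, FreeGroup.mul_mk, FreeGroup.mul_mk, h1, FreeGroup.mk_toWord]
  have h4 : (FreeGroup.mk (FreeGroup.reduceCyclically.conjugator h.toWord))⁻¹ * h *
      FreeGroup.mk (FreeGroup.reduceCyclically.conjugator h.toWord) =
      FreeGroup.mk (FreeGroup.reduceCyclically h.toWord) := by
    generalize FreeGroup.mk (FreeGroup.reduceCyclically.conjugator h.toWord) = d at h3 ⊢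
    generalize FreeGroup.mk (FreeGroup.reduceCyclically h.toWord) = c at h3 ⊢
    rw [h3]; group
  rw [h4, CycReduced, FreeGroup.toWord_mk, h2.isReduced.reduce_eq]
  exact h2

theorem conj_ne_one {h : FreeGroup (Fin n)} (h1 : h ≠ 1) (d : FreeGroup (Fin n)) :
    d⁻¹ * h * d ≠ 1 := by
  intro e
  apply h1
  have : h = d * (d⁻¹ * h * d) * d⁻¹ := by group
  rw [this, e]; group

theorem exists_attr {h : FreeGroup (Fin n)} (h1 : h ≠ 1) : ∃ ξ, Attr h ξ := by
  obtain ⟨d, hd⟩ := exists_conj_cycReduced h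
  obtain ⟨ξ, hξ, -⟩ := exists_attr_of_cycReduced hd (conj_ne_one h1 d)
  refine ⟨act d ξ, ?_⟩
  have := hξ.conj d
  simpa [mul_assoc] using this

/-- If `ζ` does not lie in the direction of `c⁻¹`, then the vertex `c⁻¹` sees it in the direction of
the identity vertex. Apply `c`, which fixes `ζ`. -/
theorem zero_of_act_eq {c : FreeGroup (Fin n)} {ζ : Boundary n} (h : act c ζ = ζ) (h1 : c ≠ 1)
    (h2 : some (ζ.1 0) ≠ hd c⁻¹) : some (ζ.1 0) = hd c := by
  obtain ⟨y, hy⟩ : ∃ y, hd c⁻¹ = some y := Option.ne_none_iff_exists'.1 (by simpa [hd_eq_none])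
  have := dir_eq_dirv (p := 1) (v := c⁻¹) (y := y) (ξ := ζ) (by simpa [dirv] using hy)
    (by rw [dir_one]; rintro rfl; exact h2 hy.symm)
  rw [dir, inv_inv, h] at this
  simpa [dirv] using this

/-- Translation by `x⁻¹` moves the question to the identity vertex and to a conjugate `c`. If `c` is
cyclically reduced, its fixed ends start with the distinct first letters of `c` and `c⁻¹`. If these
letters agree, `zero_of_act_eq` makes both fixed ends start with them. -/
theorem axis_eq_geod {h : FreeGroup (Fin n)} (h1 : h ≠ 1) {ξ η : Boundary n} (hξ : Attr h ξ)
    (hη : Attr h⁻¹ η) : axis h = geod ξ η := by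
  ext x
  have e1 := hξ.conj' x
  have e2 : Attr (x⁻¹ * h * x)⁻¹ (act x⁻¹ η) := by simpa [mul_assoc] using hη.conj' x
  have hc := conj_ne_one h1 x
  change CycReduced (x⁻¹ * h * x) ↔ (act x⁻¹ ξ).1 0 ≠ (act x⁻¹ η).1 0
  generalize x⁻¹ * h * x = c at *
  generalize act x⁻¹ ξ = ξ' at *
  generalize act x⁻¹ η = η' at *
  constructor
  · intro hcr h'
    have h2 := e1.zero_of_cycReduced hcr hc
    have h3 := e2.zero_of_cycReduced hcr.inv (by simpa using hc)
    rw [h'] at h2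
    exact (cycReduced_iff.1 hcr).resolve_left hc (h2.symm.trans h3)
  · intro hne
    by_contra hcr
    rw [cycReduced_iff, not_or, not_not] at hcr
    have key : ∀ ζ : Boundary n, act c ζ = ζ → some (ζ.1 0) = hd c := fun ζ hζ => by
      by_contra h'
      exact h' (zero_of_act_eq hζ hc (by rwa [← hcr.2]))
    exact hne (Option.some_inj.1 ((key _ e1.act_self).trans (key _ e2.act_self').symm))

theorem axis_nonempty (h : FreeGroup (Fin n)) : (axis h).Nonempty :=
  exists_conj_cycReduced h

theorem Attr.ne {h : FreeGroup (Fin n)} (h1 : h ≠ 1) {ξ η : Boundary n} (hξ : Attr h ξ)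
    (hη : Attr h⁻¹ η) : ξ ≠ η := by
  rintro rfl
  obtain ⟨x, hx⟩ := axis_nonempty h
  rw [axis_eq_geod h1 hξ hη] at hx
  exact hx rfl

/-- Two elements with the same attracting end have the same repelling end. -/
theorem Attr.inv_unique {h k : FreeGroup (Fin n)} (h1 : h ≠ 1) (k1 : k ≠ 1) {ξ η ζ : Boundary n}
    (hξ : Attr h ξ) (kξ : Attr k ξ) (hη : Attr h⁻¹ η) (kζ : Attr k⁻¹ ζ) : η = ζ := by
  obtain ⟨k₁, e₁⟩ := exists_pre_mem_geod (hξ.ne h1 hη)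
  obtain ⟨k₂, e₂⟩ := exists_pre_mem_geod (kξ.ne k1 kζ)
  -- A vertex far along the ray to the common end lies on both axes. Conjugation by it makes both
  -- elements cyclically reduced.
  obtain ⟨x, hx1, hx2⟩ : ∃ x, x ∈ axis h ∧ x ∈ axis k := by
    refine ⟨pre ξ (k₁ + k₂), ?_, ?_⟩
    · rw [axis_eq_geod h1 hξ hη]; exact e₁ _ (by omega)
    · rw [axis_eq_geod k1 kξ kζ]; exact e₂ _ (by omega)
  have hc := conj_ne_one h1 x
  have kc := conj_ne_one k1 x
  have f1 := hξ.conj' x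
  have f2 := kξ.conj' x
  have f3 : Attr (x⁻¹ * h * x)⁻¹ (act x⁻¹ η) := by simpa [mul_assoc] using hη.conj' x
  have f4 : Attr (x⁻¹ * k * x)⁻¹ (act x⁻¹ ζ) := by simpa [mul_assoc] using kζ.conj' x
  obtain ⟨ξ₁, a1, -, a2⟩ := exists_attr_of_cycReduced hx1 hc
  obtain ⟨ξ₂, b1, -, b2⟩ := exists_attr_of_cycReduced hx2 kc
  obtain rfl := a1.unique f1
  obtain rfl := b1.unique f2
  -- Both conjugates are initial segments of one periodic word, so raising each to the length of the
  -- other gives the same segment. Equal powers have equal repelling ends.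
  have e := (a2 (x⁻¹ * k * x).norm).symm.trans ((by rw [mul_comm]) : _ = _) |>.trans
    (b2 (x⁻¹ * h * x).norm)
  have p1 : 0 < (x⁻¹ * k * x).norm := Nat.pos_of_ne_zero (by simpa using kc)
  have p2 : 0 < (x⁻¹ * h * x).norm := Nat.pos_of_ne_zero (by simpa using hc)
  have g1 := f3.pow p1
  have g2 := f4.pow p2
  rw [inv_pow] at g1 g2
  rw [e] at g1
  exact act_injective _ (g1.unique g2)

/-- The orbit of the identity vertex under `g` stays on the invariant geodesic and converges to both
ends of `g`. -/
theorem eq_geod_of_translate {g : FreeGroup (Fin n)} (h1 : g ≠ 1) {a b ξ η : Boundary n}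
    (ha : Attr g a) (hb : Attr g⁻¹ b) (hl : translate g (geod ξ η) = geod ξ η)
    (h1l : (1 : FreeGroup (Fin n)) ∈ geod ξ η) : geod ξ η = geod a b := by
  have hpos : ∀ m : ℕ, g ^ m ∈ geod ξ η := fun m => by
    induction m with
    | zero => simpa using h1l
    | succ m ih => rw [← hl, mem_translate, pow_succ']; simpa using ih
  have hneg : ∀ m : ℕ, (g⁻¹) ^ m ∈ geod ξ η := fun m => by
    induction m with
    | zero => simpa using h1l
    | succ m ih => rw [← hl, mem_translate, ← pow_succ'] at ih; exact ih
  have key : ∀ {u : ℕ → FreeGroup (Fin n)} {ζ : Boundary n}, ConvergesTo u ζ →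
      (∀ m, u m ∈ geod ξ η) → ζ = ξ ∨ ζ = η := fun {u ζ} hu hm =>
    end_of_frequently fun k => by
      obtain ⟨i, hi⟩ := (hu k).exists
      exact ⟨u i, hm i, hi⟩
  have hab := ha.ne h1 hb
  rcases key ha hpos with rfl | rfl <;> rcases key hb hneg with rfl | rfl
  · exact absurd rfl hab
  · rfl
  · exact geod_comm _ _
  · exact absurd rfl hab

/-! ### Lines of the pattern and their ends -/

/-- `ξ` and `η` are the two ends of a line of the pattern. -/
def Paired (W : List (FreeGroup (Fin n))) (ξ η : Boundary n) : Prop :=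
  EndpointsOfLine W ξ η ∨ EndpointsOfLine W η ξ

theorem Paired.symm {W : List (FreeGroup (Fin n))} {ξ η : Boundary n} (h : Paired W ξ η) :
    Paired W η ξ := Or.symm h

theorem endpointsOfLine_iff {W : List (FreeGroup (Fin n))} {ξ η : Boundary n} :
    EndpointsOfLine W ξ η ↔ ∃ w ∈ W, ∃ g : FreeGroup (Fin n), Attr (g * w * g⁻¹) ξ ∧
      Attr (g * w * g⁻¹)⁻¹ η := by
  have key : ∀ (g w : FreeGroup (Fin n)) (ζ : Boundary n),
      ConvergesTo (fun m : ℕ => g * w ^ m) ζ ↔ Attr (g * w * g⁻¹) ζ := fun g w ζ => by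
    constructor
    · intro h
      simpa [Attr, conj_pow] using h.mul_right g⁻¹
    · intro h
      simpa [conj_pow] using ConvergesTo.mul_right h g
  simp only [EndpointsOfLine, key]
  simp [mul_assoc]

theorem Paired.exists_attr {W : List (FreeGroup (Fin n))} (hW : ∀ w ∈ W, w ≠ 1)
    {ξ η : Boundary n} (h : Paired W ξ η) :
    ∃ h : FreeGroup (Fin n), h ≠ 1 ∧ Attr h ξ ∧ Attr h⁻¹ η ∧
      ∃ w ∈ W, ∃ g : FreeGroup (Fin n), h = g * w * g⁻¹ ∨ h⁻¹ = g * w * g⁻¹ := by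
  rcases h with h | h
  · obtain ⟨w, hw, g, h1, h2⟩ := endpointsOfLine_iff.1 h
    refine ⟨_, ?_, h1, h2, w, hw, g, Or.inl rfl⟩
    simpa using conj_ne_one (hW w hw) g⁻¹
  · obtain ⟨w, hw, g, h1, h2⟩ := endpointsOfLine_iff.1 h
    refine ⟨_, ?_, h2, by simpa using h1, w, hw, g, Or.inr (by simp)⟩
    have := conj_ne_one (hW w hw) g⁻¹
    rw [ne_eq, inv_eq_one]
    simpa using this

section
variable {W : List (FreeGroup (Fin n))} (hW : ∀ w ∈ W, w ≠ 1)
include hW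

theorem Paired.ne {ξ η : Boundary n} (h : Paired W ξ η) : ξ ≠ η := by
  obtain ⟨k, h1, h2, h3, -⟩ := h.exists_attr hW
  exact h2.ne h1 h3

theorem Paired.unique {ξ η ζ : Boundary n} (h : Paired W ξ η) (h' : Paired W ξ ζ) : η = ζ := by
  obtain ⟨k, h1, h2, h3, -⟩ := h.exists_attr hW
  obtain ⟨k', h1', h2', h3', -⟩ := h'.exists_attr hW
  exact h2.inv_unique h1 h1' h2' h3 h3'

theorem Paired.eq_of_attr {ξ η ζ : Boundary n} (h : Paired W ξ η) {g : FreeGroup (Fin n)}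
    (h1 : g ≠ 1) (hg : Attr g ξ) (hg' : Attr g⁻¹ ζ) : η = ζ := by
  obtain ⟨k, k1, h2, h3, -⟩ := h.exists_attr hW
  exact h2.inv_unique k1 h1 hg h3 hg'

theorem mem_lines_iff {l : Set (FreeGroup (Fin n))} :
    l ∈ lines W ↔ ∃ ξ η, Paired W ξ η ∧ l = geod ξ η := by
  constructor
  · rintro ⟨w, hw, g, rfl⟩
    have h1 : g * w * g⁻¹ ≠ 1 := by simpa using conj_ne_one (hW w hw) g⁻¹
    obtain ⟨ξ, hξ⟩ := LinePattern.exists_attr h1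
    obtain ⟨η, hη⟩ := LinePattern.exists_attr (inv_ne_one.2 h1)
    exact ⟨ξ, η, Or.inl (endpointsOfLine_iff.2 ⟨w, hw, g, hξ, hη⟩), axis_eq_geod h1 hξ hη⟩
  · rintro ⟨ξ, η, h | h, rfl⟩
    · obtain ⟨w, hw, g, h1, h2⟩ := endpointsOfLine_iff.1 h
      refine ⟨w, hw, g, (axis_eq_geod ?_ h1 h2).symm⟩
      simpa using conj_ne_one (hW w hw) g⁻¹
    · obtain ⟨w, hw, g, h1, h2⟩ := endpointsOfLine_iff.1 h
      refine ⟨w, hw, g, ?_⟩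
      rw [geod_comm]
      refine (axis_eq_geod ?_ h1 h2).symm
      simpa using conj_ne_one (hW w hw) g⁻¹

theorem Paired.mem_lines {ξ η : Boundary n} (h : Paired W ξ η) : geod ξ η ∈ lines W :=
  (mem_lines_iff hW).2 ⟨ξ, η, h, rfl⟩

theorem paired_of_geod_mem {ξ η : Boundary n} (hne : ξ ≠ η) (h : geod ξ η ∈ lines W) :
    Paired W ξ η := by
  obtain ⟨ξ', η', h1, h2⟩ := (mem_lines_iff hW).1 h
  rcases geod_inj hne h2 with ⟨rfl, rfl⟩ | ⟨rfl, rfl⟩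
  · exact h1
  · exact h1.symm

end

theorem EndpointsOfLine.act {W : List (FreeGroup (Fin n))} {ξ η : Boundary n}
    (h : EndpointsOfLine W ξ η) (g : FreeGroup (Fin n)) :
    EndpointsOfLine W (act g ξ) (act g η) := by
  obtain ⟨w, hw, k, h1, h2⟩ := h
  refine ⟨w, hw, g * k, ?_, ?_⟩
  · simpa [mul_assoc] using h1.act g
  · simpa [mul_assoc] using h2.act g

theorem Paired.act {W : List (FreeGroup (Fin n))} {ξ η : Boundary n} (h : Paired W ξ η)
    (g : FreeGroup (Fin n)) : Paired W (act g ξ) (act g η) :=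
  h.imp (fun h => h.act g) fun h => h.act g

theorem translate_mem_lines {W : List (FreeGroup (Fin n))} (hW : ∀ w ∈ W, w ≠ 1)
    {l : Set (FreeGroup (Fin n))} (h : l ∈ lines W) (g : FreeGroup (Fin n)) :
    translate g l ∈ lines W := by
  obtain ⟨ξ, η, h1, rfl⟩ := (mem_lines_iff hW).1 h
  rw [translate_geod]
  exact (h1.act g).mem_lines hW

/-! ### The decomposition space and separations of the boundary -/

/-- The ends that have the same image as `ξ` in the decomposition space. -/
def fiber (W : List (FreeGroup (Fin n))) (ξ : Boundary n) : Set (Boundary n) :=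
  {ζ | ζ = ξ ∨ Paired W ξ ζ}

/-- By `Paired.unique` no end lies on two lines, so the generating relation is already transitive
once it is made reflexive and symmetric. -/
theorem mk_eq_mk_iff {W : List (FreeGroup (Fin n))} (hW : ∀ w ∈ W, w ≠ 1) {ξ η : Boundary n} :
    (Quot.mk (EndpointsOfLine W) η = Quot.mk (EndpointsOfLine W) ξ) ↔ η ∈ fiber W ξ := by
  constructor
  · intro h
    have hg := Quot.eqvGen_exact h
    clear h
    induction hg with
    | rel x y h => exact Or.inr (Or.inr h)
    | refl x => exact Or.inl rfl
    | symm x y _ ih =>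
      rcases ih with h' | h'
      · exact Or.inl h'.symm
      · exact Or.inr h'.symm
    | trans x y z h1 h2 e1 e2 =>
      rcases e1 with rfl | e1
      · exact e2
      · rcases e2 with rfl | e2
        · exact Or.inr e1
        · exact Or.inl (e1.unique hW e2.symm)
  · rintro (rfl | h | h)
    · rfl
    · exact (Quot.sound h).symm
    · exact Quot.sound h

/-- `A` and `B` form a separation of the complement of `E` in the boundary such that no line of
the pattern joins `A` and `B`. -/
structure IsSeparation (W : List (FreeGroup (Fin n))) (E A B : Set (Boundary n)) : Prop where
  isOpen_left : IsOpen A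
  isOpen_right : IsOpen B
  nonempty_left : A.Nonempty
  nonempty_right : B.Nonempty
  disjoint : Disjoint A B
  union : A ∪ B = Eᶜ
  resp : ∀ ξ η, Paired W ξ η → ξ ∈ A → η ∉ B

/-- The complement of `E` can be separated. -/
def Separable (W : List (FreeGroup (Fin n))) (E : Set (Boundary n)) : Prop :=
  ∃ A B, IsSeparation W E A B

theorem IsSeparation.symm {W : List (FreeGroup (Fin n))} {E A B : Set (Boundary n)}
    (h : IsSeparation W E A B) : IsSeparation W E B A :=
  ⟨h.2, h.1, h.4, h.3, h.5.symm, by rw [Set.union_comm]; exact h.6,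
    fun ξ η hp hB hA => h.7 η ξ hp.symm hA hB⟩

/-- Open sets of the quotient are the saturated open sets of the boundary. A part of a separation is
saturated, because a line from it can end neither in the other part nor over `S`. Closedness of the
preimage of `S` keeps open sets open when it is removed from them. -/
theorem isCutSet_iff {W : List (FreeGroup (Fin n))} (S : Set (DecompositionSpace W))
    (hS : IsClosed (Quot.mk (EndpointsOfLine W) ⁻¹' S)) :
    IsCutSet S ↔ Separable W (Quot.mk (EndpointsOfLine W) ⁻¹' S) := by
  constructor
  · intro h
    rw [IsCutSet, IsPreconnected] at h
    push Not at h
    obtain ⟨u, v, hu, hv, huv, ⟨p, hpS, hpu⟩, ⟨q, hqS, hqv⟩, hd⟩ := h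
    have hcont : Continuous (Quot.mk (EndpointsOfLine W)) := continuous_quot_mk
    refine ⟨Quot.mk _ ⁻¹' u \ Quot.mk _ ⁻¹' S, Quot.mk _ ⁻¹' v \ Quot.mk _ ⁻¹' S,
      (hu.preimage hcont).sdiff hS, (hv.preimage hcont).sdiff hS, ?_, ?_, ?_, ?_, ?_⟩
    · obtain ⟨ξ, rfl⟩ := Quot.exists_rep p
      exact ⟨ξ, hpu, hpS⟩
    · obtain ⟨ξ, rfl⟩ := Quot.exists_rep q
      exact ⟨ξ, hqv, hqS⟩
    · rw [Set.disjoint_left]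
      rintro ξ ⟨h1, h2⟩ ⟨h3, -⟩
      have : Quot.mk _ ξ ∈ (Sᶜ ∩ (u ∩ v) : Set (DecompositionSpace W)) := ⟨h2, h1, h3⟩
      rw [hd] at this; exact this
    · rw [← Set.union_sdiff_distrib]
      ext ξ
      constructor
      · exact fun h => h.2
      · exact fun h => ⟨huv h, h⟩
    · rintro ξ η hp ⟨h1, h2⟩ ⟨h3, -⟩
      have e : Quot.mk (EndpointsOfLine W) ξ = Quot.mk (EndpointsOfLine W) η := by
        rcases hp with hp | hp
        · exact Quot.sound hp
        · exact (Quot.sound hp).symm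
      rw [Set.mem_preimage, ← e] at h3
      have : Quot.mk _ ξ ∈ (Sᶜ ∩ (u ∩ v) : Set (DecompositionSpace W)) := ⟨h2, h1, h3⟩
      rw [hd] at this; exact this
  · rintro ⟨A, B, h⟩ hS'
    have key : ∀ {A B : Set (Boundary n)}, IsSeparation W (Quot.mk _ ⁻¹' S) A B →
        Quot.mk (EndpointsOfLine W) ⁻¹' (Quot.mk _ '' A) = A := by
      intro A B h
      apply Set.Subset.antisymm _ (Set.subset_preimage_image _ _)
      rintro η ⟨ξ, hξ, he⟩
      have hgen := Quot.eqvGen_exact he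
      have step : ∀ ξ η, Paired W ξ η → ξ ∈ A → η ∈ A := fun ξ η hp hξ => by
        have e : Quot.mk (EndpointsOfLine W) ξ = Quot.mk (EndpointsOfLine W) η := by
          rcases hp with hp | hp
          · exact Quot.sound hp
          · exact (Quot.sound hp).symm
        have h1 : ξ ∈ (Quot.mk (EndpointsOfLine W) ⁻¹' S)ᶜ := h.union ▸ Or.inl hξ
        have h2 : η ∈ A ∪ B := by
          rw [h.union, Set.mem_compl_iff, Set.mem_preimage, ← e]; exact h1
        exact h2.resolve_right (h.resp ξ η hp hξ)
      have : ξ ∈ A ↔ η ∈ A := by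
        clear hξ he
        induction hgen with
        | rel x y hxy => exact ⟨step _ _ (Or.inl hxy), step _ _ (Or.inr hxy)⟩
        | refl x => exact Iff.rfl
        | symm x y _ ih => exact ih.symm
        | trans x y z _ _ ih1 ih2 => exact ih1.trans ih2
      exact this.1 hξ
    have hA := key h
    have hB := key h.symm
    have := hS' (Quot.mk _ '' A) (Quot.mk _ '' B)
      (by rw [← isQuotientMap_quot_mk.isOpen_preimage, hA]; exact h.isOpen_left)
      (by rw [← isQuotientMap_quot_mk.isOpen_preimage, hB]; exact h.isOpen_right) ?_ ?_ ?_
    · obtain ⟨p, -, hp1, hp2⟩ := this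
      obtain ⟨ξ, rfl⟩ := Quot.exists_rep p
      exact Set.disjoint_left.1 h.disjoint (hA ▸ hp1 : ξ ∈ A) (hB ▸ hp2 : ξ ∈ B)
    · intro p hp
      obtain ⟨ξ, rfl⟩ := Quot.exists_rep p
      have : ξ ∈ A ∪ B := by rw [h.union]; exact hp
      exact this.imp (fun h => ⟨ξ, h, rfl⟩) fun h => ⟨ξ, h, rfl⟩
    · obtain ⟨ξ, hξ⟩ := h.nonempty_left
      have : ξ ∈ (Quot.mk (EndpointsOfLine W) ⁻¹' S)ᶜ := h.union ▸ Or.inl hξ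
      exact ⟨Quot.mk _ ξ, this, ξ, hξ, rfl⟩
    · obtain ⟨ξ, hξ⟩ := h.nonempty_right
      have : ξ ∈ (Quot.mk (EndpointsOfLine W) ⁻¹' S)ᶜ := h.union ▸ Or.inr hξ
      exact ⟨Quot.mk _ ξ, this, ξ, hξ, rfl⟩

section
variable {W : List (FreeGroup (Fin n))} (hW : ∀ w ∈ W, w ≠ 1)
include hW

theorem fiber_of_paired {ξ η : Boundary n} (h : Paired W ξ η) : fiber W ξ = {ξ, η} := by
  ext ζ
  constructor
  · rintro (rfl | h')
    · exact Or.inl rfl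
    · exact Or.inr (h'.unique hW h)
  · rintro (rfl | rfl)
    · exact Or.inl rfl
    · exact Or.inr h

omit hW in
theorem fiber_of_not_paired {ξ : Boundary n} (h : ∀ η, ¬ Paired W ξ η) : fiber W ξ = {ξ} := by
  ext ζ
  constructor
  · rintro (rfl | h')
    · rfl
    · exact absurd h' (h ζ)
  · rintro rfl; exact Or.inl rfl

theorem finite_fiber (ξ : Boundary n) : (fiber W ξ).Finite := by
  by_cases h : ∃ η, Paired W ξ η
  · obtain ⟨η, h⟩ := h
    rw [fiber_of_paired hW h]; exact Set.toFinite _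
  · push Not at h
    rw [fiber_of_not_paired h]; exact Set.toFinite _

theorem preimage_singleton (ξ : Boundary n) :
    Quot.mk (EndpointsOfLine W) ⁻¹' {Quot.mk _ ξ} = fiber W ξ := by
  ext η; exact mk_eq_mk_iff hW

theorem hasCutPoint_iff :
    HasCutPoint (DecompositionSpace W) ↔ ∃ ξ, Separable W (fiber W ξ) := by
  constructor
  · rintro ⟨p, hp⟩
    obtain ⟨ξ, rfl⟩ := Quot.exists_rep p
    rw [isCutSet_iff _ (by rw [preimage_singleton hW]; exact (finite_fiber hW ξ).isClosed),
      preimage_singleton hW] at hp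
    exact ⟨ξ, hp⟩
  · rintro ⟨ξ, hξ⟩
    refine ⟨Quot.mk _ ξ, ?_⟩
    rwa [isCutSet_iff _ (by rw [preimage_singleton hW]; exact (finite_fiber hW ξ).isClosed),
      preimage_singleton hW]

theorem preimage_pair (ξ η : Boundary n) :
    Quot.mk (EndpointsOfLine W) ⁻¹' {Quot.mk _ ξ, Quot.mk _ η} = fiber W ξ ∪ fiber W η := by
  rw [← preimage_singleton hW, ← preimage_singleton hW]; rfl

theorem hasCutTwoPoints_iff : HasCutTwoPoints (DecompositionSpace W) ↔
    ∃ ξ η, η ∉ fiber W ξ ∧ Separable W (fiber W ξ ∪ fiber W η) := by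
  have hcl : ∀ ξ η : Boundary n,
      IsClosed (Quot.mk (EndpointsOfLine W) ⁻¹' {Quot.mk _ ξ, Quot.mk _ η}) := fun ξ η => by
    rw [preimage_pair hW]
    exact ((finite_fiber hW ξ).union (finite_fiber hW η)).isClosed
  constructor
  · rintro ⟨p, q, hne, hp⟩
    obtain ⟨ξ, rfl⟩ := Quot.exists_rep p
    obtain ⟨η, rfl⟩ := Quot.exists_rep q
    rw [isCutSet_iff _ (hcl ξ η), preimage_pair hW] at hp
    exact ⟨ξ, η, fun h => hne ((mk_eq_mk_iff hW).2 h).symm, hp⟩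
  · rintro ⟨ξ, η, hne, h⟩
    refine ⟨Quot.mk _ ξ, Quot.mk _ η, fun h => hne ((mk_eq_mk_iff hW).1 h.symm), ?_⟩
    rwa [isCutSet_iff _ (hcl ξ η), preimage_pair hW]

omit hW in
theorem connectedSpace_iff (hn : 1 ≤ n) :
    ConnectedSpace (DecompositionSpace W) ↔ ¬ Separable W ∅ := by
  have h := isCutSet_iff (W := W) ∅ (by simp)
  rw [Set.preimage_empty, IsCutSet, Set.compl_empty] at h
  rw [← h, not_not, connectedSpace_iff_univ, IsConnected]
  obtain ⟨ξ, -⟩ := exists_dir_eq (n := n) 1 (⟨0, hn⟩, true)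
  exact and_iff_right ⟨Quot.mk _ ξ, trivial⟩

end

/-! ### Patterns whose Whitehead graph stays connected when a vertex is deleted -/

/-- The Whitehead graph is connected, and remains so when any one vertex is deleted. -/
def TwoConn (W : List (FreeGroup (Fin n))) : Prop :=
  ∀ (x : Letter n) (Y : Set (Letter n)), x ∉ Y → Y.Nonempty → (∃ z, z ∉ Y ∧ z ≠ x) →
    ∃ ξ η, Paired W ξ η ∧ dir 1 ξ ∈ Y ∧ dir 1 η ∉ Y ∧ dir 1 η ≠ x

theorem whiteheadGraph_adj {W : List (FreeGroup (Fin n))} (hW : ∀ w ∈ W, w ≠ 1) {x y : Letter n} :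
    (whiteheadGraph W).Adj x y ↔ x ≠ y ∧ ∃ ξ η, Paired W ξ η ∧ dir 1 ξ = x ∧ dir 1 η = y := by
  refine and_congr_right fun hxy => ?_
  constructor
  · rintro ⟨l, hl, hx, hy⟩
    obtain ⟨ξ, η, hp, rfl⟩ := (mem_lines_iff hW).1 hl
    have key : ∀ t : Letter n, t.elt ∈ geod ξ η → dir 1 ξ = t ∨ dir 1 η = t := fun t ht => by
      by_contra! h
      rw [← one_mul t.elt, mem_geod, dir_mul_elt.2 h.1, dir_mul_elt.2 h.2] at ht
      exact ht rfl
    rcases key x hx with h1 | h1 <;> rcases key y hy with h2 | h2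
    · exact absurd (h1.symm.trans h2) hxy
    · exact ⟨ξ, η, hp, h1, h2⟩
    · exact ⟨η, ξ, hp.symm, h1, h2⟩
    · exact absurd (h1.symm.trans h2) hxy
  · rintro ⟨ξ, η, hp, rfl, rfl⟩
    have h1 : (1 : FreeGroup (Fin n)) ∈ geod ξ η := hxy
    refine ⟨_, hp.mem_lines hW, ?_, ?_⟩
    · have := (mul_elt_mem_geod h1 (y := dir 1 ξ)).2 (Or.inl rfl)
      simpa using this
    · have := (mul_elt_mem_geod h1 (y := dir 1 η)).2 (Or.inr rfl)
      simpa using this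

/-- A walk that avoids `x` from a point of `Y` to a point outside must leave `Y` along some edge,
and this edge is the required line. -/
theorem twoConn_of_connected {W : List (FreeGroup (Fin n))} (hW : ∀ w ∈ W, w ≠ 1)
    (h : (whiteheadGraph W).Connected) (h' : ∀ x, ¬ IsCutVertex (whiteheadGraph W) x) :
    TwoConn W := by
  rintro x Y hx ⟨u, hu⟩ ⟨v, hv, hvx⟩
  have := h' x
  rw [IsCutVertex] at this
  push Not at this
  obtain ⟨p, hp⟩ := this u v (by rintro rfl; exact hx hu) hvx (h.preconnected u v)
  obtain ⟨d, hd, h1, h2⟩ := p.exists_boundary_dart Y hu hv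
  obtain ⟨hne, ξ, η, h3, h4, h5⟩ := (whiteheadGraph_adj hW).1 d.adj
  refine ⟨ξ, η, h3, by rwa [h4], by rwa [h5], ?_⟩
  rw [h5]
  rintro rfl
  exact hp (p.dart_snd_mem_support_of_mem_darts hd)

/-- Colour an end by whether its first letter lies in a chosen component. A line through the
identity vertex is an edge of the graph, and any other line has both ends in one direction. -/
theorem separable_of_not_connected {W : List (FreeGroup (Fin n))} (hW : ∀ w ∈ W, w ≠ 1)
    (hn : 1 ≤ n) (h : ¬ (whiteheadGraph W).Connected) : Separable W ∅ := by
  have : Nonempty (Letter n) := ⟨(⟨0, hn⟩, true)⟩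
  have : ¬ (whiteheadGraph W).Preconnected := fun h' => h ⟨h'⟩
  rw [SimpleGraph.Preconnected] at this
  push Not at this
  obtain ⟨u, v, huv⟩ := this
  refine ⟨{ζ | (whiteheadGraph W).Reachable u (dir 1 ζ)},
    {ζ | ¬ (whiteheadGraph W).Reachable u (dir 1 ζ)}, isOpen_dir _ _,
    isOpen_dir 1 fun y => ¬ (whiteheadGraph W).Reachable u y, ?_, ?_, ?_, ?_, ?_⟩
  · obtain ⟨ξ, hξ⟩ := exists_dir_eq 1 u
    exact ⟨ξ, by rw [Set.mem_ofPred_eq, hξ]⟩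
  · obtain ⟨ξ, hξ⟩ := exists_dir_eq 1 v
    exact ⟨ξ, by rw [Set.mem_ofPred_eq, hξ]; exact huv⟩
  · rw [Set.disjoint_left]; exact fun ξ h h' => h' h
  · rw [Set.compl_empty]; exact Set.eq_univ_of_forall fun ξ => em _
  · intro ξ η hp h1 h2
    by_cases he : dir 1 ξ = dir 1 η
    · rw [Set.mem_ofPred_eq, ← he] at h2; exact h2 h1
    · exact h2 (SimpleGraph.Reachable.trans h1
        (SimpleGraph.Adj.reachable ((whiteheadGraph_adj hW).2 ⟨he, ξ, η, hp, rfl, rfl⟩)))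

theorem exists_letter_ne (hn : 2 ≤ n) (x y : Letter n) : ∃ z : Letter n, z ≠ x ∧ z ≠ y := by
  have : 2 < Fintype.card (Letter n) := by simp; omega
  obtain ⟨z, hz⟩ := Finset.exists_mem_notMem_of_card_lt_card (s := {x, y})
    (t := (Finset.univ : Finset (Letter n))) (lt_of_le_of_lt Finset.card_le_two this)
  simp only [Finset.mem_univ, true_and, Finset.mem_insert, Finset.mem_singleton, not_or] at hz
  exact ⟨z, hz⟩

/-! ### Shadows have one colour when the Whitehead graph has no cut vertex -/

section
variable {W : List (FreeGroup (Fin n))} (hT : TwoConn W)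
include hT

theorem TwoConn.translate (v : FreeGroup (Fin n)) (x : Letter n) (Y : Set (Letter n)) (hx : x ∉ Y)
    (hY : Y.Nonempty) (hz : ∃ z, z ∉ Y ∧ z ≠ x) :
    ∃ ξ η, Paired W ξ η ∧ dir v ξ ∈ Y ∧ dir v η ∉ Y ∧ dir v η ≠ x := by
  obtain ⟨ξ, η, h1, h2, h3, h4⟩ := hT x Y hx hY hz
  refine ⟨act v ξ, act v η, h1.act v, ?_⟩
  rw [← mul_one v]
  simp only [mul_one v, dir_act, inv_mul_cancel]
  exact ⟨h2, h3, h4⟩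

/-- Every edge of the tree is crossed by a line. -/
theorem TwoConn.exists_crossing (hn : 2 ≤ n) (v : FreeGroup (Fin n)) (y : Letter n) :
    ∃ ξ η, Paired W ξ η ∧ dir v ξ = y ∧ dir v η ≠ y := by
  obtain ⟨z, hz⟩ := exists_letter_ne hn y y.bar
  obtain ⟨ξ, η, h1, h2, h3, h4⟩ := hT.translate v y.bar {y} (by simpa using y.bar_ne)
    ⟨y, rfl⟩ ⟨z, by simpa using hz.1, hz.2⟩
  exact ⟨ξ, η, h1, h2, h3⟩

variable {A B : Set (Boundary n)} (hA : IsOpen A) (hB : IsOpen B) (hAB : Disjoint A B)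
  (hr : ∀ ξ η, Paired W ξ η → ξ ∈ A → η ∉ B)
include hA hB hAB hr

omit hA hB hAB in
-- Suppose that every direction ahead at the vertex `x * y.elt` had one colour. Deleting the way
-- back leaves the Whitehead graph connected, so some line joins a direction with ends in `A` to
-- another kind of direction ahead, and its ends have different colours.
theorem TwoConn.exists_child {x : FreeGroup (Fin n)} {y : Letter n}
    (hs : ∀ ζ, dir x ζ = y → ζ ∈ A ∪ B) (h1 : ∃ ζ ∈ A, dir x ζ = y) (h2 : ∃ ζ ∈ B, dir x ζ = y) :
    ∃ z, z ≠ y.bar ∧ (∃ ζ ∈ A, dir (x * y.elt) ζ = z) ∧ (∃ ζ ∈ B, dir (x * y.elt) ζ = z) := by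
  by_contra! hno
  have hsub : ∀ ζ, dir (x * y.elt) ζ ≠ y.bar → dir x ζ = y := fun ζ h => dir_eq_of_mul_elt h
  obtain ⟨a, haA, ha⟩ := h1
  obtain ⟨b, hbB, hb⟩ := h2
  have ha' := dir_mul_elt_ne ha
  have hb' := dir_mul_elt_ne hb
  obtain ⟨ξ, η, hp, e1, e2, e3⟩ := hT.translate (x * y.elt) y.bar
    {z | z ≠ y.bar ∧ ∃ ζ ∈ A, dir (x * y.elt) ζ = z} (by simp) ⟨_, ha', a, haA, rfl⟩
    ⟨_, fun h => hno _ hb' h.2 b hbB rfl, hb'⟩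
  obtain ⟨hne, hex⟩ := e1
  have hξ : ξ ∈ A := by
    have := hs ξ (hsub ξ hne)
    exact this.resolve_right fun h => hno _ hne hex ξ h rfl
  have hη : η ∈ B := by
    have := hs η (hsub η e3)
    exact this.resolve_left fun h => e2 ⟨e3, η, h, rfl⟩
  exact hr ξ η hp hξ hη

/-- A shadow is contained in one of the two sets of a separation. -/
theorem TwoConn.mono {x : FreeGroup (Fin n)} {y : Letter n}
    (hs : ∀ ζ, dir x ζ = y → ζ ∈ A ∪ B) :
    (∀ ζ, dir x ζ = y → ζ ∈ A) ∨ (∀ ζ, dir x ζ = y → ζ ∈ B) := by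
  by_contra! hcon
  obtain ⟨⟨b, hb1, hb2⟩, a, ha1, ha2⟩ := hcon
  -- By `TwoConn.exists_child`, each shadow with ends of both colours contains a smaller one at the
  -- next vertex. An infinite chain of them converges to an end, and the open part that contains
  -- this end contains a whole shadow of the chain.
  let σ := {p : FreeGroup (Fin n) × Letter n // (∀ ζ, dir p.1 ζ = p.2 → ζ ∈ A ∪ B) ∧
    (∃ ζ ∈ A, dir p.1 ζ = p.2) ∧ (∃ ζ ∈ B, dir p.1 ζ = p.2)}
  have hnext : ∀ p : σ, ∃ q : σ, q.1.1 = p.1.1 * p.1.2.elt ∧ q.1.2 ≠ p.1.2.bar := by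
    rintro ⟨⟨x, y⟩, h0, h1, h2⟩
    obtain ⟨z, hz, h3, h4⟩ := hT.exists_child hr h0 h1 h2
    refine ⟨⟨(x * y.elt, z), ?_, h3, h4⟩, rfl, hz⟩
    intro ζ hζ
    exact h0 ζ (dir_eq_of_mul_elt (by simp only at hζ; rw [hζ]; exact hz))
  choose nxt hn1 hn2 using hnext
  let s : ℕ → σ := fun k => nxt^[k] ⟨(x, y), hs, ⟨a, (hs a ha1).resolve_right ha2, ha1⟩,
    ⟨b, (hs b hb1).resolve_left hb2, hb1⟩⟩
  have hsucc : ∀ k, s (k + 1) = nxt (s k) := fun k => Function.iterate_succ_apply' _ _ _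
  let ξ : Boundary n := ⟨fun k => (s k).1.2, fun k => by
    change (s (k + 1)).1.2 ≠ _
    rw [hsucc]; exact hn2 _⟩
  have hx : ∀ k, (s k).1.1 = x * pre ξ k := fun k => by
    induction k with
    | zero => simp [s]
    | succ k ih => rw [hsucc, hn1, ih, pre_succ, mul_assoc]
  have key : ∀ {C : Set (Boundary n)}, IsOpen C → act x ξ ∈ C →
      ∃ k, ∀ ζ, dir (s k).1.1 ζ = (s k).1.2 → ζ ∈ C := fun {C} hC hξ => by
    obtain ⟨k, hk⟩ := exists_shadow_subset (hC.preimage (continuous_act x)) (ξ := ξ) hξ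
    refine ⟨k, fun ζ hζ => ?_⟩
    rw [hx, dir_mul] at hζ
    simpa using hk k le_rfl _ hζ
  have h0 : dir x (act x ξ) = y := by
    have := dir_mul_act x 1 ξ
    rw [mul_one, dir_one] at this
    rw [this]; rfl
  rcases hs _ h0 with h | h
  · obtain ⟨k, hk⟩ := key hA h
    obtain ⟨-, -, ζ, hζ, hζ'⟩ := (s k).2
    exact Set.disjoint_left.1 hAB (hk ζ hζ') hζ
  · obtain ⟨k, hk⟩ := key hB h
    obtain ⟨-, ⟨ζ, hζ, hζ'⟩, -⟩ := (s k).2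
    exact Set.disjoint_left.1 hAB hζ (hk ζ hζ')

/-- The complement of one end cannot be separated. -/
theorem TwoConn.eq_empty_of_compl_singleton {ξ : Boundary n} (hu : A ∪ B = {ξ}ᶜ) :
    A = ∅ ∨ B = ∅ := by
  by_contra! hcon
  obtain ⟨⟨a, ha⟩, b, hb⟩ := hcon
  have hne : ∀ ζ ∈ A ∪ B, ξ ≠ ζ := fun ζ hζ => by rw [hu] at hζ; exact fun h => hζ h.symm
  obtain ⟨k₁, h₁⟩ := exists_dir_pre_ne (hne a (Or.inl ha))
  obtain ⟨k₂, h₂⟩ := exists_dir_pre_ne (hne b (Or.inr hb))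
  -- A vertex far enough along the ray to `ξ` sees both `a` and `b` looking back, within a single
  -- shadow that omits `ξ`.
  have e₁ := dir_pre_succ_eq_bar (h₁ (k₁ + k₂) (by omega))
  have e₂ := dir_pre_succ_eq_bar (h₂ (k₁ + k₂) (by omega))
  rcases hT.mono hA hB hAB hr (x := pre ξ (k₁ + k₂ + 1)) (y := (ξ.1 (k₁ + k₂)).bar) (by
    intro ζ hζ
    rw [hu]
    rintro rfl
    rw [dir_pre] at hζ
    exact ζ.2 _ hζ) with h | h
  · exact Set.disjoint_left.1 hAB (h b e₂) hb
  · exact Set.disjoint_left.1 hAB ha (h a e₁)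

end

/-- Each of the two shadows at the first edge towards an end of `A` has one colour. One is in `A`,
so the other must be in `B`, yet some line crosses the edge. -/
theorem TwoConn.not_separable_empty {W : List (FreeGroup (Fin n))} (hT : TwoConn W) (hn : 2 ≤ n) :
    ¬ Separable W ∅ := by
  rintro ⟨A, B, h⟩
  obtain ⟨a, ha⟩ := h.nonempty_left
  obtain ⟨b, hb⟩ := h.nonempty_right
  have hm : ∀ x y, (∀ ζ, dir x ζ = y → ζ ∈ A) ∨ (∀ ζ, dir x ζ = y → ζ ∈ B) := fun x y =>
    hT.mono h.isOpen_left h.isOpen_right h.disjoint h.resp fun ζ _ => by rw [h.union]; simp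
  have hd := Set.disjoint_left.1 h.disjoint
  have h1 : ∀ ζ, dir 1 ζ = dir 1 a → ζ ∈ A :=
    (hm 1 (dir 1 a)).resolve_right fun h' => hd ha (h' a rfl)
  have hb1 : dir 1 b ≠ dir 1 a := fun h' => hd (h1 b h') hb
  have h2 : ∀ ζ, dir (1 * (dir 1 a).elt) ζ = (dir 1 a).bar → ζ ∈ B :=
    (hm (1 * (dir 1 a).elt) (dir 1 a).bar).resolve_left fun h' => hd (h' b (dir_mul_elt.2 hb1)) hb
  obtain ⟨ξ, η, hp, e1, e2⟩ := hT.exists_crossing hn 1 (dir 1 a)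
  exact h.resp ξ η hp (h1 ξ e1) (h2 η (dir_mul_elt.2 e2))

/-! ### Projection of ends to a geodesic -/

theorem exists_exit {ξ ζ : Boundary n} (h : ξ ≠ ζ) : ∃ k, dir (pre ξ k) ζ ≠ ξ.1 k ∧
    ∀ j < k, dir (pre ξ j) ζ = ξ.1 j := by
  classical
  have hex : ∃ k, dir (pre ξ k) ζ ≠ ξ.1 k := by
    obtain ⟨k, hk⟩ := exists_dir_pre_ne h
    exact ⟨k, hk k le_rfl⟩
  exact ⟨Nat.find hex, Nat.find_spec hex, fun j hj => not_not.1 (Nat.find_min hex hj)⟩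

theorem exists_proj_aux {a b ζ : Boundary n} (h1 : (1 : FreeGroup (Fin n)) ∈ geod a b)
    (ha : ζ ≠ a) (h : dir 1 ζ = dir 1 a) :
    ∃ x, x ∈ geod a b ∧ dir x ζ ≠ dir x a ∧ dir x ζ ≠ dir x b := by
  obtain ⟨k, hk, hk'⟩ := exists_exit ha.symm
  cases k with
  | zero => rw [pre_zero, h, dir_one] at hk; exact absurd rfl hk
  | succ k =>
    have hb : dir (pre a k) b ≠ a.1 k := fun h' => by
      have := dir_pre_le (Nat.zero_le k) h'
      rw [pre_zero, ← dir_one] at this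
      exact h1 this.symm
    have hb' := dir_pre_succ_eq_bar hb
    refine ⟨pre a (k + 1), ?_, ?_, ?_⟩
    · rw [mem_geod, dir_pre, hb']; exact a.2 k
    · rwa [dir_pre]
    · rw [hb', pre_succ]
      exact dir_mul_elt_ne (hk' k (by omega))

theorem geod_nonempty {a b : Boundary n} (hab : a ≠ b) : (geod a b).Nonempty := by
  obtain ⟨k, hk⟩ := exists_pre_mem_geod hab
  exact ⟨_, hk k le_rfl⟩

/-- The vertex is the projection of `ζ`. From any vertex of the geodesic, `ζ` either branches off at
once or follows the ray to `a` or to `b` up to an exit, which exists because `ζ` is neither of the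
two. -/
theorem exists_proj {a b ζ : Boundary n} (hab : a ≠ b) (ha : ζ ≠ a) (hb : ζ ≠ b) :
    ∃ x, x ∈ geod a b ∧ dir x ζ ≠ dir x a ∧ dir x ζ ≠ dir x b := by
  obtain ⟨x, hx⟩ := geod_nonempty hab
  by_cases h : dir x ζ ≠ dir x a ∧ dir x ζ ≠ dir x b
  · exact ⟨x, hx, h⟩
  have hx1 : (1 : FreeGroup (Fin n)) ∈ geod (act x⁻¹ a) (act x⁻¹ b) := by
    rw [← translate_geod, mem_translate]; simpa using hx
  rw [not_and_or, not_not, not_not] at h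
  rcases h with h | h
  · obtain ⟨z, h1, h2, h3⟩ := exists_proj_aux (ζ := act x⁻¹ ζ) hx1
      (fun h' => ha (act_injective _ h')) (by rwa [← dir_mul, ← dir_mul, mul_one])
    refine ⟨x * z, ?_, ?_⟩
    · rw [← translate_geod, mem_translate] at h1; simpa using h1
    · rw [dir_mul, dir_mul, dir_mul]; exact ⟨h2, h3⟩
  · rw [geod_comm] at hx1
    obtain ⟨z, h1, h2, h3⟩ := exists_proj_aux (ζ := act x⁻¹ ζ) hx1
      (fun h' => hb (act_injective _ h')) (by rwa [← dir_mul, ← dir_mul, mul_one])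
    refine ⟨x * z, ?_, ?_⟩
    · rw [← translate_geod, mem_translate, geod_comm] at h1; simpa using h1
    · rw [dir_mul, dir_mul, dir_mul]; exact ⟨h3, h2⟩

theorem proj_unique {a b ζ : Boundary n} {x x' : FreeGroup (Fin n)} (hx' : x' ∈ geod a b)
    (hx : x ∈ geod a b)
    (h1 : dir x ζ ≠ dir x a) (h2 : dir x ζ ≠ dir x b) (h1' : dir x' ζ ≠ dir x' a)
    (h2' : dir x' ζ ≠ dir x' b) : x = x' := by
  by_contra hne
  obtain ⟨z, hz⟩ : ∃ z, dirv x x' = some z :=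
    Option.ne_none_iff_exists'.1 (by rwa [ne_eq, dirv_eq_none])
  have e1 : dir x ζ ≠ z := by
    rcases dirv_of_mem_geod hx' hz with h | h <;> rwa [← h]
  have e2 := dir_eq_dirv hz e1
  rcases dirv_of_mem_geod hx e2.symm with h | h
  · exact h1' h.symm
  · exact h2' h.symm

/-! ### The action of automorphisms on the boundary -/

theorem take_mul_elt {g : FreeGroup (Fin n)} {k : ℕ} (h : k < g.norm) (y : Letter n) :
    (g * y.elt).toWord.take k = g.toWord.take k ∧ g.norm ≤ (g * y.elt).norm + 1 := by
  have hl : k < g.toWord.length := h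
  simp only [FreeGroup.norm]
  rcases toWord_mul_elt g y with e | e
  · rw [e, List.take_append_of_le_length hl.le]
    simp; omega
  · rw [e, List.dropLast_eq_take, List.take_take, min_eq_left (by omega)]
    simp; omega

theorem take_mul {g c : FreeGroup (Fin n)} {k : ℕ} (h : k + c.norm ≤ g.norm) :
    (g * c).toWord.take k = g.toWord.take k := by
  induction c using reduced_induction generalizing g with
  | h1 => simp
  | h y c hc ih =>
    have hn : (y.elt * c).norm = c.norm + 1 := by
      rw [FreeGroup.norm, toWord_elt_mul_of_ne hc]; rfl
    rw [hn] at h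
    obtain ⟨h1, h2⟩ := take_mul_elt (g := g) (k := k) (by omega) y
    rw [← mul_assoc, ih (by omega), h1]

theorem agree_iff_take {ξ : Boundary n} {k : ℕ} {g : FreeGroup (Fin n)} :
    Agree ξ k g ↔ g.toWord.take k = (List.range k).map ξ.1 := by
  constructor
  · intro h
    apply List.ext_getElem?
    intro j
    by_cases hj : j < k
    · rw [List.getElem?_take_of_lt hj, h j hj]; simp [hj]
    · rw [List.getElem?_eq_none (by simp; omega), List.getElem?_eq_none (by simp; omega)]
  · intro h j hj
    rw [← List.getElem?_take_of_lt hj, h]; simp [hj]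

theorem finite_norm_lt (c : ℕ) : {g : FreeGroup (Fin n) | g.norm < c}.Finite := by
  have := (List.finite_length_lt (Letter n) c).preimage
    (f := FreeGroup.toWord) FreeGroup.toWord_injective.injOn
  exact this

theorem exists_norm_bound {φ : FreeGroup (Fin n) →* FreeGroup (Fin n)}
    (hφ : Function.Injective φ) (c : ℕ) : ∃ m, ∀ u, m ≤ u.norm → c ≤ (φ u).norm := by
  have hf : {u | (φ u).norm < c}.Finite := (finite_norm_lt c).preimage hφ.injOn
  obtain ⟨m, hm⟩ := (hf.image FreeGroup.norm).bddAbove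
  refine ⟨m + 1, fun u hu => ?_⟩
  by_contra! h
  have := hm ⟨u, h, rfl⟩
  omega

/-- A weak form of bounded cancellation. Appending a letter to `u` multiplies `φ u` on the right by
an element of norm at most `C`, which cannot reach the first `k` letters once `φ u` has norm at
least `k + C`. Injectivity and the finiteness of balls ensure this for all long `u`. -/
theorem exists_take_bound {φ : FreeGroup (Fin n) →* FreeGroup (Fin n)}
    (hφ : Function.Injective φ) (k : ℕ) : ∃ m, ∀ (ξ : Boundary n) u, Agree ξ m u →
      (φ u).toWord.take k = (φ (pre ξ m)).toWord.take k ∧ k ≤ (φ u).norm := by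
  let C := Finset.univ.sup fun y : Letter n => (φ y.elt).norm
  have hC : ∀ y : Letter n, (φ y.elt).norm ≤ C := fun y =>
    Finset.le_sup (f := fun y : Letter n => (φ y.elt).norm) (Finset.mem_univ y)
  obtain ⟨m, hm⟩ := exists_norm_bound hφ (k + C)
  refine ⟨m, fun ξ u hu => ?_⟩
  obtain ⟨Q, hQ⟩ : ∃ Q : List (Letter n), u.toWord = (pre ξ m).toWord ++ Q := by
    rw [toWord_pre, ← agree_iff_take.1 hu]
    exact ⟨_, (List.take_append_drop m u.toWord).symm⟩
  induction Q using List.reverseRecOn generalizing u with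
  | nil =>
    rw [List.append_nil, FreeGroup.toWord_inj] at hQ
    subst hQ
    have := hm (pre ξ m) (by rw [norm_pre])
    exact ⟨rfl, by omega⟩
  | append_singleton Q y ih =>
    have hr : FreeGroup.IsReduced ((pre ξ m).toWord ++ Q) := by
      refine (FreeGroup.isReduced_toWord (x := u)).infix ⟨[], [y], ?_⟩
      rw [hQ]; simp
    set v := FreeGroup.mk ((pre ξ m).toWord ++ Q) with hv
    have hvw : v.toWord = (pre ξ m).toWord ++ Q := by rw [hv, FreeGroup.toWord_mk, hr.reduce_eq]
    have huv : u = v * Letter.elt y := by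
      rw [hv, Letter.elt, FreeGroup.mul_mk, List.append_assoc, ← hQ, FreeGroup.mk_toWord]
    have hlen : (pre ξ m).toWord.length = m := norm_pre ξ m
    have hva : Agree ξ m v := by
      rw [agree_iff_take, hvw, List.take_append_of_le_length hlen.ge,
        List.take_of_length_le hlen.le, toWord_pre]
    obtain ⟨h1, h2⟩ := ih v hva hvw
    have hvn := hm v (by rw [FreeGroup.norm, hvw]; simp [hlen])
    have hun := hm u (by rw [FreeGroup.norm, hQ]; simp [hlen])
    refine ⟨?_, by omega⟩
    rw [huv, map_mul, take_mul, h1]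
    have := hC y
    omega

theorem exists_limit {v : ℕ → FreeGroup (Fin n)} (h : ∀ k, ∃ N, ∀ i ≥ N,
    (v i).toWord.take k = (v N).toWord.take k ∧ k ≤ (v i).norm) : ∃ ζ, ConvergesTo v ζ := by
  choose N hN using h
  have hlen : ∀ j i, N (j + 1) ≤ i → j < (v i).toWord.length := fun j i hi => (hN (j + 1) i hi).2
  let f : ℕ → Letter n := fun j => (v (N (j + 1))).toWord[j]'(hlen j _ le_rfl)
  have hf : ∀ j i, N (j + 1) ≤ i → (v i).toWord[j]? = some (f j) := fun j i hi => by
    rw [← List.getElem?_take_of_lt (Nat.lt_succ_self j), (hN (j + 1) i hi).1,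
      List.getElem?_take_of_lt (Nat.lt_succ_self j)]
    exact List.getElem?_eq_getElem _
  refine ⟨⟨f, fun j => ?_⟩, fun k => ?_⟩
  · set i := N (j + 1) + N (j + 1 + 1)
    have h1 := hf j i (by omega)
    have h2 := hf (j + 1) i (by omega)
    rw [List.getElem?_eq_some_iff] at h1 h2
    obtain ⟨a1, b1⟩ := h1
    obtain ⟨a2, b2⟩ := h2
    have := List.isChain_iff_getElem.1 (FreeGroup.isReduced_toWord (x := v i)) j a2
    rw [b1, b2] at this
    exact cancel_iff.1 this
  · have : ∀ᶠ i in atTop, ∀ j < k, N (j + 1) ≤ i := by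
      have := (Finset.range k).eventually_all.2 fun j _ => eventually_ge_atTop (N (j + 1))
      filter_upwards [this] with i hi j hj using hi j (Finset.mem_range.2 hj)
    filter_upwards [this] with i hi j hj using hf j i (hi j hj)

theorem exists_boundary_map {φ : FreeGroup (Fin n) →* FreeGroup (Fin n)}
    (hφ : Function.Injective φ) (ξ : Boundary n) :
    ∃ ζ, ∀ u, ConvergesTo u ξ → ConvergesTo (fun i => φ (u i)) ζ := by
  obtain ⟨ζ, hζ⟩ : ∃ ζ, ConvergesTo (fun i => φ (pre ξ i)) ζ := by
    refine exists_limit fun k => ?_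
    obtain ⟨m, hm⟩ := exists_take_bound hφ k
    refine ⟨m, fun i hi => hm ξ _ ((agree_pre ξ i).mono hi)⟩
  refine ⟨ζ, fun u hu k => ?_⟩
  obtain ⟨m, hm⟩ := exists_take_bound hφ k
  obtain ⟨i, hi, hi'⟩ := ((hζ k).and (eventually_ge_atTop m)).exists
  filter_upwards [hu m] with j hj
  rw [← Agree, agree_iff_take] at hi ⊢
  rw [(hm ξ _ hj).1, ← hi, (hm ξ _ ((agree_pre ξ i).mono hi')).1]

/-- The map induced on the boundary by an automorphism of the free group. -/
def bmap (φ : FreeGroup (Fin n) ≃* FreeGroup (Fin n)) (ξ : Boundary n) : Boundary n :=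
  (exists_boundary_map (φ := φ.toMonoidHom) φ.injective ξ).choose

theorem ConvergesTo.bmap {u : ℕ → FreeGroup (Fin n)} {ξ : Boundary n} (h : ConvergesTo u ξ)
    (φ : FreeGroup (Fin n) ≃* FreeGroup (Fin n)) : ConvergesTo (fun i => φ (u i)) (bmap φ ξ) :=
  (exists_boundary_map (φ := φ.toMonoidHom) φ.injective ξ).choose_spec u h

theorem bmap_symm_bmap (φ : FreeGroup (Fin n) ≃* FreeGroup (Fin n)) (ξ : Boundary n) :
    bmap φ.symm (bmap φ ξ) = ξ := by
  have := ((convergesTo_pre ξ).bmap φ).bmap φ.symm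
  simp only [MulEquiv.symm_apply_apply] at this
  exact this.unique (convergesTo_pre ξ)

theorem bmap_bmap_symm (φ : FreeGroup (Fin n) ≃* FreeGroup (Fin n)) (ξ : Boundary n) :
    bmap φ (bmap φ.symm ξ) = ξ := by
  simpa using bmap_symm_bmap φ.symm ξ

theorem bmap_injective (φ : FreeGroup (Fin n) ≃* FreeGroup (Fin n)) :
    Function.Injective (bmap φ) :=
  Function.LeftInverse.injective (bmap_symm_bmap φ)

theorem continuous_bmap (φ : FreeGroup (Fin n) ≃* FreeGroup (Fin n)) : Continuous (bmap φ) := by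
  rw [continuous_def]
  intro A hA
  refine isOpen_of_shadows fun ξ hξ => ?_
  obtain ⟨k, hk⟩ := exists_shadow_subset hA (ξ := bmap φ ξ) hξ
  obtain ⟨m, hm⟩ := exists_take_bound (φ := φ.toMonoidHom) φ.injective (k + 1)
  refine ⟨pre ξ m, fun ζ hζ => hk k le_rfl _ ?_⟩
  have key : ∀ ζ : Boundary n, Agree (bmap φ ζ) (k + 1) (φ (pre ζ m)) := fun ζ => by
    obtain ⟨i, hi, hi'⟩ := ((((convergesTo_pre ζ).bmap φ) (k + 1)).and
      (eventually_ge_atTop m)).exists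
    rw [← Agree, agree_iff_take] at hi
    rw [agree_iff_take, ← hi]
    exact (hm ζ _ ((agree_pre ζ i).mono hi')).1.symm
  have e : pre ζ m = pre ξ m := by
    rw [dir_pre, dir_pre_eq_iff] at hζ
    rw [pre, pre]; congr 1
    exact List.map_congr_left fun j hj => hζ j (List.mem_range.1 hj).le
  have h1 := key ζ
  rw [e] at h1
  rw [dir_pre_eq_iff]
  intro j hj
  have h2 := key ξ j (by omega)
  rw [h1 j (by omega)] at h2
  exact Option.some_inj.1 h2

theorem endpointsOfLine_bmap {W : List (FreeGroup (Fin n))} {ξ η : Boundary n}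
    (h : EndpointsOfLine W ξ η) (φ : FreeGroup (Fin n) ≃* FreeGroup (Fin n)) :
    EndpointsOfLine (W.map φ) (bmap φ ξ) (bmap φ η) := by
  obtain ⟨w, hw, g, h1, h2⟩ := h
  refine ⟨φ w, List.mem_map_of_mem hw, φ g, ?_, ?_⟩
  · simpa using h1.bmap φ
  · simpa using h2.bmap φ

theorem map_symm_map (W : List (FreeGroup (Fin n))) (φ : FreeGroup (Fin n) ≃* FreeGroup (Fin n)) :
    (W.map φ).map φ.symm = W := by
  simp [Function.comp_def]

theorem paired_bmap {W : List (FreeGroup (Fin n))} {ξ η : Boundary n}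
    (φ : FreeGroup (Fin n) ≃* FreeGroup (Fin n)) :
    Paired (W.map φ) (bmap φ ξ) (bmap φ η) ↔ Paired W ξ η := by
  constructor
  · intro h
    have : Paired ((W.map φ).map φ.symm) (bmap φ.symm (bmap φ ξ)) (bmap φ.symm (bmap φ η)) :=
      h.imp (fun h => endpointsOfLine_bmap h _) fun h => endpointsOfLine_bmap h _
    rwa [map_symm_map, bmap_symm_bmap, bmap_symm_bmap] at this
  · exact fun h => h.imp (fun h => endpointsOfLine_bmap h _) fun h => endpointsOfLine_bmap h _

theorem map_ne_one {W : List (FreeGroup (Fin n))} (hW : ∀ w ∈ W, w ≠ 1)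
    (φ : FreeGroup (Fin n) ≃* FreeGroup (Fin n)) : ∀ w ∈ W.map φ, w ≠ 1 := by
  intro w hw
  obtain ⟨v, hv, rfl⟩ := List.mem_map.1 hw
  simpa using hW v hv

theorem Separable.map {W : List (FreeGroup (Fin n))} {E : Set (Boundary n)}
    (h : Separable W E) (φ : FreeGroup (Fin n) ≃* FreeGroup (Fin n)) :
    Separable (W.map φ) (bmap φ.symm ⁻¹' E) := by
  obtain ⟨A, B, h⟩ := h
  refine ⟨bmap φ.symm ⁻¹' A, bmap φ.symm ⁻¹' B, h.isOpen_left.preimage (continuous_bmap _),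
    h.isOpen_right.preimage (continuous_bmap _), ?_, ?_, h.disjoint.preimage _, ?_, ?_⟩
  · exact h.nonempty_left.imp' (bmap φ) fun ξ hξ => by
      rwa [Set.mem_preimage, bmap_symm_bmap]
  · exact h.nonempty_right.imp' (bmap φ) fun ξ hξ => by
      rwa [Set.mem_preimage, bmap_symm_bmap]
  · rw [← Set.preimage_union, h.union]; rfl
  · intro ξ η hp
    rw [← bmap_bmap_symm φ ξ, ← bmap_bmap_symm φ η, paired_bmap] at hp
    exact h.resp _ _ hp

theorem fiber_map (W : List (FreeGroup (Fin n))) (φ : FreeGroup (Fin n) ≃* FreeGroup (Fin n))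
    (ξ : Boundary n) : bmap φ.symm ⁻¹' fiber W ξ = fiber (W.map φ) (bmap φ ξ) := by
  ext ζ
  obtain ⟨ζ, rfl⟩ : ∃ ω, ζ = bmap φ ω := ⟨_, (bmap_bmap_symm φ ζ).symm⟩
  rw [Set.mem_preimage, bmap_symm_bmap]
  exact or_congr (bmap_injective φ).eq_iff.symm (paired_bmap φ).symm

section
variable {W : List (FreeGroup (Fin n))} (hW : ∀ w ∈ W, w ≠ 1)
include hW

theorem hasCutPoint_map (φ : FreeGroup (Fin n) ≃* FreeGroup (Fin n)) :
    HasCutPoint (DecompositionSpace (W.map φ)) ↔ HasCutPoint (DecompositionSpace W) := by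
  have key : ∀ {W : List (FreeGroup (Fin n))} (_ : ∀ w ∈ W, w ≠ 1)
      (φ : FreeGroup (Fin n) ≃* FreeGroup (Fin n)), HasCutPoint (DecompositionSpace W) →
      HasCutPoint (DecompositionSpace (W.map φ)) := fun {W} hW φ h => by
    obtain ⟨ξ, h⟩ := (hasCutPoint_iff hW).1 h
    refine (hasCutPoint_iff (map_ne_one hW φ)).2 ⟨bmap φ ξ, ?_⟩
    rw [← fiber_map]; exact h.map φ
  refine ⟨fun h => ?_, key hW φ⟩
  have := key (map_ne_one hW φ) φ.symm h
  rwa [map_symm_map] at this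

theorem hasCutTwoPoints_map (φ : FreeGroup (Fin n) ≃* FreeGroup (Fin n)) :
    HasCutTwoPoints (DecompositionSpace (W.map φ)) ↔ HasCutTwoPoints (DecompositionSpace W) := by
  have key : ∀ {W : List (FreeGroup (Fin n))} (_ : ∀ w ∈ W, w ≠ 1)
      (φ : FreeGroup (Fin n) ≃* FreeGroup (Fin n)), HasCutTwoPoints (DecompositionSpace W) →
      HasCutTwoPoints (DecompositionSpace (W.map φ)) := fun {W} hW φ h => by
    obtain ⟨ξ, η, h1, h⟩ := (hasCutTwoPoints_iff hW).1 h
    refine (hasCutTwoPoints_iff (map_ne_one hW φ)).2 ⟨bmap φ ξ, bmap φ η, ?_, ?_⟩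
    · rwa [← fiber_map, Set.mem_preimage, bmap_symm_bmap]
    · rw [← fiber_map, ← fiber_map, ← Set.preimage_union]; exact h.map φ
  refine ⟨fun h => ?_, key hW φ⟩
  have := key (map_ne_one hW φ) φ.symm h
  rwa [map_symm_map] at this

omit hW in
theorem connectedSpace_map (hn : 1 ≤ n) (φ : FreeGroup (Fin n) ≃* FreeGroup (Fin n)) :
    ConnectedSpace (DecompositionSpace (W.map φ)) ↔ ConnectedSpace (DecompositionSpace W) := by
  rw [connectedSpace_iff hn, connectedSpace_iff hn, not_iff_not]
  constructor
  · intro h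
    have := h.map φ.symm
    rwa [map_symm_map] at this
  · exact fun h => h.map φ

theorem hasCutPairs_map (hn : 1 ≤ n) (φ : FreeGroup (Fin n) ≃* FreeGroup (Fin n)) :
    HasCutPairs (DecompositionSpace (W.map φ)) ↔ HasCutPairs (DecompositionSpace W) := by
  rw [HasCutPairs, HasCutPairs, connectedSpace_map hn, hasCutPoint_map hW, hasCutTwoPoints_map hW]

end

/-! ### Whitehead automorphisms -/

open Classical in
theorem whiteheadAut_elt (x : Letter n) (Z : Set (Letter n)) (y : Letter n) :
    whiteheadAut x Z y.elt = if y.1 = x.1 then y.elt else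
      (if y ∈ Z then x.elt else 1) * y.elt * (if y.bar ∈ Z then x.elt⁻¹ else 1) := by
  rcases y with ⟨i, b⟩
  cases b with
  | true =>
    have : (Letter.elt (i, true) : FreeGroup (Fin n)) = FreeGroup.of i := rfl
    rw [this, whiteheadAut, FreeGroup.lift_apply_of]; rfl
  | false =>
    have : (Letter.elt (i, false) : FreeGroup (Fin n)) = (FreeGroup.of i)⁻¹ := rfl
    rw [this, whiteheadAut, map_inv, FreeGroup.lift_apply_of]
    by_cases h : i = x.1
    · simp [h]
    · simp only [if_neg h, Letter.bar, Bool.not_false, mul_inv_rev]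
      by_cases h1 : (i, true) ∈ Z <;> by_cases h2 : (i, false) ∈ Z <;> simp [h1, h2, mul_assoc]

theorem fst_eq_iff {x y : Letter n} : y.1 = x.1 ↔ y = x ∨ y = x.bar := by
  rcases x with ⟨i, b⟩; rcases y with ⟨j, c⟩
  simp only [Letter.bar, Prod.mk.injEq]
  cases b <;> cases c <;> simp

/-- Passing from `x` to its inverse inverts the multipliers and leaves `Z` alone. The letters `x`
and `x.bar` are fixed by definition, so it does not matter whether they belong to `Z`. -/
theorem whiteheadAut_comp (x : Letter n) (Z : Set (Letter n)) :
    (whiteheadAut x Z).comp (whiteheadAut x.bar Z) = MonoidHom.id _ := by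
  classical
  refine FreeGroup.ext_hom _ _ fun i => ?_
  have e : (FreeGroup.of i : FreeGroup (Fin n)) = Letter.elt (i, true) := rfl
  rw [e, MonoidHom.comp_apply, whiteheadAut_elt, MonoidHom.id_apply]
  have hb : x.bar.1 = x.1 := rfl
  have hx : whiteheadAut x Z x.elt = x.elt := by rw [whiteheadAut_elt, if_pos rfl]
  rw [hb]
  by_cases h : (i, true).1 = x.1
  · rw [if_pos h, whiteheadAut_elt, if_pos h]
  · rw [if_neg h, map_mul, map_mul, whiteheadAut_elt, if_neg h]
    split_ifs <;> simp [hx, mul_assoc]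

/-- Whitehead automorphisms are automorphisms. -/
def whiteheadEquiv (x : Letter n) (Z : Set (Letter n)) : FreeGroup (Fin n) ≃* FreeGroup (Fin n) :=
  MonoidHom.toMulEquiv (whiteheadAut x Z) (whiteheadAut x.bar Z)
    (by simpa using whiteheadAut_comp x.bar Z) (whiteheadAut_comp x Z)

theorem coe_whiteheadEquiv (x : Letter n) (Z : Set (Letter n)) :
    ⇑(whiteheadEquiv x Z) = whiteheadAut x Z := rfl

theorem exists_equiv_of_reflTransGen {W V : List (FreeGroup (Fin n))}
    (h : Relation.ReflTransGen WhiteheadStep W V) :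
    ∃ φ : FreeGroup (Fin n) ≃* FreeGroup (Fin n), V = W.map φ := by
  induction h with
  | refl => exact ⟨MulEquiv.refl _, by simp⟩
  | tail _ h ih =>
    obtain ⟨φ, rfl⟩ := ih
    obtain ⟨x, Z, -, -, rfl, -⟩ := h
    exact ⟨φ.trans (whiteheadEquiv x Z), by rw [List.map_map]; rfl⟩

/-! ### Fundamental domains of axes -/

theorem eq_pre_of_mem_geod {v : FreeGroup (Fin n)} {ξ η : Boundary n} (h1 : 1 ∈ geod ξ η)
    (hv : v ∈ geod ξ η) (hd0 : ∀ z, hd v = some z → z = ξ.1 0) : v = pre ξ v.norm := by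
  induction v using reduced_induction generalizing ξ η with
  | h1 => simp
  | h y v hy ih =>
    have h0 : y = ξ.1 0 := hd0 y (hd_elt_mul.2 hy)
    have hη : dir 1 η ≠ y := by
      rw [mem_geod, dir_one] at h1; rw [h0]; exact h1.symm
    have hξ : dir 1 ξ = y := by rw [dir_one, h0]
    have hyg : y.elt ∈ geod ξ η := by simpa using mul_elt_mem_geod_of_dir hξ hη
    have e : act y.elt⁻¹ ξ = tail ξ := by
      rw [← Letter.elt_bar, act_elt, step_of_eq]; simpa using h0.symm
    have h1' : (1 : FreeGroup (Fin n)) ∈ geod (act y.elt⁻¹ ξ) (act y.elt⁻¹ η) := by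
      rw [← translate_geod, mem_translate]; simpa using hyg
    have hv' : v ∈ geod (act y.elt⁻¹ ξ) (act y.elt⁻¹ η) := by
      rw [← translate_geod, mem_translate]; simpa using hv
    have := ih h1' hv' fun z hz => by
      rcases dirv_of_mem_geod hv' (x := 1) (by simpa [dirv] using hz) with h | h
      · exact h.symm
      · exfalso
        have h2 : dir (1 * y.elt) η = y.bar := dir_mul_elt.2 hη
        rw [one_mul, dir] at h2
        rw [dir_one] at h
        rw [h] at h2
        exact hy (by rw [hz, h2])
    have hn : (y.elt * v).norm = v.norm + 1 := by
      rw [FreeGroup.norm, toWord_elt_mul_of_ne hy]; rfl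
    rw [hn, pre_succ', ← h0, ← e, ← this]

theorem mem_segment_iff {c : FreeGroup (Fin n)} {ξ : Boundary n} (h : pre ξ c.norm = c)
    {x : FreeGroup (Fin n)} : x ∈ segment c ↔ ∃ r < c.norm, x = pre ξ r := by
  have hw : c.toWord = (List.range c.norm).map ξ.1 := by rw [← toWord_pre, h]
  constructor
  · rintro ⟨p, hp, hne, rfl⟩
    have hl : p.length < c.norm := by
      rcases hp.length_le.lt_or_eq with h | h
      · exact h
      · exact absurd (hp.eq_of_length h) hne
    refine ⟨p.length, hl, ?_⟩
    rw [pre, List.prefix_iff_eq_take.1 hp, hw, ← List.map_take, List.take_range]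
    simp [hl.le]
  · rintro ⟨r, hr, rfl⟩
    refine ⟨(List.range r).map ξ.1, ?_, ?_, rfl⟩
    · rw [hw]
      refine List.IsPrefix.map _ ?_
      rw [← min_eq_left hr.le, ← List.take_range]
      exact List.take_prefix _ _
    · intro h
      have := congrArg List.length h
      rw [hw] at this
      simp at this
      omega

theorem pre_mul_add {c : FreeGroup (Fin n)} {ξ : Boundary n} (hp : pre ξ c.norm = c)
    (hc : Attr c ξ) (q r : ℕ) : pre ξ (c.norm * q + r) = c ^ q * pre ξ r := by
  induction q with
  | zero => simp
  | succ q ih =>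
    have : c.norm * (q + 1) + r = c.norm + (c.norm * q + r) := by ring
    rw [this, pre_add, hp, act_inv_of_act hc.act_self, ih, pow_succ', mul_assoc]

theorem pre_norm_of_attr {c : FreeGroup (Fin n)} (hc : CycReduced c) (h1 : c ≠ 1)
    {ξ : Boundary n} (hξ : Attr c ξ) : pre ξ c.norm = c := by
  obtain ⟨ζ, h, -, h3⟩ := exists_attr_of_cycReduced hc h1
  rw [hξ.unique h]
  simpa using h3 1

theorem one_mem_axis {c : FreeGroup (Fin n)} (hc : CycReduced c) : 1 ∈ axis c := by
  change CycReduced _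
  simpa using hc

/-- A high power of `c` moves `v` onto the ray from the identity vertex to the attracting end.
Division of its length by `c.norm` then finds the translate of the segment that contains it. -/
theorem exists_zpow_mul {c : FreeGroup (Fin n)} (hc : CycReduced c) (h1 : c ≠ 1)
    {v : FreeGroup (Fin n)} (hv : v ∈ axis c) : ∃ i : ℤ, ∃ x ∈ segment c, v = c ^ i * x := by
  obtain ⟨ξ, hξ⟩ := exists_attr h1
  obtain ⟨η, hη⟩ := exists_attr (inv_ne_one.2 h1)
  have hp := pre_norm_of_attr hc h1 hξ
  have hm : 0 < c.norm := by
    rw [Nat.pos_iff_ne_zero]; exact fun h => h1 (FreeGroup.norm_eq_zero.1 h)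
  have hax := axis_eq_geod h1 hξ hη
  obtain ⟨N, hN⟩ := ((hξ.mul_right v) 1).exists
  have h1g : (1 : FreeGroup (Fin n)) ∈ geod ξ η := hax ▸ one_mem_axis hc
  have hvg : c ^ N * v ∈ geod ξ η := by
    have := hax ▸ hv
    have e : geod ξ η = translate (c ^ N) (geod ξ η) := by
      rw [translate_geod]
      have := act_zpow_of_act hξ.act_self N
      have := act_zpow_of_act hη.act_self' N
      simp_all
    rw [e, mem_translate]
    simpa using this
  have := eq_pre_of_mem_geod h1g hvg fun z hz => by
    rw [Agree.hd hN] at hz; exact (Option.some_inj.1 hz).symm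
  set k := (c ^ N * v).norm
  refine ⟨(k / c.norm : ℕ) - N, pre ξ (k % c.norm), (mem_segment_iff hp).2
    ⟨_, Nat.mod_lt _ hm, rfl⟩, ?_⟩
  rw [← Nat.div_add_mod k c.norm, pre_mul_add hp hξ] at this
  rw [sub_eq_neg_add, zpow_add, mul_assoc, zpow_natCast, ← this]
  simp

theorem finite_segment (c : FreeGroup (Fin n)) : (segment c).Finite := by
  refine (c.toWord.inits.toFinset.finite_toSet.image FreeGroup.mk).subset ?_
  rintro x ⟨p, hp, -, rfl⟩
  exact ⟨p, by simpa using hp, rfl⟩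

theorem translate_axis (g h : FreeGroup (Fin n)) : translate g (axis h) = axis (g * h * g⁻¹) := by
  ext x
  rw [mem_translate]
  simp only [axis, Set.mem_ofPred_eq, mul_inv_rev, inv_inv, mul_assoc]

theorem axis_zpow_conj (c : FreeGroup (Fin n)) (i : ℤ) : translate (c ^ i) (axis c) = axis c := by
  rw [translate_axis]
  congr 1
  rw [← zpow_neg, ← zpow_add_one, ← zpow_add]
  simp

/-- The lines of the pattern through the identity vertex. -/
def linesAt (W : List (FreeGroup (Fin n))) : Set (Set (FreeGroup (Fin n))) :=
  {l | l ∈ lines W ∧ (1 : FreeGroup (Fin n)) ∈ l}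

/-- Each line is a translate of the axis of a cyclically reduced conjugate of some `w`. If it
contains the identity vertex, the translation can be adjusted by powers of that conjugate to the
inverse of a vertex of its segment, and segments are finite. -/
theorem finite_linesAt {W : List (FreeGroup (Fin n))} (hW : ∀ w ∈ W, w ≠ 1) :
    (linesAt W).Finite := by
  choose d hd using exists_conj_cycReduced (n := n)
  have hf : (⋃ w ∈ W.toFinset, (fun x => translate x⁻¹ (axis ((d w)⁻¹ * w * d w))) ''
      segment ((d w)⁻¹ * w * d w)).Finite :=
    W.toFinset.finite_toSet.biUnion fun w _ => (finite_segment _).image _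
  refine hf.subset ?_
  rintro l ⟨⟨w, hw, g, rfl⟩, h1⟩
  have e : axis (g * w * g⁻¹) = translate (g * d w) (axis ((d w)⁻¹ * w * d w)) := by
    rw [translate_axis]; congr 1; group
  rw [e, mem_translate, mul_one] at h1
  obtain ⟨i, x, hx, h⟩ := exists_zpow_mul (hd w) (conj_ne_one (hW w hw) _) h1
  simp only [Set.mem_iUnion, List.mem_toFinset]
  refine ⟨w, hw, x, hx, ?_⟩
  rw [e, inv_eq_iff_eq_inv.1 h, mul_inv_rev, translate_mul, ← zpow_neg, axis_zpow_conj]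

/-! ### Whitehead automorphisms at infinity -/

section
variable {x : Letter n} {Z : Set (Letter n)} (hx : x ∈ Z) (hx' : x.bar ∉ Z)

theorem whiteheadAut_self : whiteheadAut x Z x.elt = x.elt := by
  rw [whiteheadAut_elt, if_pos rfl]

theorem whiteheadAut_bar : whiteheadAut x Z x.bar.elt = x.bar.elt := by
  rw [whiteheadAut_elt, if_pos (fst_eq_iff.2 (Or.inr rfl))]

open Classical in
theorem whiteheadAut_elt_mul {y : Letter n} (h1 : y ≠ x) (h2 : y ≠ x.bar) (g : FreeGroup (Fin n)) :
    whiteheadAut x Z (y.elt * g) = (if y ∈ Z then x.elt else 1) * (y.elt *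
      ((if y.bar ∈ Z then x.elt⁻¹ else 1) * whiteheadAut x Z g)) := by
  rw [map_mul, whiteheadAut_elt, if_neg (by rw [fst_eq_iff]; tauto)]
  simp only [mul_assoc]

include hx hx'

/-- How a Whitehead automorphism changes the first letter of a reduced word. -/
theorem hd_whiteheadAut (g : FreeGroup (Fin n)) :
    (∀ s, hd g = some s → s ∈ Z → s ≠ x → hd (whiteheadAut x Z g) = some x ∧
      hd (x.bar.elt * whiteheadAut x Z g) = some s) ∧
    (hd g = some x → hd (whiteheadAut x Z g) = some x ∧
      ∀ z ∈ Z, hd (x.bar.elt * whiteheadAut x Z g) = some z → z = x) ∧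
    (∀ s, hd g = some s → s ∉ Z → s ≠ x.bar → hd (whiteheadAut x Z g) = some s) ∧
    (hd g = some x.bar →
      (∀ r ∈ Z, hd (x.elt * g) = some r → r ≠ x ∧ hd (whiteheadAut x Z g) = some r) ∧
      ((∀ r ∈ Z, hd (x.elt * g) ≠ some r) → hd (whiteheadAut x Z g) = some x.bar)) := by
  classical
  -- The cases need each other: a factor `x⁻¹` behind the image of one letter may cancel the `x` in
  -- front of the image of the next, and the statements about `x.bar.elt * whiteheadAut x Z g` say
  -- what appears after this cancellation.
  induction g using reduced_induction with
  | h1 =>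
    have : hd (1 : FreeGroup (Fin n)) = none := hd_eq_none.2 rfl
    simp [this]
  | h t g ht ih =>
    obtain ⟨ia, ib, ic, id⟩ := ih
    have hh : hd (t.elt * g) = some t := hd_elt_mul.2 ht
    have hnx : ∀ s, hd g = some s → hd g ≠ some x → hd (whiteheadAut x Z g) = some x →
        s ∈ Z := fun s hs hsx h => by
      by_contra hsZ
      by_cases hsb : s = x.bar
      · subst hsb
        by_cases hr : ∃ r ∈ Z, hd (x.elt * g) = some r
        · obtain ⟨r, hr, hr'⟩ := hr
          obtain ⟨h1, h2⟩ := (id hs).1 r hr hr'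
          rw [h] at h2; exact h1 (Option.some_inj.1 h2).symm
        · push Not at hr
          rw [(id hs).2 hr] at h
          exact Letter.bar_ne x (Option.some_inj.1 h)
      · have := ic s hs hsZ hsb
        rw [h] at this
        exact hsZ (Option.some_inj.1 this ▸ hx)
    have hb : hd g ≠ some x.bar → hd (whiteheadAut x Z g) ≠ some x.bar ∧
        ∀ z ∈ Z, hd (whiteheadAut x Z g) = some z → z = x := fun hg => by
      rcases hs : hd g with _ | s
      · rw [hd_eq_none.1 hs, map_one, hd_eq_none.2 rfl]; simp
      · by_cases hsx : s = x
        · rw [(ib (hsx ▸ hs)).1]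
          exact ⟨by simpa using Letter.ne_bar x, fun z _ h => (Option.some_inj.1 h).symm⟩
        · by_cases hsZ : s ∈ Z
          · rw [(ia s hs hsZ hsx).1]
            exact ⟨by simpa using Letter.ne_bar x, fun z _ h => (Option.some_inj.1 h).symm⟩
          · have hsb : s ≠ x.bar := fun h => hg (h ▸ hs)
            rw [ic s hs hsZ hsb]
            refine ⟨by simpa using hsb, fun z hz h => ?_⟩
            exact absurd (Option.some_inj.1 h ▸ hz) hsZ
    by_cases h1 : t = x
    · subst h1
      have hm : whiteheadAut t Z (t.elt * g) = t.elt * whiteheadAut t Z g := by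
        rw [map_mul, whiteheadAut_self]
      have e : t.bar.elt * (t.elt * whiteheadAut t Z g) = whiteheadAut t Z g := by
        rw [Letter.elt_bar, inv_mul_cancel_left]
      rw [hm, hh, e]
      refine ⟨fun s hs _ hsx => absurd (Option.some_inj.1 hs).symm hsx,
        fun _ => ⟨hd_elt_mul.2 (hb ht).1, (hb ht).2⟩,
        fun s hs hsZ => absurd (Option.some_inj.1 hs ▸ hx) hsZ,
        fun h => absurd (Option.some_inj.1 h) (Letter.ne_bar t)⟩
    by_cases h2 : t = x.bar
    · subst h2
      have hm : whiteheadAut x Z (x.bar.elt * g) = x.bar.elt * whiteheadAut x Z g := by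
        rw [map_mul, whiteheadAut_bar]
      have e : x.elt * (x.bar.elt * g) = g := by rw [Letter.elt_bar, mul_inv_cancel_left]
      rw [Letter.bar_bar] at ht
      rw [hm, hh, e]
      refine ⟨fun s hs hsZ => absurd (Option.some_inj.1 hs ▸ hsZ) hx',
        fun h => absurd (Option.some_inj.1 h) (Letter.bar_ne x),
        fun s hs _ hsb => absurd (Option.some_inj.1 hs).symm hsb, fun _ => ⟨fun r hr hr' => ?_,
        fun hr => ?_⟩⟩
      · have hrx : r ≠ x := fun h => ht (h ▸ hr')
        exact ⟨hrx, (ia r hr' hr hrx).2⟩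
      · rw [hd_elt_mul, Letter.bar_bar]
        intro h
        rcases hs : hd g with _ | s
        · rw [hd_eq_none.1 hs, map_one, hd_eq_none.2 rfl] at h; simp at h
        · exact hr s (hnx s hs ht h) hs
    -- The letter `t` in the middle of its image survives: what follows it does not begin with
    -- `t.bar`, even after the cancellation of multipliers.
    have key : hd ((if t.bar ∈ Z then x.elt⁻¹ else 1) * whiteheadAut x Z g) ≠ some t.bar := by
      have htx : t.bar ≠ x := fun h => h2 (Letter.bar_eq_comm.1 h)
      split_ifs with htZ
      · rw [← Letter.elt_bar]
        rcases hs : hd g with _ | s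
        · rw [hd_eq_none.1 hs, map_one, mul_one]
          have := hd_elt_mul (y := x.bar) (g := 1)
          rw [mul_one, hd_eq_none.2 rfl] at this
          rw [this.2 (by simp)]
          simpa [Letter.bar_inj] using Ne.symm h1
        · by_cases hsx : s = x
          · exact fun h => htx ((ib (hsx ▸ hs)).2 _ htZ h)
          · by_cases hsZ : s ∈ Z
            · rw [(ia s hs hsZ hsx).2]
              exact fun h => ht (h ▸ hs)
            · have : hd (whiteheadAut x Z g) ≠ some x.bar.bar := by
                rw [Letter.bar_bar]
                exact fun h => hsZ (hnx s hs (by simpa [hs] using hsx) h)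
              rw [hd_elt_mul.2 this]
              simpa [Letter.bar_inj] using Ne.symm h1
      · rw [one_mul]
        intro h
        by_cases hg : hd g = some x.bar
        · by_cases hr : ∃ r ∈ Z, hd (x.elt * g) = some r
          · obtain ⟨r, hr, hr'⟩ := hr
            rw [((id hg).1 r hr hr').2] at h
            exact htZ (Option.some_inj.1 h ▸ hr)
          · push Not at hr
            rw [(id hg).2 hr] at h
            exact h1 (Letter.bar_inj.1 (Option.some_inj.1 h)).symm
        · rcases hs : hd g with _ | s
          · rw [hd_eq_none.1 hs, map_one, hd_eq_none.2 rfl] at h; simp at h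
          · by_cases hsx : s = x
            · rw [(ib (hsx ▸ hs)).1] at h
              exact htx (Option.some_inj.1 h).symm
            · by_cases hsZ : s ∈ Z
              · rw [(ia s hs hsZ hsx).1] at h
                exact htx (Option.some_inj.1 h).symm
              · rw [ic s hs hsZ fun h => hg (h ▸ hs), ← hs] at h
                exact ht h
    rw [whiteheadAut_elt_mul h1 h2, hh]
    have k1 := hd_elt_mul.2 key
    set u := t.elt * ((if t.bar ∈ Z then x.elt⁻¹ else 1) * whiteheadAut x Z g)
    refine ⟨fun s hs hsZ hsx => ?_, fun h => absurd (Option.some_inj.1 h) h1,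
      fun s hs hsZ hsb => ?_, fun h => absurd (Option.some_inj.1 h) h2⟩
    · obtain rfl := Option.some_inj.1 hs
      rw [if_pos hsZ]
      refine ⟨hd_elt_mul.2 ?_, ?_⟩
      · rw [k1]; simpa using h2
      · rw [Letter.elt_bar, inv_mul_cancel_left, k1]
    · obtain rfl := Option.some_inj.1 hs
      rw [if_neg hsZ, one_mul, k1]

/-- A first letter `x.bar` is cancelled by the `x` in front of the image of a letter of `Z`, so the
second letter of the end has to be inspected in this case. -/
theorem bmap_whitehead_zero (ξ : Boundary n) :
    (ξ.1 0 ∈ Z → (bmap (whiteheadEquiv x Z) ξ).1 0 = x) ∧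
    (ξ.1 0 ∉ Z → ξ.1 0 ≠ x.bar → (bmap (whiteheadEquiv x Z) ξ).1 0 = ξ.1 0) ∧
    (ξ.1 0 = x.bar → ξ.1 1 ∈ Z → (bmap (whiteheadEquiv x Z) ξ).1 0 = ξ.1 1) ∧
    (ξ.1 0 = x.bar → ξ.1 1 ∉ Z → (bmap (whiteheadEquiv x Z) ξ).1 0 = x.bar) := by
  obtain ⟨i, hi, hi2⟩ := ((((convergesTo_pre ξ).bmap (whiteheadEquiv x Z)) 1).and
    (eventually_ge_atTop 2)).exists
  replace hi := Agree.hd hi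
  rw [coe_whiteheadEquiv] at hi
  have h0 : hd (pre ξ i) = some (ξ.1 0) := Agree.hd (k := 1) ((agree_pre ξ i).mono hi2)
  have h1 : ξ.1 0 = x.bar → hd (x.elt * pre ξ i) = some (ξ.1 1) := fun h => by
    obtain ⟨j, rfl⟩ : ∃ j, i = j + 1 := ⟨i - 1, by omega⟩
    rw [pre_succ', h, Letter.elt_bar, mul_inv_cancel_left]
    exact Agree.hd (k := 0) ((agree_pre (tail ξ) j).mono (by omega))
  obtain ⟨ha, hb, hc, hd'⟩ := hd_whiteheadAut hx hx' (pre ξ i)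
  refine ⟨fun h => ?_, fun h h' => ?_, fun h h' => ?_, fun h h' => ?_⟩
  · by_cases hsx : ξ.1 0 = x
    · rw [(hb (hsx ▸ h0)).1] at hi; exact (Option.some_inj.1 hi).symm
    · rw [(ha _ h0 h hsx).1] at hi; exact (Option.some_inj.1 hi).symm
  · rw [hc _ h0 h h'] at hi; exact (Option.some_inj.1 hi).symm
  · rw [((hd' (h ▸ h0)).1 _ h' (h1 h)).2] at hi; exact (Option.some_inj.1 hi).symm
  · rw [(hd' (h ▸ h0)).2 fun r hr hr' => ?_] at hi
    · exact (Option.some_inj.1 hi).symm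
    · rw [h1 h] at hr'; exact h' (Option.some_inj.1 hr' ▸ hr)

end

/-! ### Reduction of the complexity -/

/-- Whitehead's count: the lines of the new pattern through the identity vertex inject into those of
the old one. A new line comes from an old one that does not join two letters of `Z`, or from one
between two letters of `A`, translated by `x⁻¹` first. The old lines between `x` and `A` are not
used, and `hex` provides one. Since no line leaves `A` except towards `x`, there are no further new
lines. -/
theorem complexity_lt {W : List (FreeGroup (Fin n))} (hW : ∀ w ∈ W, w ≠ 1) {x : Letter n}
    {A : Set (Letter n)} (hxA : x ∉ A) (hxA' : x.bar ∉ A)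
    (hcl : ∀ ξ η, Paired W ξ η → ξ.1 0 ∈ A → η.1 0 ∈ A ∨ η.1 0 = x)
    (hex : ∃ ξ η, Paired W ξ η ∧ ξ.1 0 = x ∧ η.1 0 ∈ A) :
    complexity (W.map (whiteheadAut x (insert x A))) < complexity W := by
  obtain ⟨ξ₀, η₀, hp₀, hξ₀, hη₀⟩ := hex
  set Z := insert x A with hZ
  have hx : x ∈ Z := Set.mem_insert _ _
  have hAZ : ∀ a ∈ A, a ∈ Z := fun a => Set.mem_insert_of_mem x
  have hx' : x.bar ∉ Z := by
    rintro (h | h)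
    · exact Letter.bar_ne x h
    · exact hxA' h
  set φ := whiteheadEquiv x Z with hφ
  rw [← coe_whiteheadEquiv, ← hφ]
  set l₀ := geod ξ₀ η₀ with hl₀
  have hmem₀ : l₀ ∈ linesAt W := by
    refine ⟨hp₀.mem_lines hW, ?_⟩
    rw [hl₀, mem_geod, dir_one, dir_one, hξ₀]
    exact fun h => hxA (h ▸ hη₀)
  let R : Set (FreeGroup (Fin n)) → Set (FreeGroup (Fin n)) → Prop := fun l' l =>
    ∃ ξ η, Paired W ξ η ∧ l = geod ξ η ∧
      ((¬ (ξ.1 0 ∈ Z ∧ η.1 0 ∈ Z) ∧ l' = geod (bmap φ ξ) (bmap φ η)) ∨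
        (ξ.1 0 ∈ A ∧ η.1 0 ∈ A ∧
          l' = geod (bmap φ (act x.elt⁻¹ ξ)) (bmap φ (act x.elt⁻¹ η))))
  have hR0 : ∀ l', ¬ R l' l₀ := by
    rintro l' ⟨ξ, η, hp, h, h'⟩
    rcases geod_inj (hp₀.ne hW) h with ⟨rfl, rfl⟩ | ⟨rfl, rfl⟩
    · rcases h' with ⟨h', -⟩ | ⟨h', -, -⟩
      · exact h' ⟨hξ₀ ▸ hx, hAZ _ hη₀⟩
      · exact hxA (hξ₀ ▸ h')
    · rcases h' with ⟨h', -⟩ | ⟨-, h', -⟩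
      · exact h' ⟨hAZ _ hη₀, hξ₀ ▸ hx⟩
      · exact hxA (hξ₀ ▸ h')
  have hRi : ∀ l l' l'', R l' l → R l'' l → l' = l'' := by
    rintro l l' l'' ⟨ξ, η, hp, rfl, h1⟩ ⟨ξ', η', hp', h, h2⟩
    rcases geod_inj (hp.ne hW) h with ⟨rfl, rfl⟩ | ⟨rfl, rfl⟩
    · rcases h1 with ⟨h1, rfl⟩ | ⟨h1, h1', rfl⟩ <;> rcases h2 with ⟨h2, rfl⟩ | ⟨h2, h2', rfl⟩
      · rfl
      · exact absurd ⟨hAZ _ h2, hAZ _ h2'⟩ h1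
      · exact absurd ⟨hAZ _ h1, hAZ _ h1'⟩ h2
      · rfl
    · rcases h1 with ⟨h1, rfl⟩ | ⟨h1, h1', rfl⟩ <;> rcases h2 with ⟨h2, rfl⟩ | ⟨h2, h2', rfl⟩
      · exact geod_comm _ _
      · exact absurd ⟨hAZ _ h2', hAZ _ h2⟩ h1
      · exact absurd ⟨hAZ _ h1', hAZ _ h1⟩ h2
      · exact geod_comm _ _
  have hRe : ∀ l' ∈ linesAt (W.map φ), ∃ l ∈ linesAt W, R l' l := by
    rintro l' ⟨hl', h1⟩
    obtain ⟨ξ', η', hp, rfl⟩ := (mem_lines_iff (map_ne_one hW φ)).1 hl'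
    obtain ⟨ξ, rfl⟩ : ∃ ω, ξ' = bmap φ ω := ⟨_, (bmap_bmap_symm φ _).symm⟩
    obtain ⟨η, rfl⟩ : ∃ ω, η' = bmap φ ω := ⟨_, (bmap_bmap_symm φ _).symm⟩
    rw [paired_bmap] at hp
    rw [mem_geod, dir_one, dir_one] at h1
    obtain ⟨a1, a2, a3, a4⟩ := bmap_whitehead_zero hx hx' ξ
    obtain ⟨b1, b2, b3, b4⟩ := bmap_whitehead_zero hx hx' η
    by_cases h0 : ξ.1 0 = η.1 0
    -- The preimage of the line misses the identity vertex. Its ends can be told apart at the first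
    -- letter of their images only if both start with `x.bar`; by `hcl` their second letters then
    -- both belong to `A`.
    · have hξb : ξ.1 0 = x.bar := by
        by_contra hb
        by_cases hξZ : ξ.1 0 ∈ Z
        · exact h1 (by rw [a1 hξZ, b1 (h0 ▸ hξZ)])
        · exact h1 (by rw [a2 hξZ hb, b2 (h0 ▸ hξZ) (h0 ▸ hb), h0])
      have hηb := h0 ▸ hξb
      have step0 : ∀ ζ : Boundary n, ζ.1 0 = x.bar → (act x.elt ζ).1 0 = ζ.1 1 := fun ζ h => by
        rw [act_elt, step_of_eq h]; rfl
      have hmemA : ∀ ζ : Boundary n, ζ.1 0 = x.bar → ζ.1 1 ∈ Z → ζ.1 1 ∈ A := fun ζ h hZ => by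
        rcases hZ with h' | h'
        · have := ζ.2 0
          rw [h, Letter.bar_bar] at this
          exact absurd h' this
        · exact h'
      have hp' := hp.act x.elt
      have hne1 : ξ.1 1 ≠ η.1 1 := fun h => by
        by_cases hξ1 : ξ.1 1 ∈ Z
        · exact h1 (by rw [a3 hξb hξ1, b3 hηb (h ▸ hξ1), h])
        · exact h1 (by rw [a4 hξb hξ1, b4 hηb (h ▸ hξ1)])
      have hAA : ξ.1 1 ∈ A ∧ η.1 1 ∈ A := by
        have hx1 : ξ.1 1 ≠ x := by have := ξ.2 0; rwa [hξb, Letter.bar_bar] at this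
        have hx2 : η.1 1 ≠ x := by have := η.2 0; rwa [hηb, Letter.bar_bar] at this
        by_cases hξ1 : ξ.1 1 ∈ Z
        · have hA := hmemA ξ hξb hξ1
          refine ⟨hA, ?_⟩
          have := hcl _ _ hp' (by rwa [step0 ξ hξb])
          rw [step0 η hηb] at this
          exact this.resolve_right hx2
        · by_cases hη1 : η.1 1 ∈ Z
          · have hA := hmemA η hηb hη1
            refine ⟨?_, hA⟩
            have := hcl _ _ hp'.symm (by rwa [step0 η hηb])
            rw [step0 ξ hξb] at this
            exact this.resolve_right hx1
          · exact absurd (by rw [a4 hξb hξ1, b4 hηb hη1]) h1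
      refine ⟨geod (act x.elt ξ) (act x.elt η), ⟨hp'.mem_lines hW, ?_⟩, _, _, hp', rfl, Or.inr
        ⟨?_, ?_, ?_⟩⟩
      · rwa [mem_geod, dir_one, dir_one, step0 ξ hξb, step0 η hηb]
      · rw [step0 ξ hξb]; exact hAA.1
      · rw [step0 η hηb]; exact hAA.2
      · rw [act_inv_act, act_inv_act]
    · refine ⟨geod ξ η, ⟨hp.mem_lines hW, by rwa [mem_geod, dir_one, dir_one]⟩, _, _, hp, rfl,
        Or.inl ⟨fun h => h1 (by rw [a1 h.1, b1 h.2]), rfl⟩⟩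
  choose! f hf hfR using hRe
  have hfin := finite_linesAt hW
  calc complexity (W.map φ) ≤ (linesAt W \ {l₀}).ncard :=
        Set.ncard_le_ncard_of_injOn f (fun l' hl' => ⟨hf l' hl', fun h =>
          hR0 l' ((Set.mem_singleton_iff.1 h) ▸ hfR l' hl')⟩)
          (fun a ha b hb h => hRi _ _ _ (hfR a ha) (h ▸ hfR b hb)) (hfin.subset Set.sdiff_subset)
    _ < complexity W := Set.ncard_sdiff_singleton_lt_of_mem hmem₀ hfin

theorem exists_whiteheadStep {W : List (FreeGroup (Fin n))} (hW : ∀ w ∈ W, w ≠ 1) {x : Letter n}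
    (h : IsCutVertex (whiteheadGraph W) x) : ∃ V, WhiteheadStep W V := by
  set G := whiteheadGraph W
  obtain ⟨u, v, hu, hv, hr, hnp⟩ := h
  let C : Letter n → Set (Letter n) := fun w => {t | ∃ p : G.Walk w t, x ∉ p.support}
  -- The cut vertex separates `u` from `v`, and `x.bar` can be on the side of only one of them. The
  -- other side serves as the set `A` of `complexity_lt`; a walk from it to `w'` provides an edge to
  -- `x`.
  obtain ⟨w, w', hw, hr, hb, hw'⟩ : ∃ w w', w ≠ x ∧ G.Reachable w w' ∧ x.bar ∉ C w ∧ w' ∉ C w := by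
    by_cases hbu : x.bar ∈ C u
    · refine ⟨v, u, hv, hr.symm, ?_, ?_⟩
      · rintro ⟨p, hp⟩
        obtain ⟨q, hq⟩ := hbu
        refine hnp ⟨q.append p.reverse, ?_⟩
        simp [SimpleGraph.Walk.mem_support_append_iff, hp, hq]
      · rintro ⟨p, hp⟩
        exact hnp ⟨p.reverse, by simpa using hp⟩
    · exact ⟨u, v, hu, hr, hbu, hnp⟩
  have hcl : ∀ s t, s ∈ C w → G.Adj s t → t ∈ C w ∨ t = x := by
    rintro s t ⟨p, hp⟩ hst
    by_cases ht : t = x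
    · exact Or.inr ht
    · refine Or.inl ⟨p.concat hst, ?_⟩
      rw [SimpleGraph.Walk.support_concat]
      simpa [hp] using Ne.symm ht
  have hwC : w ∈ C w := ⟨SimpleGraph.Walk.nil, by simpa using hw.symm⟩
  have hxC : x ∉ C w := fun ⟨p, hp⟩ => hp p.end_mem_support
  obtain ⟨p⟩ := hr
  obtain ⟨d, -, hd1, hd2⟩ := p.exists_boundary_dart (C w) hwC hw'
  have hdx : d.snd = x := (hcl _ _ hd1 d.adj).resolve_left hd2
  obtain ⟨-, η, ξ, hp, h1, h2⟩ := (whiteheadGraph_adj hW).1 d.adj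
  rw [dir_one] at h1 h2
  refine ⟨_, x, insert x (C w), Set.mem_insert _ _, ?_, rfl, complexity_lt hW hxC hb ?_
    ⟨ξ, η, hp.symm, h2.trans hdx, h1 ▸ hd1⟩⟩
  · rintro (h | h)
    · exact Letter.bar_ne x h
    · exact hb h
  · intro ξ η hp hξ
    by_cases he : ξ.1 0 = η.1 0
    · exact Or.inl (he ▸ hξ)
    · refine hcl _ _ hξ ((whiteheadGraph_adj hW).2 ⟨he, ξ, η, hp, ?_, ?_⟩) <;> rw [dir_one]

theorem exists_isReductionOf {W : List (FreeGroup (Fin n))} (hW : ∀ w ∈ W, w ≠ 1) :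
    ∃ V, IsReductionOf V W := by
  induction h : complexity W using Nat.strong_induction_on generalizing W with
  | _ k ih =>
    subst h
    by_cases hc : ∃ x, IsCutVertex (whiteheadGraph W) x
    · obtain ⟨x, hx⟩ := hc
      obtain ⟨V, hV⟩ := exists_whiteheadStep hW hx
      have hV1 : ∀ v ∈ V, v ≠ 1 := by
        obtain ⟨y, Z, -, -, rfl, -⟩ := hV
        exact map_ne_one hW (whiteheadEquiv y Z)
      obtain ⟨y, Z, h1, h2, h3, hlt⟩ := id hV
      obtain ⟨U, hU, hU'⟩ := ih _ hlt hV1 rfl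
      exact ⟨U, Relation.ReflTransGen.head hV hU, hU'⟩
    · push Not at hc
      exact ⟨W, Relation.ReflTransGen.refl, hc⟩

/-! ### Colourings of the pattern along a path -/

/-- An indexing of the lines of the pattern through the identity vertex, possibly with repetitions,
together with the effect on the indices of moving to a neighbouring vertex. -/
structure LineIndex (W : List (FreeGroup (Fin n))) (I : Type) where
  ln : I → Set (FreeGroup (Fin n))
  sh : Letter n → I → I
  mem : ∀ i, ln i ∈ linesAt W
  surj : ∀ l ∈ linesAt W, ∃ i, ln i = l
  ln_sh : ∀ z i, z.elt ∈ ln i → ln (sh z i) = translate z.elt⁻¹ (ln i)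

/-- The state of a path in the tree at one of its vertices, translated to the identity vertex: the
previous vertex, the next vertex, and a set of lines through the vertex. -/
@[ext]
structure Config (n : ℕ) (I : Type) where
  back : Letter n
  fwd : Letter n
  col : Set I

instance {I : Type} [Finite I] : Finite (Config n I) :=
  Finite.of_injective (fun c : Config n I => (c.back, c.fwd, c.col)) fun c d h => by
    simp only [Prod.mk.injEq] at h
    exact Config.ext h.1 h.2.1 h.2.2

namespace LineIndex
variable {W : List (FreeGroup (Fin n))} {I : Type} (D : LineIndex W I)

/-- The path does not turn back, and the lines that leave the path at a vertex in the same
direction have the same colour. -/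
def Valid (c : Config n I) : Prop :=
  c.back ≠ c.fwd ∧ ∀ t, t ≠ c.back → t ≠ c.fwd → ∀ i j, t.elt ∈ D.ln i → t.elt ∈ D.ln j →
    (i ∈ c.col ↔ j ∈ c.col)

/-- The state `c'` may follow the state `c`. -/
def Trans (c c' : Config n I) : Prop :=
  D.Valid c' ∧ c'.back = c.fwd.bar ∧
    ∀ i, c.fwd.elt ∈ D.ln i → (i ∈ c.col ↔ D.sh c.fwd i ∈ c'.col)

/-- Some coloured line leaves the path. -/
def Toff (c : Config n I) : Prop :=
  ∃ t, t ≠ c.back ∧ t ≠ c.fwd ∧ ∃ i, t.elt ∈ D.ln i ∧ i ∈ c.col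

/-- Some line that is not coloured leaves the path. -/
def Foff (c : Config n I) : Prop :=
  ∃ t, t ≠ c.back ∧ t ≠ c.fwd ∧ ∃ i, t.elt ∈ D.ln i ∧ i ∉ c.col

/-- There is a closed path of states where lines of both colours leave the path. -/
def HasCycle : Prop :=
  ∃ p q, D.Toff p ∧ D.Foff q ∧ Relation.TransGen D.Trans p q ∧ Relation.TransGen D.Trans q p

/-- The lines through `x` with an end in `A`. -/
def col (A : Set (Boundary n)) (x : FreeGroup (Fin n)) : Set I :=
  {i | ∃ ξ η, Paired W ξ η ∧ geod ξ η = translate x (D.ln i) ∧ ξ ∈ A}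

theorem exists_paired (hW : ∀ w ∈ W, w ≠ 1) (x : FreeGroup (Fin n)) (i : I) :
    ∃ ξ η, Paired W ξ η ∧ geod ξ η = translate x (D.ln i) ∧ x ∈ geod ξ η := by
  obtain ⟨ξ, η, hp, h⟩ := (mem_lines_iff hW).1 (translate_mem_lines hW (D.mem i).1 x)
  refine ⟨ξ, η, hp, h.symm, ?_⟩
  rw [← h, mem_translate, inv_mul_cancel]
  exact (D.mem i).2

theorem exists_index (hW : ∀ w ∈ W, w ≠ 1) {x : FreeGroup (Fin n)} {ξ η : Boundary n}
    (hp : Paired W ξ η) (hx : x ∈ geod ξ η) : ∃ i, geod ξ η = translate x (D.ln i) := by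
  obtain ⟨i, hi⟩ := D.surj (translate x⁻¹ (geod ξ η))
    ⟨translate_mem_lines hW (hp.mem_lines hW) _, by rw [mem_translate]; simpa using hx⟩
  refine ⟨i, ?_⟩
  rw [hi, ← translate_mul, mul_inv_cancel, translate_one]

theorem mem_col (hW : ∀ w ∈ W, w ≠ 1) {A : Set (Boundary n)} {x : FreeGroup (Fin n)} {i : I}
    {ξ η : Boundary n} (hp : Paired W ξ η) (h : geod ξ η = translate x (D.ln i)) :
    i ∈ D.col A x ↔ ξ ∈ A ∨ η ∈ A := by
  constructor
  · rintro ⟨ξ', η', hp', h', hA⟩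
    rcases geod_inj (hp'.ne hW) (h'.trans h.symm) with ⟨rfl, rfl⟩ | ⟨rfl, rfl⟩
    · exact Or.inl hA
    · exact Or.inr hA
  · rintro (hA | hA)
    · exact ⟨ξ, η, hp, h, hA⟩
    · exact ⟨η, ξ, hp.symm, by rw [geod_comm, h], hA⟩

theorem mem_ln_iff {x : FreeGroup (Fin n)} {i : I} {ξ η : Boundary n} {t : Letter n}
    (h : geod ξ η = translate x (D.ln i)) (hx : x ∈ geod ξ η) :
    t.elt ∈ D.ln i ↔ dir x ξ = t ∨ dir x η = t := by
  rw [← mul_elt_mem_geod hx, h, mem_translate, inv_mul_cancel_left]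

section
variable (hW : ∀ w ∈ W, w ≠ 1) {A B : Set (Boundary n)}
  (hr : ∀ ξ η, Paired W ξ η → ξ ∈ A → η ∉ B)
include hW

theorem mem_col_of_subset_left {x : FreeGroup (Fin n)} {t : Letter n}
    (ht : ∀ ζ, dir x ζ = t → ζ ∈ A) {i : I} (hi : t.elt ∈ D.ln i) : i ∈ D.col A x := by
  obtain ⟨ξ, η, hp, h, hx⟩ := D.exists_paired hW x i
  rw [D.mem_ln_iff h hx] at hi
  exact (D.mem_col hW hp h).2 (hi.imp (ht _) (ht _))

include hr

theorem notMem_col_of_subset_right (hAB : Disjoint A B) {x : FreeGroup (Fin n)} {t : Letter n}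
    (ht : ∀ ζ, dir x ζ = t → ζ ∈ B) {i : I} (hi : t.elt ∈ D.ln i) : i ∉ D.col A x := by
  obtain ⟨ξ, η, hp, h, hx⟩ := D.exists_paired hW x i
  rw [D.mem_ln_iff h hx] at hi
  rw [D.mem_col hW hp h]
  rintro (hA | hA) <;> rcases hi with hi | hi
  · exact Set.disjoint_left.1 hAB hA (ht _ hi)
  · exact hr _ _ hp hA (ht _ hi)
  · exact hr _ _ hp.symm hA (ht _ hi)
  · exact Set.disjoint_left.1 hAB hA (ht _ hi)

variable (hT : TwoConn W) (hA : IsOpen A) (hB : IsOpen B) (hAB : Disjoint A B)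
include hT hA hB hAB

/-- By `TwoConn.mono`, all lines that leave the path in one direction have one colour. Across the
edge only the index of a line changes, not the line itself, so its colour is kept. -/
theorem trans_col {x : FreeGroup (Fin n)} {y z z' : Letter n} (hz : z' ≠ z.bar)
    (hs : ∀ ζ, dir (x * z.elt) ζ ≠ z.bar → dir (x * z.elt) ζ ≠ z' → ζ ∈ A ∪ B) :
    D.Trans ⟨y, z, D.col A x⟩ ⟨z.bar, z', D.col A (x * z.elt)⟩ := by
  refine ⟨⟨hz.symm, fun t h1 h2 i j hi hj => ?_⟩, rfl, fun i hi => ?_⟩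
  · rcases hT.mono hA hB hAB hr (x := x * z.elt) (y := t)
      (fun ζ h => hs ζ (h ▸ h1) (h ▸ h2)) with h | h
    · exact iff_of_true (D.mem_col_of_subset_left hW h hi) (D.mem_col_of_subset_left hW h hj)
    · exact iff_of_false (D.notMem_col_of_subset_right hW hr hAB h hi)
        (D.notMem_col_of_subset_right hW hr hAB h hj)
  · change i ∈ D.col A x ↔ D.sh z i ∈ D.col A (x * z.elt)
    rw [col, col, Set.mem_ofPred_eq, Set.mem_ofPred_eq, D.ln_sh z i hi, ← translate_mul,
      mul_inv_cancel_right]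

variable (hn : 2 ≤ n)
include hn

theorem toff_col {x : FreeGroup (Fin n)} {y z : Letter n} {ζ : Boundary n} (hζ : ζ ∈ A)
    (h1 : dir x ζ ≠ y) (h2 : dir x ζ ≠ z) (hs : ∀ ω, dir x ω = dir x ζ → ω ∈ A ∪ B) :
    D.Toff ⟨y, z, D.col A x⟩ := by
  obtain ⟨ξ, η, hp, h3, h4⟩ := hT.exists_crossing hn x (dir x ζ)
  have hx := mem_geod_of_dir h3 h4
  obtain ⟨i, hi⟩ := D.exists_index hW hp hx
  have hi' := (D.mem_ln_iff hi hx).2 (Or.inl h3)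
  refine ⟨_, h1, h2, i, hi', ?_⟩
  rcases hT.mono hA hB hAB hr hs with h | h
  · exact D.mem_col_of_subset_left hW h hi'
  · exact absurd (h ζ rfl) (Set.disjoint_left.1 hAB hζ)

theorem foff_col {x : FreeGroup (Fin n)} {y z : Letter n} {ζ : Boundary n} (hζ : ζ ∈ B)
    (h1 : dir x ζ ≠ y) (h2 : dir x ζ ≠ z) (hs : ∀ ω, dir x ω = dir x ζ → ω ∈ A ∪ B) :
    D.Foff ⟨y, z, D.col A x⟩ := by
  obtain ⟨ξ, η, hp, h3, h4⟩ := hT.exists_crossing hn x (dir x ζ)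
  have hx := mem_geod_of_dir h3 h4
  obtain ⟨i, hi⟩ := D.exists_index hW hp hx
  have hi' := (D.mem_ln_iff hi hx).2 (Or.inl h3)
  refine ⟨_, h1, h2, i, hi', ?_⟩
  rcases hT.mono hA hB hAB hr hs with h | h
  · exact absurd hζ (Set.disjoint_left.1 hAB (h ζ rfl))
  · exact D.notMem_col_of_subset_right hW hr hAB h hi'

omit hW hr hT hA hB hAB hn in
theorem transGen_of_lt {α : Type*} {r : α → α → Prop} {c : ℕ → α} {k₀ : ℕ}
    (h : ∀ k ≥ k₀, r (c k) (c (k + 1))) {k l : ℕ} (hk : k₀ ≤ k) (hkl : k < l) :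
    Relation.TransGen r (c k) (c l) := by
  induction l, hkl using Nat.le_induction with
  | base => exact Relation.TransGen.single (h k hk)
  | succ l hl ih => exact ih.tail (h l (by have := Nat.succ_le_iff.1 hl; omega))

omit hW hr hT hA hB hAB hn in
theorem exists_frequently_eq {α : Type*} [Finite α] {c : ℕ → α} {P : α → Prop}
    (h : ∃ᶠ k in atTop, P (c k)) : ∃ p, P p ∧ ∃ᶠ k in atTop, c k = p := by
  by_contra! hp
  refine h ?_
  have : ∀ᶠ k in atTop, ∀ p, P p → c k ≠ p := by
    rw [eventually_all]
    intro p
    by_cases hP : P p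
    · filter_upwards [hp p hP] with k hk _ using hk
    · exact Eventually.of_forall fun k h => absurd h hP
  filter_upwards [this] with k hk h using hk _ h rfl

/-- If both parts of a separation accumulate at an end, then a state repeats along the ray to it. -/
theorem hasCycle_of_ray [Finite I] {e : Boundary n} {k₀ : ℕ} (heA : e ∉ A) (heB : e ∉ B)
    (hs : ∀ ζ, dir (pre e k₀) ζ = e.1 k₀ → ζ ≠ e → ζ ∈ A ∪ B)
    (h1 : ∀ k, ∃ ζ ∈ A, dir (pre e k) ζ = e.1 k)
    (h2 : ∀ k, ∃ ζ ∈ B, dir (pre e k) ζ = e.1 k) : D.HasCycle := by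
  -- This is the state at vertex number `k + 1` of the ray, since vertex number `0` has no
  -- predecessor.
  let c : ℕ → Config n I := fun k => ⟨(e.1 k).bar, e.1 (k + 1), D.col A (pre e (k + 1))⟩
  have hoff : ∀ k ≥ k₀, ∀ ζ, dir (pre e (k + 1)) ζ ≠ (e.1 k).bar →
      dir (pre e (k + 1)) ζ ≠ e.1 (k + 1) → ζ ∈ A ∪ B := fun k hk ζ h h' => by
    refine hs ζ (dir_pre_le hk (dir_eq_of_mul_elt (by rwa [pre_succ] at h))) ?_
    rintro rfl
    exact h' (dir_pre _ _)
  have hc : ∀ k ≥ k₀, D.Trans (c k) (c (k + 1)) := fun k hk => by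
    have := D.trans_col hW hr hT hA hB hAB (x := pre e (k + 1)) (y := (e.1 k).bar)
      (z := e.1 (k + 1)) (z' := e.1 (k + 2)) (e.2 _) fun ζ h h' => by
        rw [← pre_succ] at h h'
        exact hoff (k + 1) (by omega) ζ h h'
    rwa [← pre_succ] at this
  -- Ends of `S` in small shadows around `e` stay with the ray for long, but they have to leave it
  -- because `e` is not in `S`.
  have hex : ∀ S : Set (Boundary n), e ∉ S → (∀ k, ∃ ζ ∈ S, dir (pre e k) ζ = e.1 k) →
      ∀ K, ∃ k ≥ K, k₀ ≤ k ∧ ∃ ζ ∈ S, dir (pre e (k + 1)) ζ ≠ (e.1 k).bar ∧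
        dir (pre e (k + 1)) ζ ≠ e.1 (k + 1) := fun S heS h K => by
    obtain ⟨ζ, hζ, hζK⟩ := h (K + k₀)
    obtain ⟨k, hk, hk'⟩ := exists_exit (ξ := e) (ζ := ζ) (fun h => heS (h ▸ hζ))
    have hlt : K + k₀ < k := by
      by_contra! hle
      exact hk (dir_pre_le hle hζK)
    obtain ⟨j, rfl⟩ : ∃ j, k = j + 1 := ⟨k - 1, by omega⟩
    refine ⟨j, by omega, by omega, ζ, hζ, ?_, hk⟩
    rw [pre_succ]
    exact dir_mul_elt_ne (hk' j (by omega))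
  have hoff' : ∀ k ≥ k₀, ∀ ζ, dir (pre e (k + 1)) ζ ≠ (e.1 k).bar →
      dir (pre e (k + 1)) ζ ≠ e.1 (k + 1) → ∀ ω, dir (pre e (k + 1)) ω = dir (pre e (k + 1)) ζ →
      ω ∈ A ∪ B := fun k hk ζ h h' ω hω => hoff k hk ω (hω ▸ h) (hω ▸ h')
  obtain ⟨p, hp, hp'⟩ := exists_frequently_eq (c := c) (P := D.Toff) (frequently_atTop.2 fun K => by
    obtain ⟨k, hk, hk0, ζ, hζ, g1, g2⟩ := hex A heA h1 K
    exact ⟨k, hk, D.toff_col hW hr hT hA hB hAB hn hζ g1 g2 (hoff' k hk0 ζ g1 g2)⟩)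
  obtain ⟨q, hq, hq'⟩ := exists_frequently_eq (c := c) (P := D.Foff) (frequently_atTop.2 fun K => by
    obtain ⟨k, hk, hk0, ζ, hζ, g1, g2⟩ := hex B heB h2 K
    exact ⟨k, hk, D.foff_col hW hr hT hA hB hAB hn hζ g1 g2 (hoff' k hk0 ζ g1 g2)⟩)
  -- Both states recur infinitely often, so they can be met in the order `p`, `q`, `p`.
  obtain ⟨k, hk, rfl⟩ := frequently_atTop.1 hp' k₀
  obtain ⟨l, hl, rfl⟩ := frequently_atTop.1 hq' (k + 1)
  obtain ⟨m, hm, hm'⟩ := frequently_atTop.1 hp' (l + 1)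
  exact ⟨_, _, hp, hq, transGen_of_lt hc hk hl, hm' ▸ transGen_of_lt hc (by omega) hm⟩

end

end LineIndex

/-! ### Cut points and cut pairs give closed paths -/

theorem dirv_eq_of_mem_geod {a b : Boundary n} {x v : FreeGroup (Fin n)} (hx : x ∈ geod a b)
    (hv : v ∈ geod a b) (h : dirv v x = some (dir v a)) : dirv x v = some (dir x b) := by
  rcases hz : dirv x v with _ | z
  · rw [dirv_eq_none] at hz
    subst hz
    rw [dirv_self] at h
    simp at h
  · rcases dirv_of_mem_geod hv hz with rfl | rfl
    · have h1 := (isTarget_dir b).eq (isTarget_dirv x) hz (by simpa using Ne.symm hx)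
        (by rw [dirv_self]; simp)
      rw [h] at h1
      exact absurd (Option.some_inj.1 h1).symm hv
    · rfl

/-- A vertex that is far towards the end `a` looks in the same direction towards everything that
is not. -/
theorem dir_eq_of_agree {a ζ ω : Boundary n} {k : ℕ} {v : FreeGroup (Fin n)}
    (hv : Agree a (k + 1) v) (hζ : dir (pre a k) ζ ≠ a.1 k) (hω : dir (pre a k) ω ≠ a.1 k) :
    dir v ζ = dir v ω :=
  dir_eq_dir (agree_iff_dirv.1 hv) hζ hω

theorem dirv_eq_of_agree {a ζ : Boundary n} {k : ℕ} {v x : FreeGroup (Fin n)}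
    (hv : Agree a (k + 1) v) (hζ : dir (pre a k) ζ ≠ a.1 k) (hx : ¬ Agree a (k + 1) x) :
    dirv v x = some (dir v ζ) :=
  ((isTarget_dir ζ).eq (isTarget_dirv x) (agree_iff_dirv.1 hv) (by simpa using hζ)
    fun h => hx (agree_iff_dirv.2 h)).symm

theorem exists_eq_mul_pre {a b : Boundary n} {x v : FreeGroup (Fin n)} (hx : x ∈ geod a b)
    (hv : v ∈ geod a b) (h : dirv x v = some (dir x b)) :
    ∃ k, v = x * pre (act x⁻¹ b) (k + 1) := by
  have h1 : (1 : FreeGroup (Fin n)) ∈ geod (act x⁻¹ b) (act x⁻¹ a) := by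
    rw [geod_comm, ← translate_geod, mem_translate]; simpa using hx
  have h2 : x⁻¹ * v ∈ geod (act x⁻¹ b) (act x⁻¹ a) := by
    rw [geod_comm, ← translate_geod, mem_translate]; simpa using hv
  have := eq_pre_of_mem_geod h1 h2 fun z hz => by
    rw [dirv] at h; rw [h] at hz
    exact (Option.some_inj.1 hz).symm
  have h0 : (x⁻¹ * v).norm ≠ 0 := fun h0 => by
    rw [FreeGroup.norm_eq_zero, inv_mul_eq_one] at h0
    rw [h0, dirv_self] at h
    simp at h
  obtain ⟨k, hk⟩ := Nat.exists_eq_succ_of_ne_zero h0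
  refine ⟨k, ?_⟩
  rw [hk] at this
  rw [← this, mul_inv_cancel_left]

theorem mul_pre_mem_geod {a b : Boundary n} {x : FreeGroup (Fin n)} (hx : x ∈ geod a b) (k : ℕ) :
    x * pre (act x⁻¹ b) k ∈ geod a b ∧
      x * pre (act x⁻¹ b) (k + 1) =
        x * pre (act x⁻¹ b) k * (dir (x * pre (act x⁻¹ b) k) b).elt := by
  have key : x * pre (act x⁻¹ b) (k + 1) =
        x * pre (act x⁻¹ b) k * (dir (x * pre (act x⁻¹ b) k) b).elt := by
    rw [pre_succ, dir_mul, dir_pre, mul_assoc]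
  refine ⟨?_, key⟩
  clear key
  induction k with
  | zero => simpa using hx
  | succ k ih =>
    have : x * pre (act x⁻¹ b) (k + 1) =
        x * pre (act x⁻¹ b) k * (dir (x * pre (act x⁻¹ b) k) b).elt := by
      rw [pre_succ, dir_mul, dir_pre, mul_assoc]
    rw [this, mul_elt_mem_geod ih]
    exact Or.inr rfl

/-! ### States near the ends of a line of the pattern -/

namespace LineIndex
variable {W : List (FreeGroup (Fin n))} {I : Type} (D : LineIndex W I)

/-- The state at `v` of the path from `a` to `b`, with the lines that have an end in `A`
coloured. -/
def conf (A : Set (Boundary n)) (a b : Boundary n) (v : FreeGroup (Fin n)) : Config n I :=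
  ⟨dir v a, dir v b, D.col A v⟩

/-- The state at `v` of the path from `a` to `b`, with all lines coloured but the one with ends
`a` and `b`. -/
def lineConf (a b : Boundary n) (v : FreeGroup (Fin n)) : Config n I :=
  ⟨dir v a, dir v b, {i | translate v (D.ln i) ≠ geod a b}⟩

theorem lineConf_mul {a b : Boundary n} {h : FreeGroup (Fin n)} (ha : act h a = a)
    (hb : act h b = b) (v : FreeGroup (Fin n)) : D.lineConf a b (h * v) = D.lineConf a b v := by
  have e : geod a b = translate h (geod a b) := by rw [translate_geod, ha, hb]
  refine Config.ext ?_ ?_ ?_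
  · change dir (h * v) a = dir v a
    rw [dir_mul, act_inv_of_act ha]
  · change dir (h * v) b = dir v b
    rw [dir_mul, act_inv_of_act hb]
  · ext i
    change translate (h * v) (D.ln i) ≠ geod a b ↔ translate v (D.ln i) ≠ geod a b
    rw [e, translate_mul, (translate_injective h).ne_iff, ← e]

section
variable (hW : ∀ w ∈ W, w ≠ 1) (hT : TwoConn W)
include hW

/-- A line through a vertex far towards `a` has an end in a shadow at `a`, and this shadow lies in
`P` and omits `b`. The line is therefore coloured unless that end is `a`, when its other end is
`a'`, outside `P`. So the colours there depend only on the line from `a` to `a'`. -/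
theorem col_eq_of_agree {P : Set (Boundary n)} {a a' b : Boundary n} {k : ℕ}
    (hp : Paired W a a') (ha' : a' ∉ P) (hk : ∀ ζ, dir (pre a k) ζ = a.1 k → ζ ∈ P)
    (hb : dir (pre a k) b ≠ a.1 k) {v : FreeGroup (Fin n)} (hv : Agree a (k + 1) v) :
    D.col (P \ {a, b}) v = {i | translate v (D.ln i) ≠ geod a a'} := by
  have hka : dir (pre a k) a' ≠ a.1 k := fun h => ha' (hk _ h)
  have key : ∀ (i : I) (ξ η : Boundary n), Paired W ξ η → geod ξ η = translate v (D.ln i) →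
      dir (pre a k) ξ = a.1 k →
      (i ∈ D.col (P \ {a, b}) v ↔ translate v (D.ln i) ≠ geod a a') := by
    intro i ξ η hp' h hξ
    rw [D.mem_col hW hp' h, ← h]
    by_cases hξa : ξ = a
    · subst hξa
      obtain rfl := hp.unique hW hp'
      simp [ha']
    · refine iff_of_true (Or.inl ⟨hk _ hξ, ?_⟩) fun hg => ?_
      · rintro (h | h)
        · exact hξa h
        · rw [Set.mem_singleton_iff] at h
          exact hb (h ▸ hξ)
      · rcases geod_inj (hp'.ne hW) hg with ⟨h, -⟩ | ⟨h, -⟩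
        · exact hξa h
        · exact hka (h ▸ hξ)
  ext i
  obtain ⟨ξ, η, hp', h, hx⟩ := D.exists_paired hW v i
  by_cases hξ : dir (pre a k) ξ = a.1 k
  · exact key i ξ η hp' h hξ
  · by_cases hη : dir (pre a k) η = a.1 k
    · exact key i η ξ hp'.symm (by rw [geod_comm, h]) hη
    · exact absurd (dir_eq_of_agree hv hξ hη) hx

theorem toff_lineConf (hT : TwoConn W) (hn : 2 ≤ n) {a b : Boundary n} {v : FreeGroup (Fin n)}
    (hv : v ∈ geod a b) : D.Toff (D.lineConf a b v) := by
  obtain ⟨t, h1, h2⟩ := exists_letter_ne hn (dir v a) (dir v b)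
  obtain ⟨ξ, η, hp, h3, h4⟩ := hT.exists_crossing hn v t
  have hx := mem_geod_of_dir h3 h4
  obtain ⟨i, hi⟩ := D.exists_index hW hp hx
  have hi' := (D.mem_ln_iff hi hx).2 (Or.inl h3)
  refine ⟨t, h1, h2, i, hi', fun h => ?_⟩
  rw [D.mem_ln_iff h.symm hv] at hi'
  exact hi'.elim h1.symm h2.symm

include hT

theorem transGen_conf {A B : Set (Boundary n)} (hr : ∀ ξ η, Paired W ξ η → ξ ∈ A → η ∉ B)
    (hA : IsOpen A) (hB : IsOpen B) (hAB : Disjoint A B) {a b : Boundary n}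
    (hu : ∀ ζ, ζ ≠ a → ζ ≠ b → ζ ∈ A ∪ B) {x v : FreeGroup (Fin n)} (hx : x ∈ geod a b)
    (hv : v ∈ geod a b) (h : dirv x v = some (dir x b)) :
    Relation.TransGen D.Trans (D.conf A a b x) (D.conf A a b v) := by
  obtain ⟨k, rfl⟩ := exists_eq_mul_pre hx hv h
  have := transGen_of_lt (r := D.Trans) (c := fun k => D.conf A a b (x * pre (act x⁻¹ b) k))
    (k₀ := 0) (fun k _ => ?_) le_rfl (Nat.succ_pos k)
  · simpa using this
  · obtain ⟨h1, h2⟩ := mul_pre_mem_geod hx k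
    obtain ⟨h3, -⟩ := mul_pre_mem_geod hx (k + 1)
    have h4 : dir (x * pre (act x⁻¹ b) (k + 1)) a = (dir (x * pre (act x⁻¹ b) k) b).bar := by
      rw [h2, dir_mul_elt]; exact h1
    simp only [conf]
    rw [h4, h2]
    refine D.trans_col hW hr hT hA hB hAB ?_ fun ζ h h' => hu ζ ?_ ?_
    · rw [← h2, ← h4]; exact h3.symm
    · rintro rfl; exact h (by rw [← h2, h4])
    · rintro rfl; exact h' rfl

/-- Half of the closed path for two lines whose ends are separated by colour. -/
theorem exists_transGen_lineConf (hn : 2 ≤ n) {P Q : Set (Boundary n)} (hP : IsOpen P)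
    (hQ : IsOpen Q) (hPQ : Disjoint P Q) (hu : P ∪ Q = Set.univ) {a a' b b' : Boundary n}
    (hr : ∀ ξ η, Paired W ξ η → ξ ∈ P → η ∈ Q → ξ = a ∨ ξ = b) (hab : a ≠ b)
    (ha : a ∈ P) (ha' : a' ∈ Q) (hb : b ∈ P) (hb' : b' ∈ Q)
    (hpa : Paired W a a') (hpb : Paired W b b') :
    ∃ k, ∀ v ∈ geod a a', Agree a (k + 1) v → ∀ u ∈ geod b b', Agree b (k + 1) u →
      ∃ q, D.Foff q ∧ Relation.TransGen D.Trans (D.lineConf a a' v) q ∧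
        Relation.TransGen D.Trans q (D.lineConf b' b u) := by
  have haa : a' ≠ a := fun h => Set.disjoint_left.1 hPQ ha (h ▸ ha')
  have hba : a' ≠ b := fun h => Set.disjoint_left.1 hPQ hb (h ▸ ha')
  have hA : IsOpen (P \ {a, b}) := hP.sdiff (Set.toFinite _).isClosed
  have hAB : Disjoint (P \ {a, b}) Q := hPQ.mono_left Set.sdiff_subset
  have hr' : ∀ ξ η, Paired W ξ η → ξ ∈ P \ {a, b} → η ∉ Q := fun ξ η hp hξ hη =>
    hξ.2 (hr ξ η hp hξ.1 hη)
  have hu' : ∀ ζ, ζ ≠ a → ζ ≠ b → ζ ∈ P \ {a, b} ∪ Q := fun ζ h h' => by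
    rcases (hu ▸ Set.mem_univ ζ : ζ ∈ P ∪ Q) with hζ | hζ
    · exact Or.inl ⟨hζ, by simp [h, h']⟩
    · exact Or.inr hζ
  -- At the projection of `a'` to the path from `a` to `b`, a line without colour leaves the path
  -- towards `a'`.
  obtain ⟨x₀, hx₀, h1, h2⟩ := exists_proj hab haa hba
  obtain ⟨k₁, hk₁⟩ := exists_shadow_subset hP ha
  obtain ⟨k₂, hk₂⟩ := exists_shadow_subset hP hb
  obtain ⟨k₃, hk₃⟩ := exists_dir_pre_ne hab
  obtain ⟨k₄, hk₄⟩ := exists_dir_pre_ne hab.symm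
  obtain ⟨k, g1, g2, g3, g4, g5⟩ : ∃ k, k₁ ≤ k ∧ k₂ ≤ k ∧ k₃ ≤ k ∧ k₄ ≤ k ∧ x₀.norm < k + 1 :=
    ⟨k₁ + k₂ + k₃ + k₄ + x₀.norm, by omega, by omega, by omega, by omega, by omega⟩
  have hx₀' : ∀ ζ : Boundary n, ¬ Agree ζ (k + 1) x₀ := fun ζ h => by
    have := h x₀.norm g5
    rw [FreeGroup.norm, List.getElem?_eq_none le_rfl] at this
    simp at this
  refine ⟨k, fun v hv hva u hu hub => ?_⟩
  have ka := hk₁ k g1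
  have kb := hk₂ k g2
  have kab := hk₃ k g3
  have kba := hk₄ k g4
  have ha'P : a' ∉ P := fun h => Set.disjoint_left.1 hPQ h ha'
  have hb'P : b' ∉ P := fun h => Set.disjoint_left.1 hPQ h hb'
  -- Near `a` the path to `b` runs along the line to `a'`, so its state is the state of this line.
  -- Likewise the path arrives at `b` along the line from `b'`.
  have e1 : dir v a' = dir v b := dir_eq_of_agree hva (fun h => ha'P (ka _ h)) kab
  have e2 : dir u b' = dir u a := dir_eq_of_agree hub (fun h => hb'P (kb _ h)) kba
  have hv' : v ∈ geod a b := by rw [mem_geod, ← e1]; exact hv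
  have hu'' : u ∈ geod a b := by rw [mem_geod, ← e2]; exact hu.symm
  have c1 : D.conf (P \ {a, b}) a b v = D.lineConf a a' v :=
    Config.ext rfl e1.symm (D.col_eq_of_agree hW hpa ha'P ka kab hva)
  have c2 : D.conf (P \ {a, b}) a b u = D.lineConf b' b u := by
    refine Config.ext e2.symm rfl ?_
    have := D.col_eq_of_agree hW hpb hb'P kb kba hub
    rw [Set.pair_comm, geod_comm] at this
    exact this
  have t1 := D.transGen_conf hW hT hr' hA hQ hAB hu' hv' hx₀
    (dirv_eq_of_agree hva kab (hx₀' a))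
  have t2 := D.transGen_conf hW hT hr' hA hQ hAB hu' hx₀ hu''
    (dirv_eq_of_mem_geod hx₀ hu'' (dirv_eq_of_agree hub kba (hx₀' b)))
  rw [c1] at t1
  rw [c2] at t2
  refine ⟨_, D.foff_col hW hr' hT hA hQ hAB hn ha' h1 h2 fun ω hω => hu' ω ?_ ?_, t1, t2⟩
  · rintro rfl; exact h1 hω.symm
  · rintro rfl; exact h2 hω.symm

omit hT in
-- An element that translates along the line preserves its states and moves `v` as far towards `a'`
-- as desired.
theorem exists_shift {a a' : Boundary n} (hp : Paired W a a') {v : FreeGroup (Fin n)}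
    (hv : v ∈ geod a a') (k : ℕ) :
    ∃ v' ∈ geod a a', Agree a' k v' ∧ D.lineConf a a' v' = D.lineConf a a' v := by
  obtain ⟨h, h1, ha, ha', -⟩ := hp.exists_attr hW
  obtain ⟨m, hm⟩ := (ha'.mul_right v k).exists
  have e1 : act (h⁻¹ ^ m) a = a := by
    have := act_zpow_of_act (act_inv_of_act ha.act_self) m
    simpa using this
  have e2 : act (h⁻¹ ^ m) a' = a' := by
    have := act_zpow_of_act ha'.act_self m
    simpa using this
  refine ⟨_, ?_, hm, D.lineConf_mul e1 e2 v⟩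
  rw [mem_geod]
  have : geod a a' = translate (h⁻¹ ^ m) (geod a a') := by rw [translate_geod, e1, e2]
  rw [← mem_geod, this, mem_translate, inv_mul_cancel_left]
  exact hv

/-- One half of the closed path goes from `a` to `b` with the ends in `P` coloured, the other from
`b'` to `a'` with those in `Q`. They fit together: near both ends of a line the coloured lines are
all but this one, whether `P` or `Q` is used, and `exists_shift` identifies the states at its two
ends. -/
theorem hasCycle_of_two_lines (hn : 2 ≤ n) {P Q : Set (Boundary n)} (hP : IsOpen P)
    (hQ : IsOpen Q) (hPQ : Disjoint P Q) (hu : P ∪ Q = Set.univ) {a a' b b' : Boundary n}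
    (hr : ∀ ξ η, Paired W ξ η → ξ ∈ P → η ∈ Q → ξ = a ∨ ξ = b) (hab : a ≠ b)
    (ha : a ∈ P) (ha' : a' ∈ Q) (hb : b ∈ P) (hb' : b' ∈ Q)
    (hpa : Paired W a a') (hpb : Paired W b b') : D.HasCycle := by
  obtain ⟨k, hk⟩ := D.exists_transGen_lineConf hW hT hn hP hQ hPQ hu hr hab ha ha' hb hb' hpa hpb
  have hr' : ∀ ξ η, Paired W ξ η → ξ ∈ Q → η ∈ P → ξ = b' ∨ ξ = a' := fun ξ η hp hξ hη => by
    rcases hr η ξ hp.symm hη hξ with rfl | rfl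
    · exact Or.inr (hp.symm.unique hW hpa)
    · exact Or.inl (hp.symm.unique hW hpb)
  have hab' : b' ≠ a' := by
    rintro rfl
    exact hab (hpa.symm.unique hW hpb.symm)
  obtain ⟨l, hl⟩ := D.exists_transGen_lineConf hW hT hn hQ hP hPQ.symm
    (by rwa [Set.union_comm]) hr' hab' hb' hb ha' ha hpb.symm hpa.symm
  obtain ⟨j, hj⟩ := exists_pre_mem_geod (hpa.ne hW)
  obtain ⟨j', hj'⟩ := exists_pre_mem_geod (hpb.ne hW)
  set v := pre a (j + (k + 1))
  set u := pre b (j' + (k + 1))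
  have hv : v ∈ geod a a' := hj _ (by omega)
  have huu : u ∈ geod b b' := hj' _ (by omega)
  obtain ⟨v', hv', hva', ev⟩ := D.exists_shift hW hpa hv (l + 1)
  obtain ⟨u', hu', hub', eu⟩ := D.exists_shift hW hpb huu (l + 1)
  obtain ⟨q, hq, t1, t2⟩ := hk v hv ((agree_pre a _).mono (by omega)) u huu
    ((agree_pre b _).mono (by omega))
  obtain ⟨q', -, t3, t4⟩ := hl u' (by rwa [geod_comm]) hub' v' (by rwa [geod_comm]) hva'
  have eu' : D.lineConf b' b u' = D.lineConf b' b u := by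
    simp only [lineConf, Config.mk.injEq] at eu ⊢
    exact ⟨eu.2.1, eu.1, by rw [geod_comm]; exact eu.2.2⟩
  refine ⟨_, q, D.toff_lineConf hW hT hn hv, hq, t1, ?_⟩
  rw [← ev]
  rw [eu'] at t3
  exact (t2.trans t3).trans t4

end

end LineIndex

section
variable {W : List (FreeGroup (Fin n))} (hW : ∀ w ∈ W, w ≠ 1)
include hW

theorem mem_fiber_of_paired {ξ ζ ω : Boundary n} (h : ζ ∈ fiber W ξ) (hp : Paired W ζ ω) :
    ω ∈ fiber W ξ := by
  rw [← mk_eq_mk_iff hW] at h ⊢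
  rw [← h, mk_eq_mk_iff hW]
  exact Or.inr hp

theorem fiber_eq_of_mem {ξ ζ : Boundary n} (h : ζ ∈ fiber W ξ) : fiber W ξ = fiber W ζ := by
  ext ω
  rw [← mk_eq_mk_iff hW] at h ⊢
  rw [← mk_eq_mk_iff hW, h]

end

theorem isOpen_union_of_tails {A : Set (Boundary n)} (hA : IsOpen A) {S : Set (Boundary n)}
    (h : ∀ e ∈ S, ∃ k, ∀ ζ, dir (pre e k) ζ = e.1 k → ζ ≠ e → ζ ∈ A) : IsOpen (A ∪ S) := by
  refine isOpen_of_shadows fun ξ hξ => ?_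
  by_cases hξA : ξ ∈ A
  · obtain ⟨k, hk⟩ := exists_shadow_subset hA hξA
    exact ⟨pre ξ k, fun ζ hζ => Or.inl (hk k le_rfl ζ (by rwa [dir_pre] at hζ))⟩
  · obtain ⟨k, hk⟩ := h ξ (hξ.resolve_left hξA)
    refine ⟨pre ξ k, fun ζ hζ => ?_⟩
    by_cases hne : ζ = ξ
    · rw [hne]; exact hξ
    · exact Or.inl (hk ζ (by rwa [dir_pre] at hζ) hne)

theorem exists_shadow_inter_finite {E : Set (Boundary n)} (hE : E.Finite) (e : Boundary n) :
    ∃ k₀, ∀ k ≥ k₀, ∀ ζ, dir (pre e k) ζ = e.1 k → ζ ≠ e → ζ ∉ E := by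
  obtain ⟨k, hk⟩ := exists_shadow_subset (A := (E \ {e})ᶜ) (hE.sdiff.isClosed.isOpen_compl)
    (ξ := e) (by simp)
  refine ⟨k, fun l hl ζ hζ hne hζE => ?_⟩
  exact hk l hl ζ hζ ⟨hζE, hne⟩

/-- A colouring of the boundary that extends a separation off `E`, where `E` is closed under taking
partners, separates off a subset `F` if all pairs with different colours meet `F`. -/
theorem IsSeparation.separable_of_extension {W : List (FreeGroup (Fin n))}
    {E A B P Q F : Set (Boundary n)} (h : IsSeparation W E A B)
    (hE : ∀ ζ ω, ζ ∈ E → Paired W ζ ω → ω ∈ E) (hP : IsOpen P) (hQ : IsOpen Q)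
    (hPQ : Disjoint P Q) (hu : P ∪ Q = Set.univ) (hPA : P \ E = A) (hQB : Q \ E = B)
    (hF : F.Finite) (hFE : F ⊆ E)
    (hpair : ∀ ξ η, Paired W ξ η → ξ ∈ E → ξ ∈ P → η ∈ Q → ξ ∈ F ∨ η ∈ F) : Separable W F := by
  refine ⟨P \ F, Q \ F, hP.sdiff hF.isClosed, hQ.sdiff hF.isClosed, ?_, ?_,
    hPQ.mono Set.sdiff_subset Set.sdiff_subset, ?_, fun ξ η hp hξ hη => ?_⟩
  · exact h.nonempty_left.mono (hPA ▸ Set.sdiff_subset_sdiff_right hFE)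
  · exact h.nonempty_right.mono (hQB ▸ Set.sdiff_subset_sdiff_right hFE)
  · rw [← Set.union_sdiff_distrib, hu, Set.compl_eq_univ_sdiff]
  · by_cases hξE : ξ ∈ E
    · exact (hpair ξ η hp hξE hξ.1 hη.1).elim hξ.2 hη.2
    · refine h.resp ξ η hp (hPA ▸ ⟨hξ.1, hξE⟩) (hQB ▸ ⟨hη.1, fun hηE => ?_⟩)
      exact hξE (hE η ξ hηE hp.symm)

/-! ### Extending a separation over the removed ends -/

namespace LineIndex
variable {W : List (FreeGroup (Fin n))} {I : Type} [Finite I] (D : LineIndex W I)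
  (hW : ∀ w ∈ W, w ≠ 1) (hT : TwoConn W) (hn : 2 ≤ n)
include hW hT hn

/-- If both colours accumulated at an end of `E`, then `hasCycle_of_ray` would give a closed path.
So near each end of `E` only one colour occurs, and the end receives this colour. -/
theorem exists_extension (hD : ¬ D.HasCycle) {E A B : Set (Boundary n)} (hE : E.Finite)
    (h : IsSeparation W E A B) : ∃ P Q, IsOpen P ∧ IsOpen Q ∧ Disjoint P Q ∧
      P ∪ Q = Set.univ ∧ P \ E = A ∧ Q \ E = B := by
  have huE : ∀ ζ, ζ ∈ A ∪ B ↔ ζ ∉ E := fun ζ => by rw [h.union]; rfl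
  have hAE : ∀ ζ ∈ A, ζ ∉ E := fun ζ hζ => (huE ζ).1 (Or.inl hζ)
  have hBE : ∀ ζ ∈ B, ζ ∉ E := fun ζ hζ => (huE ζ).1 (Or.inr hζ)
  let tail : Set (Boundary n) → Boundary n → Prop := fun A e =>
    ∃ k, ∀ ζ, dir (pre e k) ζ = e.1 k → ζ ≠ e → ζ ∈ A
  have htail : ∀ e ∈ E, tail A e ∨ tail B e := fun e he => by
    obtain ⟨k₀, hk₀⟩ := exists_shadow_inter_finite hE e
    by_contra! hcon
    refine hD (D.hasCycle_of_ray hW h.resp hT h.isOpen_left h.isOpen_right h.disjoint hn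
      (fun h => hAE e h he) (fun h => hBE e h he) (k₀ := k₀)
      (fun ζ h1 h2 => (huE ζ).2 (hk₀ k₀ le_rfl ζ h1 h2)) (fun k => ?_) fun k => ?_)
    · by_contra! hk
      refine hcon.2 ⟨k + k₀, fun ζ h1 h2 => ?_⟩
      exact ((huE ζ).2 (hk₀ _ (by omega) ζ h1 h2)).resolve_left fun h =>
        hk ζ h (dir_pre_le (by omega) h1)
    · by_contra! hk
      refine hcon.1 ⟨k + k₀, fun ζ h1 h2 => ?_⟩
      exact ((huE ζ).2 (hk₀ _ (by omega) ζ h1 h2)).resolve_right fun h =>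
        hk ζ h (dir_pre_le (by omega) h1)
  refine ⟨A ∪ {e | e ∈ E ∧ tail A e}, B ∪ {e | e ∈ E ∧ ¬ tail A e},
    isOpen_union_of_tails h.isOpen_left fun e he => he.2,
    isOpen_union_of_tails h.isOpen_right fun e he => (htail e he.1).resolve_left he.2,
    ?_, ?_, ?_, ?_⟩
  · rw [Set.disjoint_left]
    rintro ζ (h1 | h1) (h2 | h2)
    · exact Set.disjoint_left.1 h.disjoint h1 h2
    · exact hAE ζ h1 h2.1
    · exact hBE ζ h2 h1.1
    · exact h2.2 h1.2
  · refine Set.eq_univ_of_forall fun ζ => ?_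
    by_cases hζ : ζ ∈ E
    · by_cases ht : tail A ζ
      · exact Or.inl (Or.inr ⟨hζ, ht⟩)
      · exact Or.inr (Or.inr ⟨hζ, ht⟩)
    · exact ((huE ζ).2 hζ).imp Or.inl Or.inl
  · ext ζ
    constructor
    · rintro ⟨h1 | h1, h2⟩
      · exact h1
      · exact absurd h1.1 h2
    · exact fun h => ⟨Or.inl h, hAE ζ h⟩
  · ext ζ
    constructor
    · rintro ⟨h1 | h1, h2⟩
      · exact h1
      · exact absurd h1.1 h2
    · exact fun h => ⟨Or.inl h, hBE ζ h⟩

omit [Finite I] hW hn in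
theorem _root_.LinePattern.TwoConn.not_separable_singleton (ξ : Boundary n) :
    ¬ Separable W {ξ} := by
  rintro ⟨A, B, h⟩
  rcases hT.eq_empty_of_compl_singleton h.isOpen_left h.isOpen_right h.disjoint h.resp h.union
    with h' | h'
  · exact h.nonempty_left.ne_empty h'
  · exact h.nonempty_right.ne_empty h'

/-- Without a closed path the colouring would extend over both ends of the line. All other lines
respect it, so the removal of `η` alone would leave a separation, but a single end never separates.
-/
theorem hasCycle_of_cut_point {ξ : Boundary n} (h : Separable W (fiber W ξ)) : D.HasCycle := by
  by_cases hp : ∃ η, Paired W ξ η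
  · obtain ⟨η, hp⟩ := hp
    obtain ⟨A, B, h⟩ := h
    by_contra hD
    obtain ⟨P, Q, hP, hQ, hPQ, hu, hPA, hQB⟩ :=
      D.exists_extension hW hT hn hD (finite_fiber hW ξ) h
    refine hT.not_separable_singleton η (h.separable_of_extension
      (fun ζ ω h1 h2 => mem_fiber_of_paired hW h1 h2) hP hQ hPQ hu hPA hQB
      (Set.finite_singleton η) ?_ fun ζ ω h1 h2 _ _ => ?_)
    · rintro _ rfl; exact Or.inr hp
    · rcases h2 with rfl | h2
      · exact Or.inr (h1.unique hW hp)
      · exact Or.inl (h2.unique hW hp)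
  · push Not at hp
    rw [fiber_of_not_paired hp] at h
    exact absurd h (hT.not_separable_singleton ξ)

/-- Without a closed path the colouring extends, and the question is how many of the at most two
removed lines have ends of different colours. None contradicts connectedness, one gives a cut point,
and two lead to `hasCycle_of_two_lines`. -/
theorem hasCycle_of_cut_pair {ξ η : Boundary n} (h : Separable W (fiber W ξ ∪ fiber W η)) :
    D.HasCycle := by
  obtain ⟨A, B, h⟩ := h
  by_contra hD
  set E := fiber W ξ ∪ fiber W η with hEdef
  have hE : ∀ ζ ω, ζ ∈ E → Paired W ζ ω → ω ∈ E := fun ζ ω h1 h2 =>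
    h1.imp (fun h => mem_fiber_of_paired hW h h2) fun h => mem_fiber_of_paired hW h h2
  obtain ⟨P, Q, hP, hQ, hPQ, hu, hPA, hQB⟩ :=
    D.exists_extension hW hT hn hD ((finite_fiber hW ξ).union (finite_fiber hW η)) h
  have hsep := fun {F : Set (Boundary n)} => h.separable_of_extension (F := F) hE hP hQ hPQ hu
    hPA hQB
  obtain ⟨a, a', hpa, haE, ha, ha'⟩ : ∃ a a', Paired W a a' ∧ a ∈ E ∧ a ∈ P ∧ a' ∈ Q := by
    by_contra! hcon
    exact hT.not_separable_empty hn (hsep Set.finite_empty (Set.empty_subset _)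
      fun ζ ω h1 h2 h3 h4 => absurd h4 (hcon ζ ω h1 h2 h3))
  -- Were the line from `a` to `a'` the only one with two colours, its fibre alone would separate.
  obtain ⟨b, b', hpb, hbE, hb, hb', hab⟩ :
      ∃ b b', Paired W b b' ∧ b ∈ E ∧ b ∈ P ∧ b' ∈ Q ∧ a ≠ b := by
    by_contra! hcon
    refine hD (D.hasCycle_of_cut_point hW hT hn (ξ := a) (hsep (finite_fiber hW a) ?_
      fun ζ ω h1 h2 h3 h4 => Or.inl (Or.inl (hcon ζ ω h1 h2 h3 h4).symm)))
    rintro ζ (rfl | hζ)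
    · exact haE
    · exact hE _ _ haE hζ
  refine hD (D.hasCycle_of_two_lines hW hT hn hP hQ hPQ hu (fun ζ ω hp hζ hω => ?_) hab ha ha'
    hb hb' hpa hpb)
  have hζE : ζ ∈ E := by
    by_contra hζE
    refine h.resp ζ ω hp (hPA ▸ ⟨hζ, hζE⟩) (hQB ▸ ⟨hω, fun hωE => ?_⟩)
    exact hζE (hE _ _ hωE hp.symm)
  have key : ∀ {c c' : Boundary n}, Paired W c c' → c' ∈ Q → ζ ∈ fiber W c → ζ = c := by
    intro c c' hc hc' hζc
    rw [fiber_of_paired hW hc] at hζc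
    rcases hζc with h | h
    · exact h
    · exact absurd hc' (Set.disjoint_left.1 hPQ (h ▸ hζ))
  have key' : ∀ ω, a ∈ fiber W ω → b ∉ fiber W ω := by
    intro ω h1 h2
    rw [fiber_eq_of_mem hW h1, fiber_of_paired hW hpa] at h2
    rcases h2 with h | h
    · exact hab h.symm
    · exact Set.disjoint_left.1 hPQ hb (h ▸ ha')
  rcases haE with haE | haE
  · have hbη := hbE.resolve_left (key' ξ haE)
    rw [fiber_eq_of_mem hW haE, fiber_eq_of_mem hW hbη] at hEdef
    rw [hEdef] at hζE
    exact hζE.imp (key hpa ha') (key hpb hb')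
  · have hbξ := hbE.resolve_right (key' η haE)
    rw [fiber_eq_of_mem hW haE, fiber_eq_of_mem hW hbξ] at hEdef
    rw [hEdef] at hζE
    exact hζE.symm.imp (key hpa ha') (key hpb hb')

end LineIndex

/-! ### Closed paths give periodic separations -/

theorem exists_path_of_transGen {α : Type*} {r : α → α → Prop} {a b : α}
    (h : Relation.TransGen r a b) : ∃ m, 0 < m ∧ ∃ f : ℕ → α, f 0 = a ∧ f m = b ∧
      ∀ i < m, r (f i) (f (i + 1)) := by
  induction h with
  | single h =>
    rename_i b
    refine ⟨1, one_pos, fun i => if i = 0 then a else b, by simp, by simp, fun i hi => ?_⟩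
    obtain rfl : i = 0 := by omega
    simpa using h
  | tail _ h ih =>
    rename_i c d _
    obtain ⟨m, hm, f, h0, h1, hf⟩ := ih
    refine ⟨m + 1, by omega, fun i => if i ≤ m then f i else d, by simpa using h0, by simp,
      fun i hi => ?_⟩
    by_cases him : i = m
    · subst him; simpa [h1] using h
    · have h2 : i ≤ m := by omega
      have h3 : i + 1 ≤ m := by omega
      simpa [h2, h3] using hf i (by omega)

/-- If steps depend on their source only through `e`, then paths need not be longer than the
number of values of `e`. -/
theorem exists_short_path {α β : Type*} {r : α → α → Prop} {e : α → β} {T : Finset β}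
    (hT : ∀ a, e a ∈ T) (he : ∀ a a' c, e a = e a' → r a c → r a' c) {a b : α}
    (h : Relation.TransGen r a b) : ∃ m, 0 < m ∧ m ≤ T.card ∧ ∃ f : ℕ → α, f 0 = a ∧ f m = b ∧
      ∀ i < m, r (f i) (f (i + 1)) := by
  classical
  have hex := exists_path_of_transGen h
  obtain ⟨hm, f, h0, h1, hf⟩ := Nat.find_spec hex
  refine ⟨Nat.find hex, hm, ?_, f, h0, h1, hf⟩
  by_contra! hlt
  obtain ⟨i, hi, j, hj, hne, hij⟩ := Finset.exists_ne_map_eq_of_card_lt_of_maps_to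
    (s := Finset.range (Nat.find hex)) (t := T) (f := fun i => e (f i)) (by simpa using hlt)
    fun i _ => hT _
  rw [Finset.mem_range] at hi hj
  wlog hlt' : i < j generalizing i j
  · exact this j hj i hi hne.symm hij.symm (by omega)
  refine Nat.find_min hex (m := Nat.find hex - (j - i)) (by omega) ⟨by omega,
    fun k => if k ≤ i then f k else f (k + (j - i)), by simpa using h0, ?_, fun k hk => ?_⟩
  · beta_reduce
    rw [if_neg (by omega), Nat.sub_add_cancel (by omega), h1]
  · beta_reduce
    rcases lt_trichotomy k i with hk' | rfl | hk'
    · rw [if_pos hk'.le, if_pos (by omega)]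
      exact hf k (by omega)
    · rw [if_pos le_rfl, if_neg (by omega)]
      -- The loop between the two positions is cut out: the step that leaves the later one may start
      -- from the earlier one.
      refine he (f j) (f k) _ hij.symm ?_
      have := hf j hj
      rwa [show k + 1 + (j - k) = j + 1 by omega]
    · rw [if_neg (by omega), if_neg (by omega), show k + 1 + (j - i) = k + (j - i) + 1 by omega]
      exact hf _ (by omega)

theorem exists_periodic_path {α : Type*} {r : α → α → Prop} {p q : α} {m₁ m₂ : ℕ} (h₁ : 0 < m₁)
    {f₁ f₂ : ℕ → α} (a₁ : f₁ 0 = p) (b₁ : f₁ m₁ = q) (r₁ : ∀ i < m₁, r (f₁ i) (f₁ (i + 1)))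
    (h₂ : 0 < m₂) (a₂ : f₂ 0 = q) (b₂ : f₂ m₂ = p) (r₂ : ∀ i < m₂, r (f₂ i) (f₂ (i + 1))) :
    ∃ c : ℕ → α, c 0 = p ∧ c m₁ = q ∧ (∀ k, c (k + (m₁ + m₂)) = c k) ∧
      ∀ k, r (c k) (c (k + 1)) := by
  let d : ℕ → α := fun k => if k < m₁ then f₁ k else f₂ (k - m₁)
  have hd : ∀ k < m₁ + m₂, r (d k) (d (k + 1)) := fun k hk => by
    rcases lt_trichotomy (k + 1) m₁ with h | h | h
    · simp only [d, if_pos (show k < m₁ by omega), if_pos h]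
      exact r₁ k (by omega)
    · simp only [d, if_pos (show k < m₁ by omega), h, lt_irrefl, if_false, Nat.sub_self, a₂]
      have := r₁ k (by omega)
      rwa [h, b₁] at this
    · simp only [d, if_neg (show ¬ k < m₁ by omega), if_neg (show ¬ k + 1 < m₁ by omega)]
      rw [show k + 1 - m₁ = k - m₁ + 1 by omega]
      exact r₂ _ (by omega)
  have d0 : d 0 = p := by simp only [d, if_pos h₁, a₁]
  have dm : d (m₁ + m₂) = p := by
    simp only [d, if_neg (show ¬ m₁ + m₂ < m₁ by omega), Nat.add_sub_cancel_left, b₂]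
  refine ⟨fun k => d (k % (m₁ + m₂)), by simpa using d0, ?_, fun k => by simp, fun k => ?_⟩
  · simp only [Nat.mod_eq_of_lt (show m₁ < m₁ + m₂ by omega), d, lt_irrefl, if_false,
      Nat.sub_self, a₂]
  · have hlt := Nat.mod_lt k (show 0 < m₁ + m₂ by omega)
    have := hd _ hlt
    by_cases h : k % (m₁ + m₂) + 1 = m₁ + m₂
    · have e : (k + 1) % (m₁ + m₂) = 0 := by
        rw [← Nat.mod_add_mod, h, Nat.mod_self]
      simp only [e, d0]
      rwa [h, dm] at this
    · have e : (k + 1) % (m₁ + m₂) = k % (m₁ + m₂) + 1 := by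
        rw [← Nat.mod_add_mod, Nat.mod_eq_of_lt (by omega)]
      simp only [e]
      exact this

theorem hd_inv_pre_succ (ξ : Boundary n) (k : ℕ) : hd (pre ξ (k + 1))⁻¹ = some (ξ.1 k).bar := by
  have := dirv_mul_elt (x := pre ξ k) (v := 1) (y := ξ.1 k)
  rw [← pre_succ, dirv, mul_one] at this
  refine this.2 fun h => ?_
  have := agree_iff_dirv.2 h 0 (by omega)
  simp at this

theorem cycReduced_pre {ξ : Boundary n} {m : ℕ} (hm : 0 < m) (hξ : ∀ i, ξ.1 (m + i) = ξ.1 i) :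
    CycReduced (pre ξ m) := by
  obtain ⟨k, rfl⟩ : ∃ k, m = k + 1 := ⟨m - 1, by omega⟩
  refine cycReduced_iff.2 (Or.inr ?_)
  rw [hd_inv_pre_succ, Agree.hd (k := k) (agree_pre ξ _)]
  exact fun h => ξ.2 k ((hξ 0).trans (Option.some_inj.1 h))

namespace LineIndex
variable {W : List (FreeGroup (Fin n))} {I : Type} (D : LineIndex W I)

theorem toff_iff_not_foff_at {c : Config n I} (hc : D.Valid c) {t : Letter n} (h1 : t ≠ c.back)
    (h2 : t ≠ c.fwd) {i : I} (hi : t.elt ∈ D.ln i) :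
    (∃ j, t.elt ∈ D.ln j ∧ j ∈ c.col) ↔ i ∈ c.col :=
  ⟨fun ⟨_, hj, hj'⟩ => (hc.2 t h1 h2 _ i hj hi).1 hj', fun h => ⟨i, hi, h⟩⟩

section
variable (hW : ∀ w ∈ W, w ≠ 1)
include hW

/-- A line that leaves a path of states at two places can be followed from one to the other. -/
theorem exists_index_of_le (hT : TwoConn W) (hn : 2 ≤ n) {c : ℕ → Config n I}
    (hc : ∀ k, D.Trans (c k) (c (k + 1))) {a : Boundary n} (ha : ∀ k, a.1 k = (c k).fwd)
    {ζ ω : Boundary n} (hp : Paired W ζ ω) {k l : ℕ} (hkl : k ≤ l)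
    (hζ : dir (pre a k) ζ ≠ (c k).fwd) (hω : dir (pre a l) ω ≠ (c l).back) :
    ∃ i i', (dir (pre a k) ζ).elt ∈ D.ln i ∧ (dir (pre a l) ω).elt ∈ D.ln i' ∧
      (pre a k ∈ geod ζ ω → geod ζ ω = translate (pre a k) (D.ln i)) ∧
      (i ∈ (c k).col ↔ i' ∈ (c l).col) := by
  by_cases hx : pre a k ∈ geod ζ ω
  · obtain ⟨i, hi⟩ := D.exists_index hW hp hx
    have key : ∀ j, k ≤ j → j ≤ l → ∃ i', geod ζ ω = translate (pre a j) (D.ln i') ∧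
        pre a j ∈ geod ζ ω ∧ dir (pre a j) ζ ≠ a.1 j ∧ (i ∈ (c k).col ↔ i' ∈ (c j).col) := by
      intro j hkj
      induction j, hkj using Nat.le_induction with
      | base => exact fun _ => ⟨i, hi, hx, by rwa [ha], Iff.rfl⟩
      | succ j hkj ih =>
        intro hjl
        obtain ⟨i', h1, h2, h3, h4⟩ := ih (by omega)
        have h5 : dir (pre a j) ω = a.1 j := by
          obtain ⟨l, rfl⟩ : ∃ l', l = l' + 1 := ⟨l - 1, by omega⟩
          refine dir_pre_le (show j ≤ l by omega) (dir_eq_of_mul_elt ?_)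
          rw [← pre_succ, ha, ← (hc l).2.1]
          exact hω
        have hz : (a.1 j).elt ∈ D.ln i' := (D.mem_ln_iff h1 h2).2 (Or.inr h5)
        refine ⟨D.sh (a.1 j) i', ?_, ?_, ?_, ?_⟩
        · rw [D.ln_sh _ _ hz, pre_succ, ← translate_mul, mul_inv_cancel_right, h1]
        · rw [pre_succ, mul_elt_mem_geod h2]; exact Or.inr h5
        · rw [dir_pre_succ_eq_bar h3]; exact (a.2 j).symm
        · rw [h4, ha]; exact (hc j).2.2 i' (ha j ▸ hz)
    obtain ⟨i', h1, h2, -, h4⟩ := key l hkl le_rfl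
    exact ⟨i, i', (D.mem_ln_iff hi hx).2 (Or.inl rfl), (D.mem_ln_iff h1 h2).2 (Or.inr rfl),
      fun _ => hi, h4⟩
  · have hx0 := hx
    rw [mem_geod, not_not] at hx
    have hlk : l = k := by
      by_contra hne
      obtain ⟨l, rfl⟩ : ∃ l', l = l' + 1 := ⟨l - 1, by omega⟩
      refine hζ ?_
      rw [hx, ← ha]
      refine dir_pre_le (show k ≤ l by omega) (dir_eq_of_mul_elt ?_)
      rw [← pre_succ, ha, ← (hc l).2.1]
      exact hω
    subst hlk
    -- The line avoids the vertex, both of its ends lying in one direction. Any line across the edge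
    -- in this direction can serve as the common index.
    obtain ⟨ξ, η, hp', h3, h4⟩ := hT.exists_crossing hn (pre a l) (dir (pre a l) ζ)
    have hx' := mem_geod_of_dir h3 h4
    obtain ⟨i, hi⟩ := D.exists_index hW hp' hx'
    have := (D.mem_ln_iff hi hx').2 (Or.inl h3)
    exact ⟨i, i, this, hx ▸ this, fun h => absurd h hx0, Iff.rfl⟩

/-- The letters of the path form a periodic word, the ray from the identity vertex along the axis of
`g = pre a m`. Powers of `g` spread the states over the whole axis. Every end other than `a` and `b`
takes the colour of the lines that leave the axis in its direction at its projection, and no line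
joins the two colours because it can be followed from state to state. -/
theorem separable_of_periodic (hT : TwoConn W) (hn : 2 ≤ n) {c : ℕ → Config n I} {m : ℕ}
    (hm : 0 < m) (hc : ∀ k, D.Trans (c k) (c (k + 1))) (hper : ∀ k, c (k + m) = c k)
    (hTo : ∃ k, D.Toff (c k)) (hFo : ∃ k, D.Foff (c k)) {a : Boundary n}
    (hak : ∀ k, a.1 k = (c k).fwd) : pre a m ≠ 1 ∧ CycReduced (pre a m) ∧ Attr (pre a m) a ∧
      ∀ b, Attr (pre a m)⁻¹ b → Separable W {a, b} := by
  -- A transition only asserts that its target is valid, so validity at `0` is taken from one period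
  -- later.
  have hval : ∀ k, D.Valid (c k) := fun k => by
    obtain ⟨j, rfl⟩ : ∃ j, m = j + 1 := ⟨m - 1, by omega⟩
    rw [← hper k]
    exact (hc (k + j)).1
  have hperq : ∀ q k, c (m * q + k) = c k := fun q k => by
    induction q with
    | zero => simp
    | succ q ih => rw [← ih, ← hper (m * q + k)]; congr 1; ring
  have haper : ∀ i, a.1 (m + i) = a.1 i := fun i => by rw [hak, hak, add_comm, hper]
  set g := pre a m with hg
  have hnorm : g.norm = m := norm_pre a m
  have hg1 : g ≠ 1 := fun h => by rw [h, FreeGroup.norm_one] at hnorm; omega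
  have hcyc : CycReduced g := cycReduced_pre hm haper
  have hga : Attr g a := attr_of_periodic hm haper
  have hpre : pre a g.norm = g := by rw [hnorm]
  refine ⟨hg1, hcyc, hga, fun b hgb => ?_⟩
  have hax := axis_eq_geod hg1 hga hgb
  have h1ax : (1 : FreeGroup (Fin n)) ∈ geod b a := by
    rw [geod_comm, ← hax]; exact one_mem_axis hcyc
  have hpg : ∀ k, pre a k ∈ geod b a := fun k => by simpa using (mul_pre_mem_geod h1ax k).1
  have hab : a ≠ b := hga.ne hg1 hgb
  have hga' : ∀ i : ℤ, act (g ^ i) a = a := act_zpow_of_act hga.act_self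
  have hgb' : ∀ i : ℤ, act (g ^ i) b = b := act_zpow_of_act hgb.act_self'
  have hmulpre : ∀ q k, g ^ q * pre a k = pre a (m * q + k) := fun q k => by
    have := pre_mul_add hpre hga q k
    rw [hnorm] at this; exact this.symm
  -- From index `1` on, the way back is known from the preceding transition; index `0` is reached by
  -- periodicity.
  have hback : ∀ k, dir (pre a k) b = (c k).back := fun k => by
    have : ∀ k, dir (pre a (k + 1)) b = (c (k + 1)).back := fun k => by
      rw [pre_succ, (hc k).2.1, hak, dir_mul_elt, ← hak, ← dir_pre a k]; exact hpg k
    have h2 := this (m - 1 + k)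
    have h3 : m - 1 + k + 1 = m * 1 + k := by omega
    rw [h3, hperq, ← hmulpre, dir_mul, pow_one, act_inv_of_act hgb.act_self'] at h2
    exact h2
  let A : Set (Boundary n) := {ζ | ∃ (i : ℤ) (k : ℕ), dir (g ^ i * pre a k) ζ ≠ (c k).back ∧
    dir (g ^ i * pre a k) ζ ≠ (c k).fwd ∧
    ∃ j, (dir (g ^ i * pre a k) ζ).elt ∈ D.ln j ∧ j ∈ (c k).col}
  let B : Set (Boundary n) := {ζ | ∃ (i : ℤ) (k : ℕ), dir (g ^ i * pre a k) ζ ≠ (c k).back ∧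
    dir (g ^ i * pre a k) ζ ≠ (c k).fwd ∧
    ¬ ∃ j, (dir (g ^ i * pre a k) ζ).elt ∈ D.ln j ∧ j ∈ (c k).col}
  -- A power of `g` moves a vertex of the axis onto the ray where the states are indexed, without
  -- changing its state.
  have hshift : ∀ (i : ℤ) (k N : ℕ) (ζ : Boundary n), -i ≤ N →
      dir (g ^ i * pre a k) ζ = dir (pre a (m * (i + N).toNat + k)) (act (g ^ N) ζ) ∧
      c (m * (i + N).toNat + k) = c k := fun i k N ζ hN => by
    refine ⟨?_, hperq _ _⟩
    rw [← hmulpre, ← zpow_natCast, Int.toNat_of_nonneg (by omega), add_comm, zpow_add, zpow_natCast,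
      mul_assoc, dir_mul_act]
  refine ⟨A, B, ?_, ?_, ?_, ?_, ?_, ?_, ?_⟩
  · simp only [A, Set.ofPred_exists]
    exact isOpen_iUnion fun i => isOpen_iUnion fun k => isOpen_dir _ (fun t => t ≠ (c k).back ∧
      t ≠ (c k).fwd ∧ ∃ j, t.elt ∈ D.ln j ∧ j ∈ (c k).col)
  · simp only [B, Set.ofPred_exists]
    exact isOpen_iUnion fun i => isOpen_iUnion fun k => isOpen_dir _ (fun t => t ≠ (c k).back ∧
      t ≠ (c k).fwd ∧ ¬ ∃ j, t.elt ∈ D.ln j ∧ j ∈ (c k).col)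
  · obtain ⟨k, t, h1, h2, i, h3, h4⟩ := hTo
    obtain ⟨ζ, rfl⟩ := exists_dir_eq (pre a k) t
    exact ⟨ζ, 0, k, by simpa using h1, by simpa using h2, i, by simpa using h3, h4⟩
  · obtain ⟨k, t, h1, h2, i, h3, h4⟩ := hFo
    obtain ⟨ζ, rfl⟩ := exists_dir_eq (pre a k) t
    refine ⟨ζ, 0, k, by simpa using h1, by simpa using h2, ?_⟩
    rw [zpow_zero, one_mul, D.toff_iff_not_foff_at (hval k) h1 h2 h3]
    exact h4
  · rw [Set.disjoint_left]
    rintro ζ ⟨i, k, h1, h2, h3⟩ ⟨j, l, h4, h5, h6⟩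
    have hdir : ∀ (i : ℤ) k, dir (g ^ i * pre a k) a = (c k).fwd ∧
        dir (g ^ i * pre a k) b = (c k).back ∧ g ^ i * pre a k ∈ geod a b := fun i k => by
      have e1 : dir (g ^ i * pre a k) a = (c k).fwd := by
        rw [dir_mul, ← zpow_neg, hga', dir_pre, hak]
      have e2 : dir (g ^ i * pre a k) b = (c k).back := by
        rw [dir_mul, ← zpow_neg, hgb', hback]
      exact ⟨e1, e2, by rw [mem_geod, e1, e2]; exact (hval k).1.symm⟩
    obtain ⟨d1, d2, d3⟩ := hdir i k
    obtain ⟨d4, d5, d6⟩ := hdir j l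
    have he := proj_unique d6 d3 (ζ := ζ) (d1 ▸ h2) (d2 ▸ h1) (d4 ▸ h5) (d5 ▸ h4)
    have hcc : c k = c l := by
      obtain ⟨N, hN1, hN2⟩ : ∃ N : ℕ, -i ≤ N ∧ -j ≤ N :=
        ⟨(-i).toNat + (-j).toNat, by omega, by omega⟩
      have hz : ∀ (i : ℤ) k, -i ≤ (N : ℤ) → g ^ N * (g ^ i * pre a k) =
          pre a (m * (i + N).toNat + k) := fun i k hi => by
        rw [← hmulpre, ← zpow_natCast g (i + N).toNat, Int.toNat_of_nonneg (by omega), add_comm,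
          zpow_add, zpow_natCast, mul_assoc]
      have := congrArg FreeGroup.norm ((hz i k hN1).symm.trans ((congrArg (g ^ N * ·) he).trans
        (hz j l hN2)))
      rw [norm_pre, norm_pre] at this
      rw [← hperq (i + N).toNat k, this, hperq]
    rw [← he, ← hcc] at h6
    exact h6 h3
  · have hmem : ∀ (i : ℤ) k, dir (g ^ i * pre a k) a = (c k).fwd ∧
        dir (g ^ i * pre a k) b = (c k).back := fun i k =>
      ⟨by rw [dir_mul, ← zpow_neg, hga', dir_pre, hak], by rw [dir_mul, ← zpow_neg, hgb', hback]⟩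
    ext ζ
    constructor
    · rintro (⟨i, k, h1, h2, -⟩ | ⟨i, k, h1, h2, -⟩) (rfl | h)
      · exact h2 (hmem i k).1
      · rw [Set.mem_singleton_iff] at h; subst h; exact h1 (hmem i k).2
      · exact h2 (hmem i k).1
      · rw [Set.mem_singleton_iff] at h; subst h; exact h1 (hmem i k).2
    · intro h
      have hζa : ζ ≠ a := fun h' => h (Or.inl h')
      have hζb : ζ ≠ b := fun h' => h (Or.inr h')
      obtain ⟨x, hx, h1, h2⟩ := exists_proj hab hζa hζb
      rw [← hax] at hx
      obtain ⟨i, y, hy, rfl⟩ := exists_zpow_mul hcyc hg1 hx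
      obtain ⟨k, -, rfl⟩ := (mem_segment_iff hpre).1 hy
      rw [(hmem i k).1] at h1
      rw [(hmem i k).2] at h2
      by_cases h3 : ∃ j, (dir (g ^ i * pre a k) ζ).elt ∈ D.ln j ∧ j ∈ (c k).col
      · exact Or.inl ⟨i, k, h2, h1, h3⟩
      · exact Or.inr ⟨i, k, h2, h1, h3⟩
  · rintro ζ ω hp ⟨i, k, h1, h2, h3⟩ ⟨j, l, h4, h5, h6⟩
    obtain ⟨N, hN1, hN2⟩ : ∃ N : ℕ, -i ≤ N ∧ -j ≤ N :=
      ⟨(-i).toNat + (-j).toNat, by omega, by omega⟩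
    obtain ⟨e1, e2⟩ := hshift i k N ζ hN1
    obtain ⟨e3, e4⟩ := hshift j l N ω hN2
    rw [e1, ← e2] at h1 h2 h3
    rw [e3, ← e4] at h4 h5 h6
    have hp' := hp.act (g ^ N)
    rcases le_total (m * (i + N).toNat + k) (m * (j + N).toNat + l) with hle | hle
    · obtain ⟨i₁, i₂, g1, g2, -, g3⟩ := D.exists_index_of_le hW hT hn hc hak hp' hle h2 h4
      rw [D.toff_iff_not_foff_at (hval _) h1 h2 g1] at h3
      rw [D.toff_iff_not_foff_at (hval _) h4 h5 g2] at h6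
      exact h6 (g3.1 h3)
    · obtain ⟨i₁, i₂, g1, g2, -, g3⟩ := D.exists_index_of_le hW hT hn hc hak hp'.symm hle h5 h1
      rw [D.toff_iff_not_foff_at (hval _) h1 h2 g2] at h3
      rw [D.toff_iff_not_foff_at (hval _) h4 h5 g1] at h6
      exact h6 (g3.2 h3)

theorem exists_separable_of_periodic (hT : TwoConn W) (hn : 2 ≤ n) {c : ℕ → Config n I} {m : ℕ}
    (hm : 0 < m) (hc : ∀ k, D.Trans (c k) (c (k + 1))) (hper : ∀ k, c (k + m) = c k)
    (hTo : ∃ k, D.Toff (c k)) (hFo : ∃ k, D.Foff (c k)) :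
    ∃ g : FreeGroup (Fin n), g ≠ 1 ∧ CycReduced g ∧ g.norm = m ∧
      ∀ a b, Attr g a → Attr g⁻¹ b → Separable W {a, b} := by
  let a : Boundary n := ⟨fun k => (c k).fwd, fun k => by
    rw [← (hc k).2.1]; exact (hc k).1.1.symm⟩
  obtain ⟨h1, h2, h3, h4⟩ := D.separable_of_periodic hW hT hn hm hc hper hTo hFo (a := a)
    fun k => rfl
  exact ⟨_, h1, h2, norm_pre a m, fun a' b ha' hb => ha'.unique h3 ▸ h4 b hb⟩

end

end LineIndex

/-! ### Short elements from closed paths -/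

namespace LineIndex
variable {W : List (FreeGroup (Fin n))} {I : Type} (D : LineIndex W I)
  (hW : ∀ w ∈ W, w ≠ 1) (hT : TwoConn W) (hn : 2 ≤ n)
include hW hT hn

/-- The two halves of the closed path are shortened separately, so that both `p` and `q` stay on it;
this accounts for the factor `2`. -/
theorem exists_separable_of_hasCycle {β : Type*} {e : Config n I → β} {T : Finset β}
    (heT : ∀ c, e c ∈ T) (he : ∀ c c' d, e c = e c' → D.Trans c d → D.Trans c' d)
    (h : D.HasCycle) : ∃ g : FreeGroup (Fin n), g ≠ 1 ∧ CycReduced g ∧ g.norm ≤ 2 * T.card ∧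
      ∀ a b, Attr g a → Attr g⁻¹ b → Separable W {a, b} := by
  obtain ⟨p, q, hp, hq, h1, h2⟩ := h
  obtain ⟨m₁, hm₁, hl₁, f₁, a₁, b₁, r₁⟩ := exists_short_path heT he h1
  obtain ⟨m₂, hm₂, hl₂, f₂, a₂, b₂, r₂⟩ := exists_short_path heT he h2
  obtain ⟨c, c0, c1, hper, hc⟩ := exists_periodic_path hm₁ a₁ b₁ r₁ hm₂ a₂ b₂ r₂
  obtain ⟨g, g1, g2, g3, g4⟩ := D.exists_separable_of_periodic hW hT hn (m := m₁ + m₂) (by omega)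
    hc hper ⟨0, c0 ▸ hp⟩ ⟨m₁, c1 ▸ hq⟩
  exact ⟨g, g1, g2, by omega, g4⟩

end LineIndex

section
variable {W : List (FreeGroup (Fin n))} (hW : ∀ w ∈ W, w ≠ 1)
include hW

theorem fiber_of_attr {g : FreeGroup (Fin n)} (h1 : g ≠ 1) {a b : Boundary n} (ha : Attr g a)
    (hb : Attr g⁻¹ b) (hp : ¬ Paired W a b) : fiber W a = {a} :=
  fiber_of_not_paired fun _ h => hp (h.eq_of_attr hW h1 ha hb ▸ h)

theorem fiber_union_of_attr {g : FreeGroup (Fin n)} (h1 : g ≠ 1) {a b : Boundary n} (ha : Attr g a)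
    (hb : Attr g⁻¹ b) (hp : ¬ Paired W a b) : b ∉ fiber W a ∧ fiber W a ∪ fiber W b = {a, b} := by
  rw [fiber_of_attr hW h1 ha hb hp, fiber_of_attr hW (inv_ne_one.2 h1) hb (by rwa [inv_inv])
    fun h => hp h.symm]
  exact ⟨fun h => ha.ne h1 hb (Set.mem_singleton_iff.1 h).symm, rfl⟩

/-- If a line joins `a` and `b`, they are one full fibre. Otherwise both fibres are single ends,
because an end of `g` can only be paired with the other end of `g`. -/
theorem hasCut_of_separable {g : FreeGroup (Fin n)} (h1 : g ≠ 1) {a b : Boundary n} (ha : Attr g a)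
    (hb : Attr g⁻¹ b) (h : Separable W {a, b}) :
    HasCutPoint (DecompositionSpace W) ∨ HasCutTwoPoints (DecompositionSpace W) := by
  by_cases hp : Paired W a b
  · exact Or.inl ((hasCutPoint_iff hW).2 ⟨a, by rwa [fiber_of_paired hW hp]⟩)
  · obtain ⟨h2, h3⟩ := fiber_union_of_attr hW h1 ha hb hp
    exact Or.inr ((hasCutTwoPoints_iff hW).2 ⟨a, b, h2, h3.symm ▸ h⟩)

theorem hasCutPairs_iff (hT : TwoConn W) (hn : 2 ≤ n) {I : Type} [Finite I] (D : LineIndex W I) :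
    HasCutPairs (DecompositionSpace W) ↔ D.HasCycle := by
  constructor
  · rintro (h | h | h)
    · exact absurd ((connectedSpace_iff (by omega)).2 (hT.not_separable_empty hn)) h
    · obtain ⟨ξ, h⟩ := (hasCutPoint_iff hW).1 h
      exact D.hasCycle_of_cut_point hW hT hn h
    · obtain ⟨ξ, η, -, h⟩ := (hasCutTwoPoints_iff hW).1 h
      exact D.hasCycle_of_cut_pair hW hT hn h
  · intro h
    have := Fintype.ofFinite (Config n I)
    obtain ⟨g, g1, -, -, g4⟩ := D.exists_separable_of_hasCycle hW hT hn (e := id)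
      (T := Finset.univ) (fun _ => Finset.mem_univ _) (fun c c' d h => by rw [show c = c' from h]; exact id) h
    obtain ⟨a, ha⟩ := exists_attr g1
    obtain ⟨b, hb⟩ := exists_attr (inv_ne_one.2 g1)
    exact Or.inr (hasCut_of_separable hW g1 ha hb (g4 a b ha hb))

end

/-! ### The bound on the length -/

theorem mem_translate_linesAt {W : List (FreeGroup (Fin n))} (hW : ∀ w ∈ W, w ≠ 1) {z : Letter n}
    {l : Set (FreeGroup (Fin n))} (hl : l ∈ linesAt W) (hz : z.elt ∈ l) :
    translate z.elt⁻¹ l ∈ linesAt W :=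
  ⟨translate_mem_lines hW hl.1 _, by rw [mem_translate]; simpa using hz⟩

open Classical in
/-- The indexing of the lines through the identity vertex by themselves. -/
def linesIndex {W : List (FreeGroup (Fin n))} (hW : ∀ w ∈ W, w ≠ 1) :
    LineIndex W (linesAt W) where
  ln := Subtype.val
  sh z i := if h : z.elt ∈ i.1 then ⟨_, mem_translate_linesAt hW i.2 h⟩ else i
  mem := Subtype.property
  surj l hl := ⟨⟨l, hl⟩, rfl⟩
  ln_sh z i h := by rw [dif_pos h]

theorem exists_letter_ne_three (hn : 2 ≤ n) (x y z : Letter n) :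
    ∃ t : Letter n, t ≠ x ∧ t ≠ y ∧ t ≠ z := by
  by_contra! h
  have h1 : (Finset.univ : Finset (Letter n)) ⊆ {x, y, z} := fun t _ => by
    by_cases h1 : t = x
    · simp [h1]
    · by_cases h2 : t = y
      · simp [h2]
      · simp [h t h1 h2]
  have h2 := (Finset.card_le_card h1).trans Finset.card_le_three
  simp at h2
  omega

/-- Deleting `z` leaves a connected graph with at least three vertices, hence with at least two
edges. In the proof the second line has an end in a direction `s` that the first line does not use,
so the two differ. -/
theorem card_index_add_two_le {W : List (FreeGroup (Fin n))} {I : Type} [Fintype I]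
    (D : LineIndex W I) (hW : ∀ w ∈ W, w ≠ 1) (hT : TwoConn W) (hn : 2 ≤ n) (z : Letter n)
    [DecidablePred fun i => z.elt ∈ D.ln i] :
    0 < (Finset.univ.filter fun i => z.elt ∈ D.ln i).card ∧
      (Finset.univ.filter fun i => z.elt ∈ D.ln i).card + 2 ≤ Fintype.card I := by
  classical
  have hidx : ∀ {ξ η : Boundary n}, Paired W ξ η → ξ.1 0 ≠ η.1 0 → ∃ i, ∀ t : Letter n,
      t.elt ∈ D.ln i ↔ ξ.1 0 = t ∨ η.1 0 = t := fun {ξ η} hp hne => by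
    have h1 : (1 : FreeGroup (Fin n)) ∈ geod ξ η := by rwa [mem_geod, dir_one, dir_one]
    obtain ⟨i, hi⟩ := D.exists_index hW hp h1
    refine ⟨i, fun t => ?_⟩
    rw [D.mem_ln_iff hi h1, dir_one, dir_one]
  constructor
  · obtain ⟨ξ, η, hp, h1, h2⟩ := hT.exists_crossing hn 1 z
    rw [dir_one] at h1 h2
    obtain ⟨i, hi⟩ := hidx hp (h1 ▸ h2.symm)
    exact Finset.card_pos.2 ⟨i, by simp [hi, h1]⟩
  · obtain ⟨t, htz, -⟩ := exists_letter_ne hn z z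
    obtain ⟨r, hrz, hrt⟩ := exists_letter_ne hn z t
    obtain ⟨ξ, η, hp, h1, h2, h3⟩ := hT z {t} (by simpa using htz.symm) ⟨t, rfl⟩ ⟨r, hrt, hrz⟩
    obtain ⟨s, hsz, hst, hsη⟩ := exists_letter_ne_three hn z t (η.1 0)
    obtain ⟨ξ', η', hp', h1', h2', h3'⟩ := hT z {s} (by simpa using hsz.symm) ⟨s, rfl⟩
      ⟨t, fun h => hst h.symm, htz⟩
    simp only [dir_one, Set.mem_singleton_iff] at h1 h2 h3 h1' h2' h3'
    obtain ⟨i, hi⟩ := hidx hp (h1 ▸ Ne.symm h2)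
    obtain ⟨j, hj⟩ := hidx hp' (h1' ▸ Ne.symm h2')
    have hij : i ≠ j := by
      rintro rfl
      have := (hi s).1 ((hj s).2 (Or.inl h1'))
      rw [h1] at this
      exact this.elim (fun h => hst h.symm) fun h => hsη h.symm
    have hiz : z.elt ∉ D.ln i := by rw [hi, h1]; exact fun h => h.elim htz h3
    have hjz : z.elt ∉ D.ln j := by rw [hj, h1']; exact fun h => h.elim hsz h3'
    rw [← Finset.card_pair hij, ← Finset.card_union_of_disjoint]
    · exact Finset.card_le_univ _
    · rw [Finset.disjoint_left]
      intro k hk hk'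
      rw [Finset.mem_filter] at hk
      rw [Finset.mem_insert, Finset.mem_singleton] at hk'
      rcases hk' with rfl | rfl
      · exact hiz hk.2
      · exact hjz hk.2

theorem stirlingSecond_two (k : ℕ) : Nat.stirlingSecond (k + 1) 2 = 2 ^ k - 1 := by
  induction k with
  | zero => rfl
  | succ k ih =>
    rw [Nat.stirlingSecond_succ_succ, ih, Nat.stirlingSecond_one_right, pow_succ]
    have := Nat.one_le_two_pow (n := k)
    omega

/-- Partitions into two subsets suffice: their number is `2 ^ (K - 1) - 1`, and the factor `2 * n -
1` is at least `3`. -/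
theorem two_mul_le_segmentBound (hn : 2 ≤ n) {K : ℕ} (hK : 3 ≤ K) :
    2 * (2 * n * 2 ^ (K - 2)) ≤ segmentBound n K := by
  obtain ⟨k, rfl⟩ : ∃ k, K = k + 3 := ⟨K - 3, by omega⟩
  have h1 : 2 ^ (k + 2) - 1 ≤ (Finset.range (k + 3 + 1)).sup (Nat.stirlingSecond (k + 3)) := by
    rw [← stirlingSecond_two]
    exact Finset.le_sup (f := Nat.stirlingSecond (k + 3)) (Finset.mem_range.2 (by omega))
  have h2 : 3 ≤ 2 * n - 1 := by omega
  have h3 : 2 * (2 ^ (k + 1)) ≤ 3 * (2 ^ (k + 2) - 1) := by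
    have := Nat.one_le_two_pow (n := k)
    rw [pow_succ, pow_succ, pow_succ]
    omega
  calc 2 * (2 * n * 2 ^ (k + 3 - 2)) = 2 * n * (2 * 2 ^ (k + 1)) := by
        rw [show k + 3 - 2 = k + 1 by omega]; ring
    _ ≤ 2 * n * (3 * (2 ^ (k + 2) - 1)) := Nat.mul_le_mul_left _ h3
    _ ≤ 2 * n * ((2 * n - 1) * _) := Nat.mul_le_mul_left _ (Nat.mul_le_mul h2 h1)
    _ = segmentBound n (k + 3) := by rw [segmentBound, mul_assoc (2 * n)]

/-- If there is a cut point or a cut pair, then there is one that consists of the ends of a short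
cyclically reduced element. -/
theorem exists_short_separable {W : List (FreeGroup (Fin n))} (hW : ∀ w ∈ W, w ≠ 1)
    (hT : TwoConn W) (hn : 2 ≤ n) (h : HasCutPairs (DecompositionSpace W)) :
    ∃ g : FreeGroup (Fin n), g ≠ 1 ∧ CycReduced g ∧ g.norm ≤ segmentBound n (complexity W) ∧
      ∀ a b, Attr g a → Attr g⁻¹ b → Separable W {a, b} := by
  classical
  have := (finite_linesAt hW).to_subtype
  have := Fintype.ofFinite (linesAt W)
  set D := linesIndex hW
  have hK : Fintype.card (linesAt W) = complexity W := by
    rw [← Nat.card_eq_fintype_card]; rfl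
  -- A transition depends on its source only through the edge ahead and the colours of the lines
  -- across it. At most `K - 2` lines cross an edge, which leaves at most `2n * 2 ^ (K - 2)` values.
  let e : Config n (linesAt W) → Letter n × Finset (linesAt W) := fun c =>
    (c.fwd, Finset.univ.filter fun i => i ∈ c.col ∧ c.fwd.elt ∈ D.ln i)
  let T : Finset (Letter n × Finset (linesAt W)) := Finset.univ.biUnion fun z =>
    ((Finset.univ.filter fun i => z.elt ∈ D.ln i).powerset).image (Prod.mk z)
  obtain ⟨g, g1, g2, g3, g4⟩ := D.exists_separable_of_hasCycle hW hT hn (e := e) (T := T)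
    (fun c => by
      refine Finset.mem_biUnion.2 ⟨c.fwd, Finset.mem_univ _, Finset.mem_image.2 ⟨_, ?_, rfl⟩⟩
      rw [Finset.mem_powerset]
      exact Finset.monotone_filter_right _ fun i _ h => h.2)
    (fun c c' d h h' => by
      obtain ⟨hf, hcol⟩ := Prod.mk.inj h
      refine ⟨h'.1, hf ▸ h'.2.1, fun i hi => ?_⟩
      rw [← hf] at hi ⊢
      have := Finset.ext_iff.1 hcol i
      simp only [Finset.mem_filter, Finset.mem_univ, true_and, ← hf, hi, and_true] at this
      rw [← this]
      exact h'.2.2 i hi)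
    ((hasCutPairs_iff hW hT hn D).1 h)
  have hT' : T.card ≤ 2 * n * 2 ^ (complexity W - 2) := by
    refine (Finset.card_biUnion_le_card_mul _ _ (2 ^ (complexity W - 2)) fun z _ => ?_).trans
      (le_of_eq ?_)
    · refine Finset.card_image_le.trans ?_
      rw [Finset.card_powerset]
      have := (card_index_add_two_le D hW hT hn z).2
      exact Nat.pow_le_pow_right (by norm_num) (by omega)
    · congr 1
      simp [mul_comm]
  have h3 : 3 ≤ complexity W := by
    have := card_index_add_two_le D hW hT hn (⟨0, by omega⟩, true)
    omega
  exact ⟨g, g1, g2, (g3.trans (Nat.mul_le_mul_left 2 hT')).trans (two_mul_le_segmentBound hn h3), g4⟩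

/-! ### The pattern along the axis of a cyclically reduced element -/

theorem IsSeparation.act {W : List (FreeGroup (Fin n))} {E A B : Set (Boundary n)}
    (h : IsSeparation W E A B) (g : FreeGroup (Fin n)) :
    IsSeparation W (act g ⁻¹' E) (act g ⁻¹' A) (act g ⁻¹' B) := by
  refine ⟨h.isOpen_left.preimage (continuous_act g), h.isOpen_right.preimage (continuous_act g),
    ?_, ?_, h.disjoint.preimage _, ?_, fun ξ η hp => h.resp _ _ (hp.act g)⟩
  · obtain ⟨ξ, hξ⟩ := h.nonempty_left
    exact ⟨LinePattern.act g⁻¹ ξ, by rwa [Set.mem_preimage, act_act_inv]⟩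
  · obtain ⟨ξ, hξ⟩ := h.nonempty_right
    exact ⟨LinePattern.act g⁻¹ ξ, by rwa [Set.mem_preimage, act_act_inv]⟩
  · rw [← Set.preimage_union, h.union]; rfl

theorem dir_pre_eq_bar {a ζ : Boundary n} {j k : ℕ} (h : dir (pre a j) ζ ≠ a.1 j) (hjk : j ≤ k) :
    dir (pre a (k + 1)) ζ = (a.1 k).bar := by
  induction k, hjk using Nat.le_induction with
  | base => exact dir_pre_succ_eq_bar h
  | succ k _ ih =>
    refine dir_pre_succ_eq_bar ?_
    rw [ih]; exact (a.2 k).symm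

/-- `a` and `b` are the attracting and the repelling end of the cyclically reduced `g ≠ 1`. -/
structure IsAxis (g : FreeGroup (Fin n)) (a b : Boundary n) : Prop where
  cyc : CycReduced g
  ne_one : g ≠ 1
  attr : Attr g a
  attr_inv : Attr g⁻¹ b

namespace IsAxis
variable {g : FreeGroup (Fin n)} {a b : Boundary n} (hg : IsAxis g a b)
include hg

theorem axis_eq : axis g = geod a b := axis_eq_geod hg.ne_one hg.attr hg.attr_inv

theorem norm_pos : 0 < g.norm := by
  rw [Nat.pos_iff_ne_zero]; exact fun h => hg.ne_one (FreeGroup.norm_eq_zero.1 h)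

theorem pre_norm : pre a g.norm = g := pre_norm_of_attr hg.cyc hg.ne_one hg.attr

theorem ne : a ≠ b := hg.attr.ne hg.ne_one hg.attr_inv

theorem one_mem : (1 : FreeGroup (Fin n)) ∈ geod a b := hg.axis_eq ▸ one_mem_axis hg.cyc

theorem dir_pre_ne (k : ℕ) : dir (pre a k) b ≠ a.1 k := by
  have h1 : (1 : FreeGroup (Fin n)) ∈ geod b a := by rw [geod_comm]; exact hg.one_mem
  have := (mul_pre_mem_geod h1 k).1
  simp only [inv_one, act_one, one_mul] at this
  rwa [mem_geod, dir_pre] at this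

theorem dir_pre_succ (k : ℕ) : dir (pre a (k + 1)) b = (a.1 k).bar :=
  dir_pre_succ_eq_bar (hg.dir_pre_ne k)

theorem zpow_act_left (i : ℤ) : act (g ^ i) a = a := act_zpow_of_act hg.attr.act_self i

theorem zpow_act_right (i : ℤ) : act (g ^ i) b = b := act_zpow_of_act hg.attr_inv.act_self' i

theorem translate_zpow (i : ℤ) : translate (g ^ i) (geod a b) = geod a b := by
  rw [translate_geod, hg.zpow_act_left, hg.zpow_act_right]

theorem translate_self : translate g (geod a b) = geod a b := by
  simpa using hg.translate_zpow 1

theorem dir_norm {ζ : Boundary n} : dir g ζ = dir (pre a g.norm) ζ := by rw [hg.pre_norm]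

theorem b_zero : b.1 0 = (a.1 (g.norm - 1)).bar := by
  have h1 := hg.attr_inv.zero_of_cycReduced hg.cyc.inv (inv_ne_one.2 hg.ne_one)
  obtain ⟨k, hk⟩ : ∃ k, g.norm = k + 1 := ⟨g.norm - 1, by have := hg.norm_pos; omega⟩
  have h2 := hd_inv_pre_succ a k
  rw [← hk, hg.pre_norm, ← h1] at h2
  rw [hk]
  exact Option.some_inj.1 h2

theorem backVertex_eq : backVertex g = (b.1 0).elt := by
  have hw : g.toWord = (List.range g.norm).map a.1 := by rw [← toWord_pre, hg.pre_norm]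
  obtain ⟨k, hk⟩ : ∃ k, g.norm = k + 1 := ⟨g.norm - 1, by have := hg.norm_pos; omega⟩
  rw [hg.b_zero, Letter.elt_bar, backVertex, hw, hk, List.range_succ, List.map_append]
  simp [Letter.elt]

theorem pre_mem (k : ℕ) : pre a k ∈ geod a b := by
  rw [mem_geod, dir_pre]; exact (hg.dir_pre_ne k).symm

theorem mem_segment {x : FreeGroup (Fin n)} : x ∈ segment g ↔ ∃ r < g.norm, x = pre a r :=
  mem_segment_iff hg.pre_norm

theorem segment_subset {x : FreeGroup (Fin n)} (hx : x ∈ segment g) : x ∈ geod a b := by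
  obtain ⟨r, -, rfl⟩ := hg.mem_segment.1 hx
  exact hg.pre_mem r

theorem exists_zpow {x : FreeGroup (Fin n)} (hx : x ∈ geod a b) :
    ∃ i : ℤ, ∃ y ∈ segment g, x = g ^ i * y :=
  exists_zpow_mul hg.cyc hg.ne_one (hg.axis_eq ▸ hx)

theorem mem_whVertices {v : FreeGroup (Fin n)} (hv : v ∉ geod a b) :
    v ∈ whVertices (segment g) ↔ ∃ x ∈ segment g, ∃ t : Letter n, v = x * t.elt := by
  constructor
  · rintro ⟨-, x, hx, h⟩
    rw [cayleyTree, SimpleGraph.fromRel_adj] at h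
    rcases h.2 with ⟨i, h⟩ | ⟨i, h⟩
    · exact ⟨x, hx, (i, true), h⟩
    · refine ⟨x, hx, (i, false), ?_⟩
      have : Letter.elt (i, false) = (FreeGroup.of i : FreeGroup (Fin n))⁻¹ := rfl
      rw [this, h, mul_inv_cancel_right]
  · rintro ⟨x, hx, t, rfl⟩
    refine ⟨fun h => hv (hg.segment_subset h), x, hx, ?_⟩
    rw [cayleyTree, SimpleGraph.fromRel_adj]
    refine ⟨fun h => Letter.elt_ne_one t (by simpa using h), ?_⟩
    rcases t with ⟨i, _ | _⟩
    · refine Or.inr ⟨i, ?_⟩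
      have : Letter.elt (i, false) = (FreeGroup.of i : FreeGroup (Fin n))⁻¹ := rfl
      rw [this, inv_mul_cancel_right]
    · exact Or.inl ⟨i, rfl⟩

omit hg in
theorem mul_elt_notMem {x : FreeGroup (Fin n)} (hx : x ∈ geod a b) {t : Letter n} :
    x * t.elt ∉ geod a b ↔ dir x a ≠ t ∧ dir x b ≠ t := by
  rw [mul_elt_mem_geod hx, not_or]

omit hg in
/-- A line that meets the axis and passes through a vertex next to `x` off the axis has an end in
this direction. -/
theorem mem_of_mul_elt_mem {x x' : FreeGroup (Fin n)} (hx : x ∈ geod a b) (hx' : x' ∈ geod a b)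
    {t : Letter n} (ht : x * t.elt ∉ geod a b) {ξ η : Boundary n} (h : x * t.elt ∈ geod ξ η)
    (h' : x' ∈ geod ξ η) : x ∈ geod ξ η ∧ (dir x ξ = t ∨ dir x η = t) := by
  rw [mul_elt_notMem hx] at ht
  have h1 : dirv x x' ≠ some t := fun hd => by
    rcases dirv_of_mem_geod hx' hd with h | h
    · exact ht.1 h
    · exact ht.2 h
  have h2 := dirv_mul_elt.2 h1
  have key : ∀ {ξ η : Boundary n}, x * t.elt ∈ geod ξ η → dir (x * t.elt) ξ = t.bar →
      x ∈ geod ξ η ∧ (dir x ξ = t ∨ dir x η = t) := fun {ξ η} h h3 => by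
    have h4 : dir (x * t.elt) η ≠ t.bar := fun h4 => h (h3.trans h4.symm)
    have h5 := dir_eq_of_mul_elt h4
    refine ⟨?_, Or.inr h5⟩
    rw [geod_comm]
    exact mem_geod_of_dir h5 (dir_mul_elt.1 h3)
  rcases dirv_of_mem_geod h' h2 with h3 | h3
  · exact key h h3
  · obtain ⟨k1, k2⟩ := key (by rwa [geod_comm]) h3
    exact ⟨by rwa [geod_comm], k2.symm⟩

section
variable {W : List (FreeGroup (Fin n))}

theorem whConn_of_mem {l l' : Set (FreeGroup (Fin n))} (hl : l ∈ whEdges W (segment g))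
    (hl' : l' ∈ whEdges W (segment g)) {x : FreeGroup (Fin n)} (hx : x ∈ segment g) {t : Letter n}
    (ht : x * t.elt ∉ geod a b) (h : x * t.elt ∈ l) (h' : x * t.elt ∈ l') :
    WhConn W (segment g) (axis g) l l' :=
  Relation.ReflTransGen.single ⟨hl, hl', _, (hg.mem_whVertices ht).2 ⟨x, hx, t, rfl⟩,
    by rwa [hg.axis_eq], h, h'⟩

theorem whConn_induction {p : Set (FreeGroup (Fin n)) → Prop}
    (hp : ∀ l l', l ∈ whEdges W (segment g) → l' ∈ whEdges W (segment g) →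
      ∀ x ∈ segment g, ∀ t : Letter n, x * t.elt ∉ geod a b → x * t.elt ∈ l → x * t.elt ∈ l' →
      (p l ↔ p l')) {l l' : Set (FreeGroup (Fin n))}
    (h : WhConn W (segment g) (axis g) l l') : p l ↔ p l' := by
  induction h with
  | refl => rfl
  | tail _ h ih =>
    obtain ⟨h1, h2, v, h3, h4, h5, h6⟩ := h
    rw [hg.axis_eq] at h4
    obtain ⟨x, hx, t, rfl⟩ := (hg.mem_whVertices h4).1 h3
    exact ih.trans (hp _ _ h1 h2 x hx t h4 h5 h6)

omit hg in
theorem _root_.LinePattern.WhConn.symm {X H l l' : Set (FreeGroup (Fin n))}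
    (h : WhConn W X H l l') : WhConn W X H l' l := by
  induction h with
  | refl => exact Relation.ReflTransGen.refl
  | tail _ h ih =>
    obtain ⟨h1, h2, v, h3, h4, h5, h6⟩ := h
    exact Relation.ReflTransGen.head ⟨h2, h1, v, h3, h4, h6, h5⟩ ih

theorem whConn_axis_iff {l l' : Set (FreeGroup (Fin n))}
    (h : WhConn W (segment g) (axis g) l l') : l = geod a b ↔ l' = geod a b :=
  hg.whConn_induction (p := fun l => l = geod a b) (fun _ _ _ _ _ _ _ ht h1 h2 =>
    iff_of_false (fun h => ht (h ▸ h1)) (fun h => ht (h ▸ h2))) h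

variable (hW : ∀ w ∈ W, w ≠ 1)
include hW

theorem mem_looseEnds_iff {ξ η : Boundary n} (hp : Paired W ξ η) :
    geod ξ η ∈ looseEnds W g ↔ (dir 1 ξ = b.1 0 ∧ dir 1 η ≠ b.1 0) ∨
      (dir 1 η = b.1 0 ∧ dir 1 ξ ≠ b.1 0) := by
  constructor
  · rintro ⟨-, h1, h2⟩
    rw [hg.backVertex_eq, ← one_mul (Letter.elt _)] at h1
    exact edge_mem_geod h2 h1
  · intro h
    refine ⟨hp.mem_lines hW, ?_, ?_⟩
    · rw [hg.backVertex_eq, ← one_mul (Letter.elt _)]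
      rcases h with h | h
      · exact mul_elt_mem_geod_of_dir h.1 h.2
      · rw [geod_comm]; exact mul_elt_mem_geod_of_dir h.1 h.2
    · rcases h with h | h
      · exact mem_geod_of_dir h.1 h.2
      · rw [geod_comm]; exact mem_geod_of_dir h.1 h.2

/-- The edge `g e` starts at the last vertex of the segment, so every line across it meets the
segment. -/
theorem translate_looseEnds {l : Set (FreeGroup (Fin n))} (hl : l ∈ looseEnds W g) :
    translate g l ∈ whEdges W (segment g) := by
  refine ⟨translate_mem_lines hW hl.1 g, pre a (g.norm - 1), ?_, hg.mem_segment.2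
    ⟨_, by have := hg.norm_pos; omega, rfl⟩⟩
  have h1 := hl.2.1
  rw [mem_translate]
  convert h1 using 1
  have h2 : pre a (g.norm - 1) * (a.1 (g.norm - 1)).elt = g := by
    rw [← pre_succ, Nat.sub_add_cancel hg.norm_pos, hg.pre_norm]
  rw [hg.backVertex_eq, hg.b_zero, Letter.elt_bar, inv_mul_eq_iff_eq_mul,
    eq_mul_inv_iff_mul_eq, h2]

end

end IsAxis

/-! ### Components of the Whitehead graph over a segment of the axis -/

namespace IsAxis
variable {g : FreeGroup (Fin n)} {a b : Boundary n} (hg : IsAxis g a b)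
  {W : List (FreeGroup (Fin n))} (hW : ∀ w ∈ W, w ≠ 1)
include hg

theorem exists_off {ζ : Boundary n} (hζ : ζ ≠ a) (h0 : dir 1 ζ ≠ b.1 0) :
    ∃ k, dir (pre a k) ζ ≠ dir (pre a k) a ∧ dir (pre a k) ζ ≠ dir (pre a k) b ∧
      ∀ j < k, dir (pre a j) ζ = a.1 j := by
  obtain ⟨k, hk, hk'⟩ := exists_exit hζ.symm
  refine ⟨k, by rwa [dir_pre], ?_, hk'⟩
  cases k with
  | zero => rwa [pre_zero, dir_one b]
  | succ k =>
    rw [hg.dir_pre_succ, pre_succ]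
    exact dir_mul_elt_ne (hk' k (by omega))

theorem dir_one_ne_of_off {k : ℕ} {ζ : Boundary n} (h1 : dir (pre a k) ζ ≠ a.1 k)
    (h2 : dir (pre a k) ζ ≠ dir (pre a k) b) : dir 1 ζ ≠ b.1 0 := by
  intro h
  cases k with
  | zero => rw [pre_zero, h, dir_one] at h2; exact h2 rfl
  | succ k =>
    refine h2 ?_
    rw [hg.dir_pre_succ]
    refine dir_pre_eq_bar (j := 0) ?_ (Nat.zero_le k)
    rw [pre_zero, h, ← dir_one b]
    exact hg.dir_pre_ne 0

include hW

omit hg in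
theorem geod_eq_of_end (hg : IsAxis g a b) {ξ η : Boundary n} (hp : Paired W ξ η)
    (h : ξ = a ∨ ξ = b) : geod ξ η = geod a b := by
  rcases h with rfl | rfl
  · rw [hp.eq_of_attr hW hg.ne_one hg.attr hg.attr_inv]
  · rw [hp.eq_of_attr hW (inv_ne_one.2 hg.ne_one) hg.attr_inv (by rw [inv_inv]; exact hg.attr),
      geod_comm]

variable (hT : TwoConn W)
include hT

/-- In `Wh([*, g)) \ H`, every component contains a loose end at `e`. -/
theorem exists_whConn_looseEnds {l : Set (FreeGroup (Fin n))} (hl : l ∈ whEdges W (segment g)) :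
    ∃ l' ∈ looseEnds W g, WhConn W (segment g) (axis g) l l' := by
  by_contra! hcon
  let C : Set (Set (FreeGroup (Fin n))) :=
    {l' | l' ∈ whEdges W (segment g) ∧ WhConn W (segment g) (axis g) l l'}
  have hC : ∀ l' ∈ C, l' ∉ looseEnds W g := fun l' h h' => hcon l' h' h.2
  -- `C` is a component without loose ends at `e`, and `U` is the set of vertices on its lines. The
  -- ends that leave the axis along the segment through `U` form `A`. The ends that leave it
  -- elsewhere along the segment, and all those beyond `e`, form `B`.
  let U : Set (FreeGroup (Fin n)) := {v | ∃ l' ∈ C, v ∈ l'}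
  let A : Set (Boundary n) := {ζ | ∃ r < g.norm, dir (pre a r) ζ ≠ a.1 r ∧
    dir (pre a r) ζ ≠ dir (pre a r) b ∧ pre a r * (dir (pre a r) ζ).elt ∈ U}
  let B : Set (Boundary n) := {ζ | dir 1 ζ = b.1 0} ∪ {ζ | ∃ r < g.norm, dir (pre a r) ζ ≠ a.1 r ∧
    dir (pre a r) ζ ≠ dir (pre a r) b ∧ pre a r * (dir (pre a r) ζ).elt ∉ U}
  have hAo : IsOpen A := by
    simp only [A, Set.ofPred_exists]
    refine isOpen_iUnion fun r => ?_
    simp only [Set.ofPred_and]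
    exact isOpen_const.inter (isOpen_dir _ fun t => t ≠ a.1 r ∧ t ≠ dir (pre a r) b ∧
      pre a r * t.elt ∈ U)
  have hBo : IsOpen B := by
    refine (isOpen_dir 1 fun t => t = b.1 0).union ?_
    simp only [Set.ofPred_exists]
    refine isOpen_iUnion fun r => ?_
    simp only [Set.ofPred_and]
    exact isOpen_const.inter (isOpen_dir _ fun t => t ≠ a.1 r ∧ t ≠ dir (pre a r) b ∧
      pre a r * t.elt ∉ U)
  have huniq : ∀ {r s : ℕ} {ζ : Boundary n}, dir (pre a r) ζ ≠ a.1 r →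
      dir (pre a r) ζ ≠ dir (pre a r) b → dir (pre a s) ζ ≠ a.1 s →
      dir (pre a s) ζ ≠ dir (pre a s) b → r = s := fun {r s ζ} h1 h2 h3 h4 => by
    have := proj_unique (hg.pre_mem s) (hg.pre_mem r) (ζ := ζ) (by rwa [dir_pre]) h2
      (by rwa [dir_pre]) h4
    have := congrArg FreeGroup.norm this
    rwa [norm_pre, norm_pre] at this
  have hAB : Disjoint A B := by
    rw [Set.disjoint_left]
    rintro ζ ⟨r, hr, h1, h2, h3⟩ (h4 | ⟨s, hs, h4, h5, h6⟩)
    · exact hg.dir_one_ne_of_off h1 h2 h4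
    · obtain rfl := huniq h1 h2 h4 h5
      exact h6 h3
  -- a line that leaves at a vertex of `U` belongs to the class
  have hmemC : ∀ {ξ η : Boundary n} {r : ℕ}, Paired W ξ η → r < g.norm →
      dir (pre a r) ξ ≠ a.1 r → dir (pre a r) ξ ≠ dir (pre a r) b →
      dir (pre a r) η ≠ dir (pre a r) ξ → pre a r * (dir (pre a r) ξ).elt ∈ U → geod ξ η ∈ C := by
    intro ξ η r hp hr h1 h2 h3 ⟨l', hl', hl''⟩
    have hx : pre a r ∈ segment g := hg.mem_segment.2 ⟨r, hr, rfl⟩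
    have hm : geod ξ η ∈ whEdges W (segment g) := ⟨hp.mem_lines hW, pre a r, h3.symm, hx⟩
    refine ⟨hm, hl'.2.trans (hg.whConn_of_mem hl'.1 hm hx ?_ hl'' ?_)⟩
    · rw [mul_elt_notMem (hg.pre_mem r), dir_pre]; exact ⟨h1.symm, h2.symm⟩
    · exact mul_elt_mem_geod_of_dir rfl h3
  have hr : ∀ ξ η, Paired W ξ η → ξ ∈ A → η ∉ B := by
    rintro ξ η hp ⟨r, hr, h1, h2, h3⟩ (h4 | ⟨s, hs, h4, h5, h6⟩)
    · have hξ := hg.dir_one_ne_of_off h1 h2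
      refine hC _ (hmemC hp hr h1 h2 (fun h => ?_) h3)
        ((hg.mem_looseEnds_iff hW hp).2 (Or.inr ⟨h4, hξ⟩))
      exact hg.dir_one_ne_of_off (h ▸ h1) (h ▸ h2) h4
    · have hrη : dir (pre a r) η ≠ dir (pre a r) ξ := fun h => by
        obtain rfl := huniq (h ▸ h1) (h ▸ h2) h4 h5
        exact h6 (h ▸ h3)
      have hsξ : dir (pre a s) ξ ≠ dir (pre a s) η := fun h => by
        obtain rfl := huniq (h ▸ h4) (h ▸ h5) h1 h2
        exact h6 (h ▸ h3)
      refine h6 ⟨_, hmemC hp hr h1 h2 hrη h3, ?_⟩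
      rw [geod_comm]
      exact mul_elt_mem_geod_of_dir rfl hsξ
  -- The ends that the vertex `g` sees looking back form one shadow, which `A` and `B` cover.
  have hcover : ∀ ζ, dir g ζ = b.1 0 → ζ ∈ A ∪ B := by
    intro ζ hζ
    by_cases h0 : dir 1 ζ = b.1 0
    · exact Or.inr (Or.inl h0)
    · have hpos := hg.norm_pos
      obtain ⟨k, hk⟩ : ∃ k, g.norm = k + 1 := ⟨g.norm - 1, by omega⟩
      rw [hg.dir_norm, hg.b_zero, hk, pre_succ, Nat.add_sub_cancel, dir_mul_elt] at hζ
      have hζa : ζ ≠ a := by rintro rfl; exact hζ (dir_pre _ _)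
      obtain ⟨r, h1, h2, h3⟩ := hg.exists_off hζa h0
      rw [dir_pre] at h1
      have hrk : r < g.norm := by
        by_contra! h
        exact hζ (h3 k (by omega))
      by_cases hU : pre a r * (dir (pre a r) ζ).elt ∈ U
      · exact Or.inl ⟨r, hrk, h1, h2, hU⟩
      · exact Or.inr (Or.inr ⟨r, hrk, h1, h2, hU⟩)
  have hAS : ∀ ζ ∈ A, dir g ζ = b.1 0 := by
    rintro ζ ⟨r, hr, h1, h2, -⟩
    obtain ⟨k, hk⟩ : ∃ k, g.norm = k + 1 := ⟨g.norm - 1, by omega⟩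
    rw [hg.dir_norm, hg.b_zero, hk, Nat.add_sub_cancel]
    exact dir_pre_eq_bar h1 (by omega)
  have hbB : b ∈ B := Or.inl (dir_one b)
  have hbS : dir g b = b.1 0 := by
    obtain ⟨k, hk⟩ : ∃ k, g.norm = k + 1 := ⟨g.norm - 1, by have := hg.norm_pos; omega⟩
    rw [hg.dir_norm, hg.b_zero, hk, hg.dir_pre_succ, Nat.add_sub_cancel]
  -- By `TwoConn.mono` this shadow has one colour, and it contains `b`, which belongs to `B`.
  have hAe : ∀ ζ, ζ ∉ A := by
    rcases hT.mono hAo hBo hAB hr hcover with h | h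
    · exact absurd hbB (Set.disjoint_left.1 hAB (h b hbS))
    · exact fun ζ hζ => Set.disjoint_left.1 hAB hζ (h ζ (hAS ζ hζ))
  -- so the given line does not leave the axis along the segment
  have hUe : ∀ r < g.norm, ∀ t, t ≠ a.1 r → t ≠ dir (pre a r) b → pre a r * t.elt ∉ U := by
    intro r hr t h1 h2 h3
    obtain ⟨ζ, rfl⟩ := exists_dir_eq (pre a r) t
    exact hAe ζ ⟨r, hr, h1, h2, h3⟩
  obtain ⟨ξ, η, hp, rfl⟩ := (mem_lines_iff hW).1 hl.1
  have hlC : geod ξ η ∈ C := ⟨hl, Relation.ReflTransGen.refl⟩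
  obtain ⟨x, hx, hxs⟩ := hl.2
  obtain ⟨r, hr, rfl⟩ := hg.mem_segment.1 hxs
  have hends : ∀ {ξ η : Boundary n}, geod ξ η ∈ C → pre a r ∈ geod ξ η →
      dir (pre a r) ξ = a.1 r ∨ dir (pre a r) ξ = dir (pre a r) b := fun {ξ η} h1 h2 => by
    by_contra! h3
    exact hUe r hr _ h3.1 h3.2 ⟨_, h1, mul_elt_mem_geod_of_dir rfl h2.symm⟩
  -- Going back along the axis, the line would either leave it through `U` or cross `e`, and both
  -- are excluded.
  have hfin : ∀ {ξ η : Boundary n}, Paired W ξ η → geod ξ η ∈ C → dir (pre a r) ξ = a.1 r →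
      dir (pre a r) η = dir (pre a r) b → False := by
    intro ξ η hp hC' hξ hη
    have hξ0 : dir 1 ξ ≠ b.1 0 := by
      have := dir_pre_le (Nat.zero_le r) hξ
      rw [pre_zero] at this
      rw [this, ← dir_one b]
      exact (hg.dir_pre_ne 0).symm
    refine hC _ hC' ((hg.mem_looseEnds_iff hW hp).2 (Or.inr ⟨?_, hξ0⟩))
    by_contra hη0
    have hηa : η ≠ a := by
      rintro rfl
      rw [dir_pre] at hη
      exact hg.dir_pre_ne r hη.symm
    obtain ⟨k, h1, h2, h3⟩ := hg.exists_off hηa hη0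
    rw [dir_pre] at h1
    have hkr : k < r := by
      by_contra! hle
      rcases hle.lt_or_eq with hlt | rfl
      · exact hg.dir_pre_ne r (hη ▸ h3 r hlt)
      · exact h2 hη
    have hξk := dir_pre_le hkr.le hξ
    refine hUe k (by omega) _ h1 h2 ⟨_, hC', ?_⟩
    rw [geod_comm]
    exact mul_elt_mem_geod_of_dir rfl (by rw [hξk]; exact h1.symm)
  have hlC' : geod η ξ ∈ C := by rwa [geod_comm]
  have hx' : pre a r ∈ geod η ξ := by rwa [geod_comm]
  rcases hends hlC hx with h1 | h1 <;> rcases hends hlC' hx' with h2 | h2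
  · exact hx (h1.trans h2.symm)
  · exact hfin hp hlC h1 h2
  · exact hfin hp.symm hlC' h2 h1
  · exact hx (h1.trans h2.symm)

end IsAxis

/-- Some end of the line belongs to `A`. -/
def Coloured (W : List (FreeGroup (Fin n))) (A : Set (Boundary n))
    (l : Set (FreeGroup (Fin n))) : Prop :=
  ∃ ξ η, Paired W ξ η ∧ l = geod ξ η ∧ ξ ∈ A

theorem coloured_translate {W : List (FreeGroup (Fin n))} {A : Set (Boundary n)}
    {l : Set (FreeGroup (Fin n))} (h : FreeGroup (Fin n)) :
    Coloured W A (translate h l) ↔ Coloured W (act h ⁻¹' A) l := by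
  constructor
  · rintro ⟨ξ, η, hp, hl, hA⟩
    refine ⟨act h⁻¹ ξ, act h⁻¹ η, hp.act _, ?_, by rwa [Set.mem_preimage, act_act_inv]⟩
    rw [← translate_geod, ← hl, ← translate_mul, inv_mul_cancel, translate_one]
  · rintro ⟨ξ, η, hp, rfl, hA⟩
    exact ⟨act h ξ, act h η, hp.act _, translate_geod _ _ _, hA⟩

theorem finite_looseEnds {W : List (FreeGroup (Fin n))} (hW : ∀ w ∈ W, w ≠ 1)
    (g : FreeGroup (Fin n)) : (looseEnds W g).Finite :=
  (finite_linesAt hW).subset fun _ hl => ⟨hl.1, hl.2.2⟩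

/-- Both conditions pass to intersections: they can be checked for each compatible partition
separately. -/
theorem isCompatible_finestPartition (W : List (FreeGroup (Fin n))) (g : FreeGroup (Fin n)) :
    IsCompatible W g (finestPartition W g) := by
  refine ⟨fun a b h P hP => hP.1 a b h, fun a b c d h1 h2 => ?_⟩
  exact forall₂_congr fun P hP => hP.2 a b c d h1 h2

theorem finestPartition_le {W : List (FreeGroup (Fin n))} {g : FreeGroup (Fin n)}
    {P : Setoid (looseEnds W g)} (hP : IsCompatible W g P) {a b : looseEnds W g}
    (h : finestPartition W g a b) : P a b := h P hP

/-! ### From a separation to inequivalent loose ends -/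

namespace IsAxis
variable {g : FreeGroup (Fin n)} {a b : Boundary n} (hg : IsAxis g a b)
  {W : List (FreeGroup (Fin n))} (hW : ∀ w ∈ W, w ≠ 1)
include hg

theorem preimage_zpow (i : ℤ) : act (g ^ i) ⁻¹' ({a, b} : Set (Boundary n)) = {a, b} := by
  ext ζ
  simp only [Set.mem_preimage, Set.mem_insert_iff, Set.mem_singleton_iff]
  rw [← (act_injective (g ^ i)).eq_iff (a := ζ) (b := a), hg.zpow_act_left,
    ← (act_injective (g ^ i)).eq_iff (a := ζ) (b := b), hg.zpow_act_right]

/-- Connections pass through vertices off the axis, and `g` preserves the axis. So it is compatible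
to set the axis apart from all other lines, and the finest partition does so too. -/
theorem finestPartition_axis {l l' : looseEnds W g} (h : finestPartition W g l l') :
    l.1 = geod a b ↔ l'.1 = geod a b := by
  let P : Setoid (looseEnds W g) := ⟨fun l l' => l.1 = geod a b ↔ l'.1 = geod a b,
    fun _ => Iff.rfl, fun h => h.symm, fun h h' => h.trans h'⟩
  have hP : IsCompatible W g P := by
    have key : ∀ l : Set (FreeGroup (Fin n)), translate g l = geod a b ↔ l = geod a b := fun l => by
      conv_lhs => rw [← hg.translate_self]
      exact (translate_injective g).eq_iff
    refine ⟨fun _ _ h => hg.whConn_axis_iff h, fun l₁ l₂ l₃ l₄ h1 h2 => ?_⟩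
    have h1 := (hg.whConn_axis_iff h1).trans (key _)
    have h2 := (hg.whConn_axis_iff h2).trans (key _)
    change (_ ↔ _) ↔ (_ ↔ _)
    rw [h1, h2]
  exact finestPartition_le hP h

include hW

theorem axis_mem_looseEnds (h : geod a b ∈ lines W) : geod a b ∈ looseEnds W g := by
  rw [hg.mem_looseEnds_iff hW (paired_of_geod_mem hW hg.ne h)]
  refine Or.inr ⟨dir_one b, ?_⟩
  have := hg.one_mem
  rwa [mem_geod, dir_one b] at this

/-- A line through the identity vertex that `g` preserves has the ends of `g`. Conversely, an axis
that is a line is alone in its subset by `finestPartition_axis`. -/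
theorem hasSegregatedFreeEdge_iff : HasSegregatedFreeEdge W g ↔ geod a b ∈ lines W := by
  constructor
  · rintro ⟨l, hl, -⟩
    obtain ⟨ξ, η, hp, h⟩ := (mem_lines_iff hW).1 l.2.1
    have h1 := l.2.2.2
    rw [h] at hl h1
    rw [← eq_geod_of_translate hg.ne_one hg.attr hg.attr_inv hl h1]
    exact hp.mem_lines hW
  · intro h
    exact ⟨⟨_, hg.axis_mem_looseEnds hW h⟩, hg.translate_self, fun l hl =>
      Subtype.ext ((hg.finestPartition_axis hl).1 rfl)⟩

omit hg in
theorem coloured_iff_of_end {A : Set (Boundary n)} {ξ η : Boundary n} (hp : Paired W ξ η) :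
    Coloured W A (geod ξ η) ↔ ξ ∈ A ∨ η ∈ A := by
  constructor
  · rintro ⟨ξ', η', hp', h', hA⟩
    rcases geod_inj (hp.ne hW) h' with ⟨rfl, rfl⟩ | ⟨rfl, rfl⟩
    · exact Or.inl hA
    · exact Or.inr hA
  · rintro (hA | hA)
    · exact ⟨ξ, η, hp, rfl, hA⟩
    · exact ⟨η, ξ, hp.symm, geod_comm _ _, hA⟩

variable (hT : TwoConn W)
include hT

/-- The shadow at `x` in the direction `t` omits `a` and `b`, so it has one colour, and the line has
an end in it. -/
theorem coloured_iff_of_mem {A B : Set (Boundary n)} (hs : IsSeparation W {a, b} A B)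
    {x : FreeGroup (Fin n)} (hx : x ∈ geod a b) {t : Letter n} (ht : x * t.elt ∉ geod a b)
    {l : Set (FreeGroup (Fin n))} (hl : l ∈ lines W) {x' : FreeGroup (Fin n)}
    (hx' : x' ∈ geod a b) (h' : x' ∈ l) (h : x * t.elt ∈ l) {ζ : Boundary n}
    (hζ : dir x ζ = t) : Coloured W A l ↔ ζ ∈ A := by
  obtain ⟨ξ, η, hp, rfl⟩ := (mem_lines_iff hW).1 hl
  have hend := (mem_of_mul_elt_mem hx hx' ht h h').2
  rw [mul_elt_notMem hx] at ht
  have hsub : ∀ ω, dir x ω = t → ω ∈ A ∪ B := fun ω hω => by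
    rw [hs.union]
    rintro (rfl | h)
    · exact ht.1 hω
    · rw [Set.mem_singleton_iff] at h; subst h; exact ht.2 hω
  rw [coloured_iff_of_end hW hp]
  rcases hT.mono hs.isOpen_left hs.isOpen_right hs.disjoint hs.resp hsub with h | h
  · exact iff_of_true (hend.imp (h _) (h _)) (h ζ hζ)
  · refine iff_of_false ?_ fun hA => Set.disjoint_left.1 hs.disjoint hA (h ζ hζ)
    rintro (hA | hA) <;> rcases hend with he | he
    · exact Set.disjoint_left.1 hs.disjoint hA (h _ he)
    · exact hs.resp _ _ hp hA (h _ he)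
    · exact hs.resp _ _ hp.symm hA (h _ he)
    · exact Set.disjoint_left.1 hs.disjoint hA (h _ he)

theorem coloured_iff_of_whConn {A B : Set (Boundary n)} (hs : IsSeparation W {a, b} A B)
    {l l' : Set (FreeGroup (Fin n))} (h : WhConn W (segment g) (axis g) l l') :
    Coloured W A l ↔ Coloured W A l' := by
  refine hg.whConn_induction (p := Coloured W A) (fun l l' hl hl' x hx t ht h1 h2 => ?_) h
  obtain ⟨ζ, hζ⟩ := exists_dir_eq x t
  obtain ⟨y, hy, hy'⟩ := hl.2
  obtain ⟨y', hz, hz'⟩ := hl'.2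
  rw [hg.coloured_iff_of_mem hW hT hs (hg.segment_subset hx) ht hl.1 (hg.segment_subset hy') hy h1
    hζ, hg.coloured_iff_of_mem hW hT hs (hg.segment_subset hx) ht hl'.1 (hg.segment_subset hz') hz
    h2 hζ]

theorem exists_looseEnd_ne (hn : 2 ≤ n) : ∃ l ∈ looseEnds W g, l ≠ geod a b := by
  obtain ⟨z, h1, h2⟩ := exists_letter_ne hn (a.1 0) (b.1 0)
  have h0 := hg.one_mem
  rw [mem_geod, dir_one, dir_one] at h0
  obtain ⟨ξ, η, hp, h3, h4, h5⟩ := hT (a.1 0) {b.1 0} (by simpa using h0) ⟨_, rfl⟩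
    ⟨z, by simpa using h2, h1⟩
  rw [Set.mem_singleton_iff] at h3 h4
  refine ⟨_, (hg.mem_looseEnds_iff hW hp).2 (Or.inl ⟨h3, h4⟩), fun h => ?_⟩
  rcases geod_inj (hp.ne hW) h with ⟨rfl, rfl⟩ | ⟨rfl, rfl⟩
  · exact h4 (dir_one η)
  · exact h5 (dir_one η)

/-- A separation of the ends of the axis gives two inequivalent loose ends. -/
theorem exists_inequivalent (hn : 2 ≤ n) (hs : Separable W {a, b}) :
    ∃ l l' : looseEnds W g, l.1 ≠ geod a b ∧ l'.1 ≠ geod a b ∧ ¬ finestPartition W g l l' := by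
  obtain ⟨A, B, hs⟩ := hs
  by_contra! hcon
  have hsi : ∀ i : ℤ, IsSeparation W {a, b} (act (g ^ i) ⁻¹' A) (act (g ^ i) ⁻¹' B) := fun i => by
    have := hs.act (g ^ i)
    rwa [hg.preimage_zpow] at this
  have hinv : ∀ (i : ℤ) {l l' : Set (FreeGroup (Fin n))}, WhConn W (segment g) (axis g) l l' →
      (Coloured W A (translate (g ^ i) l) ↔ Coloured W A (translate (g ^ i) l')) := fun i l l' h => by
    rw [coloured_translate, coloured_translate]
    exact hg.coloured_iff_of_whConn hW hT (hsi i) h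
  -- Loose ends are equivalent if all their translates along the axis have equal colours. Using all
  -- powers of `g` makes this compatible with splicing, which only shifts `i` by one.
  let P : Setoid (looseEnds W g) := ⟨fun l l' => ∀ i : ℤ,
    (Coloured W A (translate (g ^ i) l.1) ↔ Coloured W A (translate (g ^ i) l'.1)),
    fun _ _ => Iff.rfl, fun h i => (h i).symm, fun h h' i => (h i).trans (h' i)⟩
  have hP : IsCompatible W g P := by
    refine ⟨fun _ _ h i => hinv i h, fun l₁ l₂ l₃ l₄ h1 h2 => ?_⟩
    have key : ∀ i : ℤ, (Coloured W A (translate (g ^ i) l₁.1) ↔ Coloured W A (translate (g ^ i) l₂.1)) ↔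
        (Coloured W A (translate (g ^ (i + 1)) l₃.1) ↔
          Coloured W A (translate (g ^ (i + 1)) l₄.1)) := fun i => by
      rw [hinv i h1, hinv i h2, ← translate_mul, ← translate_mul, ← zpow_add_one]
    constructor
    · intro h i
      have := (key (i - 1)).1 (h _)
      rwa [sub_add_cancel] at this
    · exact fun h i => (key i).2 (h _)
  obtain ⟨l₀, hl₀, hne⟩ := hg.exists_looseEnd_ne hW hT hn
  -- If all loose ends but the axis are equivalent, then all lines but the axis over one translate
  -- of the segment have one colour. The line `l₀` and its translate by `g` carry this colour on to
  -- the next translate.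
  have hκ : ∀ (i : ℤ) (l : Set (FreeGroup (Fin n))), l ∈ whEdges W (segment g) → l ≠ geod a b →
      (Coloured W A (translate (g ^ i) l) ↔ Coloured W A (translate (g ^ i) l₀)) := by
    intro i l hl hlne
    obtain ⟨l', hl', hc⟩ := hg.exists_whConn_looseEnds hW hT hl
    rw [hinv i hc]
    exact finestPartition_le hP (hcon ⟨l', hl'⟩ ⟨l₀, hl₀⟩
      (fun h => hlne ((hg.whConn_axis_iff hc).2 h)) hne) i
  have hstep : ∀ i : ℤ, Coloured W A (translate (g ^ (i + 1)) l₀) ↔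
      Coloured W A (translate (g ^ i) l₀) := fun i => by
    rw [zpow_add_one, translate_mul]
    refine hκ i _ (hg.translate_looseEnds hW hl₀) fun h => hne ?_
    rw [← hg.translate_self] at h
    exact translate_injective g h
  have hconst : ∀ i : ℤ, Coloured W A (translate (g ^ i) l₀) ↔ Coloured W A l₀ := fun i => by
    induction i using Int.induction_on with
    | zero => rw [zpow_zero, translate_one]
    | succ i ih => rw [hstep, ih]
    | pred i ih => rw [← ih, ← hstep, sub_add_cancel]
  have hmem : ∀ ζ, ζ ≠ a → ζ ≠ b → (ζ ∈ A ↔ Coloured W A l₀) := by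
    intro ζ h1 h2
    obtain ⟨x, hx, h3, h4⟩ := exists_proj hg.ne h1 h2
    obtain ⟨i, y, hy, rfl⟩ := hg.exists_zpow hx
    obtain ⟨ξ, η, hp, h5, h6⟩ := hT.exists_crossing hn (g ^ i * y) (dir (g ^ i * y) ζ)
    have hl := hp.mem_lines hW
    have hxl := mem_geod_of_dir h5 h6
    have hxl' := mul_elt_mem_geod_of_dir h5 h6
    have hoff : g ^ i * y * (dir (g ^ i * y) ζ).elt ∉ geod a b := by
      rw [mul_elt_notMem hx]; exact ⟨h3.symm, h4.symm⟩
    rw [← hg.coloured_iff_of_mem hW hT hs hx hoff hl hx hxl hxl' rfl, ← hconst i,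
      ← hκ i (translate (g ^ i)⁻¹ (geod ξ η)), ← translate_mul, mul_inv_cancel, translate_one]
    · refine ⟨translate_mem_lines hW hl _, y, ?_, hy⟩
      rw [mem_translate, inv_inv]; exact hxl
    · intro h
      refine hoff ?_
      rw [← hg.translate_zpow i, ← h, ← translate_mul, mul_inv_cancel, translate_one]
      exact hxl'
  have hne' : ∀ ζ, ζ ∈ A ∪ B → ζ ≠ a ∧ ζ ≠ b := fun ζ hζ => by
    rw [hs.union] at hζ
    exact ⟨fun h => hζ (Or.inl h), fun h => hζ (Or.inr h)⟩
  obtain ⟨ζ, hζ⟩ := hs.nonempty_left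
  obtain ⟨ω, hω⟩ := hs.nonempty_right
  have h1 := hmem ζ (hne' ζ (Or.inl hζ)).1 (hne' ζ (Or.inl hζ)).2
  have h2 := hmem ω (hne' ω (Or.inr hω)).1 (hne' ω (Or.inr hω)).2
  exact Set.disjoint_left.1 hs.disjoint (h2.2 (h1.1 hζ)) hω

end IsAxis

/-! ### From inequivalent loose ends to a separation -/

namespace IsAxis
variable {g : FreeGroup (Fin n)} {a b : Boundary n} (hg : IsAxis g a b)
  {W : List (FreeGroup (Fin n))} (hW : ∀ w ∈ W, w ≠ 1)
include hg hW

/-- The permutation of the classes of loose ends that is induced by connectivity. -/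
theorem exists_perm (hT : TwoConn W) : ∃ τ : Equiv.Perm (Quotient (finestPartition W g)),
    ∀ l l' : looseEnds W g, WhConn W (segment g) (axis g) l' (translate g l) →
      τ (Quotient.mk _ l) = Quotient.mk _ l' := by
  have hfin : Finite (looseEnds W g) := (finite_looseEnds hW g).to_subtype
  -- Each component has a loose end at `e`, so the map is defined everywhere. The two directions of
  -- the compatibility condition make it well defined and injective on classes, of which there are
  -- finitely many.
  have htot : ∀ l : looseEnds W g, ∃ l' : looseEnds W g,
      WhConn W (segment g) (axis g) l' (translate g l) := fun l => by
    obtain ⟨l', hl', h⟩ := hg.exists_whConn_looseEnds hW hT (hg.translate_looseEnds hW l.2)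
    exact ⟨⟨l', hl'⟩, h.symm⟩
  choose f hf using htot
  have hcomp := isCompatible_finestPartition W g
  let τ : Quotient (finestPartition W g) → Quotient (finestPartition W g) :=
    Quotient.map f fun c d h => (hcomp.2 _ _ c d (hf c) (hf d)).2 h
  have hτ : Function.Injective τ := by
    intro p q
    induction p, q using Quotient.inductionOn₂ with
    | _ c d =>
      intro h
      exact Quotient.sound ((hcomp.2 _ _ c d (hf c) (hf d)).1 (Quotient.exact h))
  refine ⟨Equiv.ofBijective τ (Finite.injective_iff_bijective.1 hτ), fun l l' h => ?_⟩
  exact Quotient.sound ((hcomp.2 _ _ l l (hf l) h).2 (Setoid.refl' _ _))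

/-- Two inequivalent loose ends give a separation of the ends of the axis. -/
theorem separable_of_inequivalent (hT : TwoConn W) (hn : 2 ≤ n) {l₀ l₁ : looseEnds W g}
    (h₀ : l₀.1 ≠ geod a b) (h₁ : l₁.1 ≠ geod a b) (hne : ¬ finestPartition W g l₀ l₁) :
    Separable W {a, b} := by
  have hfin : Finite (looseEnds W g) := (finite_looseEnds hW g).to_subtype
  obtain ⟨τ, hτ⟩ := hg.exists_perm hW hT
  have hcomp := isCompatible_finestPartition W g
  set m := g.norm with hm
  have hmpos : 0 < m := hg.norm_pos
  set D := linesIndex hW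
  -- The colour over the `q`-th translate of the segment, with lines moved back to the segment
  -- itself: coloured are those whose class `τ ^ q` takes to the class of `l₀`. By `hcols` the
  -- colours agree at the edges between consecutive translates.
  let col : ℕ → Set (FreeGroup (Fin n)) → Prop := fun q l => ∃ l' : looseEnds W g,
    WhConn W (segment g) (axis g) l l' ∧ (τ ^ q) (Quotient.mk _ l') = Quotient.mk _ l₀
  have hcolc : ∀ q {l l' : Set (FreeGroup (Fin n))}, WhConn W (segment g) (axis g) l l' →
      (col q l ↔ col q l') := fun q l l' h =>
    ⟨fun ⟨c, h1, h2⟩ => ⟨c, h.symm.trans h1, h2⟩, fun ⟨c, h1, h2⟩ => ⟨c, h.trans h1, h2⟩⟩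
  have hcols : ∀ q (l : looseEnds W g), col q (translate g l) ↔ col (q + 1) l := fun q l => by
    constructor
    · rintro ⟨c, h1, h2⟩
      refine ⟨l, Relation.ReflTransGen.refl, ?_⟩
      rw [pow_succ, Equiv.Perm.mul_apply, hτ _ _ h1.symm, h2]
    · rintro ⟨c, h1, h2⟩
      obtain ⟨d, hd, hd'⟩ := hg.exists_whConn_looseEnds hW hT (hg.translate_looseEnds hW l.2)
      refine ⟨⟨d, hd⟩, hd', ?_⟩
      rw [← h2, pow_succ, Equiv.Perm.mul_apply, ← hτ l ⟨d, hd⟩ hd'.symm]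
      congr 2
      exact Quotient.sound (hcomp.1 _ _ h1)
  let s : ℕ → ℕ → Config n (linesAt W) := fun q r =>
    ⟨dir (pre a r) b, a.1 r, {i | col q (translate (pre a r) i.1)}⟩
  have hvalid : ∀ q, ∀ r < m, D.Valid (s q r) := fun q r hr => by
    have hx : pre a r ∈ segment g := hg.mem_segment.2 ⟨r, hr, rfl⟩
    refine ⟨hg.dir_pre_ne r, fun t h1 h2 i j hi hj => ?_⟩
    have hedge : ∀ i : linesAt W, translate (pre a r) i.1 ∈ whEdges W (segment g) := fun i =>
      ⟨translate_mem_lines hW i.2.1 _, pre a r, by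
        rw [mem_translate, inv_mul_cancel]; exact i.2.2, hx⟩
    refine hcolc q (hg.whConn_of_mem (hedge i) (hedge j) hx (t := t) ?_ ?_ ?_)
    · rw [mul_elt_notMem (hg.pre_mem r), dir_pre]; exact ⟨h2.symm, h1.symm⟩
    · rw [mem_translate, inv_mul_cancel_left]; exact hi
    · rw [mem_translate, inv_mul_cancel_left]; exact hj
  have hsh : ∀ (r : ℕ) (i : linesAt W), (a.1 r).elt ∈ i.1 →
      translate (pre a (r + 1)) (D.sh (a.1 r) i).1 = translate (pre a r) i.1 := fun r i hi => by
    have := D.ln_sh (a.1 r) i hi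
    rw [show (D.sh (a.1 r) i).1 = D.ln (D.sh (a.1 r) i) from rfl, this, pre_succ, ← translate_mul,
      mul_inv_cancel_right]
    rfl
  have hs1 : ∀ q r, r + 1 < m → D.Trans (s q r) (s q (r + 1)) := fun q r hr => by
    refine ⟨hvalid q _ hr, hg.dir_pre_succ r, fun i hi => ?_⟩
    change col q (translate (pre a r) i.1) ↔ col q (translate (pre a (r + 1)) (D.sh (a.1 r) i).1)
    rw [hsh r i hi]
  have hs2 : ∀ q r, r + 1 = m → D.Trans (s q r) (s (q + 1) 0) := fun q r hr => by
    have hbr : b.1 0 = (a.1 r).bar := by rw [hg.b_zero, ← hm, ← hr, Nat.add_sub_cancel]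
    refine ⟨hvalid _ _ hmpos, ?_, fun i hi => ?_⟩
    · change dir (pre a 0) b = (a.1 r).bar
      rw [pre_zero, dir_one, hbr]
    · change col q (translate (pre a r) i.1) ↔ col (q + 1) (translate (pre a 0) (D.sh (a.1 r) i).1)
      have hloose : (D.sh (a.1 r) i).1 ∈ looseEnds W g := by
        refine ⟨(D.sh (a.1 r) i).2.1, ?_, (D.sh (a.1 r) i).2.2⟩
        have := D.ln_sh (a.1 r) i hi
        rw [show (D.sh (a.1 r) i).1 = D.ln (D.sh (a.1 r) i) from rfl, this, hg.backVertex_eq, hbr,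
          Letter.elt_bar, mem_translate, inv_inv, mul_inv_cancel]
        exact i.2.2
      rw [← hsh r i hi, hr, hm, hg.pre_norm, pre_zero, translate_one]
      exact hcols q ⟨_, hloose⟩
  let c : ℕ → Config n (linesAt W) := fun k => s (k / m) (k % m)
  have hc : ∀ k, D.Trans (c k) (c (k + 1)) := fun k => by
    have hlt := Nat.mod_lt k hmpos
    have hk := Nat.div_add_mod k m
    set q := k / m with hq
    set r := k % m with hr
    have e : k + 1 = m * q + (r + 1) := by omega
    simp only [c, ← hq, ← hr]
    by_cases h : r + 1 < m
    · rw [e, Nat.mul_add_div hmpos, Nat.mul_add_mod, Nat.div_eq_of_lt h, Nat.mod_eq_of_lt h]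
      exact hs1 q r h
    · have h' : r + 1 = m := by omega
      rw [e, h', Nat.mul_add_div hmpos, Nat.mul_add_mod, Nat.div_self hmpos, Nat.mod_self]
      exact hs2 q r h'
  have hpre : ∀ k, pre a k = g ^ (k / m) * pre a (k % m) := fun k => by
    conv_lhs => rw [← Nat.div_add_mod k m, hm, pre_mul_add hg.pre_norm hg.attr]
  have hdir : ∀ k, dir (pre a k) a = dir (pre a (k % m)) a ∧
      dir (pre a k) b = dir (pre a (k % m)) b := fun k => by
    have ha := hg.zpow_act_left (-(k / m : ℕ))
    have hb := hg.zpow_act_right (-(k / m : ℕ))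
    rw [zpow_neg, zpow_natCast] at ha hb
    rw [hpre k, dir_mul, dir_mul, ha, hb]
    exact ⟨rfl, rfl⟩
  have hak : ∀ k, a.1 k = (c k).fwd := fun k => by
    have := (hdir k).1
    rwa [dir_pre, dir_pre] at this
  have hback : ∀ k, dir (pre a k) b = (c k).back := fun k => (hdir k).2
  have hc0 : ∀ i : linesAt W, i ∈ (c 0).col ↔ col 0 i.1 := fun i => by
    change col (0 / m) (translate (pre a (0 % m)) i.1) ↔ _
    rw [Nat.zero_div, Nat.zero_mod, pre_zero, translate_one]
  -- A loose end other than the axis leaves the axis somewhere ahead, and it keeps its colour until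
  -- then. So lines of both colours leave.
  have hfollow : ∀ l : looseEnds W g, l.1 ≠ geod a b → ∃ k, ∃ t, t ≠ (c k).back ∧ t ≠ (c k).fwd ∧
      ∃ i, t.elt ∈ D.ln i ∧ (i ∈ (c k).col ↔ col 0 l.1) := by
    intro l hl
    obtain ⟨ξ, η, hp, hle, h1, h2⟩ : ∃ ξ η, Paired W ξ η ∧ l.1 = geod ξ η ∧ dir 1 ξ = b.1 0 ∧
        dir 1 η ≠ b.1 0 := by
      obtain ⟨ξ, η, hp, hle⟩ := (mem_lines_iff hW).1 l.2.1
      have := l.2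
      rw [hle, hg.mem_looseEnds_iff hW hp] at this
      rcases this with h | h
      · exact ⟨ξ, η, hp, hle, h⟩
      · exact ⟨η, ξ, hp.symm, by rw [hle, geod_comm], h⟩
    have hηa : η ≠ a := fun h => hl (by
      rw [hle, geod_comm]; exact geod_eq_of_end hW hg hp.symm (Or.inl h))
    obtain ⟨k, h3, h4, -⟩ := hg.exists_off hηa h2
    have h0 : dir (pre a 0) ξ ≠ (c 0).fwd := by
      rw [pre_zero, h1, ← hak, ← dir_one b]
      exact hg.dir_pre_ne 0
    have h4' := h4
    rw [hback] at h4'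
    obtain ⟨i, i', g1, g2, g3, g4⟩ := D.exists_index_of_le hW hT hn hc hak hp (Nat.zero_le k) h0 h4'
    refine ⟨k, _, h4', ?_, i', g2, ?_⟩
    · rwa [← hak, ← dir_pre a k]
    · rw [← g4, hc0]
      have h5 := g3 (by rw [pre_zero, ← hle]; exact l.2.2.2)
      rw [pre_zero, translate_one, ← hle] at h5
      rw [h5]; rfl
  have hq0 : col 0 l₀ := ⟨l₀, Relation.ReflTransGen.refl, rfl⟩
  have hq1 : ¬ col 0 l₁ := by
    rintro ⟨d, h1, h2⟩
    refine hne ?_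
    have h3 := hcomp.1 _ _ h1
    have h4 : finestPartition W g d l₀ := Quotient.exact h2
    exact Setoid.symm' _ (Setoid.trans' _ h3 h4)
  have hTo : ∃ k, D.Toff (c k) := by
    obtain ⟨k, t, h1, h2, i, h3, h4⟩ := hfollow l₀ h₀
    exact ⟨k, t, h1, h2, i, h3, h4.2 hq0⟩
  have hFo : ∃ k, D.Foff (c k) := by
    obtain ⟨k, t, h1, h2, i, h3, h4⟩ := hfollow l₁ h₁
    exact ⟨k, t, h1, h2, i, h3, fun h => hq1 (h4.1 h)⟩
  have hNpos : 0 < orderOf τ := orderOf_pos τ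
  -- The states repeat once `τ ^ q` has returned to the identity. The separation obtained is for `g
  -- ^ orderOf τ`, which has the same ends as `g`.
  have hper : ∀ k, c (k + m * orderOf τ) = c k := fun k => by
    simp only [c]
    rw [Nat.add_mul_div_left _ _ hmpos, Nat.add_mul_mod_self_left]
    simp only [s, col, pow_add, pow_orderOf_eq_one, mul_one]
  obtain ⟨-, -, -, hsep⟩ := D.separable_of_periodic hW hT hn (Nat.mul_pos hmpos hNpos) hc hper hTo
    hFo hak
  refine hsep b ?_
  have := pre_mul_add hg.pre_norm hg.attr (orderOf τ) 0
  rw [add_zero, pre_zero, mul_one] at this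
  rw [hm, this, ← inv_pow]
  exact hg.attr_inv.pow hNpos

/-- The axis, being a line, forms a subset of its own, so more than two subsets means two
inequivalent loose ends besides it. -/
theorem passesCutPointTest_iff (hT : TwoConn W) (hn : 2 ≤ n) :
    PassesCutPointTest W g ↔ geod a b ∈ lines W ∧ Separable W {a, b} := by
  have hfin : Finite (looseEnds W g) := (finite_looseEnds hW g).to_subtype
  rw [PassesCutPointTest, hg.hasSegregatedFreeEdge_iff hW]
  refine and_congr_right fun hl => ?_
  set H : looseEnds W g := ⟨_, hg.axis_mem_looseEnds hW hl⟩ with hH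
  have := Fintype.ofFinite (Quotient (finestPartition W g))
  rw [partitionSize, Nat.card_eq_fintype_card, Fintype.two_lt_card_iff]
  constructor
  · rintro ⟨p, q, r, hpq, hpr, hqr⟩
    obtain ⟨p, q, hpq, hp, hq⟩ : ∃ p q : Quotient (finestPartition W g), p ≠ q ∧
        p ≠ Quotient.mk _ H ∧ q ≠ Quotient.mk _ H := by
      by_cases h1 : p = Quotient.mk _ H
      · exact ⟨q, r, hqr, fun h => hpq (h1.trans h.symm), fun h => hpr (h1.trans h.symm)⟩
      · by_cases h2 : q = Quotient.mk _ H
        · exact ⟨p, r, hpr, h1, fun h => hqr (h2.trans h.symm)⟩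
        · exact ⟨p, q, hpq, h1, h2⟩
    induction p, q using Quotient.inductionOn₂ with
    | _ l l' =>
      refine hg.separable_of_inequivalent hW hT hn (l₀ := l) (l₁ := l') (fun h => hp ?_)
        (fun h => hq ?_) fun h => hpq (Quotient.sound h)
      · congr 1; exact Subtype.ext h
      · congr 1; exact Subtype.ext h
  · intro h
    obtain ⟨l, l', h1, h2, h3⟩ := hg.exists_inequivalent hW hT hn h
    refine ⟨Quotient.mk _ H, Quotient.mk _ l, Quotient.mk _ l', fun h => ?_, fun h => ?_, fun h => ?_⟩
    · exact h1 ((hg.finestPartition_axis (Quotient.exact h)).1 rfl)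
    · exact h2 ((hg.finestPartition_axis (Quotient.exact h)).1 rfl)
    · exact h3 (Quotient.exact h)

theorem passesCutPairTest_iff (hT : TwoConn W) (hn : 2 ≤ n) :
    PassesCutPairTest W g ↔ geod a b ∉ lines W ∧ Separable W {a, b} := by
  have hfin : Finite (looseEnds W g) := (finite_looseEnds hW g).to_subtype
  rw [PassesCutPairTest, hg.hasSegregatedFreeEdge_iff hW]
  refine and_congr_right fun hl => ?_
  have := Fintype.ofFinite (Quotient (finestPartition W g))
  rw [partitionSize, Nat.card_eq_fintype_card, Fintype.one_lt_card_iff]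
  constructor
  · rintro ⟨p, q, hpq⟩
    induction p, q using Quotient.inductionOn₂ with
    | _ l l' =>
      exact hg.separable_of_inequivalent hW hT hn (l₀ := l) (l₁ := l') (fun h => hl (h ▸ l.2.1))
        (fun h => hl (h ▸ l'.2.1)) fun h => hpq (Quotient.sound h)
  · intro h
    obtain ⟨l, l', -, -, h3⟩ := hg.exists_inequivalent hW hT hn h
    exact ⟨Quotient.mk _ l, Quotient.mk _ l', fun h => h3 (Quotient.exact h)⟩

end IsAxis

/-! ### The criteria -/

theorem exists_isAxis {g : FreeGroup (Fin n)} (hc : CycReduced g) (h1 : g ≠ 1) :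
    ∃ a b, IsAxis g a b := by
  obtain ⟨a, ha⟩ := exists_attr h1
  obtain ⟨b, hb⟩ := exists_attr (inv_ne_one.2 h1)
  exact ⟨a, b, hc, h1, ha, hb⟩

theorem Separable.act {W : List (FreeGroup (Fin n))} {a b : Boundary n} (h : Separable W {a, b})
    (g : FreeGroup (Fin n)) : Separable W {act g a, act g b} := by
  obtain ⟨A, B, h⟩ := h
  refine ⟨_, _, (?_ : LinePattern.act g⁻¹ ⁻¹' {a, b} = _) ▸ h.act g⁻¹⟩
  ext ζ
  simp only [Set.mem_preimage, Set.mem_insert_iff, Set.mem_singleton_iff]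
  rw [← (act_injective g).eq_iff, ← (act_injective g).eq_iff (b := b), act_act_inv]

section
variable {V : List (FreeGroup (Fin n))} (hV : ∀ v ∈ V, v ≠ 1) (hT : TwoConn V) (hn : 2 ≤ n)
include hV hT hn

/-- A fibre that is a single end never separates, so a cut point comes from a line. A translation
makes the element of this line cyclically reduced. -/
theorem hasCutPoint_iff_test : HasCutPoint (DecompositionSpace V) ↔
    ∃ v ∈ V, ∃ g : FreeGroup (Fin n), IsConj v g ∧ CycReduced g ∧ PassesCutPointTest V g := by
  rw [hasCutPoint_iff hV]
  constructor
  · rintro ⟨ξ, h⟩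
    by_cases hp : ∃ η, Paired V ξ η
    · obtain ⟨η, hp⟩ := hp
      rw [fiber_of_paired hV hp] at h
      obtain ⟨ξ, η, hp, h⟩ : ∃ ξ η, EndpointsOfLine V ξ η ∧ Separable V {ξ, η} := by
        rcases hp with hp | hp
        · exact ⟨ξ, η, hp, h⟩
        · exact ⟨η, ξ, hp, by rwa [Set.pair_comm]⟩
      obtain ⟨v, hv, k, h1, h2⟩ := endpointsOfLine_iff.1 hp
      obtain ⟨d, hd⟩ := exists_conj_cycReduced (k * v * k⁻¹)
      have hne : k * v * k⁻¹ ≠ 1 := by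
        simpa using conj_ne_one (hV v hv) k⁻¹
      have hax : IsAxis (d⁻¹ * (k * v * k⁻¹) * d) (act d⁻¹ ξ) (act d⁻¹ η) := by
        refine ⟨hd, conj_ne_one hne d, h1.conj' d, ?_⟩
        have := h2.conj' d
        simpa [mul_assoc] using this
      refine ⟨v, hv, _, ?_, hd, (hax.passesCutPointTest_iff hV hT hn).2 ⟨?_, h.act d⁻¹⟩⟩
      · exact isConj_iff.2 ⟨d⁻¹ * k, by simp [mul_assoc]⟩
      · exact Paired.mem_lines hV (Paired.act (Or.inl hp : Paired V ξ η) d⁻¹)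
    · push Not at hp
      rw [fiber_of_not_paired hp] at h
      exact absurd h (hT.not_separable_singleton ξ)
  · rintro ⟨v, hv, g, hc, hg, ht⟩
    have h1 : g ≠ 1 := by
      rintro rfl
      exact hV v hv (isConj_one_left.1 hc)
    obtain ⟨a, b, hax⟩ := exists_isAxis hg h1
    obtain ⟨h2, h3⟩ := (hax.passesCutPointTest_iff hV hT hn).1 ht
    refine ⟨a, ?_⟩
    rwa [fiber_of_paired hV (paired_of_geod_mem hV hax.ne h2)]

/-- The element from `exists_short_separable` might have produced a cut point; the absence of cut
points ensures that its axis is not a line. -/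
theorem hasCutTwoPoints_iff_test (hcp : ¬ HasCutPoint (DecompositionSpace V)) :
    HasCutTwoPoints (DecompositionSpace V) ↔ ∃ g : FreeGroup (Fin n), g ≠ 1 ∧ CycReduced g ∧
      g.norm ≤ segmentBound n (complexity V) ∧ PassesCutPairTest V g := by
  constructor
  · intro h
    obtain ⟨g, g1, g2, g3, g4⟩ := exists_short_separable hV hT hn (Or.inr (Or.inr h))
    obtain ⟨a, b, hax⟩ := exists_isAxis g2 g1
    have hs := g4 a b hax.attr hax.attr_inv
    refine ⟨g, g1, g2, g3, (hax.passesCutPairTest_iff hV hT hn).2 ⟨fun hl => hcp ?_, hs⟩⟩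
    refine (hasCutPoint_iff hV).2 ⟨a, ?_⟩
    rwa [fiber_of_paired hV (paired_of_geod_mem hV hax.ne hl)]
  · rintro ⟨g, g1, g2, -, ht⟩
    obtain ⟨a, b, hax⟩ := exists_isAxis g2 g1
    obtain ⟨h2, h3⟩ := (hax.passesCutPairTest_iff hV hT hn).1 ht
    exact (hasCut_of_separable hV g1 hax.attr hax.attr_inv h3).resolve_left hcp

end

/-- The finite tests decide about cut points and cut pairs. -/
theorem finite_tests (hn : 2 ≤ n) {W : List (FreeGroup (Fin n))} (hW : ∀ w ∈ W, w ≠ 1) :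
    (∃ V, IsReductionOf V W) ∧ ∀ V, IsReductionOf V W →
      (ConnectedSpace (DecompositionSpace W) ↔ (whiteheadGraph V).Connected) ∧
      ((whiteheadGraph V).Connected →
        (HasCutPoint (DecompositionSpace W) ↔
          ∃ v ∈ V, ∃ g : FreeGroup (Fin n), IsConj v g ∧ CycReduced g ∧ PassesCutPointTest V g) ∧
        (¬ HasCutPoint (DecompositionSpace W) →
          (HasCutTwoPoints (DecompositionSpace W) ↔
            ∃ g : FreeGroup (Fin n), g ≠ 1 ∧ CycReduced g ∧
              g.norm ≤ segmentBound n (complexity V) ∧ PassesCutPairTest V g))) := by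
  refine ⟨exists_isReductionOf hW, fun V ⟨hV, hV'⟩ => ?_⟩
  obtain ⟨φ, rfl⟩ := exists_equiv_of_reflTransGen hV
  have hφ := map_ne_one hW φ
  rw [← hasCutPoint_map hW φ, ← hasCutTwoPoints_map hW φ, ← connectedSpace_map (by omega) φ]
  refine ⟨⟨fun h => ?_, fun h => ?_⟩, fun h => ?_⟩
  · by_contra hc
    exact (connectedSpace_iff (by omega)).1 h (separable_of_not_connected hφ (by omega) hc)
  · exact (connectedSpace_iff (by omega)).2
      ((twoConn_of_connected hφ h hV').not_separable_empty hn)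
  · have hT := twoConn_of_connected hφ h hV'
    exact ⟨hasCutPoint_iff_test hφ hT hn, hasCutTwoPoints_iff_test hφ hT hn⟩

/-! ### Indexing the lines by rotations of cyclic words -/

/-- An indexing of the rotations of cyclically reduced conjugates of the elements of a list. -/
structure RotationSystem (V : List (FreeGroup (Fin n))) (I : Type) where
  word : I → List (Letter n)
  ne_nil : ∀ i, word i ≠ []
  cyc : ∀ i, FreeGroup.IsCyclicallyReduced (word i)
  inj : Function.Injective word
  next : I → I
  word_next : ∀ i, word (next i) = (word i).rotate 1
  mem : ∀ i, ∃ v ∈ V, IsConj v (FreeGroup.mk (word i))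
  surj : ∀ v ∈ V, ∃ i, IsConj v (FreeGroup.mk (word i))

namespace RotationSystem
variable {V : List (FreeGroup (Fin n))} {I : Type} (S : RotationSystem V I)

/-- The group element of an index. -/
def elem (i : I) : FreeGroup (Fin n) := FreeGroup.mk (S.word i)

theorem toWord_elem (i : I) : (S.elem i).toWord = S.word i :=
  (S.cyc i).isReduced.reduce_eq

theorem cycReduced (i : I) : CycReduced (S.elem i) := by
  rw [CycReduced, toWord_elem]
  exact S.cyc i

theorem elem_ne_one (i : I) : S.elem i ≠ 1 := fun h => S.ne_nil i <| by
  rw [← S.toWord_elem, h, FreeGroup.toWord_one]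

/-- The line of the index leaves the identity vertex in the direction of the letter. -/
def Ends (i : I) (t : Letter n) : Prop :=
  (S.word i).head? = some t ∨ (S.word i).getLast? = some t.bar

theorem hd_elem (i : I) : hd (S.elem i) = (S.word i).head? := by
  rw [hd, toWord_elem]

theorem hd_elem_inv (i : I) {t : Letter n} :
    hd (S.elem i)⁻¹ = some t ↔ (S.word i).getLast? = some t.bar := by
  rw [hd, FreeGroup.toWord_inv, toWord_elem, FreeGroup.invRev, List.head?_reverse,
    List.getLast?_map, Option.map_eq_some_iff]
  constructor
  · rintro ⟨a, h, rfl⟩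
    simpa [Letter.bar] using h
  · intro h
    exact ⟨_, h, by simp [Letter.bar]⟩

theorem elt_mem_axis (i : I) (t : Letter n) : t.elt ∈ axis (S.elem i) ↔ S.Ends i t := by
  have h1 := S.elem_ne_one i
  have hc := S.cycReduced i
  obtain ⟨ξ, hξ⟩ := exists_attr h1
  obtain ⟨η, hη⟩ := exists_attr (inv_ne_one.2 h1)
  have hx := one_mem_axis hc
  rw [axis_eq_geod h1 hξ hη] at hx ⊢
  have := mul_elt_mem_geod (y := t) hx
  rw [one_mul, dir_one, dir_one] at this
  rw [this, Ends, ← hd_elem_inv, ← hd_elem, ← hξ.zero_of_cycReduced hc h1,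
    ← hη.zero_of_cycReduced hc.inv (inv_ne_one.2 h1), Option.some_inj, Option.some_inj]

theorem not_head_and_last {i : I} {t : Letter n} (h : (S.word i).head? = some t)
    (h' : (S.word i).getLast? = some t.bar) : False := by
  rcases cycReduced_iff.1 (S.cycReduced i) with h1 | h1
  · exact S.elem_ne_one i h1
  · exact h1 (by rw [hd_elem, h, S.hd_elem_inv i |>.2 h'])

theorem word_iterate (k : ℕ) (i : I) : S.word (S.next^[k] i) = (S.word i).rotate k := by
  induction k with
  | zero => simp
  | succ k ih => rw [Function.iterate_succ_apply', S.word_next, ih, List.rotate_rotate]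

/-- The previous rotation. -/
def prev (i : I) : I := S.next^[(S.word i).length - 1] i

theorem next_prev (i : I) : S.next (S.prev i) = i := by
  refine S.inj ?_
  have := List.length_pos_iff.2 (S.ne_nil i)
  rw [prev, ← Function.iterate_succ_apply' (f := S.next), word_iterate,
    show ((S.word i).length - 1).succ = (S.word i).length by omega, List.rotate_length]

theorem prev_next (i : I) : S.prev (S.next i) = i := by
  refine S.inj (List.rotate_injective 1 ?_)
  change (S.word _).rotate 1 = (S.word _).rotate 1
  rw [← word_next, next_prev, word_next]

theorem exists_head (i : I) : ∃ z, (S.word i).head? = some z ∧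
    (S.word (S.next i)).getLast? = some z ∧
    S.elem (S.next i) = z.elt⁻¹ * S.elem i * z.elt := by
  obtain ⟨z, l, h⟩ := List.exists_cons_of_ne_nil (S.ne_nil i)
  have h' : S.word (S.next i) = l ++ [z] := by
    rw [S.word_next, h, List.rotate_cons_succ, List.rotate_zero]
  refine ⟨z, by rw [h]; rfl, by rw [h']; simp, ?_⟩
  rw [elem, elem, h, h', ← List.singleton_append (x := z) (l := l), ← FreeGroup.mul_mk,
    ← FreeGroup.mul_mk]
  change _ = z.elt⁻¹ * (z.elt * _) * z.elt
  rw [inv_mul_cancel_left]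
  rfl

theorem elem_next {i : I} {z : Letter n} (h : (S.word i).head? = some z) :
    S.elem (S.next i) = z.elt⁻¹ * S.elem i * z.elt := by
  obtain ⟨y, h1, -, h2⟩ := S.exists_head i
  rw [h1, Option.some_inj] at h
  rw [← h, h2]

theorem head_iff_last_next {i : I} {z : Letter n} :
    (S.word i).head? = some z ↔ (S.word (S.next i)).getLast? = some z := by
  obtain ⟨y, h1, h2, -⟩ := S.exists_head i
  rw [h1, h2]

theorem exists_iterate {i : I} {x : FreeGroup (Fin n)} (hx : x ∈ segment (S.elem i)) :
    ∃ k, S.elem (S.next^[k] i) = x⁻¹ * S.elem i * x := by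
  obtain ⟨p, ⟨s, hs⟩, -, rfl⟩ := hx
  rw [toWord_elem] at hs
  refine ⟨p.length, ?_⟩
  rw [elem, word_iterate, ← hs, List.rotate_append_length_eq, elem, ← hs, ← FreeGroup.mul_mk,
    ← FreeGroup.mul_mk, inv_mul_cancel_left]

open Classical in
/-- The indexing of the lines through the identity vertex. -/
def lineIndex : LineIndex V I where
  ln i := axis (S.elem i)
  -- If `z` is the first letter, the line is followed along its word, otherwise against it. For
  -- lines that do not contain `z.elt` the value plays no role.
  sh z i := if (S.word i).head? = some z then S.next i else S.prev i
  mem i := by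
    obtain ⟨v, hv, hc⟩ := S.mem i
    obtain ⟨g, hg⟩ := isConj_iff.1 hc
    exact ⟨⟨v, hv, g, by rw [hg]; rfl⟩, one_mem_axis (S.cycReduced i)⟩
  surj l hl := by
    obtain ⟨⟨v, hv, g, rfl⟩, h1⟩ := hl
    obtain ⟨i, hi⟩ := S.surj v hv
    obtain ⟨d, hd⟩ := isConj_iff.1 hi
    have hg : axis (g * v * g⁻¹) = translate (g * d⁻¹) (axis (S.elem i)) := by
      rw [translate_axis, elem, ← hd]
      congr 1
      group
    rw [hg] at h1 ⊢
    rw [mem_translate, mul_one] at h1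
    obtain ⟨m, x, hx, hm⟩ := exists_zpow_mul (S.cycReduced i) (S.elem_ne_one i) h1
    obtain ⟨k, hk⟩ := S.exists_iterate hx
    refine ⟨_, (congrArg axis hk).trans ?_⟩
    rw [← inv_inv (g * d⁻¹), hm, mul_inv_rev, ← zpow_neg, translate_mul, axis_zpow_conj,
      translate_axis, inv_inv]
  ln_sh z i hz := by
    rw [elt_mem_axis] at hz
    rw [translate_axis, inv_inv]
    split_ifs with h
    · rw [S.elem_next h]
    · have h2 := hz.resolve_left h
      have h3 := S.head_iff_last_next (i := S.prev i) (z := z.bar)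
      rw [next_prev] at h3
      have h4 := S.elem_next (h3.2 h2)
      rw [next_prev] at h4
      congr 1
      have h5 : z.bar.elt = z.elt⁻¹ := by simp
      rw [h5] at h4
      rw [h4]
      group

theorem elt_mem_ln (i : I) (t : Letter n) : t.elt ∈ S.lineIndex.ln i ↔ S.Ends i t :=
  S.elt_mem_axis i t

theorem sh_of_head {i : I} {z : Letter n} (h : (S.word i).head? = some z) :
    S.lineIndex.sh z i = S.next i := if_pos h

theorem sh_of_head_ne {i : I} {z : Letter n} (h : (S.word i).head? ≠ some z) :
    S.lineIndex.sh z i = S.prev i := if_neg h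

/-- Lines that are followed against their word are indexed here by their images under `next`, so
that a test needs forward rotations only. -/
theorem trans_iff {c c' : Config n I} : S.lineIndex.Trans c c' ↔
    S.lineIndex.Valid c' ∧ c'.back = c.fwd.bar ∧ ∀ i,
      ((S.word i).head? = some c.fwd → (i ∈ c.col ↔ S.next i ∈ c'.col)) ∧
      ((S.word i).head? = some c.fwd.bar → (S.next i ∈ c.col ↔ i ∈ c'.col)) := by
  refine and_congr_right fun _ => and_congr_right fun _ => ⟨fun h i => ⟨fun hi => ?_, fun hi => ?_⟩,
    fun h i hi => ?_⟩
  · have := h i ((S.elt_mem_ln _ _).2 (Or.inl hi))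
    rwa [S.sh_of_head hi] at this
  · have hl := S.head_iff_last_next.1 hi
    have := h (S.next i) ((S.elt_mem_ln _ _).2 (Or.inr hl))
    rwa [S.sh_of_head_ne fun h' => S.not_head_and_last h' hl, prev_next] at this
  · rw [elt_mem_ln] at hi
    by_cases h' : (S.word i).head? = some c.fwd
    · rw [S.sh_of_head h']
      exact (h i).1 h'
    · rw [S.sh_of_head_ne h']
      have h3 := S.head_iff_last_next (i := S.prev i) (z := c.fwd.bar)
      rw [next_prev] at h3
      have := (h (S.prev i)).2 (h3.2 (hi.resolve_left h'))
      rwa [next_prev] at this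

end RotationSystem

section
variable {V : List (FreeGroup (Fin n))} (hV : ∀ v ∈ V, v ≠ 1) {I : Type} (D : LineIndex V I)
include hV

theorem LineIndex.twoConn_iff : TwoConn V ↔ ∀ (x : Letter n) (Y : Set (Letter n)), x ∉ Y →
    Y.Nonempty → (∃ z, z ∉ Y ∧ z ≠ x) →
    ∃ i a b, a.elt ∈ D.ln i ∧ b.elt ∈ D.ln i ∧ a ∈ Y ∧ b ∉ Y ∧ b ≠ x := by
  refine forall_congr' fun x => forall_congr' fun Y => forall_congr' fun _ => forall_congr' fun _ =>
    forall_congr' fun _ => ⟨?_, ?_⟩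
  · rintro ⟨ξ, η, hp, h1, h2, h3⟩
    have hx : 1 ∈ geod ξ η := fun h => h2 (h ▸ h1)
    obtain ⟨i, hi⟩ := D.exists_index hV hp hx
    exact ⟨i, _, _, (D.mem_ln_iff hi hx).2 (Or.inl rfl), (D.mem_ln_iff hi hx).2 (Or.inr rfl),
      h1, h2, h3⟩
  · rintro ⟨i, a, b, ha, hb, h1, h2, h3⟩
    obtain ⟨ξ, η, hp, h, hx⟩ := D.exists_paired hV 1 i
    rw [D.mem_ln_iff h hx] at ha hb
    rcases ha with rfl | rfl <;> rcases hb with rfl | rfl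
    · exact absurd h1 h2
    · exact ⟨ξ, η, hp, h1, h2, h3⟩
    · exact ⟨η, ξ, hp.symm, h1, h2, h3⟩
    · exact absurd h1 h2

theorem LineIndex.not_connected_iff (hn : 1 ≤ n) : ¬ (whiteheadGraph V).Connected ↔
    ∃ Y : Set (Letter n), Y.Nonempty ∧ (∃ z, z ∉ Y) ∧
      ∀ i a b, a.elt ∈ D.ln i → b.elt ∈ D.ln i → a ∈ Y → b ∈ Y := by
  have hadj : ∀ a b, (whiteheadGraph V).Adj a b ↔ a ≠ b ∧ ∃ i, a.elt ∈ D.ln i ∧ b.elt ∈ D.ln i := by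
    intro a b
    rw [whiteheadGraph_adj hV]
    refine and_congr_right fun hne => ⟨?_, ?_⟩
    · rintro ⟨ξ, η, hp, rfl, rfl⟩
      obtain ⟨i, hi⟩ := D.exists_index hV hp (x := 1) hne
      exact ⟨i, (D.mem_ln_iff hi hne).2 (Or.inl rfl), (D.mem_ln_iff hi hne).2 (Or.inr rfl)⟩
    · rintro ⟨i, ha, hb⟩
      obtain ⟨ξ, η, hp, h, hx⟩ := D.exists_paired hV 1 i
      rw [D.mem_ln_iff h hx] at ha hb
      rcases ha with rfl | rfl <;> rcases hb with rfl | rfl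
      · exact absurd rfl hne
      · exact ⟨ξ, η, hp, rfl, rfl⟩
      · exact ⟨η, ξ, hp.symm, rfl, rfl⟩
      · exact absurd rfl hne
  constructor
  · intro h
    have : Nonempty (Letter n) := ⟨(⟨0, hn⟩, true)⟩
    rw [SimpleGraph.connected_iff, and_iff_left this, SimpleGraph.Preconnected] at h
    push Not at h
    obtain ⟨u, v, huv⟩ := h
    refine ⟨{a | (whiteheadGraph V).Reachable u a}, ⟨u, .rfl⟩, ⟨v, huv⟩, fun i a b ha hb h => ?_⟩
    by_cases hab : a = b
    · exact hab ▸ h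
    · exact SimpleGraph.Reachable.trans h ((hadj a b).2 ⟨hab, i, ha, hb⟩).reachable
  · rintro ⟨Y, ⟨u, hu⟩, ⟨v, hv⟩, h⟩ hc
    obtain ⟨p⟩ := hc.preconnected u v
    refine hv ?_
    clear hv
    induction p with
    | nil => exact hu
    | cons hab _ ih =>
      obtain ⟨-, i, ha, hb⟩ := (hadj _ _).1 hab
      exact ih (h i _ _ ha hb hu)

end

/-! ### Primitive recursive checks on lists -/

section
variable {α β γ : Type} [Primcodable α] [Primcodable β] [Primcodable γ]

attribute [fun_prop] Primrec Primrec.id Primrec.const Primrec.comp Primrec.fst Primrec.snd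
  Primrec.pair

@[fun_prop]
theorem primrec_append {f g : α → List β} (hf : Primrec f) (hg : Primrec g) :
    Primrec fun a => f a ++ g a := Primrec.list_append.comp hf hg

@[fun_prop]
theorem primrec_cons {f : α → β} {g : α → List β} (hf : Primrec f) (hg : Primrec g) :
    Primrec fun a => f a :: g a := Primrec.list_cons.comp hf hg

@[fun_prop]
theorem primrec_map {f : α → List β} {g : α → β → γ} (hf : Primrec f)
    (hg : Primrec fun p : α × β => g p.1 p.2) : Primrec fun a => (f a).map (g a) :=
  Primrec.list_map hf hg

@[fun_prop]
theorem primrec_flatMap {f : α → List β} {g : α → β → List γ} (hf : Primrec f)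
    (hg : Primrec fun p : α × β => g p.1 p.2) : Primrec fun a => (f a).flatMap (g a) :=
  Primrec.list_flatMap hf hg

@[fun_prop]
theorem primrec_foldr {f : α → List β} {g : α → γ} {h : α → β → γ → γ} (hf : Primrec f)
    (hg : Primrec g) (hh : Primrec fun p : α × (β × γ) => h p.1 p.2.1 p.2.2) :
    Primrec fun a => (f a).foldr (h a) (g a) :=
  Primrec.list_foldr (h := fun a p => h a p.1 p.2) hf hg hh

@[fun_prop]
theorem primrec_reverse {f : α → List β} (hf : Primrec f) : Primrec fun a => (f a).reverse :=
  Primrec.list_reverse.comp hf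

@[fun_prop]
theorem primrec_head? {f : α → List β} (hf : Primrec f) : Primrec fun a => (f a).head? :=
  Primrec.list_head?.comp hf

@[fun_prop]
theorem primrec_getLast? {f : α → List β} (hf : Primrec f) : Primrec fun a => (f a).getLast? := by
  simp only [List.getLast?_eq_head?_reverse]
  fun_prop

@[fun_prop]
theorem primrec_tail {f : α → List β} (hf : Primrec f) : Primrec fun a => (f a).tail :=
  Primrec.list_tail.comp hf

@[fun_prop]
theorem primrec_rotate_one {f : α → List β} (hf : Primrec f) :
    Primrec fun a => (f a).rotate 1 := by
  have h : ∀ l : List β, l.rotate 1 = l.tail ++ l.head?.toList := fun l => by cases l <;> simp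
  simp only [h]
  exact primrec_append (by fun_prop) (Primrec.optionToList.comp (by fun_prop))

@[fun_prop]
theorem primrec_getD {f : α → List β} {g : α → ℕ} {h : α → β} (hf : Primrec f) (hg : Primrec g)
    (hh : Primrec h) : Primrec fun a => (f a).getD (g a) (h a) := by
  simp only [List.getD_eq_getElem?_getD]
  exact Primrec.option_getD.comp (Primrec.list_getElem?.comp hf hg) hh

@[fun_prop]
theorem primrec_range {f : α → ℕ} (hf : Primrec f) : Primrec fun a => List.range (f a) :=
  Primrec.list_range.comp hf

@[fun_prop]
theorem primrec_some {f : α → β} (hf : Primrec f) : Primrec fun a => some (f a) :=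
  Primrec.option_some.comp hf

@[fun_prop]
theorem primrec_mod {f g : α → ℕ} (hf : Primrec f) (hg : Primrec g) :
    Primrec fun a => f a % g a := Primrec.nat_mod.comp hf hg

@[fun_prop]
theorem primrec_not {f : α → Bool} (hf : Primrec f) : Primrec fun a => !f a :=
  Primrec.not.comp hf

@[fun_prop]
theorem primrec_and {f g : α → Bool} (hf : Primrec f) (hg : Primrec g) :
    Primrec fun a => f a && g a := Primrec.and.comp hf hg

@[fun_prop]
theorem primrec_or {f g : α → Bool} (hf : Primrec f) (hg : Primrec g) :
    Primrec fun a => f a || g a := Primrec.or.comp hf hg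

@[fun_prop]
theorem primrec_decide_eq [DecidableEq β] {f g : α → β} (hf : Primrec f) (hg : Primrec g) :
    Primrec fun a => decide (f a = g a) :=
  (Primrec.eq (α := β)).decide.comp hf hg

@[fun_prop]
theorem primrec_decide_lt {f g : α → ℕ} (hf : Primrec f) (hg : Primrec g) :
    Primrec fun a => decide (f a < g a) := Primrec.nat_lt.decide.comp hf hg

@[fun_prop]
theorem primrec_cond {c : α → Bool} {f g : α → β} (hc : Primrec c) (hf : Primrec f)
    (hg : Primrec g) : Primrec fun a => bif c a then f a else g a := Primrec.cond hc hf hg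

@[fun_prop]
theorem primrec_all {f : α → List β} {g : α → β → Bool} (hf : Primrec f)
    (hg : Primrec fun p : α × β => g p.1 p.2) : Primrec fun a => (f a).all (g a) := by
  have : ∀ a, (f a).all (g a) = (f a).foldr (fun b c => g a b && c) true := fun a => by
    induction f a <;> simp_all
  simp only [this]
  fun_prop

@[fun_prop]
theorem primrec_any {f : α → List β} {g : α → β → Bool} (hf : Primrec f)
    (hg : Primrec fun p : α × β => g p.1 p.2) : Primrec fun a => (f a).any (g a) := by
  have : ∀ a, (f a).any (g a) = (f a).foldr (fun b c => g a b || c) false := fun a => by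
    induction f a <;> simp_all
  simp only [this]
  fun_prop

@[fun_prop]
theorem primrec_decide_mem [BEq β] [LawfulBEq β] {f : α → β} {g : α → List β} (hf : Primrec f)
    (hg : Primrec g) : Primrec fun a => decide (f a ∈ g a) := by
  classical
  have : ∀ a, decide (f a ∈ g a) = (g a).any fun b => decide (f a = b) := fun a => by
    rw [Bool.eq_iff_iff, decide_eq_true_iff, List.any_eq_true]
    exact ⟨fun h => ⟨_, h, decide_eq_true rfl⟩, fun ⟨b, h, h'⟩ => of_decide_eq_true h' ▸ h⟩
  simp only [this]
  fun_prop

@[fun_prop]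
theorem primrec_sublists' {f : α → List β} (hf : Primrec f) :
    Primrec fun a => (f a).sublists' := by
  have : ∀ l : List β, l.sublists' = l.foldr (fun b s => s ++ s.map (List.cons b)) [[]] := fun l => by
    induction l with
    | nil => rfl
    | cons b l ih => rw [List.sublists'_cons, List.foldr_cons, ← ih]
  simp only [this]
  fun_prop

@[fun_prop]
theorem primrec_reduce [DecidableEq β] {f : α → List (β × Bool)} (hf : Primrec f) :
    Primrec fun a => FreeGroup.reduce (f a) := by
  have : ∀ l : List (β × Bool), FreeGroup.reduce l = l.foldr (fun x r =>
      bif decide (r.head? = some (x.1, !x.2)) then r.tail else x :: r) [] := fun l => by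
    induction l with
    | nil => rfl
    | cons x l ih =>
      rw [FreeGroup.reduce.cons, List.foldr_cons, ← ih]
      cases FreeGroup.reduce l with
      | nil => rfl
      | cons y r =>
        have : (x.1 = y.1 ∧ x.2 = !y.2) ↔ y = (x.1, !x.2) := by
          rw [Prod.ext_iff, eq_comm]
          cases x.2 <;> cases y.2 <;> simp
        simp [this, Bool.cond_decide]
  simp only [this]
  fun_prop

@[fun_prop]
theorem primrec_invRev {f : α → List (β × Bool)} (hf : Primrec f) :
    Primrec fun a => FreeGroup.invRev (f a) := by
  simp only [FreeGroup.invRev]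
  fun_prop

end

/-! ### The algorithm -/

/-- Words as lists of letters `(i, true)` and `(i, false)`. -/
abbrev Code : Type := List (ℕ × Bool)

/-- The codes of the letters. -/
def letterCodes (n : ℕ) : Code := (List.range n).flatMap fun i => [(i, true), (i, false)]

/-- The line of the cyclic word `u` leaves the identity vertex in the direction `t`. -/
def endsB (t : ℕ × Bool) (u : Code) : Bool :=
  decide (u.head? = some t) || decide (u.getLast? = some (t.1, !t.2))

/-- The code of a state: the previous vertex, the next vertex, and the set of coloured lines. -/
abbrev ConfigCode : Type := (ℕ × Bool) × (ℕ × Bool) × List Code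

/-- The test for `LineIndex.Valid`. -/
def validB (n : ℕ) (R : List Code) (c : ConfigCode) : Bool :=
  !decide (c.1 = c.2.1) && (letterCodes n).all fun t => decide (t = c.1) || decide (t = c.2.1) ||
    R.all fun u => R.all fun v => !endsB t u || !endsB t v ||
      decide (decide (u ∈ c.2.2) = decide (v ∈ c.2.2))

/-- The test for `LineIndex.Trans`. -/
def transB (n : ℕ) (R : List Code) (c c' : ConfigCode) : Bool :=
  validB n R c' && decide (c'.1 = (c.2.1.1, !c.2.1.2)) && R.all fun u =>
    (!decide (u.head? = some c.2.1) ||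
      decide (decide (u ∈ c.2.2) = decide (u.rotate 1 ∈ c'.2.2))) &&
    (!decide (u.head? = some (c.2.1.1, !c.2.1.2)) ||
      decide (decide (u.rotate 1 ∈ c.2.2) = decide (u ∈ c'.2.2)))

/-- The test for `LineIndex.Toff` and `LineIndex.Foff`. -/
def offB (n : ℕ) (R : List Code) (b : Bool) (c : ConfigCode) : Bool :=
  (letterCodes n).any fun t => !decide (t = c.1) && !decide (t = c.2.1) &&
    R.any fun u => endsB t u && decide (decide (u ∈ c.2.2) = b)

/-- The codes of all the states. -/
def configCodes (n : ℕ) (R : List Code) : List ConfigCode :=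
  (letterCodes n).flatMap fun b => (letterCodes n).flatMap fun f =>
    R.sublists'.map fun s => (b, f, s)

/-- Reachability by at least one transition: every set of states that contains the successors of
`p` and is closed under transitions contains `q`. -/
def reachB (n : ℕ) (R : List Code) (p q : ConfigCode) : Bool :=
  (configCodes n R).sublists'.all fun S =>
    !((configCodes n R).all fun c => !(decide (c = p) || decide (c ∈ S)) ||
      (configCodes n R).all fun c' => !transB n R c c' || decide (c' ∈ S)) || decide (q ∈ S)

/-- The test for `LineIndex.HasCycle`. -/
def hasCycleB (n : ℕ) (R : List Code) : Bool :=
  (configCodes n R).any fun p => (configCodes n R).any fun q =>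
    offB n R true p && offB n R false q && reachB n R p q && reachB n R q p

/-- Some line joins `Y` to a vertex outside `Y` that is not `x`. -/
def crossB (n : ℕ) (R : List Code) (x : ℕ × Bool) (Y : Code) : Bool :=
  R.any fun u => (letterCodes n).any fun a => (letterCodes n).any fun b =>
    endsB a u && endsB b u && decide (a ∈ Y) && !decide (b ∈ Y) && !decide (b = x)

/-- The test for `TwoConn`. -/
def twoConnB (n : ℕ) (R : List Code) : Bool :=
  (letterCodes n).all fun x => (letterCodes n).sublists'.all fun Y =>
    decide (x ∈ Y) || !((letterCodes n).any fun y => decide (y ∈ Y)) ||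
    !((letterCodes n).any fun z => !decide (z ∈ Y) && !decide (z = x)) || crossB n R x Y

/-- The test for the Whitehead graph to be disconnected. -/
def discB (n : ℕ) (R : List Code) : Bool :=
  (letterCodes n).sublists'.any fun Y =>
    ((letterCodes n).any fun y => decide (y ∈ Y)) &&
    ((letterCodes n).any fun z => !decide (z ∈ Y)) &&
    R.all fun u => (letterCodes n).all fun a => (letterCodes n).all fun b =>
      !endsB a u || !endsB b u || !decide (a ∈ Y) || decide (b ∈ Y)

/-- Substitution of words for the letters. -/
def substC (n : ℕ) (us : List Code) (w : Code) : Code :=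
  w.flatMap fun x => bif x.2 then us.getD (x.1 % n) [] else FreeGroup.invRev (us.getD (x.1 % n) [])

/-- The composition of two substitutions is the identity. -/
def inverseB (n : ℕ) (us vs : List Code) : Bool :=
  (List.range n).all fun i => decide (FreeGroup.reduce (substC n us (vs.getD i [])) = [(i, true)])

/-- The image of `w` is conjugate to `u` by an element of the list `C`. -/
def conjB (n : ℕ) (us C : List Code) (w u : Code) : Bool :=
  C.any fun c => decide (FreeGroup.reduce (substC n us w ++ c) = FreeGroup.reduce (c ++ u))

/-- The list consists of cyclically reduced words and is closed under rotations. -/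
def rotationsB (n : ℕ) (R : List Code) : Bool :=
  R.all fun u => !decide (u = []) && decide (FreeGroup.reduce (u ++ u) = u ++ u) &&
    (u.all fun x => decide (x.1 < n)) && decide (u.rotate 1 ∈ R)

/-- A certificate: an automorphism, its inverse, a list of cyclically reduced words, and a list of
conjugating elements. -/
abbrev Certificate : Type := List Code × List Code × List Code × List Code

/-- The test for a certificate. -/
def certB (n : ℕ) (L : List Code) (c : Certificate) : Bool :=
  inverseB n c.1 c.2.1 && inverseB n c.2.1 c.1 && rotationsB n c.2.2.1 &&
  (c.2.2.1.all fun u => L.any fun w => conjB n c.1 c.2.2.2 w u) &&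
  (L.all fun w => c.2.2.1.any fun u => conjB n c.1 c.2.2.2 w u) &&
  (discB n c.2.2.1 || twoConnB n c.2.2.1)

/-- The answer that a certificate gives. -/
def answerB (n : ℕ) (R : List Code) : Bool := discB n R || hasCycleB n R

/-- The test for the input. -/
def inputB (n : ℕ) (L : List Code) : Bool :=
  decide (1 < n) && L.all fun w => !decide (w = []) && decide (FreeGroup.reduce w = w) &&
    w.all fun x => decide (x.1 < n)

section
variable {α : Type} [Primcodable α] {k : α → ℕ} {us vs R S C L : α → List Code} {u w : α → Code}
  {t : α → ℕ × Bool} {c c' : α → ConfigCode}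

@[fun_prop]
theorem primrec_letterCodes (hk : Primrec k) : Primrec fun a => letterCodes (k a) := by
  unfold letterCodes
  fun_prop

@[fun_prop]
theorem primrec_endsB (ht : Primrec t) (hu : Primrec u) : Primrec fun a => endsB (t a) (u a) := by
  unfold endsB
  fun_prop

@[fun_prop]
theorem primrec_validB (hk : Primrec k) (hR : Primrec R) (hc : Primrec c) :
    Primrec fun a => validB (k a) (R a) (c a) := by
  unfold validB
  fun_prop

@[fun_prop]
theorem primrec_transB (hk : Primrec k) (hR : Primrec R) (hc : Primrec c) (hc' : Primrec c') :
    Primrec fun a => transB (k a) (R a) (c a) (c' a) := by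
  unfold transB
  fun_prop

@[fun_prop]
theorem primrec_offB (b : Bool) (hk : Primrec k) (hR : Primrec R) (hc : Primrec c) :
    Primrec fun a => offB (k a) (R a) b (c a) := by
  unfold offB
  fun_prop

@[fun_prop]
theorem primrec_configCodes (hk : Primrec k) (hR : Primrec R) :
    Primrec fun a => configCodes (k a) (R a) := by
  unfold configCodes
  fun_prop

@[fun_prop]
theorem primrec_reachB (hk : Primrec k) (hR : Primrec R) (hc : Primrec c) (hc' : Primrec c') :
    Primrec fun a => reachB (k a) (R a) (c a) (c' a) := by
  unfold reachB
  fun_prop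

@[fun_prop]
theorem primrec_hasCycleB (hk : Primrec k) (hR : Primrec R) :
    Primrec fun a => hasCycleB (k a) (R a) := by
  unfold hasCycleB
  fun_prop

@[fun_prop]
theorem primrec_crossB (hk : Primrec k) (hR : Primrec R) (ht : Primrec t) (hw : Primrec w) :
    Primrec fun a => crossB (k a) (R a) (t a) (w a) := by
  unfold crossB
  fun_prop

@[fun_prop]
theorem primrec_twoConnB (hk : Primrec k) (hR : Primrec R) :
    Primrec fun a => twoConnB (k a) (R a) := by
  unfold twoConnB
  fun_prop

@[fun_prop]
theorem primrec_discB (hk : Primrec k) (hR : Primrec R) :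
    Primrec fun a => discB (k a) (R a) := by
  unfold discB
  fun_prop

@[fun_prop]
theorem primrec_substC (hk : Primrec k) (hus : Primrec us) (hw : Primrec w) :
    Primrec fun a => substC (k a) (us a) (w a) := by
  unfold substC
  fun_prop

@[fun_prop]
theorem primrec_inverseB (hk : Primrec k) (hus : Primrec us) (hvs : Primrec vs) :
    Primrec fun a => inverseB (k a) (us a) (vs a) := by
  unfold inverseB
  fun_prop

@[fun_prop]
theorem primrec_conjB (hk : Primrec k) (hus : Primrec us) (hC : Primrec C) (hw : Primrec w)
    (hu : Primrec u) : Primrec fun a => conjB (k a) (us a) (C a) (w a) (u a) := by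
  unfold conjB
  fun_prop

@[fun_prop]
theorem primrec_rotationsB (hk : Primrec k) (hR : Primrec R) :
    Primrec fun a => rotationsB (k a) (R a) := by
  unfold rotationsB
  fun_prop

@[fun_prop]
theorem primrec_certB {c : α → Certificate} (hk : Primrec k) (hL : Primrec L) (hc : Primrec c) :
    Primrec fun a => certB (k a) (L a) (c a) := by
  unfold certB
  fun_prop

@[fun_prop]
theorem primrec_answerB (hk : Primrec k) (hR : Primrec R) :
    Primrec fun a => answerB (k a) (R a) := by
  unfold answerB
  fun_prop

@[fun_prop]
theorem primrec_inputB (hk : Primrec k) (hL : Primrec L) :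
    Primrec fun a => inputB (k a) (L a) := by
  unfold inputB
  fun_prop

end

/-- One step of the search for a certificate. -/
def searchStep (x : ℕ × List Code) (m : ℕ) : Option Bool :=
  bif inputB x.1 x.2 then
    (Encodable.decode (α := Certificate) m).bind fun c =>
      bif certB x.1 x.2 c then some (answerB x.1 c.2.2.1) else none
  -- Inadmissible inputs are answered at once, which makes the search total.
  else some false

theorem primrec_searchStep : Primrec₂ searchStep := by
  unfold searchStep
  refine primrec_cond (by fun_prop) ?_ (by fun_prop)
  exact Primrec.option_bind (Primrec.decode.comp Primrec.snd)
    (g := fun (a : (ℕ × List Code) × ℕ) (c : Certificate) =>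
      bif certB a.1.1 a.1.2 c then some (answerB a.1.1 c.2.2.1) else none)
    (show Primrec _ by fun_prop)

/-- If certificates are correct and always exist, then the search computes the predicate. -/
theorem exists_computable (P : ℕ × List Code → Prop)
    (h1 : ∀ x : ℕ × List Code, inputB x.1 x.2 → ∀ c, certB x.1 x.2 c → (answerB x.1 c.2.2.1 ↔ P x))
    (h2 : ∀ x : ℕ × List Code, inputB x.1 x.2 → ∃ c, certB x.1 x.2 c) :
    ∃ f : ℕ × List Code → Bool, Computable f ∧ ∀ x, inputB x.1 x.2 → (f x = true ↔ P x) := by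
  have hd : ∀ x, (Nat.rfindOpt (searchStep x)).Dom := fun x => by
    rw [Nat.rfindOpt_dom]
    by_cases hx : inputB x.1 x.2 = true
    · obtain ⟨c, hc⟩ := h2 x hx
      exact ⟨Encodable.encode c, answerB x.1 c.2.2.1, by simp [searchStep, hx, hc]⟩
    · exact ⟨0, false, by simp [searchStep, hx]⟩
  refine ⟨fun x => (Nat.rfindOpt (searchStep x)).get (hd x),
    (Partrec.rfindOpt primrec_searchStep.to_comp).of_eq fun x => (Part.some_get _).symm,
    fun x hx => ?_⟩
  obtain ⟨m, hm⟩ := Nat.rfindOpt_spec (Part.get_mem (hd x))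
  simp only [searchStep, hx, cond_true, Option.mem_def, Option.bind_eq_some_iff] at hm
  obtain ⟨c, -, hc⟩ := hm
  by_cases hc' : certB x.1 x.2 c = true
  · rw [hc', cond_true, Option.some_inj] at hc
    rw [← h1 x hx c hc', hc]
  · simp [hc'] at hc

/-! ### Correctness of the tests -/

/-- The code of a letter. -/
def enc (y : Letter n) : ℕ × Bool := (y.1.val, y.2)

/-- The letter with the given code. -/
def dec [NeZero n] (x : ℕ × Bool) : Letter n := (Fin.ofNat n x.1, x.2)

theorem dec_enc [NeZero n] (y : Letter n) : dec (enc y) = y := by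
  simp [dec, enc]

theorem enc_injective : Function.Injective (enc : Letter n → ℕ × Bool) := fun a b h => by
  simp only [enc, Prod.mk.injEq] at h
  exact Prod.ext (Fin.ext h.1) h.2

theorem mem_letterCodes {x : ℕ × Bool} : x ∈ letterCodes n ↔ x.1 < n := by
  obtain ⟨i, b⟩ := x
  cases b <;> simp [letterCodes]

theorem enc_mem_letterCodes (y : Letter n) : enc y ∈ letterCodes n := mem_letterCodes.2 y.1.2

theorem exists_enc {x : ℕ × Bool} (hx : x ∈ letterCodes n) : ∃ y : Letter n, enc y = x :=
  ⟨(⟨x.1, mem_letterCodes.1 hx⟩, x.2), rfl⟩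

theorem all_letterCodes {p : ℕ × Bool → Bool} :
    (letterCodes n).all p = true ↔ ∀ y : Letter n, p (enc y) = true := by
  rw [List.all_eq_true]
  refine ⟨fun h y => h _ (enc_mem_letterCodes y), fun h x hx => ?_⟩
  obtain ⟨y, rfl⟩ := exists_enc hx
  exact h y

theorem any_letterCodes {p : ℕ × Bool → Bool} :
    (letterCodes n).any p = true ↔ ∃ y : Letter n, p (enc y) = true := by
  rw [List.any_eq_true]
  refine ⟨fun ⟨x, hx, h⟩ => ?_, fun ⟨y, h⟩ => ⟨_, enc_mem_letterCodes y, h⟩⟩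
  obtain ⟨y, rfl⟩ := exists_enc hx
  exact ⟨y, h⟩

theorem exists_mem_sublists' {α : Type*} (l : List α) (p : α → Prop) :
    ∃ s ∈ l.sublists', ∀ a ∈ l, a ∈ s ↔ p a := by
  classical
  exact ⟨l.filter p, List.mem_sublists'.2 List.filter_sublist, fun a ha => by simp [ha]⟩

theorem exists_letters (Y : Set (Letter n)) :
    ∃ s ∈ (letterCodes n).sublists', ∀ y, enc y ∈ s ↔ y ∈ Y := by
  obtain ⟨s, hs, h⟩ := exists_mem_sublists' (letterCodes n) fun x => ∃ y ∈ Y, enc y = x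
  refine ⟨s, hs, fun y => (h _ (enc_mem_letterCodes y)).trans ⟨?_, fun hy => ⟨y, hy, rfl⟩⟩⟩
  rintro ⟨z, hz, hzy⟩
  rwa [← enc_injective hzy]

/-- Reachability is detected by closed sublists. -/
theorem transGen_iff_sublists {α β : Type*} {C : List α} {d : α → β} (hd : ∀ b, ∃ a ∈ C, d a = b)
    {r : α → α → Prop} {s : β → β → Prop} (h : ∀ a ∈ C, ∀ a' ∈ C, r a a' ↔ s (d a) (d a'))
    {p q : α} (hp : p ∈ C) (hq : q ∈ C) : Relation.TransGen s (d p) (d q) ↔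
      ∀ S ∈ C.sublists', (∀ a ∈ C, a = p ∨ a ∈ S → ∀ a' ∈ C, r a a' → a' ∈ S) → q ∈ S := by
  constructor
  · intro ht S _ hS
    have : ∀ b, Relation.TransGen s (d p) b → ∀ a ∈ C, d a = b → a ∈ S := by
      intro b hb
      induction hb with
      | single hb => exact fun a ha hab => hS p hp (Or.inl rfl) a ha ((h p hp a ha).2 (hab ▸ hb))
      | tail _ hb ih =>
        intro a ha hab
        obtain ⟨a', ha', hb'⟩ := hd _
        exact hS a' ha' (Or.inr (ih a' ha' hb')) a ha ((h a' ha' a ha).2 (by rwa [hab, hb']))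
    exact this _ ht q hq rfl
  · intro hS
    obtain ⟨S, hSC, hS'⟩ := exists_mem_sublists' C fun a => Relation.TransGen s (d p) (d a)
    refine (hS' q hq).1 (hS S hSC fun a ha hap a' ha' hr => (hS' a' ha').2 ?_)
    have hs := (h a ha a' ha').1 hr
    rcases hap with rfl | haS
    · exact Relation.TransGen.single hs
    · exact ((hS' a ha).1 haS).tail hs

/-- The value of a word. -/
def valC [NeZero n] (u : Code) : FreeGroup (Fin n) := FreeGroup.mk (u.map dec)

theorem exists_map_enc {u : Code} (hu : ∀ x ∈ u, x.1 < n) :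
    ∃ u' : List (Letter n), u'.map enc = u := by
  induction u with
  | nil => exact ⟨[], rfl⟩
  | cons x u ih =>
    obtain ⟨u', rfl⟩ := ih fun y hy => hu y (List.mem_cons_of_mem _ hy)
    exact ⟨(⟨x.1, hu x List.mem_cons_self⟩, x.2) :: u', rfl⟩

theorem map_dec_map_enc [NeZero n] (u : List (Letter n)) : (u.map enc).map dec = u := by
  rw [List.map_map]
  exact (List.map_congr_left fun y _ => dec_enc y).trans (List.map_id _)

theorem isReduced_map_enc {u : List (Letter n)} :
    FreeGroup.IsReduced (u.map enc) ↔ FreeGroup.IsReduced u := by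
  rw [FreeGroup.IsReduced, FreeGroup.IsReduced, List.isChain_map]
  simp [enc, Fin.val_inj]

/-- The condition on the last and the first letter is the one at the seam of `u ++ u`, and free
reduction can test it. -/
theorem isCyclicallyReduced_iff {u : List (Letter n)} :
    FreeGroup.IsCyclicallyReduced u ↔ FreeGroup.IsReduced (u ++ u) := by
  rw [FreeGroup.IsCyclicallyReduced, FreeGroup.IsReduced, FreeGroup.IsReduced,
    List.isChain_append]
  tauto

section
variable {R : List Code} (hR : rotationsB n R = true)
include hR

theorem exists_of_mem_rotations {u : Code} (hu : u ∈ R) : ∃ u' : List (Letter n),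
    u'.map enc = u ∧ u' ≠ [] ∧ FreeGroup.IsCyclicallyReduced u' := by
  have h := List.all_eq_true.1 hR u hu
  simp only [Bool.and_eq_true, Bool.not_eq_true', decide_eq_false_iff_not, decide_eq_true_eq,
    List.all_eq_true] at h
  obtain ⟨u', rfl⟩ := exists_map_enc h.1.2
  refine ⟨u', rfl, by simpa using h.1.1.1, isCyclicallyReduced_iff.2 ?_⟩
  rw [← isReduced_map_enc, List.map_append]
  exact FreeGroup.IsReduced.of_reduce_eq h.1.1.2

theorem rotate_mem_rotations {u : Code} (hu : u ∈ R) : u.rotate 1 ∈ R := by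
  have h := List.all_eq_true.1 hR u hu
  simp only [Bool.and_eq_true, decide_eq_true_eq] at h
  exact h.2

variable [NeZero n] {V : List (FreeGroup (Fin n))} (hmem : ∀ u ∈ R, ∃ v ∈ V, IsConj v (valC u))
  (hsurj : ∀ v ∈ V, ∃ u ∈ R, IsConj v (valC u))

theorem map_enc_map_dec {u : Code} (hu : u ∈ R) : (u.map (dec (n := n))).map enc = u := by
  obtain ⟨u', rfl, -⟩ := exists_of_mem_rotations hR hu
  rw [map_dec_map_enc]

/-- The rotation system of a list of words. -/
def rotationSystem : RotationSystem V {u // u ∈ R} where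
  word u := u.1.map dec
  ne_nil u := by
    obtain ⟨u', h, h1, -⟩ := exists_of_mem_rotations hR u.2
    rwa [← h, map_dec_map_enc]
  cyc u := by
    obtain ⟨u', h, -, h2⟩ := exists_of_mem_rotations hR u.2
    rwa [← h, map_dec_map_enc]
  inj u v h := Subtype.ext <| by
    rw [← map_enc_map_dec hR u.2, ← map_enc_map_dec hR v.2]
    exact congrArg _ h
  next u := ⟨u.1.rotate 1, rotate_mem_rotations hR u.2⟩
  word_next u := List.map_rotate _ _ _
  mem u := hmem u.1 u.2
  surj v hv := by
    obtain ⟨u, hu, h⟩ := hsurj v hv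
    exact ⟨⟨u, hu⟩, h⟩

theorem head?_dec {u : Code} (hu : u ∈ R) {t : Letter n} :
    (u.map dec).head? = some t ↔ u.head? = some (enc t) := by
  conv_rhs => rw [← map_enc_map_dec hR hu]
  rw [List.head?_map (f := enc), Option.map_eq_some_iff]
  exact ⟨fun h => ⟨t, h, rfl⟩, fun ⟨y, h, hy⟩ => enc_injective hy ▸ h⟩

theorem getLast?_dec {u : Code} (hu : u ∈ R) {t : Letter n} :
    (u.map dec).getLast? = some t ↔ u.getLast? = some (enc t) := by
  conv_rhs => rw [← map_enc_map_dec hR hu]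
  rw [List.getLast?_map (f := enc), Option.map_eq_some_iff]
  exact ⟨fun h => ⟨t, h, rfl⟩, fun ⟨y, h, hy⟩ => enc_injective hy ▸ h⟩

theorem endsB_iff (u : {u // u ∈ R}) (t : Letter n) :
    endsB (enc t) u.1 = true ↔ t.elt ∈ (rotationSystem hR hmem hsurj).lineIndex.ln u := by
  rw [RotationSystem.elt_mem_ln, RotationSystem.Ends, endsB, Bool.or_eq_true, decide_eq_true_eq,
    decide_eq_true_eq]
  exact or_congr (head?_dec hR u.2).symm (getLast?_dec hR u.2 (t := t.bar)).symm

omit hR in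
theorem all_iff_subtype {p : Code → Bool} : R.all p = true ↔ ∀ u : {u // u ∈ R}, p u.1 = true := by
  rw [List.all_eq_true, Subtype.forall]

omit hR in
theorem any_iff_subtype {p : Code → Bool} : R.any p = true ↔ ∃ u : {u // u ∈ R}, p u.1 = true := by
  rw [List.any_eq_true, Subtype.exists]
  simp only [exists_prop]

omit hR in
/-- The state with the given code. -/
def decConfig (R : List Code) (c : ConfigCode) : Config n {u // u ∈ R} :=
  ⟨dec c.1, dec c.2.1, {u | u.1 ∈ c.2.2}⟩

omit hR in
theorem exists_configCode (c : Config n {u // u ∈ R}) :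
    ∃ k ∈ configCodes n R, decConfig R k = c := by
  obtain ⟨s, hs, h⟩ := exists_mem_sublists' R fun u => ∃ hu : u ∈ R, ⟨u, hu⟩ ∈ c.col
  refine ⟨(enc c.back, enc c.fwd, s), ?_, Config.ext (dec_enc _) (dec_enc _) ?_⟩
  · simp only [configCodes, List.mem_flatMap, List.mem_map]
    exact ⟨_, enc_mem_letterCodes _, _, enc_mem_letterCodes _, s, hs, rfl⟩
  · ext u
    exact (h u.1 u.2).trans ⟨fun ⟨_, hu⟩ => hu, fun hu => ⟨u.2, hu⟩⟩

omit hR [NeZero n] in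
theorem exists_eq_of_mem_configCodes {k : ConfigCode} (hk : k ∈ configCodes n R) :
    ∃ (b f : Letter n) (s : List Code), k = (enc b, enc f, s) := by
  simp only [configCodes, List.mem_flatMap, List.mem_map] at hk
  obtain ⟨b, hb, f, hf, s, -, rfl⟩ := hk
  obtain ⟨b, rfl⟩ := exists_enc hb
  obtain ⟨f, rfl⟩ := exists_enc hf
  exact ⟨b, f, s, rfl⟩

omit hR in
theorem decConfig_mk (b f : Letter n) (s : List Code) :
    decConfig R (enc b, enc f, s) = ⟨b, f, {u | u.1 ∈ s}⟩ := by
  rw [decConfig, dec_enc, dec_enc]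

theorem validB_iff {k : ConfigCode} (hk : k ∈ configCodes n R) :
    validB n R k = true ↔ (rotationSystem hR hmem hsurj).lineIndex.Valid (decConfig R k) := by
  obtain ⟨b, f, s, rfl⟩ := exists_eq_of_mem_configCodes hk
  rw [decConfig_mk, validB, LineIndex.Valid, Bool.and_eq_true, all_letterCodes]
  refine and_congr (by simp [enc_injective.eq_iff]) (forall_congr' fun t => ?_)
  simp only [Bool.or_eq_true, all_iff_subtype, Bool.not_eq_true', decide_eq_true_eq,
    enc_injective.eq_iff, ← endsB_iff hR hmem hsurj, decide_eq_decide, Set.mem_ofPred_eq,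
    ← Bool.not_eq_true]
  refine ⟨fun h h1 h2 u v hu hv => ?_, fun h => ?_⟩
  · exact ((h.resolve_left (not_or.2 ⟨h1, h2⟩)) u v).resolve_left (by simp [hu, hv])
  · by_cases h1 : t = b ∨ t = f
    · exact Or.inl h1
    · rw [not_or] at h1
      refine Or.inr fun u v => or_iff_not_imp_left.2 fun h' => ?_
      rw [not_or, not_not, not_not] at h'
      exact h h1.1 h1.2 u v h'.1 h'.2

theorem transB_iff {k k' : ConfigCode} (hk : k ∈ configCodes n R) (hk' : k' ∈ configCodes n R) :
    transB n R k k' = true ↔ (rotationSystem hR hmem hsurj).lineIndex.Trans (decConfig R k) (decConfig R k') := by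
  rw [RotationSystem.trans_iff, ← validB_iff hR hmem hsurj hk', transB, Bool.and_eq_true,
    Bool.and_eq_true, and_assoc, all_iff_subtype]
  obtain ⟨b, f, s, rfl⟩ := exists_eq_of_mem_configCodes hk
  obtain ⟨b', f', s', rfl⟩ := exists_eq_of_mem_configCodes hk'
  rw [decConfig_mk, decConfig_mk]
  refine and_congr_right fun _ => and_congr ?_ (forall_congr' fun u => ?_)
  · rw [decide_eq_true_eq]
    exact enc_injective.eq_iff (b := f.bar)
  · simp only [Bool.and_eq_true, Bool.or_eq_true, Bool.not_eq_true', decide_eq_false_iff_not,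
      decide_eq_true_eq, decide_eq_decide, ← imp_iff_not_or]
    refine and_congr (imp_congr (head?_dec hR u.2).symm Iff.rfl)
      (imp_congr (head?_dec hR u.2 (t := f.bar)).symm Iff.rfl)

theorem offB_true_iff {k : ConfigCode} (hk : k ∈ configCodes n R) :
    offB n R true k = true ↔ (rotationSystem hR hmem hsurj).lineIndex.Toff (decConfig R k) := by
  obtain ⟨b, f, s, rfl⟩ := exists_eq_of_mem_configCodes hk
  rw [decConfig_mk, offB, LineIndex.Toff, any_letterCodes]
  simp only [Bool.and_eq_true, any_iff_subtype, Bool.not_eq_true', decide_eq_true_eq,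
    enc_injective.eq_iff, ← endsB_iff hR hmem hsurj, decide_eq_false_iff_not, Set.mem_ofPred_eq,
    and_assoc, ne_eq]

theorem offB_false_iff {k : ConfigCode} (hk : k ∈ configCodes n R) :
    offB n R false k = true ↔ (rotationSystem hR hmem hsurj).lineIndex.Foff (decConfig R k) := by
  obtain ⟨b, f, s, rfl⟩ := exists_eq_of_mem_configCodes hk
  rw [decConfig_mk, offB, LineIndex.Foff, any_letterCodes]
  simp only [Bool.and_eq_true, any_iff_subtype, Bool.not_eq_true', decide_eq_true_eq,
    enc_injective.eq_iff, ← endsB_iff hR hmem hsurj, decide_eq_false_iff_not, Set.mem_ofPred_eq,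
    and_assoc, ne_eq]

theorem reachB_iff {p q : ConfigCode} (hp : p ∈ configCodes n R) (hq : q ∈ configCodes n R) :
    reachB n R p q = true ↔
      Relation.TransGen (rotationSystem hR hmem hsurj).lineIndex.Trans (decConfig R p) (decConfig R q) := by
  rw [transGen_iff_sublists exists_configCode (fun a ha a' ha' =>
    transB_iff hR hmem hsurj ha ha') hp hq, reachB, List.all_eq_true]
  refine forall₂_congr fun S _ => ?_
  rw [Bool.or_eq_true, Bool.not_eq_true', ← Bool.not_eq_true, ← imp_iff_not_or, decide_eq_true_eq,
    List.all_eq_true]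
  refine imp_congr_left (forall₂_congr fun a _ => ?_)
  rw [Bool.or_eq_true, Bool.not_eq_true', ← Bool.not_eq_true, ← imp_iff_not_or, Bool.or_eq_true,
    decide_eq_true_eq, decide_eq_true_eq, List.all_eq_true]
  refine imp_congr_right fun _ => forall₂_congr fun a' _ => ?_
  rw [Bool.or_eq_true, Bool.not_eq_true', ← Bool.not_eq_true, ← imp_iff_not_or, decide_eq_true_eq]

theorem hasCycleB_iff : hasCycleB n R = true ↔ (rotationSystem hR hmem hsurj).lineIndex.HasCycle := by
  rw [hasCycleB, List.any_eq_true]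
  simp only [List.any_eq_true, Bool.and_eq_true]
  constructor
  · rintro ⟨p, hp, q, hq, ⟨⟨h1, h2⟩, h3⟩, h4⟩
    exact ⟨_, _, (offB_true_iff hR hmem hsurj hp).1 h1, (offB_false_iff hR hmem hsurj hq).1 h2,
      (reachB_iff hR hmem hsurj hp hq).1 h3, (reachB_iff hR hmem hsurj hq hp).1 h4⟩
  · rintro ⟨p, q, h1, h2, h3, h4⟩
    obtain ⟨p, hp, rfl⟩ := exists_configCode p
    obtain ⟨q, hq, rfl⟩ := exists_configCode q
    exact ⟨p, hp, q, hq, ⟨⟨(offB_true_iff hR hmem hsurj hp).2 h1,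
      (offB_false_iff hR hmem hsurj hq).2 h2⟩, (reachB_iff hR hmem hsurj hp hq).2 h3⟩,
      (reachB_iff hR hmem hsurj hq hp).2 h4⟩

omit hR [NeZero n] in
theorem forall_letters {P : Code → Prop} {Q : Set (Letter n) → Prop}
    (h : ∀ s Y, (∀ y, enc y ∈ s ↔ y ∈ Y) → (P s ↔ Q Y)) :
    (∀ s ∈ (letterCodes n).sublists', P s) ↔ ∀ Y, Q Y := by
  constructor
  · intro hP Y
    obtain ⟨s, hs, hY⟩ := exists_letters Y
    exact (h s Y hY).1 (hP s hs)
  · exact fun hQ s _ => (h s {y | enc y ∈ s} fun _ => Iff.rfl).2 (hQ _)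

theorem crossB_iff {x : Letter n} {s : Code} {Y : Set (Letter n)} (hY : ∀ y, enc y ∈ s ↔ y ∈ Y) :
    crossB n R (enc x) s = true ↔ ∃ i a b, a.elt ∈ (rotationSystem hR hmem hsurj).lineIndex.ln i ∧ b.elt ∈ (rotationSystem hR hmem hsurj).lineIndex.ln i ∧ a ∈ Y ∧
      b ∉ Y ∧ b ≠ x := by
  simp only [crossB, any_iff_subtype, any_letterCodes, Bool.and_eq_true, Bool.not_eq_true',
    decide_eq_true_eq, decide_eq_false_iff_not, enc_injective.eq_iff,
    ← endsB_iff hR hmem hsurj, hY, and_assoc, ne_eq]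

include hmem hsurj in
theorem twoConnB_iff (hV : ∀ v ∈ V, v ≠ 1) : twoConnB n R = true ↔ TwoConn V := by
  rw [LineIndex.twoConn_iff hV (rotationSystem hR hmem hsurj).lineIndex, twoConnB, all_letterCodes]
  refine forall_congr' fun x => ?_
  rw [List.all_eq_true]
  refine forall_letters fun s Y hY => ?_
  rw [← crossB_iff hR hmem hsurj hY]
  simp only [Bool.or_eq_true, Bool.not_eq_true', ← Bool.not_eq_true, any_letterCodes,
    Bool.and_eq_true, decide_eq_true_eq, enc_injective.eq_iff, hY, Set.Nonempty, ne_eq]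
  rw [or_assoc, or_assoc, or_iff_not_imp_left, ← imp_iff_not_or, ← imp_iff_not_or]

include hmem hsurj in
theorem discB_iff (hV : ∀ v ∈ V, v ≠ 1) (hn : 1 ≤ n) :
    discB n R = true ↔ ¬ (whiteheadGraph V).Connected := by
  rw [LineIndex.not_connected_iff hV (rotationSystem hR hmem hsurj).lineIndex hn, discB,
    ← not_iff_not, Bool.not_eq_true, List.any_eq_false, not_exists]
  refine forall_letters fun s Y hY => not_congr ?_
  simp only [Bool.or_eq_true, Bool.not_eq_true', ← Bool.not_eq_true, any_letterCodes,
    all_letterCodes, all_iff_subtype, Bool.and_eq_true, decide_eq_true_eq, hY, Set.Nonempty,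
    ← endsB_iff hR hmem hsurj, and_assoc]
  refine and_congr_right fun _ => and_congr_right fun _ => forall_congr' fun i =>
    forall_congr' fun a => forall_congr' fun b => ?_
  tauto

end

/-! ### Certificates -/

/-- The code of a group element. -/
def encW (g : FreeGroup (Fin n)) : Code := g.toWord.map enc

theorem encodeWords_eq (W : List (FreeGroup (Fin n))) : encodeWords W = W.map encW := rfl

theorem lt_of_mem_encW {g : FreeGroup (Fin n)} : ∀ x ∈ encW g, x.1 < n := fun x hx => by
  obtain ⟨y, -, rfl⟩ := List.mem_map.1 hx
  exact y.1.2

theorem reduce_map_enc {u v : List (Letter n)} (h : FreeGroup.mk u = FreeGroup.mk v) :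
    FreeGroup.reduce (u.map enc) = FreeGroup.reduce (v.map enc) := by
  have := congrArg (FreeGroup.map (Fin.val : Fin n → ℕ)) h
  rw [FreeGroup.map.mk, FreeGroup.map.mk] at this
  exact FreeGroup.reduce.sound this

section
variable [NeZero n]

theorem valC_encW (g : FreeGroup (Fin n)) : valC (encW g) = g := by
  rw [valC, encW, map_dec_map_enc, FreeGroup.mk_toWord]

theorem valC_append (u v : Code) : (valC (u ++ v) : FreeGroup (Fin n)) = valC u * valC v := by
  rw [valC, valC, valC, List.map_append, FreeGroup.mul_mk]

theorem valC_invRev (u : Code) : (valC (FreeGroup.invRev u) : FreeGroup (Fin n)) = (valC u)⁻¹ := by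
  rw [valC, valC, FreeGroup.inv_mk, FreeGroup.invRev, FreeGroup.invRev, List.map_reverse,
    List.map_map, List.map_map]
  rfl

theorem valC_eq_of_reduce {u v : Code} (h : FreeGroup.reduce u = FreeGroup.reduce v) :
    (valC u : FreeGroup (Fin n)) = valC v := by
  have := congrArg (FreeGroup.map (Fin.ofNat n)) (FreeGroup.reduce.exact h)
  rwa [FreeGroup.map.mk, FreeGroup.map.mk] at this

theorem reduce_eq_of_valC {u v : Code} (hu : ∀ x ∈ u, x.1 < n) (hv : ∀ x ∈ v, x.1 < n)
    (h : (valC u : FreeGroup (Fin n)) = valC v) : FreeGroup.reduce u = FreeGroup.reduce v := by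
  obtain ⟨u, rfl⟩ := exists_map_enc hu
  obtain ⟨v, rfl⟩ := exists_map_enc hv
  rw [valC, valC, map_dec_map_enc, map_dec_map_enc] at h
  exact reduce_map_enc h

/-- The endomorphism that is given by a list of words. -/
def substHom (us : List Code) : FreeGroup (Fin n) →* FreeGroup (Fin n) :=
  FreeGroup.lift fun i => valC (us.getD i.val [])

theorem substHom_valC (us : List Code) (w : Code) :
    substHom us (valC w) = (valC (substC n us w) : FreeGroup (Fin n)) := by
  induction w with
  | nil => exact map_one _
  | cons x w ih =>
    have h1 : (valC (x :: w) : FreeGroup (Fin n)) = FreeGroup.mk [dec x] * valC w := by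
      rw [valC, valC, FreeGroup.mul_mk]
      rfl
    have h2 : substC n us (x :: w) = (bif x.2 then us.getD (x.1 % n) [] else
      FreeGroup.invRev (us.getD (x.1 % n) [])) ++ substC n us w := rfl
    rw [h1, h2, map_mul, ih, valC_append]
    congr 1
    obtain ⟨i, b⟩ := x
    cases b
    · have : (FreeGroup.mk [dec (i, false)] : FreeGroup (Fin n)) =
        (FreeGroup.of (Fin.ofNat n i))⁻¹ := rfl
      rw [this, map_inv, substHom, FreeGroup.lift_apply_of, cond_false, valC_invRev]
      rfl
    · have : (FreeGroup.mk [dec (i, true)] : FreeGroup (Fin n)) =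
        FreeGroup.of (Fin.ofNat n i) := rfl
      rw [this, substHom, FreeGroup.lift_apply_of, cond_true]
      rfl

theorem substHom_comp {us vs : List Code} (h : inverseB n us vs = true) :
    (substHom us).comp (substHom vs) = MonoidHom.id (FreeGroup (Fin n)) := by
  ext i
  have := of_decide_eq_true (List.all_eq_true.1 h i.val (List.mem_range.2 i.2))
  rw [MonoidHom.comp_apply, substHom.eq_def vs, FreeGroup.lift_apply_of, substHom_valC,
    valC_eq_of_reduce (v := [(i.val, true)]) (this.trans rfl)]
  change FreeGroup.mk [dec (enc (i, true))] = _
  rw [dec_enc]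
  rfl

theorem isConj_of_conjB {us C : List Code} {w u : Code} (h : conjB n us C w u = true) :
    IsConj (substHom us (valC w) : FreeGroup (Fin n)) (valC u) := by
  obtain ⟨c, -, hc⟩ := List.any_eq_true.1 h
  have := valC_eq_of_reduce (n := n) (of_decide_eq_true hc)
  rw [valC_append, valC_append, ← substHom_valC] at this
  exact isConj_iff.2 ⟨(valC c)⁻¹, by rw [inv_inv, mul_assoc, this, inv_mul_cancel_left]⟩

theorem map_valC_encodeWords (W : List (FreeGroup (Fin n))) : (encodeWords W).map valC = W := by
  rw [encodeWords_eq, List.map_map]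
  exact (List.map_congr_left fun w _ => valC_encW w).trans (List.map_id _)

/-- A certificate gives the right answer. -/
theorem answerB_iff (hn : 2 ≤ n) {W : List (FreeGroup (Fin n))} (hW : ∀ w ∈ W, w ≠ 1)
    {c : Certificate} (hc : certB n (encodeWords W) c = true) :
    answerB n c.2.2.1 = true ↔ HasCutPairs (DecompositionSpace W) := by
  obtain ⟨us, vs, R, C⟩ := c
  simp only [certB, Bool.and_eq_true] at hc
  obtain ⟨⟨⟨⟨⟨h1, h2⟩, hR⟩, h3⟩, h4⟩, h5⟩ := hc
  let φ : FreeGroup (Fin n) ≃* FreeGroup (Fin n) :=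
    MonoidHom.toMulEquiv (substHom us) (substHom vs) (substHom_comp h2) (substHom_comp h1)
  have hV := map_ne_one hW φ
  have hval : ∀ w ∈ encodeWords W, (valC w : FreeGroup (Fin n)) ∈ W := fun w hw =>
    map_valC_encodeWords W ▸ List.mem_map_of_mem hw
  have hmem : ∀ u ∈ R, ∃ v ∈ W.map φ, IsConj v (valC u) := fun u hu => by
    obtain ⟨w, hw, h⟩ := List.any_eq_true.1 (List.all_eq_true.1 h3 u hu)
    exact ⟨_, List.mem_map_of_mem (hval w hw), isConj_of_conjB h⟩
  have hsurj : ∀ v ∈ W.map φ, ∃ u ∈ R, IsConj v (valC u) := fun v hv => by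
    obtain ⟨w, hw, rfl⟩ := List.mem_map.1 hv
    obtain ⟨u, hu, h⟩ := List.any_eq_true.1 (List.all_eq_true.1 h4 (encW w) (List.mem_map_of_mem hw))
    have := isConj_of_conjB h
    rw [valC_encW] at this
    exact ⟨u, hu, this⟩
  rw [← hasCutPairs_map hW (by omega) φ, answerB, Bool.or_eq_true]
  -- The certificate ensures that the Whitehead graph is disconnected or satisfies `TwoConn`; in the
  -- second case closed paths of states decide.
  by_cases hd : discB n R = true
  · refine iff_of_true (Or.inl hd) (Or.inl ?_)
    rw [connectedSpace_iff (by omega), not_not]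
    exact separable_of_not_connected hV (by omega) ((discB_iff hR hmem hsurj hV (by omega)).1 hd)
  · have hT := (twoConnB_iff hR hmem hsurj hV).1 (by simpa [hd] using h5)
    rw [hasCutPairs_iff hV hT hn (rotationSystem hR hmem hsurj).lineIndex, hasCycleB_iff hR hmem hsurj,
      or_iff_right hd]

/-- The list of the images of the basis. -/
def imageCodes (φ : FreeGroup (Fin n) →* FreeGroup (Fin n)) : List Code :=
  (List.finRange n).map fun i => encW (φ (FreeGroup.of i))

omit [NeZero n] in
theorem imageCodes_getD (φ : FreeGroup (Fin n) →* FreeGroup (Fin n)) (i : Fin n) :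
    (imageCodes φ).getD i.val [] = encW (φ (FreeGroup.of i)) := by
  simp [imageCodes, List.getD_eq_getElem?_getD]

theorem substHom_imageCodes (φ : FreeGroup (Fin n) →* FreeGroup (Fin n)) :
    substHom (imageCodes φ) = φ := by
  ext i
  rw [substHom, FreeGroup.lift_apply_of, imageCodes_getD, valC_encW]

theorem lt_of_mem_substC (φ : FreeGroup (Fin n) →* FreeGroup (Fin n)) (w : Code) :
    ∀ x ∈ substC n (imageCodes φ) w, x.1 < n := by
  intro x hx
  obtain ⟨y, -, hy⟩ := List.mem_flatMap.1 hx
  have hi := imageCodes_getD φ (Fin.ofNat n y.1)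
  change (imageCodes φ).getD (y.1 % n) [] = _ at hi
  rw [hi] at hy
  cases h : y.2 <;> rw [h] at hy
  · rw [cond_false, FreeGroup.invRev, List.mem_reverse, List.mem_map] at hy
    obtain ⟨z, hz, rfl⟩ := hy
    exact lt_of_mem_encW z hz
  · exact lt_of_mem_encW x hy

theorem inverseB_imageCodes {φ ψ : FreeGroup (Fin n) →* FreeGroup (Fin n)}
    (h : φ.comp ψ = MonoidHom.id _) : inverseB n (imageCodes φ) (imageCodes ψ) = true := by
  rw [inverseB, List.all_eq_true]
  intro i hi
  rw [decide_eq_true_eq]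
  refine (reduce_eq_of_valC (n := n) (v := [(i, true)]) (lt_of_mem_substC φ _) ?_ ?_).trans rfl
  · simpa using List.mem_range.1 hi
  · rw [← substHom_valC, substHom_imageCodes, imageCodes_getD ψ ⟨i, List.mem_range.1 hi⟩, valC_encW,
      ← MonoidHom.comp_apply, h]
    change _ = FreeGroup.mk [dec (enc (⟨i, List.mem_range.1 hi⟩, true))]
    rw [dec_enc]
    rfl

theorem exists_conjugator (φ : FreeGroup (Fin n) →* FreeGroup (Fin n)) {w u : Code}
    (hu : ∀ x ∈ u, x.1 < n) (h : IsConj (φ (valC w)) (valC u)) :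
    ∃ c : Code, FreeGroup.reduce (substC n (imageCodes φ) w ++ c) = FreeGroup.reduce (c ++ u) := by
  obtain ⟨d, hd⟩ := isConj_iff.1 h
  refine ⟨encW d⁻¹, reduce_eq_of_valC (n := n) ?_ ?_ ?_⟩
  · exact fun x hx => (List.mem_append.1 hx).elim (lt_of_mem_substC φ w x) (lt_of_mem_encW x)
  · exact fun x hx => (List.mem_append.1 hx).elim (lt_of_mem_encW x) (hu x)
  · rw [valC_append, valC_append, valC_encW, ← substHom_valC, substHom_imageCodes, ← hd]
    group

end

/-- The square of a rotation of `l` is a subword of the cube of `l`, which is reduced. -/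
theorem IsCyclicallyReduced.rotate {l : List (Letter n)} (h : FreeGroup.IsCyclicallyReduced l)
    (k : ℕ) : FreeGroup.IsCyclicallyReduced (l.rotate k) := by
  rw [isCyclicallyReduced_iff, List.rotate_eq_drop_append_take_mod]
  have h3 := (h.flatten_replicate 3).isReduced
  refine List.IsChain.infix h3 ⟨l.take (k % l.length), l.drop (k % l.length), ?_⟩
  generalize k % l.length = m
  conv_rhs => rw [← List.take_append_drop m l]
  simp only [List.replicate_succ, List.replicate_zero, List.flatten_cons, List.flatten_nil,
    List.append_nil, List.append_assoc]

theorem isConj_rotate (l : List (Letter n)) (k : ℕ) :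
    IsConj (FreeGroup.mk l) (FreeGroup.mk (l.rotate k)) := by
  rw [List.rotate_eq_drop_append_take_mod]
  refine isConj_iff.2 ⟨(FreeGroup.mk (l.take (k % l.length)))⁻¹, ?_⟩
  generalize k % l.length = m
  have : FreeGroup.mk l = FreeGroup.mk (l.take m) * FreeGroup.mk (l.drop m) := by
    rw [FreeGroup.mul_mk, List.take_append_drop]
  rw [this, inv_inv, inv_mul_cancel_left, FreeGroup.mul_mk]

theorem exists_list_of_forall {α β : Type*} {P : α → β → Prop} (l : List α)
    (h : ∀ a ∈ l, ∃ b, P a b) : ∃ C : List β, ∀ a ∈ l, ∃ b ∈ C, P a b := by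
  choose f hf using h
  exact ⟨l.attach.map fun a => f a.1 a.2, fun a ha =>
    ⟨f a ha, List.mem_map.2 ⟨⟨a, ha⟩, List.mem_attach _ _, rfl⟩, hf a ha⟩⟩

/-- A reduction of `W` provides the certificate: the automorphism that leads to it, all rotations of
the cyclically reduced conjugates of its elements, and the conjugators. Only its existence matters,
as the search will find one. -/
theorem exists_certificate (hn : 2 ≤ n) {W : List (FreeGroup (Fin n))} (hW : ∀ w ∈ W, w ≠ 1) :
    ∃ c, certB n (encodeWords W) c = true := by
  have : NeZero n := ⟨by omega⟩
  obtain ⟨V, hV, hcut⟩ := exists_isReductionOf hW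
  obtain ⟨φ, rfl⟩ := exists_equiv_of_reflTransGen hV
  have hV1 := map_ne_one hW φ
  choose d hd using exists_conj_cycReduced (n := n)
  let core : FreeGroup (Fin n) → FreeGroup (Fin n) := fun v => (d v)⁻¹ * v * d v
  have hcore : ∀ v, IsConj v (core v) := fun v => isConj_iff.2 ⟨(d v)⁻¹, by rw [inv_inv]⟩
  let R : List Code := (W.map φ).flatMap fun v => (encW (core v)).cyclicPermutations
  have hRmem : ∀ u, u ∈ R ↔ ∃ v ∈ W.map φ, ∃ k, u = ((core v).toWord.rotate k).map enc := by
    intro u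
    rw [List.mem_flatMap]
    refine exists_congr fun v => and_congr_right fun _ => ?_
    rw [List.mem_cyclicPermutations_iff, List.isRotated_comm]
    exact exists_congr fun k => by rw [encW, ← List.map_rotate, eq_comm]
  have hlt : ∀ u ∈ R, ∀ x ∈ u, x.1 < n := fun u hu x hx => by
    obtain ⟨v, -, k, rfl⟩ := (hRmem u).1 hu
    obtain ⟨y, -, rfl⟩ := List.mem_map.1 hx
    exact y.1.2
  have hR : rotationsB n R = true := by
    rw [rotationsB, List.all_eq_true]
    intro u hu
    simp only [Bool.and_eq_true, Bool.not_eq_true', decide_eq_false_iff_not, decide_eq_true_eq,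
      List.all_eq_true]
    refine ⟨⟨⟨?_, ?_⟩, hlt u hu⟩, ?_⟩ <;> obtain ⟨v, hv, k, rfl⟩ := (hRmem u).1 hu
    · rw [List.map_eq_nil_iff, List.rotate_eq_nil_iff, FreeGroup.toWord_eq_nil_iff]
      exact conj_ne_one (hV1 v hv) _
    · rw [← List.map_append]
      exact (isReduced_map_enc.2 (isCyclicallyReduced_iff.1
        (IsCyclicallyReduced.rotate (hd v) k))).reduce_eq
    · exact (hRmem _).2 ⟨v, hv, k + 1, by rw [← List.map_rotate, List.rotate_rotate]⟩
  have hconj : ∀ u ∈ R, ∃ v ∈ W.map φ, IsConj v (valC u) := fun u hu => by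
    obtain ⟨v, hv, k, rfl⟩ := (hRmem u).1 hu
    refine ⟨v, hv, (hcore v).trans ?_⟩
    rw [valC, map_dec_map_enc]
    have := isConj_rotate (core v).toWord k
    rwa [FreeGroup.mk_toWord] at this
  have hsurj : ∀ v ∈ W.map φ, ∃ u ∈ R, IsConj v (valC u) := fun v hv =>
    ⟨encW (core v), (hRmem _).2 ⟨v, hv, 0, by rw [List.rotate_zero]; rfl⟩, by
      rw [valC_encW]; exact hcore v⟩
  -- Every rotation must come from a word of the input, and every word of the input must have a
  -- rotation. The conjugators for both requirements are collected in one list.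
  obtain ⟨C, hC⟩ := exists_list_of_forall (P := fun u c => ∃ w ∈ encodeWords W,
    FreeGroup.reduce (substC n (imageCodes φ.toMonoidHom) w ++ c) = FreeGroup.reduce (c ++ u)) R
    fun u hu => by
      obtain ⟨v, hv, h⟩ := hconj u hu
      obtain ⟨w, hw, rfl⟩ := List.mem_map.1 hv
      rw [← valC_encW w] at h
      obtain ⟨c, hc⟩ := exists_conjugator φ.toMonoidHom (hlt u hu) h
      exact ⟨c, encW w, List.mem_map_of_mem hw, hc⟩
  obtain ⟨C', hC'⟩ := exists_list_of_forall (P := fun w c => ∃ u ∈ R,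
    FreeGroup.reduce (substC n (imageCodes φ.toMonoidHom) w ++ c) = FreeGroup.reduce (c ++ u))
    (encodeWords W) fun w hw => by
      obtain ⟨w, hw', rfl⟩ := List.mem_map.1 hw
      obtain ⟨u, hu, h⟩ := hsurj (φ w) (List.mem_map_of_mem hw')
      rw [← valC_encW w] at h
      obtain ⟨c, hc⟩ := exists_conjugator φ.toMonoidHom (hlt u hu) h
      exact ⟨c, u, hu, hc⟩
  refine ⟨(imageCodes φ.toMonoidHom, imageCodes φ.symm.toMonoidHom, R, C ++ C'), ?_⟩
  simp only [certB, Bool.and_eq_true, Bool.or_eq_true]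
  refine ⟨⟨⟨⟨⟨inverseB_imageCodes ?_, inverseB_imageCodes ?_⟩, hR⟩, ?_⟩, ?_⟩, ?_⟩
  · ext; simp
  · ext; simp
  · rw [List.all_eq_true]
    intro u hu
    obtain ⟨c, hc, w, hw, h⟩ := hC u hu
    exact List.any_eq_true.2 ⟨w, hw, List.any_eq_true.2
      ⟨c, List.mem_append_left _ hc, decide_eq_true h⟩⟩
  · rw [List.all_eq_true]
    intro w hw
    obtain ⟨c, hc, u, hu, h⟩ := hC' w hw
    exact List.any_eq_true.2 ⟨u, hu, List.any_eq_true.2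
      ⟨c, List.mem_append_right _ hc, decide_eq_true h⟩⟩
  · rw [discB_iff hR hconj hsurj hV1 (by omega), twoConnB_iff hR hconj hsurj hV1]
    by_cases h : (whiteheadGraph (W.map φ)).Connected
    · exact Or.inr (twoConn_of_connected hV1 h hcut)
    · exact Or.inl h

theorem inputB_iff {L : List Code} : inputB n L = true ↔ 2 ≤ n ∧
    ∃ W : List (FreeGroup (Fin n)), (∀ w ∈ W, w ≠ 1) ∧ encodeWords W = L := by
  simp only [inputB, Bool.and_eq_true, decide_eq_true_eq, Bool.not_eq_true', List.all_eq_true,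
    decide_eq_false_iff_not]
  refine and_congr_right fun hn => ⟨fun h => ?_, ?_⟩
  · have : NeZero n := ⟨by omega⟩
    have key : ∀ w ∈ L, ∃ g : FreeGroup (Fin n), g ≠ 1 ∧ encW g = w := fun w hw => by
      obtain ⟨⟨h1, h2⟩, h3⟩ := h w hw
      obtain ⟨u, rfl⟩ := exists_map_enc h3
      have hu := (isReduced_map_enc.1 (FreeGroup.IsReduced.of_reduce_eq h2)).reduce_eq
      rw [← FreeGroup.toWord_mk] at hu
      refine ⟨FreeGroup.mk u, fun h => h1 ?_, by rw [encW, hu]⟩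
      rw [← hu, h, FreeGroup.toWord_one, List.map_nil]
    refine ⟨L.map valC, fun g hg => ?_, ?_⟩
    · obtain ⟨w, hw, rfl⟩ := List.mem_map.1 hg
      obtain ⟨g, hg, rfl⟩ := key w hw
      rwa [valC_encW]
    · rw [encodeWords_eq, List.map_map]
      refine (List.map_congr_left fun w hw => ?_).trans (List.map_id _)
      obtain ⟨g, -, rfl⟩ := key w hw
      rw [Function.comp_apply, valC_encW, id]
  · rintro ⟨W, hW, rfl⟩ w hw
    obtain ⟨g, hg, rfl⟩ := List.mem_map.1 hw
    refine ⟨⟨fun h => hW g hg ?_, ?_⟩, lt_of_mem_encW⟩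
    · exact FreeGroup.toWord_eq_nil_iff.1 (List.map_eq_nil_iff.1 h)
    · exact (isReduced_map_enc.2 FreeGroup.isReduced_toWord).reduce_eq

/-- There is an algorithm that detects cut pairs. -/
theorem exists_algorithm : ∃ f : ℕ × List (List (ℕ × Bool)) → Bool, Computable f ∧
    ∀ n : ℕ, 2 ≤ n → ∀ W : List (FreeGroup (Fin n)), (∀ w ∈ W, w ≠ 1) →
      (f (n, encodeWords W) = true ↔ HasCutPairs (DecompositionSpace W)) := by
  -- The property to be decided speaks of codes and so quantifies over the lists with a given code;
  -- injectivity of the encoding makes the quantifier harmless.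
  have huniq : ∀ n, 2 ≤ n → ∀ W W' : List (FreeGroup (Fin n)), encodeWords W = encodeWords W' →
      W = W' := fun n hn W W' h => by
    have : NeZero n := ⟨by omega⟩
    rw [← map_valC_encodeWords W, h, map_valC_encodeWords]
  obtain ⟨f, hf, hf'⟩ := exists_computable
    (fun x => ∃ W : List (FreeGroup (Fin x.1)), encodeWords W = x.2 ∧
      HasCutPairs (DecompositionSpace W)) (by
      rintro ⟨n, L⟩ hx c hc
      dsimp only at hx hc ⊢
      obtain ⟨hn, W, hW, rfl⟩ := inputB_iff.1 hx
      have : NeZero n := ⟨by omega⟩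
      refine (answerB_iff hn hW hc).trans ⟨fun h => ⟨W, rfl, h⟩, ?_⟩
      rintro ⟨W', h, h'⟩
      rwa [huniq n hn W' W h] at h') (by
      rintro ⟨n, L⟩ hx
      dsimp only at hx ⊢
      obtain ⟨hn, W, hW, rfl⟩ := inputB_iff.1 hx
      exact exists_certificate hn hW)
  refine ⟨f, hf, fun n hn W hW => (hf' _ (inputB_iff.2 ⟨hn, W, hW, rfl⟩)).trans
    ⟨?_, fun h => ⟨W, rfl, h⟩⟩⟩
  rintro ⟨W', h, h'⟩
  rwa [huniq n hn W' W h] at h'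

end LinePattern

end

theorem mainTheorem3 :
    (∃ f : ℕ × List (List (ℕ × Bool)) → Bool, Computable f ∧
      ∀ n : ℕ, 2 ≤ n → ∀ W : List (FreeGroup (Fin n)), (∀ w ∈ W, w ≠ 1) →
        (f (n, LinePattern.encodeWords W) = true ↔
          LinePattern.HasCutPairs (LinePattern.DecompositionSpace W))) ∧
    (∀ n : ℕ, 2 ≤ n → ∀ W : List (FreeGroup (Fin n)), (∀ w ∈ W, w ≠ 1) →
      (∃ V, LinePattern.IsReductionOf V W) ∧
      ∀ V, LinePattern.IsReductionOf V W →
        (ConnectedSpace (LinePattern.DecompositionSpace W) ↔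
          (LinePattern.whiteheadGraph V).Connected) ∧
        ((LinePattern.whiteheadGraph V).Connected →
          (LinePattern.HasCutPoint (LinePattern.DecompositionSpace W) ↔
            ∃ v ∈ V, ∃ g : FreeGroup (Fin n), IsConj v g ∧ LinePattern.CycReduced g ∧
              LinePattern.PassesCutPointTest V g) ∧
          (¬ LinePattern.HasCutPoint (LinePattern.DecompositionSpace W) →
            (LinePattern.HasCutTwoPoints (LinePattern.DecompositionSpace W) ↔
              ∃ g : FreeGroup (Fin n), g ≠ 1 ∧ LinePattern.CycReduced g ∧
                g.norm ≤ LinePattern.segmentBound n (LinePattern.complexity V) ∧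
                LinePattern.PassesCutPairTest V g)))) := by
  exact ⟨LinePattern.exists_algorithm, fun _ hn _ hW => LinePattern.finite_tests hn hW⟩
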